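/- Let $a>0$ and $\alpha\in\mathbb R$ with $a\alpha\neq-1$. Let $H_\alpha$ be the one-dimensional Laplacian with two $\delta$-interactions of strength $\alpha$ at $\pm a$, i.e. the operator in $L^2(\mathbb R)$ given by $H_\alpha\psi=-\psi''$ on the domain of all $\psi\in H^2(\mathbb R\setminus\{\pm a\})$ with $\psi(\pm a+0)=\psi(\pm a-0)$ and $\alpha\,\psi(\pm a+0)=\psi'(\pm a+0)-\psi'(\pm a-0)$. Then $H_\alpha$ generates a strongly continuous unitary group $e^{-itH_\alpha}$; let $P_c$ be the orthogonal projector onto the absolutely continuous subspace of $H_\alpha$. For real $n\ge 0$ and $t>0$ put $$z_n(x,y)=4an+|x+a|+|y+a|,\qquad a_n=\frac{z_n}{4\sqrt t}-\frac{\alpha\sqrt t}{4},\qquad b_n=\frac{z_n}{4\sqrt t}+\frac{\alpha\sqrt t}{4},$$ $$r_n(t;x,y)=\sqrt{\tfrac{\pi}{2}}\;|\alpha|^{2n+1}\Big(\frac{it}{2}\Big)^{n}e^{iz_n^2/4t}\,e^{(ia_n-b_n)^2}\,D\big[-2n-1,\,-\operatorname{sign}(\alpha)\,2i\,(a_n+ib_n)\big],$$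 $$p_m(t;x,y)=(-1)^m\,r_{m/2}\big(t;x,(-1)^my\big)\qquad(m=0,1,2,\dots),$$ where powers are principal and $D[\nu,z]=D_\nu(z)$ is the parabolic cylinder function, which for $\nu<0$ is $D_\nu(z)=\frac{e^{-z^2/4}}{\Gamma(-\nu)}\int_0^\infty s^{-\nu-1}e^{-s^2/2-zs}\,ds$. Then for every $t>0$ the series $$\sum_{m=0}^{\infty}\big[p_m(t;x,y)+p_m(t;-x,-y)\big]$$ converges uniformly with respect to $(x,y)\in\mathbb R^2$, and $e^{-itH_\alpha}P_c$ has the integral kernel $$U_\alpha(t;x,y)=\frac{1}{\sqrt{4\pi it}}\,e^{i|x-y|^2/4t}-\frac1{2\pi}\sum_{m=0}^{\infty}\big[p_m(t;x,y)+p_m(t;-x,-y)\big],$$ that is, for every $\phi\in L^1(\mathbb R)\cap L^2(\mathbb R)$ one has $(e^{-itH_\alpha}P_c\phi)(x)=\int_{\mathbb R}U_\alpha(t;x,y)\phi(y)\,dy$ for almost every $x$. -/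

import Mathlib

open MeasureTheory Filter Topology Set

noncomputable section

namespace TwoDelta

/-! ### Unitary groups, spectral measures and the absolutely continuous subspace -/

section Abstract

variable {E : Type*} [NormedAddCommGroup E] [InnerProductSpace ℂ E] [CompleteSpace E]

/-- `U t = exp (-i t H)`: the strongly continuous one-parameter unitary group whose generator is
`-i H`, domain included. By Stone's theorem there is exactly one such `U` if `H` is self-adjoint,
and none otherwise. -/
structure IsUnitaryGroupOf (H : E →ₗ.[ℂ] E) (U : ℝ → E →L[ℂ] E) : Prop where
  unitary : ∀ t, U t ∈ unitary (E →L[ℂ] E)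
  map_zero : U 0 = 1
  map_add : ∀ s t, U (s + t) = U s * U t
  continuous : ∀ ψ, Continuous fun t => U t ψ
  generator : ∀ ψ φ, (ψ, φ) ∈ H.graph ↔ HasDerivAt (fun t => U t ψ) (-Complex.I • φ) 0

/-- `μ` is the spectral measure at the vector `ψ` of the self-adjoint operator that generates
`U t = exp (-i t H)`: the finite Borel measure with `⟨ψ, exp (-i t H) ψ⟩ = ∫ exp (-i t l) dμ(l)`
for all real `t` (it is unique, a finite measure being determined by its Fourier transform). -/
def IsSpectralMeasure (U : ℝ → E →L[ℂ] E) (ψ : E) (μ : Measure ℝ) : Prop :=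
  IsFiniteMeasure μ ∧
    ∀ t : ℝ, inner ℂ ψ (U t ψ) = ∫ l : ℝ, Complex.exp (-(Complex.I * t * l)) ∂μ

/-- The absolutely continuous subspace: all vectors whose spectral measure is absolutely
continuous with respect to Lebesgue measure. These vectors already form a closed subspace, so that
taking the closed span adds nothing. -/
def acSubspace (U : ℝ → E →L[ℂ] E) : Submodule ℂ E :=
  (Submodule.span ℂ {ψ : E | ∃ μ : Measure ℝ, IsSpectralMeasure U ψ μ ∧ μ ≪ volume}
    ).topologicalClosure

/-- The projector `P_c` onto the absolutely continuous subspace. -/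
def acProjection (U : ℝ → E →L[ℂ] E) : E →L[ℂ] E :=
  haveI : CompleteSpace (acSubspace U) := Submodule.topologicalClosure.completeSpace _
  (acSubspace U).starProjection

end Abstract

/-! ### The Hamiltonian with two delta interactions -/

/-- The Hilbert space `L²(ℝ)` of complex-valued functions. -/
abbrev L2 : Type := Lp ℂ 2 (volume : Measure ℝ)

/-- At the point `c` the function `f` is continuous (as far as its one-sided limits go) and its
derivative `g` jumps by `α f(c)`: `f(c+0) = f(c-0)` and `α f(c+0) = g(c+0) - g(c-0)`. -/
def DeltaCondition (α : ℝ) (f g : ℝ → ℂ) (c : ℝ) : Prop :=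
  ∃ v dr dl : ℂ, Tendsto f (𝓝[>] c) (𝓝 v) ∧ Tendsto f (𝓝[<] c) (𝓝 v) ∧
    Tendsto g (𝓝[>] c) (𝓝 dr) ∧ Tendsto g (𝓝[<] c) (𝓝 dl) ∧ (α : ℂ) * v = dr - dl

/-- `ψ` lies in the domain of `H_α` and `H_α ψ = φ`. The first part says
`ψ ∈ H²(ℝ \ {±a})` with `-ψ'' = φ`: off `±a`, `ψ` has a `C¹` representative `f` whose derivative
`g = f'` is locally absolutely continuous with derivative `-φ`, and `f`, `g`, `φ` are in `L²`.
The second part is the interface condition at `a` and at `-a`. -/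
def HasAction (a α : ℝ) (ψ φ : L2) : Prop :=
  ∃ f g : ℝ → ℂ,
    (ψ =ᵐ[volume] f ∧ MemLp g 2 volume ∧
      (∀ x ∈ ({a, -a}ᶜ : Set ℝ), HasDerivAt f (g x) x) ∧
      (∀ x y : ℝ, x ≤ y → Icc x y ⊆ ({a, -a}ᶜ : Set ℝ) → g y - g x = ∫ s in x..y, -φ s)) ∧
    DeltaCondition α f g a ∧ DeltaCondition α f g (-a)

/-- The graph of `H_α`. -/
def hamiltonianGraph (a α : ℝ) : Submodule ℂ (L2 × L2) where
  carrier := {p | HasAction a α p.1 p.2}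
  zero_mem' := by
    refine ⟨0, 0, ⟨Lp.coeFn_zero _ _ _, MemLp.zero, fun x _ => hasDerivAt_const _ _, ?_⟩, ?_, ?_⟩
    · intro x y _ _
      rw [intervalIntegral.integral_congr_ae (g := fun _ => (0 : ℂ))]
      · simp
      · filter_upwards [Lp.coeFn_zero ℂ 2 (volume : Measure ℝ)] with s hs _
        simp
    · exact ⟨0, 0, 0, tendsto_const_nhds, tendsto_const_nhds, tendsto_const_nhds,
        tendsto_const_nhds, by simp⟩
    · exact ⟨0, 0, 0, tendsto_const_nhds, tendsto_const_nhds, tendsto_const_nhds,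
        tendsto_const_nhds, by simp⟩
  add_mem' := by
    rintro ⟨ψ, φ⟩ ⟨ψ', φ'⟩ ⟨f, g, ⟨h1, h2, h3, h4⟩, h5, h6⟩ ⟨f', g', ⟨h1', h2', h3', h4'⟩, h5', h6'⟩
    have hd : ∀ c, DeltaCondition α f g c → DeltaCondition α f' g' c →
        DeltaCondition α (f + f') (g + g') c := by
      rintro c ⟨v, dr, dl, e1, e2, e3, e4, e5⟩ ⟨v', dr', dl', e1', e2', e3', e4', e5'⟩
      exact ⟨v + v', dr + dr', dl + dl', e1.add e1', e2.add e2', e3.add e3', e4.add e4', by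
        rw [mul_add, e5, e5']; ring⟩
    refine ⟨f + f', g + g', ⟨(Lp.coeFn_add ψ ψ').trans (h1.add h1'), h2.add h2',
      fun x hx => (h3 x hx).add (h3' x hx), ?_⟩, hd _ h5 h5', hd _ h6 h6'⟩
    intro x y hxy hI
    have hloc : ∀ χ : L2, IntervalIntegrable (fun s => -χ s) volume x y := fun χ =>
      (LocallyIntegrable.integrableOn_isCompact ((Lp.memLp χ).locallyIntegrable (by norm_num))
        isCompact_uIcc).intervalIntegrable.neg
    have e : (∫ s in x..y, -(φ + φ' : L2) s) = ∫ s in x..y, (-φ s + -φ' s) := by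
      apply intervalIntegral.integral_congr_ae
      filter_upwards [Lp.coeFn_add φ φ'] with s hs _
      rw [hs, Pi.add_apply]; ring
    change g y + g' y - (g x + g' x) = ∫ s in x..y, -(φ + φ' : L2) s
    rw [e, intervalIntegral.integral_add (hloc φ) (hloc φ'), ← h4 x y hxy hI, ← h4' x y hxy hI]
    ring
  smul_mem' := by
    rintro k ⟨ψ, φ⟩ ⟨f, g, ⟨h1, h2, h3, h4⟩, h5, h6⟩
    have hd : ∀ c, DeltaCondition α f g c → DeltaCondition α (k • f) (k • g) c := by
      rintro c ⟨v, dr, dl, e1, e2, e3, e4, e5⟩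
      exact ⟨k • v, k • dr, k • dl, e1.const_smul k, e2.const_smul k, e3.const_smul k,
        e4.const_smul k, by rw [← smul_sub, ← e5, mul_smul_comm]⟩
    refine ⟨k • f, k • g, ⟨(Lp.coeFn_smul k ψ).trans (h1.const_smul k), h2.const_smul k,
      fun x hx => (h3 x hx).const_smul k, ?_⟩, hd _ h5, hd _ h6⟩
    intro x y hxy hI
    have e : (∫ s in x..y, -(k • φ : L2) s) = ∫ s in x..y, k • (-φ s) := by
      apply intervalIntegral.integral_congr_ae
      filter_upwards [Lp.coeFn_smul k φ] with s hs _
      rw [hs, Pi.smul_apply, smul_neg]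
    change k • g y - k • g x = ∫ s in x..y, -(k • φ : L2) s
    rw [e, intervalIntegral.integral_smul, ← h4 x y hxy hI, smul_sub]

/-- The operator `H_α = -d²/dx² + α (δ_a + δ_{-a})` in `L²(ℝ)`, as a partially defined linear
operator. -/
def hamiltonian (a α : ℝ) : L2 →ₗ.[ℂ] L2 :=
  (hamiltonianGraph a α).toLinearPMap

/-- The action of `H_α` on a vector is well defined. -/
theorem hamiltonianGraph_functional (a α : ℝ) :
    ∀ p ∈ hamiltonianGraph a α, p.1 = 0 → p.2 = 0 := by
  rintro ⟨ψ, φ⟩ ⟨f, g, ⟨h1, -, h3, h4⟩, -, -⟩ h0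
  simp only at h0 h1 h4 ⊢
  have hΩ : IsOpen ({a, -a}ᶜ : Set ℝ) := (Set.toFinite _).isClosed.isOpen_compl
  have hf0 : f =ᵐ[volume] 0 := by
    rw [h0] at h1
    exact h1.symm.trans (Lp.coeFn_zero _ _ _)
  have hf : EqOn f 0 ({a, -a}ᶜ : Set ℝ) :=
    Measure.eqOn_open_of_ae_eq (ae_restrict_of_ae hf0) hΩ
      (fun x hx => (h3 x hx).continuousAt.continuousWithinAt) continuousOn_const
  have hg : ∀ x ∈ ({a, -a}ᶜ : Set ℝ), g x = 0 := fun x hx =>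
    (h3 x hx).unique ((hasDerivAt_const x (0 : ℂ)).congr_of_eventuallyEq
      (hf.eventuallyEq_of_mem (hΩ.mem_nhds hx)))
  have hloc : LocallyIntegrable (φ : ℝ → ℂ) volume := (Lp.memLp φ).locallyIntegrable (by norm_num)
  have hder := LocallyIntegrable.ae_hasDerivAt_integral hloc
  have hfin : ∀ᵐ x : ℝ, x ∈ ({a, -a}ᶜ : Set ℝ) :=
    (measure_eq_zero_iff_ae_notMem).1 ((Set.toFinite ({a, -a} : Set ℝ)).measure_zero volume)
  apply (Lp.eq_zero_iff_ae_eq_zero).2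
  filter_upwards [hder, hfin] with x hx hxΩ
  refine (hx x).unique ((hasDerivAt_const x (0 : ℂ)).congr_of_eventuallyEq ?_)
  obtain ⟨ε, hε, hball⟩ := Metric.isOpen_iff.1 hΩ x hxΩ
  filter_upwards [Metric.ball_mem_nhds x hε] with y hy
  have key : ∀ u v : ℝ, u ≤ v → u ∈ Metric.ball x ε → v ∈ Metric.ball x ε →
      ∫ s in u..v, φ s = 0 := by
    intro u v huv hu hv
    have hsub : Icc u v ⊆ ({a, -a}ᶜ : Set ℝ) :=
      (((convex_ball x ε).ordConnected).out hu hv).trans hball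
    have := h4 u v huv hsub
    rw [hg v (hball hv), hg u (hball hu), intervalIntegral.integral_neg, sub_zero] at this
    exact neg_eq_zero.1 this.symm
  rcases le_total x y with h | h
  · exact key x y h (Metric.mem_ball_self hε) hy
  · rw [intervalIntegral.integral_symm, key y x h hy (Metric.mem_ball_self hε), neg_zero]

/-- `ψ ∈ D(H_α)` and `H_α ψ = φ` mean exactly what `HasAction` says. -/
theorem mem_hamiltonian_graph (a α : ℝ) (ψ φ : L2) :
    (ψ, φ) ∈ (hamiltonian a α).graph ↔ HasAction a α ψ φ := by
  rw [hamiltonian, Submodule.toLinearPMap_graph_eq _ (hamiltonianGraph_functional a α)]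
  rfl

/-! ### Integral kernels -/

/-- `K` is the integral kernel of the bounded operator `T` on `L²(ℝ)`:
`(T φ)(x) = ∫ K(x,y) φ(y) dy` for almost every `x`, with an absolutely convergent integral, for
every `φ ∈ L²(ℝ) ∩ L¹(ℝ)`. -/
def IsIntegralKernel (T : L2 →L[ℂ] L2) (K : ℝ → ℝ → ℂ) : Prop :=
  Measurable (Function.uncurry K) ∧
    ∀ φ : L2, Integrable φ volume →
      ∀ᵐ x : ℝ, Integrable (fun y => K x y * φ y) volume ∧ T φ x = ∫ y, K x y * φ y

/-! ### The explicit kernel -/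

/-- The parabolic cylinder function `D[ν, z] = D_ν(z)` of order `ν < 0` (the only orders needed):
`D_ν(z) = e^{-z²/4} / Γ(-ν) ∫_0^∞ s^{-ν-1} e^{-s²/2 - z s} ds`, for every complex `z`. -/
def parabolicCylinderD (ν : ℝ) (z : ℂ) : ℂ :=
  Complex.exp (-z ^ 2 / 4) / (Real.Gamma (-ν) : ℂ) *
    ∫ s in Ioi (0 : ℝ), ((s ^ (-ν - 1) : ℝ) : ℂ) * Complex.exp (-(s : ℂ) ^ 2 / 2 - z * s)

/-- `z_n(x,y) = 4 a n + |x + a| + |y + a|`, for real `n`. -/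
def zn (a n x y : ℝ) : ℝ := 4 * a * n + |x + a| + |y + a|

/-- `a_n(x,y,t) = z_n / (4 √t) - α √t / 4`. -/
def an (a α n t x y : ℝ) : ℝ := zn a n x y / (4 * √t) - α * √t / 4

/-- `b_n(x,y,t) = z_n / (4 √t) + α √t / 4`. -/
def bn (a α n t x y : ℝ) : ℝ := zn a n x y / (4 * √t) + α * √t / 4

/-- `r_n(t;x,y)`, for real `n` (only integers and half-integers are used):
`√(π/2) |α|^{2n+1} (it/2)^n e^{i z_n²/4t} e^{(i a_n - b_n)²} D[-2n-1, -sign(α) 2i (a_n + i b_n)]`. -/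
def rn (a α n t x y : ℝ) : ℂ :=
  ((√(Real.pi / 2) : ℝ) : ℂ) * ((|α| ^ (2 * n + 1) : ℝ) : ℂ) * (Complex.I * t / 2) ^ (n : ℂ) *
    Complex.exp (Complex.I * (zn a n x y : ℂ) ^ 2 / (4 * t)) *
    Complex.exp ((Complex.I * an a α n t x y - bn a α n t x y) ^ 2) *
    parabolicCylinderD (-2 * n - 1)
      (-(Real.sign α : ℂ) * (2 * Complex.I) * (an a α n t x y + Complex.I * bn a α n t x y))

/-- `p_m(t;x,y) = (-1)^m r_{m/2}(t; x, (-1)^m y)`. -/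
def pm (a α : ℝ) (m : ℕ) (t x y : ℝ) : ℂ :=
  (-1) ^ m * rn a α ((m : ℝ) / 2) t x ((-1) ^ m * y)

/-- The `m`-th term `p_m(t;x,y) + p_m(t;-x,-y)` of the series. -/
def seriesTerm (a α t : ℝ) (m : ℕ) (x y : ℝ) : ℂ :=
  pm a α m t x y + pm a α m t (-x) (-y)

/-- The sum of the series, that is, the limit of its partial sums. -/
def seriesSum (a α t x y : ℝ) : ℂ :=
  ∑'[SummationFilter.conditional ℕ] m, seriesTerm a α t m x y

/-- The free kernel `(4πit)^{-1/2} e^{i|x-y|²/4t}`. -/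
def freeKernel (t x y : ℝ) : ℂ :=
  (4 * Real.pi * Complex.I * t : ℂ) ^ (-(1 / 2) : ℂ) *
    Complex.exp (Complex.I * ((|x - y| : ℝ) : ℂ) ^ 2 / (4 * t))

/-- `U_α(t;x,y)`. -/
def kernelU (a α t x y : ℝ) : ℂ :=
  freeKernel t x y - 1 / (2 * Real.pi) * seriesSum a α t x y

end TwoDelta

end

noncomputable section

namespace TwoDelta

/-! ### Unitary groups generated by symmetric operators with a surjective real shift. -/

section Abstract

/-! Existence. Green's identity makes `H_α` symmetric, since the interface conditions are exactly
what keeps the Wronskian of two solutions continuous at `±a`. Solving the resolvent equation by hand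
shows that `H_α + l²` is onto for `l > |α|`. The inverse `R` is then bounded, self-adjoint and of
dense range, and the group is obtained from the functional calculus of `R` alone: `z exp(-it(1/z -
c))` is continuous on the real axis, even at `0`, and represents `U t ∘ R` (`exists_unitaryGroup`).
No spectral theorem for unbounded operators is used.

Spectral representation. Reflection symmetry splits everything into parities `σ = ±1`. In each
sector the generalized eigenfunction of energy `k²` is a standing wave plus the outgoing waves
`source` emitted at `±a`, with denominator `denom = 2k + iα(1 + σ e^{2iak})`. The squared modulus of
the transform `modeInt` is that of the free transform minus a multiple of `G(k) + G(-k)`, where `G =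
resolventPart` extends meromorphically to the upper half-plane (`conj_modeInt_mul_modeInt`). A zero
of `denom` there yields an eigenvector with eigenvalue `k²`, so symmetry of `H_α` forces it onto the
imaginary axis; it is unique and simple. The residue theorem (`integral_resolventPart`) shows that
the transform loses exactly the squared overlap with the bound state, and Plancherel turns this into
completeness. Since the transforms carry the evolution to multiplication by `e^{-itk²}`, the
projector `P_c` is the sum of `F* F` over both parities (`acProjection_eq`,
`exists_spectral_representation`).

The assumption `aα ≠ -1` concerns the threshold `k = 0`. In the odd sector `denom` always vanishes
there, with derivative `2 + 2aα`. A simple zero is compensated by the odd sources, which vanish at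
`k = 0` as well; at `aα = -1` the zero is no longer simple.

The kernel. Matrix elements of `U t P_c` are oscillating integrals over `k` of an explicit bounded
kernel `modeKernel`. Replacing `it` by `(√(it) + ε)²` makes them absolutely convergent Gaussian
integrals, so Fubini applies, and `ε → 0` is taken at the end (`integral_oscillating_eq`). The free
part gives the free propagator. In the scattered part `denom = (2k + iα)(1 - q)` with `q = -σ r(k)
e^{2iak}` and `r = iα/(2k + iα)` the reflection coefficient of a single delta, so that `iα/denom` is
a geometric series, one term for each number of passages between `±a`. Writing `r^{m+1}` as a Gamma
integral and integrating over `k` first leaves a Gaussian integral over a half-line, which is a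
parabolic cylinder function; its closed form is continuous up to `ϑ² = it` and there equals
`r_{m/2}` (`integral_eq_cylinderTerm`, `rn_eq_cylinderTerm`).

Uniform convergence. After `N + 1` terms the remainder is at most `C/(1+k²) |r(k)|^N` with `C`
independent of `(x,y)`: one factor `1/√(1+k²)` comes from `scatteringPart`, the other from one spare
power of `r`. Since `|r| < 1` off `k = 0`, dominated convergence in `k` gives a bound that tends to
`0` uniformly in `(x,y)` (`tendstoUniformly_of_ne_zero`). -/

/-- A uniformly bounded family of operators that converges strongly on the range of an operator
with dense range converges strongly everywhere. -/
theorem tendsto_of_bounded_of_denseRange {E E' ι : Type*} [NormedAddCommGroup E]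
    [NormedSpace ℂ E] [NormedAddCommGroup E'] [NormedSpace ℂ E']
    {l : Filter ι} {T : ι → E →L[ℂ] E'} {T₀ : E →L[ℂ] E'} {C : ℝ} (hC : ∀ᶠ i in l, ‖T i‖ ≤ C)
    {X : Type*} {e : X → E} (he : DenseRange e)
    (h : ∀ x, Tendsto (fun i => T i (e x)) l (𝓝 (T₀ (e x)))) (ψ : E) :
    Tendsto (fun i => T i ψ) l (𝓝 (T₀ ψ)) := by
  rw [Metric.tendsto_nhds]
  intro ε hε
  set K := |C| + ‖T₀‖ + 1 with hK
  have hKpos : 0 < K := by positivity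
  obtain ⟨x, hx⟩ := Metric.denseRange_iff.1 he ψ (ε / (2 * K)) (by positivity)
  rw [dist_eq_norm] at hx
  filter_upwards [hC, (Metric.tendsto_nhds.1 (h x)) (ε / 2) (by positivity)] with i hi hi'
  rw [dist_eq_norm] at hi' ⊢
  have e1 : T i ψ - T₀ ψ = T i (ψ - e x) + (T i (e x) - T₀ (e x)) - T₀ (ψ - e x) := by
    simp only [map_sub]; abel
  have h1 : ‖T i (ψ - e x)‖ ≤ |C| * ‖ψ - e x‖ :=
    (T i).le_of_opNorm_le (hi.trans (le_abs_self C)) _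
  have h2 : ‖T₀ (ψ - e x)‖ ≤ ‖T₀‖ * ‖ψ - e x‖ := T₀.le_opNorm _
  have h3 : K * ‖ψ - e x‖ < ε / 2 := by
    calc K * ‖ψ - e x‖ < K * (ε / (2 * K)) := by gcongr
      _ = ε / 2 := by field_simp
  have h4 := norm_nonneg (ψ - e x)
  calc ‖T i ψ - T₀ ψ‖ ≤ ‖T i (ψ - e x)‖ + ‖T i (e x) - T₀ (e x)‖ + ‖T₀ (ψ - e x)‖ := by
        rw [e1]; exact (norm_sub_le _ _).trans (by gcongr; exact norm_add_le _ _)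
    _ < ε := by nlinarith

variable {E : Type*} [NormedAddCommGroup E] [InnerProductSpace ℂ E] [CompleteSpace E]

/-- `z exp (-i t (1/z - c))`, as a function of the real number `z`. -/
def resolventPhase (c t : ℝ) (z : ℂ) : ℂ :=
  z * Complex.exp (-(Complex.I * t * ((z.re⁻¹ - c : ℝ) : ℂ)))

theorem norm_resolventPhase (c t : ℝ) (z : ℂ) : ‖resolventPhase c t z‖ = ‖z‖ := by
  rw [resolventPhase, norm_mul]
  have : -(Complex.I * t * ((z.re⁻¹ - c : ℝ) : ℂ)) = ((-t * (z.re⁻¹ - c) : ℝ) : ℂ) * Complex.I := by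
    push_cast; ring
  rw [this, Complex.norm_exp_ofReal_mul_I, mul_one]

/-- At real points the phase factor has modulus one, so the prefactor `z` forces continuity at `0`
whatever value `0⁻¹` takes. Off the real axis continuity can fail where `z.re = 0`; only the
spectrum of a self-adjoint operator matters later. -/
theorem continuousOn_resolventPhase (c t : ℝ) :
    ContinuousOn (resolventPhase c t) {z : ℂ | z.im = 0} := by
  intro z hz
  by_cases h0 : z = 0
  · subst h0
    have h00 : resolventPhase c t 0 = 0 := by simp [resolventPhase]
    apply ContinuousAt.continuousWithinAt
    rw [ContinuousAt, h00, tendsto_zero_iff_norm_tendsto_zero]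
    simp only [norm_resolventPhase]
    simpa using (continuous_norm (E := ℂ)).tendsto 0
  · have hre : z.re ≠ 0 := fun h => h0 (Complex.ext h hz)
    apply ContinuousAt.continuousWithinAt
    unfold resolventPhase
    have h1 : ContinuousAt (fun z : ℂ => z.re⁻¹) z := Complex.continuous_re.continuousAt.inv₀ hre
    refine continuousAt_id.mul (Complex.continuous_exp.continuousAt.comp ?_)
    refine (continuousAt_const.mul ?_).neg
    exact Complex.continuous_ofReal.continuousAt.comp (h1.sub continuousAt_const)

theorem norm_exp_I_sub_one_le (x : ℝ) : ‖Complex.exp (-(Complex.I * x)) - 1‖ ≤ |x| := by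
  have := Real.norm_exp_I_mul_ofReal_sub_one_le (x := -x)
  simpa using this

theorem norm_exp_I_sub_one_add_le (x : ℝ) :
    ‖Complex.exp (-(Complex.I * x)) - 1 + Complex.I * x‖ ≤ 3 * x ^ 2 := by
  have hx : ‖-(Complex.I * (x : ℂ))‖ = |x| := by simp
  rcases le_or_gt |x| 1 with h | h
  · have := Complex.norm_exp_sub_one_sub_id_le (x := -(Complex.I * (x : ℂ))) (by rwa [hx])
    rw [hx, sq_abs, sub_neg_eq_add] at this
    nlinarith [sq_nonneg x]
  · calc _ ≤ ‖Complex.exp (-(Complex.I * x)) - 1‖ + ‖Complex.I * (x : ℂ)‖ := norm_add_le _ _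
      _ ≤ |x| + |x| := by
        gcongr
        · exact norm_exp_I_sub_one_le x
        · simp
      _ ≤ 3 * x ^ 2 := by rw [← sq_abs]; nlinarith

/-- A symmetric operator `H` such that `H + c` is onto for some real `c` has a bounded self-adjoint
inverse of `H + c` with dense range. -/
theorem exists_resolvent {H : E →ₗ.[ℂ] E}
    (hsymm : ∀ p ∈ H.graph, ∀ q ∈ H.graph, inner ℂ p.2 q.1 = inner ℂ p.1 q.2) (c : ℝ)
    (hsurj : ∀ φ, ∃ ψ, (ψ, φ - (c : ℂ) • ψ) ∈ H.graph) :
    ∃ R : E →L[ℂ] E, IsSelfAdjoint R ∧ DenseRange R ∧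
      ∀ φ, (R φ, φ - (c : ℂ) • R φ) ∈ H.graph := by
  -- The shift `c` is real, so it cancels from both sides of the symmetry relation and the solution
  -- map of `H + c` is symmetric.
  have key : ∀ ψ φ η χ, (ψ, φ - (c : ℂ) • ψ) ∈ H.graph → (η, χ - (c : ℂ) • η) ∈ H.graph →
      inner ℂ φ η = inner ℂ ψ χ := by
    intro ψ φ η χ h1 h2
    have := hsymm _ h1 _ h2
    simp only [inner_sub_left, inner_sub_right, inner_smul_left, inner_smul_right,
      Complex.conj_ofReal] at this
    linear_combination this
  have uniq : ∀ ψ ψ' φ, (ψ, φ - (c : ℂ) • ψ) ∈ H.graph → (ψ', φ - (c : ℂ) • ψ') ∈ H.graph →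
      ψ = ψ' := by
    intro ψ ψ' φ h1 h2
    refine ext_inner_right ℂ fun χ => ?_
    obtain ⟨η, hη⟩ := hsurj χ
    rw [← key _ _ _ _ h1 hη, ← key _ _ _ _ h2 hη]
  choose r hr using hsurj
  let Rl : E →ₗ[ℂ] E :=
    { toFun := r
      map_add' := fun φ χ => by
        refine uniq _ _ (φ + χ) (hr _) ?_
        have := H.graph.add_mem (hr φ) (hr χ)
        rw [Prod.mk_add_mk, sub_add_sub_comm, ← smul_add] at this
        exact this
      map_smul' := fun k φ => by
        refine uniq _ _ (k • φ) (hr _) ?_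
        have := H.graph.smul_mem k (hr φ)
        rw [Prod.smul_mk, smul_sub, smul_comm] at this
        exact this }
  have hRsymm : Rl.IsSymmetric := fun φ χ => (key _ _ _ _ (hr φ) (hr χ)).symm
  -- Hellinger–Toeplitz: a symmetric operator defined everywhere is bounded.
  let R : E →L[ℂ] E := ⟨Rl, hRsymm.continuous⟩
  have hRsa : IsSelfAdjoint R :=
    (ContinuousLinearMap.isSelfAdjoint_iff_isSymmetric).2 hRsymm
  have hRinj : ∀ φ, R φ = 0 → φ = 0 := by
    intro φ h
    have h' : r φ = 0 := h
    have := hr φ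
    rw [h', smul_zero, sub_zero] at this
    exact H.graph_fst_eq_zero_snd this rfl
  refine ⟨R, hRsa, ?_, hr⟩
  -- For a symmetric operator the orthogonal complement of the range is the kernel, which is trivial
  -- by `hRinj`.
  have h1 : (LinearMap.range (R : E →ₗ[ℂ] E))ᗮ = ⊥ := by
    rw [Submodule.eq_bot_iff]
    intro x hx
    apply hRinj
    refine ext_inner_left ℂ fun v => ?_
    rw [inner_zero_right]
    exact (hRsymm v x).symm.trans ((Submodule.mem_orthogonal _ _).1 hx _ ⟨v, rfl⟩)
  have h2 := Submodule.topologicalClosure_eq_top_iff.2 h1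
  exact (Submodule.dense_iff_topologicalClosure_eq_top).2 h2

/-- The operators `exp (-i t (1/R - c)) R`, for a bounded self-adjoint operator `R`. -/
def phaseOp (R : E →L[ℂ] E) (c t : ℝ) : E →L[ℂ] E := cfc (resolventPhase c t) R

/-! ### Functional calculus of the bounded resolvent. -/

section PhaseOp

variable {R : E →L[ℂ] E}

theorem im_eq_zero_of_mem_spectrum (hR : IsSelfAdjoint R) {z : ℂ} (hz : z ∈ spectrum ℂ R) : z.im = 0 :=
  hR.im_eq_zero_of_mem_spectrum hz

theorem continuousOn_resolventPhase_spectrum (hR : IsSelfAdjoint R) (c : ℝ) (t : ℝ) :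
    ContinuousOn (resolventPhase c t) (spectrum ℂ R) :=
  (continuousOn_resolventPhase c t).mono fun _ hz => im_eq_zero_of_mem_spectrum hR hz

theorem cfc_id_eq (hR : IsSelfAdjoint R) : cfc (fun z : ℂ => z) R = R := by
  have hn : IsStarNormal R := hR.isStarNormal
  exact cfc_id' ℂ R

theorem phaseOp_zero (hR : IsSelfAdjoint R) (c : ℝ) : phaseOp R c 0 = R := by
  rw [phaseOp, ← cfc_id_eq hR]
  conv_rhs => rw [← cfc_id_eq hR]
  rw [cfc_id_eq hR]
  congr 1
  ext z
  simp [resolventPhase]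

/-- The symbol has the same modulus as `z`, hence `T* T` is the same for `phaseOp R c t` and for
`R`. This is the isometry of the future `U t` on the range of `R`. -/
theorem norm_phaseOp_apply (hR : IsSelfAdjoint R) (c : ℝ) (t : ℝ) (φ : E) : ‖phaseOp R c t φ‖ = ‖R φ‖ := by
  have hn : IsStarNormal R := hR.isStarNormal
  have hcont := continuousOn_resolventPhase_spectrum hR c t
  have h1 : star (phaseOp R c t) * phaseOp R c t = star R * R := by
    have e1 : star (phaseOp R c t) * phaseOp R c t
        = cfc (fun z => star (resolventPhase c t z) * resolventPhase c t z) R := by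
      rw [cfc_mul _ _ R hcont.star hcont, cfc_star, phaseOp]
    have e2 : star R * R = cfc (fun z : ℂ => star z * z) R := by
      rw [cfc_mul (fun z : ℂ => star z) (fun z => z) R (by fun_prop) (by fun_prop),
        cfc_star, cfc_id_eq hR]
    rw [e1, e2]
    congr 1
    ext z
    have a1 := Complex.normSq_eq_conj_mul_self (z := resolventPhase c t z)
    have a2 := Complex.normSq_eq_conj_mul_self (z := z)
    rw [Complex.star_def, ← a1, ← a2, Complex.normSq_eq_norm_sq, Complex.normSq_eq_norm_sq,
      norm_resolventPhase]
  have h2 : ∀ T : E →L[ℂ] E, ‖T φ‖ ^ 2 = RCLike.re (inner ℂ φ ((star T * T) φ)) := fun T => by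
    rw [ContinuousLinearMap.star_eq_adjoint]
    exact T.apply_norm_sq_eq_inner_adjoint_right φ
  have h3 := h2 (phaseOp R c t)
  rw [h1, ← h2 R] at h3
  exact (pow_left_inj₀ (norm_nonneg _) (norm_nonneg _) two_ne_zero).1 h3

/-- Each `phaseOp` stands for `U t ∘ R`, so the group law holds up to one surplus factor `R`. -/
theorem phaseOp_mul_phaseOp (hR : IsSelfAdjoint R) (c : ℝ) (s t : ℝ) :
    phaseOp R c s * phaseOp R c t = phaseOp R c (s + t) * R := by
  have hn : IsStarNormal R := hR.isStarNormal
  have h1 : phaseOp R c (s + t) * R = cfc (fun z => resolventPhase c (s + t) z * z) R := by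
    rw [cfc_mul _ _ R (continuousOn_resolventPhase_spectrum hR c _) (by fun_prop),
      cfc_id_eq hR, phaseOp]
  rw [h1, phaseOp, phaseOp, ← cfc_mul _ _ R (continuousOn_resolventPhase_spectrum hR c s)
    (continuousOn_resolventPhase_spectrum hR c t)]
  congr 1
  ext z
  simp only [resolventPhase]
  rw [show -(Complex.I * ((s + t : ℝ) : ℂ) * ((z.re⁻¹ - c : ℝ) : ℂ))
    = -(Complex.I * s * ((z.re⁻¹ - c : ℝ) : ℂ)) + -(Complex.I * t * ((z.re⁻¹ - c : ℝ) : ℂ)) by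
      push_cast; ring, Complex.exp_add]
  ring

theorem phaseOp_comm (hR : IsSelfAdjoint R) (c : ℝ) (t : ℝ) : phaseOp R c t * R = R * phaseOp R c t := by
  have h := phaseOp_mul_phaseOp hR c 0 t
  rw [phaseOp_zero hR, zero_add] at h
  exact h.symm

theorem norm_le_of_mem_spectrum {z : ℂ} (hz : z ∈ spectrum ℂ R) : ‖z‖ ≤ ‖R‖ := by
  rcases subsingleton_or_nontrivial (E →L[ℂ] E) with h | h
  · simp [spectrum.of_subsingleton] at hz
  · exact spectrum.norm_le_norm_of_mem hz

/-- For `z` in the spectrum, `z (1/z - c) = 1 - c z` (both sides taken to be `0` at `z = 0`). -/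
theorem norm_mul_inv_sub_le (hR : IsSelfAdjoint R) (c : ℝ) {z : ℂ} (hz : z ∈ spectrum ℂ R) :
    ‖z‖ * |z.re⁻¹ - c| ≤ 1 + |c| * ‖R‖ := by
  have him := im_eq_zero_of_mem_spectrum hR hz
  have hz' : z = (z.re : ℂ) := Complex.ext rfl (by simp [him])
  have hn := norm_le_of_mem_spectrum hz
  have h1 : ‖z‖ = |z.re| := by rw [hz']; simp
  rw [h1] at hn ⊢
  rw [← abs_mul, mul_sub]
  calc |z.re * z.re⁻¹ - z.re * c| ≤ |z.re * z.re⁻¹| + |z.re * c| := abs_sub _ _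
    _ ≤ 1 + |c| * ‖R‖ := by
      gcongr
      · by_cases h : z.re = 0 <;> simp [h]
      · rw [abs_mul, mul_comm]; gcongr

/-- The weight `z` tames the generator `1/z - c`, as `z (1/z - c)` is bounded on the spectrum. The
estimate serves twice: for strong continuity and as the uniform bound on difference quotients. -/
theorem norm_phaseOp_sub_le (hR : IsSelfAdjoint R) (c : ℝ) (s t : ℝ) :
    ‖phaseOp R c t - phaseOp R c s‖ ≤ |t - s| * (1 + |c| * ‖R‖) := by
  have hn : IsStarNormal R := hR.isStarNormal
  rw [phaseOp, phaseOp, ← cfc_sub _ _ R (continuousOn_resolventPhase_spectrum hR c t)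
    (continuousOn_resolventPhase_spectrum hR c s)]
  refine norm_cfc_le (by positivity) fun z hz => ?_
  have e : resolventPhase c t z - resolventPhase c s z = resolventPhase c s z *
      (Complex.exp (-(Complex.I * (((t - s) * (z.re⁻¹ - c) : ℝ) : ℂ))) - 1) := by
    simp only [resolventPhase]
    rw [mul_sub, mul_one, mul_assoc z, ← Complex.exp_add]
    congr 3
    push_cast; ring
  rw [e, norm_mul, norm_resolventPhase]
  calc _ ≤ ‖z‖ * |(t - s) * (z.re⁻¹ - c)| := by gcongr; exact norm_exp_I_sub_one_le _
    _ = |t - s| * (‖z‖ * |z.re⁻¹ - c|) := by rw [abs_mul]; ring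
    _ ≤ _ := by gcongr; exact norm_mul_inv_sub_le hR c hz

/-- The second-order Taylor remainder of the phase contains `(1/z - c)²` and so needs two powers of
`z`; that is why the extra factor `R` appears. It differentiates the group on the range of `R²`. -/
theorem norm_phaseOp_sub_add_mul_le (hR : IsSelfAdjoint R) (c : ℝ) (t : ℝ) :
    ‖(phaseOp R c t - R + (Complex.I * t) • (1 - (c : ℂ) • R)) * R‖
      ≤ 3 * t ^ 2 * (1 + |c| * ‖R‖) ^ 2 := by
  have hn : IsStarNormal R := hR.isStarNormal
  have hc := continuousOn_resolventPhase_spectrum hR c t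
  have e : (phaseOp R c t - R + (Complex.I * t) • (1 - (c : ℂ) • R)) * R
      = cfc (fun z => (resolventPhase c t z - z + (Complex.I * t) * (1 - c * z)) * z) R := by
    have hid : ContinuousOn (fun z : ℂ => z) (spectrum ℂ R) := continuousOn_id
    have h2 : ContinuousOn (fun z : ℂ => Complex.I * t * (1 - c * z)) (spectrum ℂ R) := by fun_prop
    rw [cfc_mul (fun z => resolventPhase c t z - z + Complex.I * t * (1 - c * z)) (fun z => z) R
      ((hc.fun_sub hid).fun_add h2) hid, cfc_id_eq hR,
      cfc_add R (fun z => resolventPhase c t z - z) _ (hc.fun_sub hid) h2,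
      cfc_sub _ (fun z => z) R hc hid,
      cfc_const_mul _ _ R (by fun_prop), cfc_sub _ _ R (by fun_prop) (by fun_prop),
      cfc_const_mul _ _ R (by fun_prop), cfc_id_eq hR, cfc_const_one ℂ R, phaseOp]
  rw [e]
  refine norm_cfc_le (by positivity) fun z hz => ?_
  have him := im_eq_zero_of_mem_spectrum hR hz
  by_cases h0 : z = 0
  · subst h0; simp; positivity
  have hz' : z = (z.re : ℂ) := Complex.ext rfl (by simp [him])
  have hre : (z.re : ℂ) ≠ 0 := by rwa [← hz']
  have e2 : (resolventPhase c t z - z + (Complex.I * t) * (1 - c * z)) * z = z ^ 2 *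
      (Complex.exp (-(Complex.I * ((t * (z.re⁻¹ - c) : ℝ) : ℂ))) - 1
        + Complex.I * ((t * (z.re⁻¹ - c) : ℝ) : ℂ)) := by
    have e3 : (1 - c * z : ℂ) = z * ((z.re⁻¹ - c : ℝ) : ℂ) := by
      rw [hz']; push_cast; rw [Complex.ofReal_re]; field_simp
    rw [e3, resolventPhase, show Complex.I * ((t * (z.re⁻¹ - c) : ℝ) : ℂ)
      = Complex.I * t * ((z.re⁻¹ - c : ℝ) : ℂ) by push_cast; ring]
    ring
  rw [e2, norm_mul, norm_pow]
  calc _ ≤ ‖z‖ ^ 2 * (3 * (t * (z.re⁻¹ - c)) ^ 2) := by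
        gcongr; exact norm_exp_I_sub_one_add_le _
    _ = 3 * t ^ 2 * (‖z‖ * |z.re⁻¹ - c|) ^ 2 := by rw [mul_pow ‖z‖, sq_abs]; ring
    _ ≤ _ := by gcongr; exact norm_mul_inv_sub_le hR c hz

end PhaseOp

/-- A symmetric operator `H` such that `H + c` is onto for some real `c` generates a unitary
group. -/
theorem exists_unitaryGroup {H : E →ₗ.[ℂ] E}
    (hsymm : ∀ p ∈ H.graph, ∀ q ∈ H.graph, inner ℂ p.2 q.1 = inner ℂ p.1 q.2) (c : ℝ)
    (hsurj : ∀ φ, ∃ ψ, (ψ, φ - (c : ℂ) • ψ) ∈ H.graph) : ∃ U, IsUnitaryGroupOf H U := by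
  obtain ⟨R, hR, hd, hgraph⟩ := exists_resolvent hsymm c hsurj
  let W := phaseOp R c
  -- On the dense range of `R` the rule `R φ ↦ W t φ` is isometric, so it has a unique bounded
  -- extension.
  let U : ℝ → E →L[ℂ] E := fun t => (W t : E →ₗ[ℂ] E).extendOfNorm (R : E →ₗ[ℂ] E)
  have hbd : ∀ t φ, ‖(W t : E →ₗ[ℂ] E) φ‖ ≤ 1 * ‖(R : E →ₗ[ℂ] E) φ‖ := fun t φ => by
    rw [one_mul]; exact (norm_phaseOp_apply hR c t φ).le
  have hUR : ∀ t φ, U t (R φ) = W t φ := fun t φ =>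
    LinearMap.extendOfNorm_eq (f := (W t : E →ₗ[ℂ] E)) (e := (R : E →ₗ[ℂ] E)) hd ⟨1, hbd t⟩ φ
  have hext : ∀ S T : E →L[ℂ] E, (∀ φ, S (R φ) = T (R φ)) → S = T := fun S T h =>
    ContinuousLinearMap.coeFn_injective (hd.equalizer S.continuous T.continuous (funext h))
  have hnorm : ∀ t ψ, ‖U t ψ‖ = ‖ψ‖ := fun t => by
    refine fun ψ => hd.induction_on (p := fun ψ => ‖U t ψ‖ = ‖ψ‖) ψ
      (isClosed_eq (by fun_prop) (by fun_prop)) fun φ => ?_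
    rw [hUR]; exact norm_phaseOp_apply hR c t φ
  have hop : ∀ t, ‖U t‖ ≤ 1 := fun t =>
    (U t).opNorm_le_bound zero_le_one fun ψ => by rw [hnorm, one_mul]
  have hzero : U 0 = 1 := hext _ _ fun φ => by
    rw [hUR]; simp only [W]; rw [phaseOp_zero hR]; rfl
  have hadd : ∀ s t, U (s + t) = U s * U t := fun s t => by
    refine hext _ _ fun φ => ?_
    rw [mul_apply_eq_comp, hUR, hUR]
    have : (W (s + t)) = U s * W t := hext _ _ fun φ => by
      have h1 := congrArg (· φ) (phaseOp_mul_phaseOp hR c s t)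
      have h2 := congrArg (· φ) (phaseOp_comm hR c t)
      simp only [mul_apply_eq_comp] at h1 h2 ⊢
      simp only [W] at hUR ⊢
      rw [← h1, h2, hUR]
    exact congrArg (· φ) this
  have hunit : ∀ t, U t ∈ unitary (E →L[ℂ] E) := fun t => by
    have h1 : star (U t) * U t = 1 := ((U t).norm_map_iff_adjoint_comp_self).1 (hnorm t)
    have h2 : U t * U (-t) = 1 := by rw [← hadd, add_neg_cancel, hzero]
    -- An isometry has only a left inverse; the group law supplies the right inverse `U (-t)` and
    -- identifies it with the adjoint.
    have h3 : star (U t) = U (-t) := by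
      rw [← mul_one (star (U t)), ← h2, ← mul_assoc, h1, one_mul]
    exact Unitary.mem_iff.2 ⟨h1, by rw [h3, h2]⟩
  have hcont : ∀ ψ, Continuous fun t => U t ψ := fun ψ => by
    rw [continuous_iff_continuousAt]
    intro s
    refine tendsto_of_bounded_of_denseRange (Eventually.of_forall hop) hd (fun φ => ?_) ψ
    simp only [hUR]
    rw [tendsto_iff_norm_sub_tendsto_zero]
    refine squeeze_zero (g := fun t => |t - s| * (1 + |c| * ‖R‖) * ‖φ‖)
      (fun _ => norm_nonneg _) (fun t => ?_) ?_
    · rw [← sub_apply]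
      exact (W t - W s).le_of_opNorm_le (norm_phaseOp_sub_le hR c s t) φ
    · have : Continuous fun t : ℝ => |t - s| * (1 + |c| * ‖R‖) * ‖φ‖ := by fun_prop
      simpa using this.tendsto s
  -- Difference quotients of `W` at `0` are uniformly bounded by the Lipschitz estimate and converge
  -- on the dense range of `R` by the Taylor estimate, hence strongly everywhere.
  have hder : ∀ φ, HasDerivAt (fun t => U t (R φ)) (-Complex.I • (φ - (c : ℂ) • R φ)) 0 := by
    intro φ
    rw [hasDerivAt_iff_tendsto_slope_zero]
    let T : ℝ → E →L[ℂ] E := fun t => t⁻¹ • (W t - R)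
    let T₀ : E →L[ℂ] E := -Complex.I • (1 - (c : ℂ) • R)
    have hT : Tendsto (fun t => T t φ) (𝓝[≠] 0) (𝓝 (T₀ φ)) := by
      refine tendsto_of_bounded_of_denseRange (C := 1 + |c| * ‖R‖) ?_ hd (fun χ => ?_) φ
      · filter_upwards [self_mem_nhdsWithin] with t ht
        have := norm_phaseOp_sub_le hR c 0 t
        rw [phaseOp_zero hR, sub_zero] at this
        simp only [T]
        rw [norm_smul, norm_inv, Real.norm_eq_abs]
        rw [inv_mul_le_iff₀ (abs_pos.2 ht)]
        exact this
      · rw [tendsto_iff_norm_sub_tendsto_zero]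
        refine squeeze_zero' (g := fun t => |t| * (3 * (1 + |c| * ‖R‖) ^ 2 * ‖χ‖))
          (Eventually.of_forall fun _ => norm_nonneg _) ?_ ?_
        · filter_upwards [self_mem_nhdsWithin] with t ht
          have ht' : (t : ℂ) ≠ 0 := by exact_mod_cast ht
          have e : T t (R χ) - T₀ (R χ) = t⁻¹ • (((phaseOp R c t - R
              + (Complex.I * t) • (1 - (c : ℂ) • R)) * R) χ) := by
            have : t⁻¹ • ((Complex.I * t) • (R χ - (c : ℂ) • R (R χ)))
                = Complex.I • (R χ - (c : ℂ) • R (R χ)) := by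
              rw [← Complex.coe_smul, smul_smul]
              congr 1
              push_cast; field_simp
            simp only [T, T₀, W, mul_apply_eq_comp, add_apply,
              smul_apply, sub_apply,
              one_apply_eq_self, smul_add, this, neg_smul,
              neg_apply, sub_neg_eq_add]
          rw [e, norm_smul, norm_inv, Real.norm_eq_abs, inv_mul_le_iff₀ (abs_pos.2 ht)]
          refine (ContinuousLinearMap.le_of_opNorm_le _ (norm_phaseOp_sub_add_mul_le hR c t) χ).trans
            (le_of_eq ?_)
          rw [← sq_abs t]; ring
        · have : Continuous fun t : ℝ => |t| * (3 * (1 + |c| * ‖R‖) ^ 2 * ‖χ‖) := by fun_prop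
          simpa using (this.tendsto 0).mono_left nhdsWithin_le_nhds
    refine (hT.congr fun t => ?_)
    simp [T, hUR, W, phaseOp_zero hR]
  refine ⟨U, hunit, hzero, hadd, hcont, fun ψ φ => ⟨fun h => ?_, fun h => ?_⟩⟩
  -- Both sides solve `(H + c) η = φ + c ψ`. Their difference `d` satisfies `H d = -c d` and is
  -- orthogonal to all `χ`, by symmetry against `R χ`.
  · have h1 : R (φ + (c : ℂ) • ψ) = ψ := by
      have h2 := hgraph (φ + (c : ℂ) • ψ)
      have h3 := H.graph.sub_mem h2 h
      set d := R (φ + (c : ℂ) • ψ) - ψ with hdd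
      have h4 : (d, (0 : E) - (c : ℂ) • d) ∈ H.graph := by
        convert h3 using 1
        rw [Prod.mk_sub_mk, hdd, smul_sub]
        congr 1
        abel
      refine sub_eq_zero.1 (ext_inner_right ℂ fun χ => ?_)
      have h5 := hsymm _ h4 _ (hgraph χ)
      simp only [zero_sub, inner_neg_left, inner_sub_right, inner_smul_left, inner_smul_right,
        Complex.conj_ofReal] at h5
      rw [inner_zero_left]
      linear_combination -h5
    have h2 := hder (φ + (c : ℂ) • ψ)
    rwa [h1, add_sub_cancel_right] at h2
  -- The generator is not larger than `H`: the difference `d` has `d/dt U t d = i c d` at `0`.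
  -- Moving `U t` onto `R χ`, whose derivative is known from `hder`, shows that `d` is orthogonal to
  -- every `χ`.
  · have h1 : R (φ + (c : ℂ) • ψ) = ψ := by
      have h2 := hder (φ + (c : ℂ) • ψ)
      set d := R (φ + (c : ℂ) • ψ) - ψ with hdd
      have h3 : HasDerivAt (fun t => U t d) ((Complex.I * c) • d) 0 := by
        have := h2.fun_sub h
        simp only [← map_sub] at this
        convert this using 1
        rw [hdd]
        module
      refine sub_eq_zero.1 (ext_inner_right ℂ fun χ => ?_)
      have h4 := (h3.inner ℂ (hasDerivAt_const (0 : ℝ) (R χ)))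
      have h5 := ((hasDerivAt_const (0 : ℝ) d).inner ℂ
        ((hder χ).scomp_of_eq (0 : ℝ) (hasDerivAt_neg (0 : ℝ)) (by simp)))
      have h6 : (fun t => inner ℂ (U t d) (R χ)) = fun t => inner ℂ d (U (-t) (R χ)) := by
        ext t
        have h7 : U (-t) (U t d) = d := by
          rw [← mul_apply_eq_comp, ← hadd, neg_add_cancel, hzero]; rfl
        conv_rhs => rw [← h7]
        exact ((U (-t)).inner_map_map_of_mem_unitary (hunit (-t)) _ _).symm
      have h8 := h4.unique (h6 ▸ h5)
      simp only [hzero, one_apply_eq_self, inner_zero_right, inner_zero_left,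
        zero_add, add_zero, neg_zero, Function.comp, inner_smul_left, inner_smul_right,
        inner_sub_right, map_mul, Complex.conj_I, Complex.conj_ofReal, neg_smul, one_smul,
        inner_neg_right] at h8
      rw [inner_zero_left]
      have : Complex.I * inner ℂ d χ = 0 := by linear_combination -h8
      exact (mul_eq_zero.1 this).resolve_left Complex.I_ne_zero
    have h2 := hgraph (φ + (c : ℂ) • ψ)
    rwa [h1, add_sub_cancel_right] at h2

end Abstract

/-! ### Multiplication operators on `L²(ℝ)` -/

theorem norm_sq_eq_integral (f : L2) : ‖f‖ ^ 2 = ∫ x, ‖f x‖ ^ 2 := by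
  have h := inner_self_eq_norm_sq_to_K (𝕜 := ℂ) f
  rw [L2.inner_def] at h
  have h2 : (∫ x, inner ℂ (f x) (f x)) = ((∫ x, ‖f x‖ ^ 2 : ℝ) : ℂ) := by
    rw [← integral_complex_ofReal]
    congr 1
    ext x
    rw [inner_self_eq_norm_sq_to_K]
    push_cast
    rfl
  rw [h2] at h
  exact (Complex.ofReal_injective (by simpa using h)).symm

/-- Dominated convergence in `L²`. -/
theorem tendsto_zero_of_dominated {ι : Type*} {l : Filter ι} [l.IsCountablyGenerated]
    {F : ι → L2} {f : ι → ℝ → ℂ} {G : ℝ → ℝ} (hF : ∀ i, F i =ᵐ[volume] f i)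
    (hG : MemLp G 2 volume) (hb : ∀ᶠ i in l, ∀ᵐ x, ‖f i x‖ ≤ G x)
    (hlim : ∀ᵐ x, Tendsto (fun i => f i x) l (𝓝 0)) : Tendsto F l (𝓝 0) := by
  rw [tendsto_zero_iff_norm_tendsto_zero]
  have h1 : Tendsto (fun i => ∫ x, ‖f i x‖ ^ 2) l (𝓝 (∫ _ : ℝ, (0 : ℝ))) := by
    refine tendsto_integral_filter_of_dominated_convergence (fun x => G x ^ 2) ?_ ?_ ?_ ?_
    · exact Eventually.of_forall fun i =>
        (((Lp.aestronglyMeasurable (F i)).congr (hF i)).norm.pow 2)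
    · filter_upwards [hb] with i hi
      filter_upwards [hi] with x hx
      rw [norm_pow, norm_norm]
      gcongr
    · exact hG.integrable_sq
    · filter_upwards [hlim] with x hx
      simpa using hx.norm.pow 2
  have h2 : (fun i => ‖F i‖) = fun i => √(∫ x, ‖f i x‖ ^ 2) := by
    ext i
    rw [← Real.sqrt_sq (norm_nonneg (F i)), norm_sq_eq_integral]
    congr 1
    refine integral_congr_ae ?_
    filter_upwards [hF i] with x hx
    rw [hx]
  rw [h2]
  simpa using h1.sqrt

theorem memLp_mul_of_norm_le_one {m : ℝ → ℂ} (hm : Measurable m) (hb : ∀ k, ‖m k‖ ≤ 1) (φ : L2) :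
    MemLp (fun k => m k * φ k) 2 volume := by
  refine (Lp.memLp φ).of_le (hm.aestronglyMeasurable.mul (Lp.aestronglyMeasurable φ)) ?_
  refine Eventually.of_forall fun k => ?_
  rw [norm_mul]
  exact mul_le_of_le_one_left (norm_nonneg _) (hb k)

/-- Multiplication by a measurable function of modulus at most one, as an operator on `L²(ℝ)`. -/
def mulOp (m : ℝ → ℂ) (hm : Measurable m) (hb : ∀ k, ‖m k‖ ≤ 1) : L2 →L[ℂ] L2 :=
  LinearMap.mkContinuous
    { toFun := fun φ => (memLp_mul_of_norm_le_one hm hb φ).toLp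
      map_add' := fun φ χ => by
        apply Lp.ext
        filter_upwards [(memLp_mul_of_norm_le_one hm hb (φ + χ)).coeFn_toLp,
          (memLp_mul_of_norm_le_one hm hb φ).coeFn_toLp,
          (memLp_mul_of_norm_le_one hm hb χ).coeFn_toLp, Lp.coeFn_add φ χ,
          Lp.coeFn_add (memLp_mul_of_norm_le_one hm hb φ).toLp
            (memLp_mul_of_norm_le_one hm hb χ).toLp] with k h1 h2 h3 h4 h5
        rw [h1, h5, Pi.add_apply, h2, h3, h4, Pi.add_apply, mul_add]
      map_smul' := fun c φ => by
        apply Lp.ext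
        filter_upwards [(memLp_mul_of_norm_le_one hm hb (c • φ)).coeFn_toLp,
          (memLp_mul_of_norm_le_one hm hb φ).coeFn_toLp, Lp.coeFn_smul c φ,
          Lp.coeFn_smul c (memLp_mul_of_norm_le_one hm hb φ).toLp] with k h1 h2 h3 h4
        rw [h1, RingHom.id_apply, h4, Pi.smul_apply, h2, h3, Pi.smul_apply, smul_eq_mul,
          smul_eq_mul]
        ring } 1 fun φ => by
    rw [one_mul]
    refine Lp.norm_le_norm_of_ae_le ?_
    filter_upwards [(memLp_mul_of_norm_le_one hm hb φ).coeFn_toLp] with k h1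
    change ‖((memLp_mul_of_norm_le_one hm hb φ).toLp : ℝ → ℂ) k‖ ≤ _
    rw [h1, norm_mul]
    exact mul_le_of_le_one_left (norm_nonneg _) (hb k)

theorem coeFn_mulOp (m : ℝ → ℂ) (hm : Measurable m) (hb : ∀ k, ‖m k‖ ≤ 1) (φ : L2) :
    mulOp m hm hb φ =ᵐ[volume] fun k => m k * φ k :=
  (memLp_mul_of_norm_le_one hm hb φ).coeFn_toLp

/-- The phase `exp (-i t k²)`. -/
def phase (t k : ℝ) : ℂ := Complex.exp (-(Complex.I * t * ((k ^ 2 : ℝ) : ℂ)))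

theorem phase_eq (t k : ℝ) : phase t k = Complex.exp (-(Complex.I * ((t * k ^ 2 : ℝ) : ℂ))) := by
  rw [phase]; congr 1; push_cast; ring

theorem norm_phase (t k : ℝ) : ‖phase t k‖ = 1 := by
  rw [phase_eq, show -(Complex.I * ((t * k ^ 2 : ℝ) : ℂ)) = ((-(t * k ^ 2) : ℝ) : ℂ) * Complex.I by
    push_cast; ring, Complex.norm_exp_ofReal_mul_I]

theorem continuous_phase (t : ℝ) : Continuous (phase t) := by
  unfold phase; fun_prop

/-- The free evolution in momentum space, that is, multiplication by `exp (-i t k²)`. -/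
def phaseMul (t : ℝ) : L2 →L[ℂ] L2 :=
  mulOp (phase t) (continuous_phase t).measurable fun k => (norm_phase t k).le

theorem coeFn_phaseMul (t : ℝ) (φ : L2) : phaseMul t φ =ᵐ[volume] fun k => phase t k * φ k :=
  coeFn_mulOp _ _ _ φ

theorem phaseMul_zero : phaseMul 0 = 1 := by
  ext1 φ
  apply Lp.ext
  filter_upwards [coeFn_phaseMul 0 φ] with k hk
  rw [hk]; simp [phase]

theorem phaseMul_add (s t : ℝ) : phaseMul (s + t) = phaseMul s * phaseMul t := by
  ext1 φ
  apply Lp.ext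
  rw [mul_apply_eq_comp]
  filter_upwards [coeFn_phaseMul (s + t) φ, coeFn_phaseMul s (phaseMul t φ), coeFn_phaseMul t φ]
    with k h1 h2 h3
  rw [h1, h2, h3, ← mul_assoc, phase, phase, phase, ← Complex.exp_add]
  congr 2
  push_cast; ring

theorem norm_phaseMul_le (t : ℝ) : ‖phaseMul t‖ ≤ 1 := by
  unfold phaseMul mulOp
  exact LinearMap.mkContinuous_norm_le _ zero_le_one _

theorem continuous_phaseMul (φ : L2) : Continuous fun t => phaseMul t φ := by
  rw [continuous_iff_continuousAt]
  intro s
  rw [ContinuousAt, ← tendsto_sub_nhds_zero_iff]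
  refine tendsto_zero_of_dominated (f := fun t k => (phase t k - phase s k) * φ k)
    (G := fun k => 2 * ‖φ k‖) (fun t => ?_) ((Lp.memLp φ).norm.const_mul 2) ?_ ?_
  · filter_upwards [Lp.coeFn_sub (phaseMul t φ) (phaseMul s φ), coeFn_phaseMul t φ,
      coeFn_phaseMul s φ] with k h1 h2 h3
    rw [h1, Pi.sub_apply, h2, h3, sub_mul]
  · refine Eventually.of_forall fun t => Eventually.of_forall fun k => ?_
    rw [norm_mul]
    gcongr
    exact (norm_sub_le _ _).trans (by rw [norm_phase, norm_phase]; norm_num)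
  · refine Eventually.of_forall fun k => ?_
    have : Continuous fun t : ℝ => (phase t k - phase s k) * φ k := by
      unfold phase; fun_prop
    simpa using this.tendsto s

/-- A vector `g` with `k² g ∈ L²` lies in the domain of the generator of `exp (-i t k²)`. -/
theorem hasDerivAt_phaseMul {g g' : L2} (h : g' =ᵐ[volume] fun k => ((k ^ 2 : ℝ) : ℂ) * g k) :
    HasDerivAt (fun t => phaseMul t g) (-Complex.I • g') 0 := by
  rw [hasDerivAt_iff_tendsto_slope_zero, ← tendsto_sub_nhds_zero_iff]
  simp only [zero_add, phaseMul_zero, one_apply_eq_self]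
  -- The `if` records the value at `t = 0`, where `t⁻¹ = 0` leaves only `i k² g`. A representative
  -- is required for every `t`, but the bound only on the punctured neighbourhood.
  refine tendsto_zero_of_dominated
    (f := fun t k => (t : ℂ)⁻¹ * (phase t k - 1 + Complex.I * ((t * k ^ 2 : ℝ) : ℂ)) * g k
      + if t = 0 then Complex.I * ((k ^ 2 : ℝ) : ℂ) * g k else 0)
    (G := fun k => 2 * ‖g' k‖) (fun t => ?_) ((Lp.memLp g').norm.const_mul 2) ?_ ?_
  · filter_upwards [Lp.coeFn_sub (t⁻¹ • (phaseMul t g - g)) (-Complex.I • g'),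
      Lp.coeFn_smul t⁻¹ (phaseMul t g - g), Lp.coeFn_sub (phaseMul t g) g, coeFn_phaseMul t g,
      Lp.coeFn_smul (-Complex.I) g', h] with k h1 h2 h3 h4 h5 h6
    rw [h1, Pi.sub_apply, h2, Pi.smul_apply, h3, Pi.sub_apply, h4, h5, Pi.smul_apply, h6]
    split_ifs with h0
    · simp [h0, mul_assoc]
    · have : (t : ℂ) ≠ 0 := by exact_mod_cast h0
      rw [← Complex.coe_smul, smul_eq_mul, smul_eq_mul]
      push_cast
      field_simp
      ring
  · filter_upwards [self_mem_nhdsWithin] with t ht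
    have ht' : t ≠ 0 := ht
    filter_upwards [h] with k hk
    rw [if_neg ht', add_zero, hk, norm_mul, norm_mul, norm_mul, norm_inv, ← mul_assoc]
    refine mul_le_mul_of_nonneg_right ?_ (norm_nonneg _)
    rw [Complex.norm_real, Complex.norm_real, inv_mul_le_iff₀ (norm_pos_iff.2 ht')]
    calc _ ≤ ‖phase t k - 1‖ + ‖Complex.I * ((t * k ^ 2 : ℝ) : ℂ)‖ := norm_add_le _ _
      _ ≤ |t * k ^ 2| + |t * k ^ 2| := by
        gcongr
        · rw [phase_eq]; exact norm_exp_I_sub_one_le _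
        · simp
      _ = _ := by rw [abs_mul]; simp only [Real.norm_eq_abs]; ring
  · refine Eventually.of_forall fun k => ?_
    have h1 : Tendsto (fun t : ℝ => |t| * (3 * (k ^ 2) ^ 2 * ‖g k‖)) (𝓝[≠] 0) (𝓝 0) := by
      have : Continuous fun t : ℝ => |t| * (3 * (k ^ 2) ^ 2 * ‖g k‖) := by fun_prop
      simpa using (this.tendsto 0).mono_left nhdsWithin_le_nhds
    refine squeeze_zero_norm' ?_ h1
    filter_upwards [self_mem_nhdsWithin] with t ht
    have ht' : t ≠ 0 := ht
    rw [if_neg ht', add_zero, norm_mul, norm_mul, norm_inv, ← mul_assoc]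
    refine mul_le_mul_of_nonneg_right ?_ (norm_nonneg _)
    rw [Complex.norm_real, inv_mul_le_iff₀ (norm_pos_iff.2 ht'), phase_eq]
    refine (norm_exp_I_sub_one_add_le _).trans (le_of_eq ?_)
    rw [Real.norm_eq_abs, mul_pow, ← sq_abs t]; ring

/-! ### Intertwining -/

section Intertwining

variable {E : Type*} [NormedAddCommGroup E] [InnerProductSpace ℂ E] [CompleteSpace E]

theorem hasDerivAt_clm {E E' : Type*} [NormedAddCommGroup E] [NormedSpace ℂ E]
    [NormedAddCommGroup E'] [NormedSpace ℂ E'] (T : E →L[ℂ] E') {f : ℝ → E} {f' : E} {x : ℝ}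
    (h : HasDerivAt f f' x) : HasDerivAt (fun t => T (f t)) (T f') x :=
  (T.restrictScalars ℝ).hasFDerivAt.comp_hasDerivAt x h

theorem IsUnitaryGroupOf.inner_apply_right {H : E →ₗ.[ℂ] E} {U : ℝ → E →L[ℂ] E}
    (hU : IsUnitaryGroupOf H U) (t : ℝ) (ψ φ : E) :
    inner ℂ ψ (U t φ) = inner ℂ (U (-t) ψ) φ := by
  have h : U t (U (-t) ψ) = ψ := by
    rw [← mul_apply_eq_comp, ← hU.map_add, add_neg_cancel, hU.map_zero, one_apply_eq_self]
  conv_lhs => rw [← h]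
  exact (U t).inner_map_map_of_mem_unitary (hU.unitary t) _ _

/-- The domain of `H` is invariant under the group. -/
theorem IsUnitaryGroupOf.apply_mem_graph {H : E →ₗ.[ℂ] E} {U : ℝ → E →L[ℂ] E}
    (hU : IsUnitaryGroupOf H U) (t : ℝ) {ψ φ : E} (h : (ψ, φ) ∈ H.graph) :
    (U t ψ, U t φ) ∈ H.graph := by
  rw [hU.generator] at h ⊢
  have h1 := hasDerivAt_clm (U t) h
  convert h1 using 1
  · ext s
    rw [← mul_apply_eq_comp, ← mul_apply_eq_comp, ← hU.map_add, ← hU.map_add, add_comm]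
  · simp

/-- An operator that intertwines the generators of two unitary groups intertwines the groups. -/
theorem IsUnitaryGroupOf.intertwine {E' : Type*} [NormedAddCommGroup E'] [NormedSpace ℂ E']
    {H : E →ₗ.[ℂ] E} {U : ℝ → E →L[ℂ] E} (hU : IsUnitaryGroupOf H U) {V : ℝ → E' →L[ℂ] E'}
    (hV1 : ∀ t, ‖V t‖ ≤ 1) (hV0 : V 0 = 1) (hVadd : ∀ s t, V (s + t) = V s * V t)
    (hVc : ∀ g, Continuous fun t => V t g) (F : E →L[ℂ] E')
    (hF : ∀ ψ φ, (ψ, φ) ∈ H.graph → HasDerivAt (fun t => V t (F ψ)) (-Complex.I • F φ) 0)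
    {ψ φ : E} (h : (ψ, φ) ∈ H.graph) (t : ℝ) : F (U t ψ) = V t (F ψ) := by
  have h0 : ∀ ψ φ, (ψ, φ) ∈ H.graph → HasDerivAt (fun t => V (-t) (F (U t ψ))) 0 0 := by
    intro ψ φ h
    have e : (fun t => V (-t) (F (U t ψ)))
        = fun t => V (-t) (F ψ) + V (-t) (F (U t ψ) - F ψ) := by
      ext t; rw [← _root_.map_add, add_sub_cancel]
    have h1 : HasDerivAt (fun t => V (-t) (F ψ)) (Complex.I • F φ) 0 := by
      have := (hF ψ φ h).scomp_of_eq (0 : ℝ) (hasDerivAt_neg (0 : ℝ)) (by simp)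
      simpa [Function.comp_def] using this
    have h2 : HasDerivAt (fun t => F (U t ψ)) (-Complex.I • F φ) 0 := by
      have := hasDerivAt_clm F ((hU.generator ψ φ).1 h)
      simpa using this
    -- `V` is only strongly continuous, so no product rule is at hand; contractivity together with
    -- strong continuity suffices because the vector vanishes at `t = 0`.
    have h3 : HasDerivAt (fun t => V (-t) (F (U t ψ) - F ψ)) (-Complex.I • F φ) 0 := by
      rw [hasDerivAt_iff_tendsto_slope_zero] at h2 ⊢
      simp only [zero_add, hU.map_zero, one_apply_eq_self, sub_self, _root_.map_zero, sub_zero] at h2 ⊢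
      have h4 : Tendsto (fun t => V (-t) (-Complex.I • F φ)) (𝓝[≠] 0)
          (𝓝 (-Complex.I • F φ)) := by
        have := ((hVc (-Complex.I • F φ)).comp continuous_neg).tendsto 0
        simp only [Function.comp, neg_zero, hV0, one_apply_eq_self] at this
        exact this.mono_left nhdsWithin_le_nhds
      have h5 : Tendsto (fun t => V (-t) (t⁻¹ • (F (U t ψ) - F ψ) - -Complex.I • F φ)) (𝓝[≠] 0)
          (𝓝 0) := by
        refine squeeze_zero_norm (a := fun t => ‖t⁻¹ • (F (U t ψ) - F ψ) - -Complex.I • F φ‖)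
          (fun t => ?_) ?_
        · exact ((V (-t)).le_of_opNorm_le (hV1 _) _).trans (by rw [one_mul])
        · exact tendsto_iff_norm_sub_tendsto_zero.1 h2
      have := h5.add h4
      rw [zero_add] at this
      refine this.congr fun t => ?_
      rw [← _root_.map_add, sub_add_cancel]
      exact (V (-t)).map_smul_of_tower t⁻¹ _
    rw [e]
    have := h1.add h3
    rw [← add_smul, add_neg_cancel, zero_smul] at this
    exact this
  -- Both groups translate the claim at time `s` back to time `0`, the domain of `H` being
  -- invariant. A vanishing derivative then makes `V (-t) F (U t ψ)` constant.
  have h1 : ∀ s, HasDerivAt (fun t => V (-t) (F (U t ψ))) 0 s := by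
    intro s
    have h2 := hasDerivAt_clm (V (-s)) (h0 _ _ (hU.apply_mem_graph s h))
    rw [_root_.map_zero] at h2
    have h3 := h2.scomp_of_eq s ((hasDerivAt_id s).sub_const s) (by simp)
    rw [smul_zero] at h3
    convert h3 using 1
    ext t
    simp only [Function.comp, id]
    rw [← mul_apply_eq_comp (V (-s)), ← hVadd, ← mul_apply_eq_comp (U (t - s)), ← hU.map_add]
    congr 2
    · ring
    · rw [sub_add_cancel]
  have h2 := is_const_of_deriv_eq_zero (fun s => (h1 s).differentiableAt) (fun s => (h1 s).deriv) t 0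
  simp only [neg_zero, hU.map_zero, hV0, one_apply_eq_self] at h2
  rw [← h2, ← mul_apply_eq_comp, ← hVadd, add_neg_cancel, hV0, one_apply_eq_self]

/-- The evolution of an eigenvector. -/
theorem IsUnitaryGroupOf.apply_eigenvector {H : E →ₗ.[ℂ] E} {U : ℝ → E →L[ℂ] E}
    (hU : IsUnitaryGroupOf H U) {v : E} {e : ℝ} (hv : (v, (e : ℂ) • v) ∈ H.graph) (t : ℝ) :
    U t v = Complex.exp (-(Complex.I * t * e)) • v := by
  have h1 : ∀ s, HasDerivAt (fun t : ℝ => Complex.exp (Complex.I * t * e) • U t v) 0 s := by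
    intro s
    have h2 := (hU.generator _ _).1 (hU.apply_mem_graph s hv)
    have h3 := h2.scomp_of_eq s ((hasDerivAt_id s).sub_const s) (by simp)
    have e1 : (fun t => U t (U s v)) ∘ (fun y => id y - s) = fun t => U t v := by
      ext t
      simp only [Function.comp, id]
      rw [← mul_apply_eq_comp, ← hU.map_add, sub_add_cancel]
    rw [e1, one_smul] at h3
    have h4 : HasDerivAt (fun t : ℝ => Complex.exp (Complex.I * t * e))
        (Complex.exp (Complex.I * s * e) * (Complex.I * e)) s := by
      have : HasDerivAt (fun t : ℝ => Complex.I * (t : ℂ) * e) (Complex.I * e) s := by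
        have := ((hasDerivAt_id s).ofReal_comp.const_mul Complex.I).mul_const (e : ℂ)
        simpa using this
      exact this.cexp
    have h5 := h4.fun_smul h3
    convert h5 using 1
    rw [map_smul]
    module
  have h2 := is_const_of_deriv_eq_zero (fun s => (h1 s).differentiableAt) (fun s => (h1 s).deriv) t 0
  simp only [Complex.ofReal_zero, mul_zero, zero_mul, Complex.exp_zero, one_smul, hU.map_zero,
    one_apply_eq_self] at h2
  rw [← h2, smul_smul, ← Complex.exp_add, neg_add_cancel, Complex.exp_zero, one_smul, h2]

end Intertwining

/-! ### The absolutely continuous subspace from a spectral representation -/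

/-- Apart from `0`, the preimage is the image of the positive part of `N` under `√` and `-√`, both
differentiable there, and such maps preserve null sets. -/
theorem volume_preimage_sq_eq_zero {N : Set ℝ} (hN : volume N = 0) :
    volume ((fun k : ℝ => k ^ 2) ⁻¹' N) = 0 := by
  have hN' : volume (N ∩ Ioi 0) = 0 := measure_mono_null inter_subset_left hN
  have hd : DifferentiableOn ℝ Real.sqrt (N ∩ Ioi 0) := fun x hx =>
    (Real.hasDerivAt_sqrt (ne_of_gt hx.2)).differentiableAt.differentiableWithinAt
  have h1 := addHaar_image_eq_zero_of_differentiableOn_of_addHaar_eq_zero volume hd hN'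
  have h2 := addHaar_image_eq_zero_of_differentiableOn_of_addHaar_eq_zero volume hd.neg hN'
  refine measure_mono_null (t := {0} ∪ Real.sqrt '' (N ∩ Ioi 0) ∪ (-Real.sqrt) '' (N ∩ Ioi 0)) ?_
    (measure_union_null (measure_union_null (by simp) h1) h2)
  intro k hk
  rcases lt_trichotomy k 0 with h | h | h
  · exact Or.inr ⟨k ^ 2, ⟨hk, sq_pos_of_neg h⟩, by
      rw [Pi.neg_apply, Real.sqrt_sq_eq_abs, abs_of_neg h, neg_neg]⟩
  · exact Or.inl (Or.inl h)
  · exact Or.inl (Or.inr ⟨k ^ 2, ⟨hk, by simp only [mem_Ioi]; positivity⟩, Real.sqrt_sq h.le⟩)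

/-- The distribution of `k²` under the density `|g(k)|²`. -/
def energyMeasure (g : L2) : Measure ℝ :=
  (volume.withDensity fun k => (ENNReal.ofReal (‖g k‖ ^ 2))).map fun k => k ^ 2

theorem measurable_energyDensity (g : L2) :
    Measurable fun k => (ENNReal.ofReal (‖g k‖ ^ 2)) :=
  ((Lp.stronglyMeasurable g).norm.measurable.pow_const 2).ennreal_ofReal

theorem integrable_norm_sq (g : L2) : Integrable (fun k => ‖g k‖ ^ 2) volume :=
  (Lp.memLp g).integrable_norm_pow two_ne_zero

instance isFiniteMeasure_energyMeasure (g : L2) : IsFiniteMeasure (energyMeasure g) := by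
  have : IsFiniteMeasure (volume.withDensity fun k => (ENNReal.ofReal (‖g k‖ ^ 2))) :=
    isFiniteMeasure_withDensity_ofReal (integrable_norm_sq g).2
  unfold energyMeasure
  infer_instance

theorem energyMeasure_absolutelyContinuous (g : L2) : energyMeasure g ≪ volume := by
  refine Measure.AbsolutelyContinuous.mk fun N hN hN0 => ?_
  rw [energyMeasure, Measure.map_apply (by fun_prop) hN]
  exact withDensity_absolutelyContinuous _ _ (volume_preimage_sq_eq_zero hN0)

theorem integral_energyMeasure (g : L2) (t : ℝ) :
    ∫ l, Complex.exp (-(Complex.I * t * l)) ∂energyMeasure g = inner ℂ g (phaseMul t g) := by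
  rw [energyMeasure, integral_map (by fun_prop) (by fun_prop),
    integral_withDensity_eq_integral_toReal_smul (measurable_energyDensity g) (by simp),
    L2.inner_def]
  refine integral_congr_ae ?_
  filter_upwards [coeFn_phaseMul t g] with k hk
  rw [hk, ENNReal.toReal_ofReal (by positivity), RCLike.inner_apply, phase, Complex.real_smul,
    mul_assoc (Complex.exp _), Complex.mul_conj, Complex.normSq_eq_norm_sq, mul_comm]

theorem IsSpectralMeasure.unique {E : Type*} [NormedAddCommGroup E] [InnerProductSpace ℂ E]
    [CompleteSpace E] {U : ℝ → E →L[ℂ] E} {ψ : E} {μ ν : Measure ℝ}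
    (hμ : IsSpectralMeasure U ψ μ) (hν : IsSpectralMeasure U ψ ν) : μ = ν := by
  obtain ⟨_, hμ⟩ := hμ
  obtain ⟨_, hν⟩ := hν
  refine Measure.ext_of_charFun ?_
  ext t
  have h := (hμ (-t)).symm.trans (hν (-t))
  rw [charFun_apply_real, charFun_apply_real]
  convert h using 4 <;> push_cast <;> ring

/-- If `L²(ℝ, dk)`-valued operators `F i` diagonalize the group as multiplication by
`exp (-i t k²)` and are, together with the eigenvectors `v i`, complete, then `∑ (F i)* F i` is the
projector onto the absolutely continuous subspace. -/
theorem acProjection_eq {E ι : Type*} [NormedAddCommGroup E] [InnerProductSpace ℂ E]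
    [CompleteSpace E] [Fintype ι] {H : E →ₗ.[ℂ] E} {U : ℝ → E →L[ℂ] E}
    (hU : IsUnitaryGroupOf H U) (F : ι → E →L[ℂ] L2) (v : ι → E) (e : ι → ℝ)
    (hF : ∀ i t ψ, F i (U t ψ) = phaseMul t (F i ψ))
    (hv : ∀ i, (v i, (e i : ℂ) • v i) ∈ H.graph) (hFv : ∀ i j, F i (v j) = 0)
    (hcomp : ∀ ψ, ∑ i, (F i).adjoint (F i ψ) + ∑ i, inner ℂ (v i) ψ • v i = ψ) (ψ : E) :
    acProjection U ψ = ∑ i, (F i).adjoint (F i ψ) := by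
  -- By completeness this is the spectral measure of every `ψ`: distributions of `k²` coming from
  -- the transforms, plus atoms at the eigenvalues.
  let ν : E → Measure ℝ := fun ψ => ∑ i, energyMeasure (F i ψ)
    + ∑ i, ENNReal.ofReal (‖inner ℂ (v i) ψ‖ ^ 2) • Measure.dirac (e i)
  have hdir : ∀ ψ i, IsFiniteMeasure
      (ENNReal.ofReal (‖inner ℂ (v i) ψ‖ ^ 2) • Measure.dirac (e i)) := fun ψ i =>
    Measure.smul_finite _ ENNReal.ofReal_ne_top
  have hfin : ∀ ψ, IsFiniteMeasure (ν ψ) := fun ψ => by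
    have h1 : IsFiniteMeasure (∑ i, energyMeasure (F i ψ)) := inferInstance
    have h2 : IsFiniteMeasure
        (∑ i, ENNReal.ofReal (‖inner ℂ (v i) ψ‖ ^ 2) • Measure.dirac (e i)) := inferInstance
    exact inferInstanceAs (IsFiniteMeasure (_ + _))
  have hint : ∀ (μ : Measure ℝ) [IsFiniteMeasure μ] (t : ℝ),
      Integrable (fun l : ℝ => Complex.exp (-(Complex.I * t * l))) μ := fun μ _ t => by
    refine Integrable.of_bound (by fun_prop) 1 (Eventually.of_forall fun l => ?_)
    rw [show -(Complex.I * t * l) = ((-(t * l) : ℝ) : ℂ) * Complex.I by push_cast; ring,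
      Complex.norm_exp_ofReal_mul_I]
  have hν : ∀ ψ, IsSpectralMeasure U ψ (ν ψ) := fun ψ => by
    refine ⟨hfin ψ, fun t => ?_⟩
    have h1 : IsFiniteMeasure (∑ i, energyMeasure (F i ψ)) := inferInstance
    have h2 : IsFiniteMeasure
        (∑ i, ENNReal.ofReal (‖inner ℂ (v i) ψ‖ ^ 2) • Measure.dirac (e i)) := inferInstance
    rw [integral_add_measure (hint _ t) (hint _ t), integral_finsetSum_measure fun i _ => hint _ t,
      integral_finsetSum_measure fun i _ => hint _ t]
    conv_lhs => rw [← hcomp (U t ψ)]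
    rw [inner_add_right, inner_sum, inner_sum]
    congr 1
    · refine Finset.sum_congr rfl fun i _ => ?_
      rw [integral_energyMeasure, ContinuousLinearMap.adjoint_inner_right, hF]
    · refine Finset.sum_congr rfl fun i _ => ?_
      rw [integral_smul_measure, integral_dirac, inner_smul_right, hU.inner_apply_right,
        hU.apply_eigenvector (hv i), inner_smul_left, ENNReal.toReal_ofReal (by positivity),
        ← inner_conj_symm ψ (v i), mul_assoc, Complex.mul_conj, Complex.normSq_eq_norm_sq,
        Complex.real_smul, mul_comm, ← Complex.exp_conj]
      congr 2
      simp
  have horth : ∀ i ψ, inner ℂ (v i) (∑ j, (F j).adjoint (F j ψ)) = 0 := fun i ψ => by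
    rw [inner_sum]
    refine Finset.sum_eq_zero fun j _ => ?_
    rw [ContinuousLinearMap.adjoint_inner_right, hFv, inner_zero_left]
  have : CompleteSpace (acSubspace U) := Submodule.topologicalClosure.completeSpace _
  refine Submodule.eq_starProjection_of_mem_orthogonal ?_ ?_
  · refine Submodule.le_topologicalClosure _ (Submodule.subset_span ⟨_, hν _, ?_⟩)
    -- The proposed projection is orthogonal to all `v i`, so its spectral measure has no atoms.
    have h0 : (∑ i, ENNReal.ofReal (‖inner ℂ (v i) (∑ j, (F j).adjoint (F j ψ))‖ ^ 2)
        • Measure.dirac (e i)) = 0 := Finset.sum_eq_zero fun i _ => by rw [horth]; simp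
    simp only [ν]
    rw [h0, add_zero]
    refine Measure.AbsolutelyContinuous.mk fun N _ hN0 => ?_
    rw [Measure.finsetSum_apply]
    exact Finset.sum_eq_zero fun i _ => energyMeasure_absolutelyContinuous _ hN0
  · have hsub : ψ - ∑ i, (F i).adjoint (F i ψ) = ∑ i, inner ℂ (v i) ψ • v i := by
      rw [sub_eq_iff_eq_add', hcomp]
    rw [hsub, acSubspace, Submodule.orthogonal_closure]
    refine Submodule.sum_mem _ fun i _ => Submodule.smul_mem _ _ ?_
    rw [Submodule.mem_orthogonal]
    intro χ hχ
    induction hχ using Submodule.span_induction with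
    | mem χ hχ =>
      obtain ⟨μ, hμ, hac⟩ := hχ
      -- Conversely, an absolutely continuous spectral measure gives `{e i}` no mass. All
      -- contributions to that mass are nonnegative, so the one of `v i` vanishes and `χ` is
      -- orthogonal to `v i`.
      rw [hμ.unique (hν χ)] at hac
      have h1 := hac (show volume {e i} = 0 by simp)
      simp only [ν] at h1
      rw [Measure.add_apply, add_eq_zero, Measure.finsetSum_apply, Measure.finsetSum_apply,
        Finset.sum_eq_zero_iff, Finset.sum_eq_zero_iff] at h1
      have h2 := h1.2 i (Finset.mem_univ i)
      simp at h2
      exact inner_eq_zero_symm.1 h2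
    | zero => simp
    | add x y _ _ hx hy => rw [inner_add_left, hx, hy, add_zero]
    | smul c x _ hx => rw [inner_smul_left, hx, mul_zero]

/-! ### Green's identity -/

/-- Absolute continuity of primitives of real functions is applied to real and imaginary part
separately. -/
theorem absolutelyContinuousOnInterval_integral {u : ℝ → ℂ} (hu : Integrable u volume) (p q : ℝ)
    (C : ℂ) : AbsolutelyContinuousOnInterval (fun x => C + ∫ s in p..x, u s) p q := by
  have hre : IntervalIntegrable (fun s => (u s).re) volume p q := hu.re.intervalIntegrable
  have him : IntervalIntegrable (fun s => (u s).im) volume p q := hu.im.intervalIntegrable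
  have hc : ∀ c : ℂ, AbsolutelyContinuousOnInterval (fun _ : ℝ => c) p q := fun c =>
    (LipschitzWith.const c).lipschitzOnWith.absolutelyContinuousOnInterval (K := 0)
  have h := (hc C).add (((hre.absolutelyContinuousOnInterval_intervalIntegral
    left_mem_uIcc).fun_smul (hc 1)).add
    ((him.absolutelyContinuousOnInterval_intervalIntegral left_mem_uIcc).fun_smul (hc Complex.I)))
  refine Eq.subst (motive := fun F => AbsolutelyContinuousOnInterval F p q) ?_ h
  funext x
  simp only [Pi.add_apply]
  congr 1
  symm
  rw [← Complex.coe_smul, ← Complex.coe_smul, smul_eq_mul, smul_eq_mul, mul_one,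
    ← intervalIntegral.integral_ofReal, ← intervalIntegral.integral_ofReal,
    ← intervalIntegral.integral_mul_const, ← intervalIntegral.integral_add]
  · simp
  · exact hu.re.ofReal.intervalIntegrable
  · exact (hu.im.ofReal.mul_const _).intervalIntegrable

/-- Integration by parts for two functions that are integrals. -/
theorem integral_mul_add_mul_eq {f g u v : ℝ → ℂ} {p q : ℝ} (hpq : p ≤ q)
    (hu : IntervalIntegrable u volume p q) (hv : IntervalIntegrable v volume p q)
    (hf : ∀ x ∈ Icc p q, f x - f p = ∫ s in p..x, u s)
    (hg : ∀ x ∈ Icc p q, g x - g p = ∫ s in p..x, v s) :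
    ∫ s in p..q, (u s * g s + f s * v s) = f q * g q - f p * g p := by
  -- Cutting off to `(p, q]` makes the primitives defined and continuous on the whole line without
  -- changing anything on `[p, q]`.
  have hu' : Integrable (indicator (Ioc p q) u) volume :=
    (integrable_indicator_iff measurableSet_Ioc).2 ((intervalIntegrable_iff_integrableOn_Ioc_of_le hpq).1 hu)
  have hv' : Integrable (indicator (Ioc p q) v) volume :=
    (integrable_indicator_iff measurableSet_Ioc).2 ((intervalIntegrable_iff_integrableOn_Ioc_of_le hpq).1 hv)
  set u' := indicator (Ioc p q) u
  set v' := indicator (Ioc p q) v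
  let F : ℝ → ℂ := fun x => f p + ∫ s in p..x, u' s
  let G : ℝ → ℂ := fun x => g p + ∫ s in p..x, v' s
  have hind : ∀ w : ℝ → ℂ, ∀ x ∈ Icc p q,
      ∫ s in p..x, indicator (Ioc p q) w s = ∫ s in p..x, w s := by
    intro w x hx
    refine intervalIntegral.integral_congr_ae (Eventually.of_forall fun s hs => ?_)
    rw [uIoc_of_le hx.1] at hs
    exact indicator_of_mem (show s ∈ Ioc p q from ⟨hs.1, hs.2.trans hx.2⟩) _
  have hF : ∀ x ∈ Icc p q, F x = f x := fun x hx => by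
    simp only [F, u']; rw [hind u x hx, ← hf x hx]; ring
  have hG : ∀ x ∈ Icc p q, G x = g x := fun x hx => by
    simp only [G, v']; rw [hind v x hx, ← hg x hx]; ring
  have hFac := absolutelyContinuousOnInterval_integral hu' p q (f p)
  have hGac := absolutelyContinuousOnInterval_integral hv' p q (g p)
  have hFc : Continuous F := continuous_const.add
    (intervalIntegral.continuous_primitive (fun _ _ => hu'.intervalIntegrable) p)
  have hGc : Continuous G := continuous_const.add
    (intervalIntegral.continuous_primitive (fun _ _ => hv'.intervalIntegrable) p)
  let w : ℝ → ℂ := indicator (Ioc p q) fun s => u' s * G s + F s * v' s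
  have hw : Integrable w volume := by
    refine (integrable_indicator_iff measurableSet_Ioc).2 ?_
    refine (intervalIntegrable_iff_integrableOn_Ioc_of_le hpq).1 ?_
    exact (hu'.intervalIntegrable.mul_continuousOn hGc.continuousOn).add
      (hv'.intervalIntegrable.continuousOn_mul hFc.continuousOn)
  -- `F G` minus the candidate integral is absolutely continuous with derivative zero almost
  -- everywhere, hence constant on the interval.
  have hac := (hFac.fun_smul hGac).sub (absolutelyContinuousOnInterval_integral hw p q 0)
  obtain ⟨C, hC⟩ := hac.const_of_ae_hasDerivAt_zero (by
    have hp : ∀ᵐ x : ℝ, x ≠ p := by simp [ae_iff]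
    filter_upwards [hu'.intervalIntegrable (a := p) (b := q) |>.ae_hasDerivAt_integral,
      hv'.intervalIntegrable (a := p) (b := q) |>.ae_hasDerivAt_integral,
      hw.intervalIntegrable (a := p) (b := q) |>.ae_hasDerivAt_integral, hp] with x h1 h2 h3 h4 hx
    have d1 := (h1 hx p left_mem_uIcc).const_add (f p)
    have d2 := (h2 hx p left_mem_uIcc).const_add (g p)
    have d3 := (h3 hx p left_mem_uIcc).const_add 0
    have hxx : x ∈ Ioc p q := by
      rw [uIcc_of_le hpq] at hx
      exact ⟨lt_of_le_of_ne hx.1 (Ne.symm h4), hx.2⟩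
    have hwx : w x = u' x * G x + F x * v' x := indicator_of_mem hxx _
    have d4 := (d1.fun_smul d2).sub d3
    rw [hwx, smul_eq_mul, smul_eq_mul] at d4
    simp only [F, G] at d4
    exact d4.congr_deriv (by ring))
  have h1 := hC q right_mem_uIcc
  have h2 := hC p left_mem_uIcc
  simp only [Pi.sub_apply, zero_add, smul_eq_mul, intervalIntegral.integral_same, add_zero,
    sub_zero] at h1 h2
  have e1 : F q * G q - ∫ s in p..q, w s = f p * g p := h1.trans h2.symm
  have e2 : ∫ s in p..q, w s = ∫ s in p..q, (u s * g s + f s * v s) := by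
    refine intervalIntegral.integral_congr_ae (Eventually.of_forall fun s hs => ?_)
    rw [uIoc_of_le hpq] at hs
    simp only [w]
    rw [indicator_of_mem hs, hF s ⟨hs.1.le, hs.2⟩, hG s ⟨hs.1.le, hs.2⟩]
    simp only [u', v']
    rw [indicator_of_mem hs, indicator_of_mem hs]
  rw [← e2, ← hF q (right_mem_Icc.2 hpq), ← hG q (right_mem_Icc.2 hpq)]
  linear_combination -e1

/-- `f` solves `-f'' = φ` off `±a` (with `g = f'`) and satisfies the interface conditions. -/
structure IsSol (a α : ℝ) (f g φ : ℝ → ℂ) : Prop where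
  locallyIntegrable : LocallyIntegrable φ volume
  hasDerivAt : ∀ x ∈ ({a, -a}ᶜ : Set ℝ), HasDerivAt f (g x) x
  sub_eq : ∀ x y : ℝ, x ≤ y → Icc x y ⊆ ({a, -a}ᶜ : Set ℝ) → g y - g x = ∫ s in x..y, -φ s
  delta : DeltaCondition α f g a
  delta_neg : DeltaCondition α f g (-a)

theorem hasAction_iff {a α : ℝ} {ψ φ : L2} : HasAction a α ψ φ ↔
    ∃ f g : ℝ → ℂ, ψ =ᵐ[volume] f ∧ MemLp g 2 volume ∧ IsSol a α f g φ := by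
  constructor
  · rintro ⟨f, g, ⟨h1, h2, h3, h4⟩, h5, h6⟩
    exact ⟨f, g, h1, h2, (Lp.memLp φ).locallyIntegrable (by norm_num), h3, h4, h5, h6⟩
  · rintro ⟨f, g, h1, h2, -, h3, h4, h5, h6⟩
    exact ⟨f, g, ⟨h1, h2, h3, h4⟩, h5, h6⟩

theorem LocallyIntegrable.intervalIntegrable' {φ : ℝ → ℂ} (h : LocallyIntegrable φ volume)
    (p q : ℝ) : IntervalIntegrable φ volume p q :=
  (h.integrableOn_isCompact isCompact_uIcc).intervalIntegrable

section Green

variable {a α : ℝ} {f g φ f₁ g₁ φ₁ f₂ g₂ φ₂ : ℝ → ℂ}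

theorem IsSol.continuousOn_deriv (h : IsSol a α f g φ) {p q : ℝ}
    (hs : Icc p q ⊆ ({a, -a}ᶜ : Set ℝ)) : ContinuousOn g (Icc p q) := by
  have hc : Continuous fun x => g p + ∫ s in p..x, -φ s := continuous_const.add
    (intervalIntegral.continuous_primitive
      (fun u v => (LocallyIntegrable.intervalIntegrable' h.locallyIntegrable u v).neg) p)
  refine hc.continuousOn.congr fun x hx => ?_
  simp only
  rw [← h.sub_eq p x hx.1 ((Icc_subset_Icc_right hx.2).trans hs)]
  ring

/-- The Wronskian identity on an interval free of interaction points. -/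
theorem IsSol.wronskian_sub (h₁ : IsSol a α f₁ g₁ φ₁) (h₂ : IsSol a α f₂ g₂ φ₂) {p q : ℝ}
    (hpq : p ≤ q) (hs : Icc p q ⊆ ({a, -a}ᶜ : Set ℝ)) :
    (f₁ q * g₂ q - g₁ q * f₂ q) - (f₁ p * g₂ p - g₁ p * f₂ p)
      = ∫ s in p..q, (φ₁ s * f₂ s - f₁ s * φ₂ s) := by
  -- Integration by parts of `f g'`. Subtracting the identity with the two solutions exchanged
  -- cancels the symmetric term `g g'`.
  have key : ∀ {f g φ f' g' φ' : ℝ → ℂ}, IsSol a α f g φ → IsSol a α f' g' φ' →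
      ∫ s in p..q, (g s * g' s + f s * -φ' s) = f q * g' q - f p * g' p := by
    intro f g φ f' g' φ' h h'
    have hg := h.continuousOn_deriv hs
    refine integral_mul_add_mul_eq hpq (hg.intervalIntegrable_of_Icc hpq)
      (LocallyIntegrable.intervalIntegrable' h'.locallyIntegrable p q).neg (fun x hx => ?_)
      fun x hx => h'.sub_eq p x hx.1 ((Icc_subset_Icc_right hx.2).trans hs)
    have hsub : Icc p x ⊆ Icc p q := Icc_subset_Icc_right hx.2
    rw [intervalIntegral.integral_eq_sub_of_hasDerivAt]
    · intro y hy
      rw [uIcc_of_le hx.1] at hy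
      exact h.hasDerivAt y (hs (hsub hy))
    · exact (hg.mono hsub).intervalIntegrable_of_Icc hx.1
  have hf : ∀ {f g φ : ℝ → ℂ}, IsSol a α f g φ → ContinuousOn f (uIcc p q) := fun h x hx => by
    rw [uIcc_of_le hpq] at hx
    exact (h.hasDerivAt x (hs hx)).continuousAt.continuousWithinAt
  have hg : ∀ {f g φ : ℝ → ℂ}, IsSol a α f g φ → ContinuousOn g (uIcc p q) := fun h => by
    rw [uIcc_of_le hpq]; exact h.continuousOn_deriv hs
  have hi : ∀ {f g φ f' g' φ' : ℝ → ℂ}, IsSol a α f g φ → IsSol a α f' g' φ' →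
      IntervalIntegrable (fun s => g s * g' s + f s * -φ' s) volume p q := fun h h' =>
    ((hg h).mul (hg h')).intervalIntegrable.add
      ((LocallyIntegrable.intervalIntegrable' h'.locallyIntegrable p q).neg.continuousOn_mul (hf h))
  have e1 := key h₁ h₂
  have e2 := key h₂ h₁
  have e3 := intervalIntegral.integral_sub (hi h₁ h₂) (hi h₂ h₁)
  rw [e1, e2] at e3
  rw [show f₁ q * g₂ q - g₁ q * f₂ q - (f₁ p * g₂ p - g₁ p * f₂ p)
    = f₁ q * g₂ q - f₁ p * g₂ p - (f₂ q * g₁ q - f₂ p * g₁ p) by ring, ← e3]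
  congr 1
  ext s
  ring

/-- The Wronskian of two solutions has a limit at each interaction point. -/
theorem DeltaCondition.wronskian {c : ℝ} (h₁ : DeltaCondition α f₁ g₁ c)
    (h₂ : DeltaCondition α f₂ g₂ c) : ∃ l : ℂ,
    Tendsto (fun x => f₁ x * g₂ x - g₁ x * f₂ x) (𝓝[>] c) (𝓝 l) ∧
    Tendsto (fun x => f₁ x * g₂ x - g₁ x * f₂ x) (𝓝[<] c) (𝓝 l) := by
  obtain ⟨v, dr, dl, e1, e2, e3, e4, e5⟩ := h₁
  obtain ⟨v', dr', dl', e1', e2', e3', e4', e5'⟩ := h₂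
  -- The Wronskian jumps by `v (α v') - (α v) v' = 0`, which is all that the interface condition is
  -- used for in Green's identity.
  refine ⟨v * dr' - dr * v', (e1.mul e3').sub (e3.mul e1'), ?_⟩
  have := (e2.mul e4').sub (e4.mul e2')
  convert this using 2
  linear_combination v' * e5 - v * e5'

/-- Green's identity between points on either side of the interaction points. -/
theorem IsSol.wronskian_sub_of_lt (ha : 0 < a) (h₁ : IsSol a α f₁ g₁ φ₁)
    (h₂ : IsSol a α f₂ g₂ φ₂)
    (hi : Integrable (fun s => φ₁ s * f₂ s - f₁ s * φ₂ s) volume) {p q : ℝ} (hp : p < -a)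
    (hq : a < q) :
    (f₁ q * g₂ q - g₁ q * f₂ q) - (f₁ p * g₂ p - g₁ p * f₂ p)
      = ∫ s in p..q, (φ₁ s * f₂ s - f₁ s * φ₂ s) := by
  set W : ℝ → ℂ := fun x => f₁ x * g₂ x - g₁ x * f₂ x with hW
  set η : ℝ → ℂ := fun s => φ₁ s * f₂ s - f₁ s * φ₂ s with hη
  let I : ℝ → ℂ := fun x => ∫ s in (0 : ℝ)..x, η s
  have hIc : Continuous I :=
    intervalIntegral.continuous_primitive (fun _ _ => hi.intervalIntegrable) 0
  have hI : ∀ x y, ∫ s in x..y, η s = I y - I x := fun x y => by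
    simp only [I]
    rw [intervalIntegral.integral_interval_sub_left] <;> exact hi.intervalIntegrable
  have hsub : ∀ x y, x ≤ y → Icc x y ⊆ ({a, -a}ᶜ : Set ℝ) → W y - W x = I y - I x :=
    fun x y hxy hs => by rw [← hI]; exact h₁.wronskian_sub h₂ hxy hs
  obtain ⟨l, hl1, hl2⟩ := h₁.delta.wronskian h₂.delta
  obtain ⟨l', hl1', hl2'⟩ := h₁.delta_neg.wronskian h₂.delta_neg
  have ce : ∀ c, Tendsto I (𝓝[<] c) (𝓝 (I c)) := fun c => (hIc.tendsto c).mono_left nhdsWithin_le_nhds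
  have ce' : ∀ c, Tendsto I (𝓝[>] c) (𝓝 (I c)) := fun c => (hIc.tendsto c).mono_left nhdsWithin_le_nhds
  -- The four pieces `(p, -a)`, `(-a, 0)`, `(0, a)`, `(a, q)` are taken as one-sided limits at `±a`
  -- and telescope.
  have k1 : l' - W p = I (-a) - I p := by
    refine tendsto_nhds_unique_of_eventuallyEq (hl2'.sub_const (W p)) ((ce (-a)).sub_const (I p)) ?_
    filter_upwards [Ioo_mem_nhdsLT hp] with x hx
    refine hsub p x hx.1.le fun y hy => ?_
    simp only [mem_compl_iff, mem_insert_iff, mem_singleton_iff, not_or]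
    constructor <;> intro h <;> linarith [hy.1, hy.2, hx.1, hx.2]
  have k4 : W q - l = I q - I a := by
    refine tendsto_nhds_unique_of_eventuallyEq (hl1.const_sub (W q)) ((ce' a).const_sub (I q)) ?_
    filter_upwards [Ioo_mem_nhdsGT hq] with x hx
    refine hsub x q hx.2.le fun y hy => ?_
    simp only [mem_compl_iff, mem_insert_iff, mem_singleton_iff, not_or]
    constructor <;> intro h <;> linarith [hy.1, hy.2, hx.1, hx.2]
  have mid : ∀ x y, x ≤ y → -a < x → y < a → W y - W x = I y - I x := fun x y hxy hx hy => by
    refine hsub x y hxy fun z hz => ?_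
    simp only [mem_compl_iff, mem_insert_iff, mem_singleton_iff, not_or]
    constructor <;> intro h <;> linarith [hz.1, hz.2]
  have k2 : W 0 - l' = I 0 - I (-a) := by
    refine tendsto_nhds_unique_of_eventuallyEq (hl1'.const_sub (W 0)) ((ce' (-a)).const_sub (I 0)) ?_
    filter_upwards [Ioo_mem_nhdsGT (show -a < 0 by linarith)] with x hx
    exact mid x 0 hx.2.le hx.1 ha
  have k3 : l - W 0 = I a - I 0 := by
    refine tendsto_nhds_unique_of_eventuallyEq (hl2.sub_const (W 0)) ((ce a).sub_const (I 0)) ?_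
    filter_upwards [Ioo_mem_nhdsLT ha] with x hx
    exact mid 0 x hx.1.le (by linarith) hx.2
  rw [hI]
  change W q - W p = _
  linear_combination k1 + k2 + k3 + k4

/-- Half-lines have infinite measure, so an integrable function can have no limit but `0`. The `L¹`
alternative is for Wronskians of two `L²` solutions, the `L²` alternative for an `L²` solution
against a merely bounded one. -/
theorem eq_zero_of_tendsto_of_integrable_norm_sq {W : ℝ → ℂ} {l : ℂ} {F : Filter ℝ}
    (hF : F = atTop ∨ F = atBot)
    (hW : Integrable W volume ∨ Integrable (fun x => ‖W x‖ ^ 2) volume)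
    (h : Tendsto W F (𝓝 l)) : l = 0 := by
  have hinf : ∀ s ∈ F, volume s = ⊤ := by
    rcases hF with rfl | rfl
    · intro s hs
      obtain ⟨b, hb⟩ := mem_atTop_sets.1 hs
      exact top_le_iff.1 (Real.volume_Ici (a := b) ▸ measure_mono hb)
    · intro s hs
      obtain ⟨b, hb⟩ := mem_atBot_sets.1 hs
      exact top_le_iff.1 (Real.volume_Iic (a := b) ▸ measure_mono hb)
  rcases hW with hW | hW
  · exact IntegrableAtFilter.eq_zero_of_tendsto ⟨univ, univ_mem, hW.integrableOn⟩ hinf h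
  · have := IntegrableAtFilter.eq_zero_of_tendsto ⟨univ, univ_mem, hW.integrableOn⟩ hinf
      (h.norm.pow 2)
    simpa using this

/-- Green's identity on the line. -/
theorem IsSol.integral_eq (ha : 0 < a) (h₁ : IsSol a α f₁ g₁ φ₁) (h₂ : IsSol a α f₂ g₂ φ₂)
    (hi₁ : Integrable (fun s => φ₁ s * f₂ s) volume)
    (hi₂ : Integrable (fun s => f₁ s * φ₂ s) volume)
    (hW : Integrable (fun x => f₁ x * g₂ x - g₁ x * f₂ x) volume ∨
      Integrable (fun x => ‖f₁ x * g₂ x - g₁ x * f₂ x‖ ^ 2) volume) :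
    ∫ s, φ₁ s * f₂ s = ∫ s, f₁ s * φ₂ s := by
  have hi := hi₁.sub hi₂
  set W : ℝ → ℂ := fun x => f₁ x * g₂ x - g₁ x * f₂ x
  set η : ℝ → ℂ := fun s => φ₁ s * f₂ s - f₁ s * φ₂ s
  have hi : Integrable η volume := hi₁.sub hi₂
  have key : ∀ p q, p < -a → a < q → W q - W p = ∫ s in p..q, η s := fun p q hp hq =>
    h₁.wronskian_sub_of_lt ha h₂ hi hp hq
  -- Increments of `W` are integrals of an integrable function, so `W` has a limit at infinity;
  -- integrability of `W` or `|W|²` then forces it to be `0`.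
  have t1 : Tendsto W atTop (𝓝 0) := by
    have h1 := intervalIntegral_tendsto_integral_Ioi (-a - 1) hi.integrableOn tendsto_id
    have h2 := h1.add_const (W (-a - 1))
    have h3 : Tendsto W atTop (𝓝 ((∫ s in Ioi (-a - 1), η s) + W (-a - 1))) := by
      refine h2.congr' ?_
      filter_upwards [eventually_gt_atTop a] with q hq
      rw [id, ← key _ _ (by linarith) hq]; ring
    rwa [eq_zero_of_tendsto_of_integrable_norm_sq (Or.inl rfl) hW h3] at h3
  have t2 : Tendsto W atBot (𝓝 0) := by
    have h1 := intervalIntegral_tendsto_integral_Iic (a + 1) hi.integrableOn tendsto_id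
    have h2 := h1.const_sub (W (a + 1))
    have h3 : Tendsto W atBot (𝓝 (W (a + 1) - ∫ s in Iic (a + 1), η s)) := by
      refine h2.congr' ?_
      filter_upwards [eventually_lt_atBot (-a)] with q hq
      rw [id, ← key _ _ hq (by linarith)]; ring
    rwa [eq_zero_of_tendsto_of_integrable_norm_sq (Or.inr rfl) hW h3] at h3
  have t3 := intervalIntegral_tendsto_integral hi tendsto_neg_atTop_atBot tendsto_id
  have t4 : Tendsto (fun q => W q - W (-q)) atTop (𝓝 (0 - 0)) :=
    t1.sub (t2.comp tendsto_neg_atTop_atBot)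
  have h0 : ∫ s, η s = 0 - 0 := by
    refine tendsto_nhds_unique (t3.congr' ?_) t4
    filter_upwards [eventually_gt_atTop a] with q hq
    rw [id, ← key _ _ (by linarith) hq]
  rw [sub_zero] at h0
  exact sub_eq_zero.1 ((integral_sub hi₁ hi₂).symm.trans h0)

end Green

theorem DeltaCondition.conj {α : ℝ} {f g : ℝ → ℂ} {c : ℝ} (h : DeltaCondition α f g c) :
    DeltaCondition α (fun x => (starRingEnd ℂ) (f x)) (fun x => (starRingEnd ℂ) (g x)) c := by
  obtain ⟨v, dr, dl, e1, e2, e3, e4, e5⟩ := h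
  have hc := Complex.continuous_conj
  refine ⟨_, _, _, (hc.tendsto _).comp e1, (hc.tendsto _).comp e2, (hc.tendsto _).comp e3,
    (hc.tendsto _).comp e4, ?_⟩
  rw [← map_sub, ← e5, map_mul, Complex.conj_ofReal]

theorem IsSol.conj {a α : ℝ} {f g φ : ℝ → ℂ} (h : IsSol a α f g φ) :
    IsSol a α (fun x => (starRingEnd ℂ) (f x)) (fun x => (starRingEnd ℂ) (g x))
      (fun x => (starRingEnd ℂ) (φ x)) where
  locallyIntegrable := fun x =>
    (h.locallyIntegrable x).imp fun s hs => ⟨hs.1, (Complex.conjCLE : ℂ →L[ℝ] ℂ).integrable_comp hs.2⟩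
  hasDerivAt := fun x hx => (h.hasDerivAt x hx).star
  sub_eq := fun x y hxy hs => by
    rw [← map_sub, h.sub_eq x y hxy hs]
    rw [intervalIntegral.integral_of_le hxy, intervalIntegral.integral_of_le hxy, ← integral_conj]
    simp only [map_neg]
  delta := h.delta.conj
  delta_neg := h.delta_neg.conj

/-- `H_α` is symmetric. -/
theorem HasAction.symm {a α : ℝ} (ha : 0 < a) {ψ φ ψ' φ' : L2} (h : HasAction a α ψ φ)
    (h' : HasAction a α ψ' φ') : inner ℂ φ ψ' = inner ℂ ψ φ' := by
  obtain ⟨f, g, hf, hg, hs⟩ := hasAction_iff.1 h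
  obtain ⟨f', g', hf', hg', hs'⟩ := hasAction_iff.1 h'
  have mf : MemLp (fun x => (starRingEnd ℂ) (f x)) 2 volume :=
    ((memLp_congr_ae hf).1 (Lp.memLp ψ)).star
  have mf' : MemLp f' 2 volume := (memLp_congr_ae hf').1 (Lp.memLp ψ')
  have mg : MemLp (fun x => (starRingEnd ℂ) (g x)) 2 volume := hg.star
  have mφ : MemLp (fun x => (starRingEnd ℂ) (φ x)) 2 volume := (Lp.memLp φ).star
  have key := hs.conj.integral_eq ha hs' (mφ.integrable_mul mf')
    (mf.integrable_mul (Lp.memLp φ')) (Or.inl ((mf.integrable_mul hg').sub (mg.integrable_mul mf')))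
  rw [L2.inner_def, L2.inner_def]
  convert key using 1
  · refine integral_congr_ae ?_
    filter_upwards [hf'] with x hx
    rw [hx, RCLike.inner_apply, mul_comm]
  · refine integral_congr_ae ?_
    filter_upwards [hf] with x hx
    rw [hx, RCLike.inner_apply, mul_comm]

/-! ### Exponential solutions and point sources -/

/-- `exp (i k |x|)`. -/
def expAbs (k : ℂ) (x : ℝ) : ℂ := Complex.exp (Complex.I * k * (|x| : ℝ))

/-- The derivative of `exp (i k |x|)` off the origin. -/
def expAbsDeriv (k : ℂ) (x : ℝ) : ℂ := Complex.I * k * (SignType.sign x : ℝ) * expAbs k x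

theorem continuous_expAbs (k : ℂ) : Continuous (expAbs k) := by
  unfold expAbs; fun_prop

theorem measurable_expAbsDeriv (k : ℂ) : Measurable (expAbsDeriv k) := by
  unfold expAbsDeriv
  have h : Measurable fun x : ℝ => ((SignType.sign x : ℝ)) := by
    have : (fun x : ℝ => ((SignType.sign x : ℝ))) = fun x => if 0 < x then 1 else if x < 0 then -1 else 0 := by
      ext x
      rcases lt_trichotomy x 0 with h | h | h
      · simp [h, not_lt.2 h.le]
      · simp [h]
      · simp [h]
    rw [this]
    exact Measurable.ite measurableSet_Ioi measurable_const
      (Measurable.ite measurableSet_Iio measurable_const measurable_const)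
  exact ((measurable_const.mul h.complex_ofReal)).mul (continuous_expAbs k).measurable

theorem expAbs_zero (k : ℂ) : expAbs k 0 = 1 := by simp [expAbs]

theorem expAbs_neg (k : ℂ) (x : ℝ) : expAbs k (-x) = expAbs k x := by simp [expAbs]

theorem norm_expAbs (k : ℂ) (x : ℝ) : ‖expAbs k x‖ = Real.exp (-(k.im * |x|)) := by
  rw [expAbs, Complex.norm_exp]
  simp

theorem norm_expAbs_le_one {k : ℂ} (hk : 0 ≤ k.im) (x : ℝ) : ‖expAbs k x‖ ≤ 1 := by
  rw [norm_expAbs, Real.exp_le_one_iff]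
  have := mul_nonneg hk (abs_nonneg x)
  linarith

theorem norm_expAbsDeriv_le (k : ℂ) (x : ℝ) : ‖expAbsDeriv k x‖ ≤ ‖k‖ * ‖expAbs k x‖ := by
  rw [expAbsDeriv, norm_mul, norm_mul, norm_mul, Complex.norm_I, one_mul, Complex.norm_real]
  gcongr
  refine mul_le_of_le_one_right (norm_nonneg _) ?_
  rcases lt_trichotomy x 0 with h | h | h <;> simp [h]

theorem expAbs_of_pos (k : ℂ) {x : ℝ} (hx : 0 ≤ x) : expAbs k x = Complex.exp (Complex.I * k * x) := by
  rw [expAbs, abs_of_nonneg hx]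

theorem expAbs_of_neg (k : ℂ) {x : ℝ} (hx : x ≤ 0) :
    expAbs k x = Complex.exp (-(Complex.I * k) * x) := by
  rw [expAbs, abs_of_nonpos hx]; congr 1; push_cast; ring

theorem hasDerivAt_cexp_mul (c : ℂ) (x : ℝ) :
    HasDerivAt (fun x : ℝ => Complex.exp (c * x)) (c * Complex.exp (c * x)) x := by
  have : HasDerivAt (fun x : ℝ => c * (x : ℂ)) c x := by
    simpa using (hasDerivAt_id x).ofReal_comp.const_mul c
  simpa [mul_comm] using this.cexp

theorem hasDerivAt_expAbs (k : ℂ) {x : ℝ} (hx : x ≠ 0) :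
    HasDerivAt (expAbs k) (expAbsDeriv k x) x := by
  rcases lt_or_gt_of_ne hx with h | h
  · refine ((hasDerivAt_cexp_mul (-(Complex.I * k)) x).congr_of_eventuallyEq ?_).congr_deriv ?_
    · filter_upwards [Iio_mem_nhds h] with y hy using expAbs_of_neg k (le_of_lt hy)
    · rw [expAbsDeriv, expAbs_of_neg k h.le]; simp [h]
  · refine ((hasDerivAt_cexp_mul (Complex.I * k) x).congr_of_eventuallyEq ?_).congr_deriv ?_
    · filter_upwards [Ioi_mem_nhds h] with y hy using expAbs_of_pos k (le_of_lt hy)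
    · rw [expAbsDeriv, expAbs_of_pos k h.le]; simp [h]

theorem hasDerivAt_expAbsDeriv (k : ℂ) {x : ℝ} (hx : x ≠ 0) :
    HasDerivAt (expAbsDeriv k) (-(k ^ 2 * expAbs k x)) x := by
  have h1 : HasDerivAt (fun y => Complex.I * k * (SignType.sign x : ℝ) * expAbs k y)
      (Complex.I * k * (SignType.sign x : ℝ) * expAbsDeriv k x) x :=
    (hasDerivAt_expAbs k hx).const_mul _
  refine (h1.congr_of_eventuallyEq ?_).congr_deriv ?_
  · rcases lt_or_gt_of_ne hx with h | h
    · filter_upwards [Iio_mem_nhds h] with y hy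
      rw [expAbsDeriv, sign_neg h, sign_neg hy]
    · filter_upwards [Ioi_mem_nhds h] with y hy
      rw [expAbsDeriv, sign_pos h, sign_pos hy]
  · have h2 : ((SignType.sign x : ℝ) : ℂ) ^ 2 = 1 := by
      rcases lt_or_gt_of_ne hx with h | h <;> simp [h]
    rw [expAbsDeriv]
    linear_combination (Complex.I ^ 2 * k ^ 2 * expAbs k x) * h2 + k ^ 2 * expAbs k x * Complex.I_sq

theorem tendsto_expAbsDeriv_pos (k : ℂ) :
    Tendsto (expAbsDeriv k) (𝓝[>] 0) (𝓝 (Complex.I * k)) := by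
  have h : Tendsto (fun x => Complex.I * k * expAbs k x) (𝓝[>] 0) (𝓝 (Complex.I * k)) := by
    have := ((continuous_expAbs k).tendsto 0).const_mul (Complex.I * k)
    rw [expAbs_zero, mul_one] at this
    exact this.mono_left nhdsWithin_le_nhds
  refine h.congr' ?_
  filter_upwards [self_mem_nhdsWithin] with x hx
  rw [expAbsDeriv, sign_pos hx]; simp

theorem tendsto_expAbsDeriv_neg (k : ℂ) :
    Tendsto (expAbsDeriv k) (𝓝[<] 0) (𝓝 (-(Complex.I * k))) := by
  have h : Tendsto (fun x => -(Complex.I * k) * expAbs k x) (𝓝[<] 0) (𝓝 (-(Complex.I * k))) := by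
    have := ((continuous_expAbs k).tendsto 0).const_mul (-(Complex.I * k))
    rw [expAbs_zero, mul_one] at this
    exact this.mono_left nhdsWithin_le_nhds
  refine h.congr' ?_
  filter_upwards [self_mem_nhdsWithin] with x hx
  rw [expAbsDeriv, sign_neg hx]; simp

theorem integrable_exp_neg_mul_abs {c : ℝ} (hc : 0 < c) :
    Integrable (fun x : ℝ => Real.exp (-(c * |x|))) volume := by
  rw [← integrableOn_univ, ← Iic_union_Ioi (a := (0 : ℝ)), integrableOn_union]
  constructor
  · refine (integrableOn_exp_mul_Iic hc 0).congr_fun (fun x hx => ?_) measurableSet_Iic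
    rw [abs_of_nonpos hx]; ring_nf
  · refine (integrableOn_exp_mul_Ioi (neg_lt_zero.2 hc) 0).congr_fun (fun x hx => ?_)
      measurableSet_Ioi
    rw [abs_of_pos hx]; ring_nf

theorem integrable_expAbs {k : ℂ} (hk : 0 < k.im) : Integrable (expAbs k) volume := by
  refine (integrable_exp_neg_mul_abs hk).mono' (continuous_expAbs k).aestronglyMeasurable ?_
  exact Eventually.of_forall fun x => (norm_expAbs k x).le

theorem memLp_expAbs {k : ℂ} (hk : 0 < k.im) : MemLp (expAbs k) 2 volume := by
  rw [memLp_two_iff_integrable_sq_norm (continuous_expAbs k).aestronglyMeasurable]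
  refine (integrable_exp_neg_mul_abs (c := 2 * k.im) (by linarith)).congr ?_
  refine Eventually.of_forall fun x => ?_
  simp only
  rw [norm_expAbs, ← Real.exp_nat_mul]
  congr 1; push_cast; ring

theorem memLp_expAbsDeriv {k : ℂ} (hk : 0 < k.im) : MemLp (expAbsDeriv k) 2 volume :=
  (memLp_expAbs hk).of_le_mul (measurable_expAbsDeriv k).aestronglyMeasurable
    (Eventually.of_forall fun x => norm_expAbsDeriv_le k x)

/-- A smooth solution plus two point sources at `±a` of strengths fixed by the interface
conditions. -/
theorem IsSol.of_sources {a α : ℝ} (ha : 0 < a) {f₀ g₀ φ₀ : ℝ → ℂ} (k c₁ c₂ : ℂ)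
    (hφ : LocallyIntegrable φ₀ volume) (hf : ∀ x, HasDerivAt f₀ (g₀ x) x)
    (hg : ∀ x y, x ≤ y → g₀ y - g₀ x = ∫ s in x..y, -φ₀ s)
    (h₁ : (α : ℂ) * (f₀ a + c₁ + c₂ * expAbs k (2 * a)) = 2 * (Complex.I * k) * c₁)
    (h₂ : (α : ℂ) * (f₀ (-a) + c₁ * expAbs k (2 * a) + c₂) = 2 * (Complex.I * k) * c₂) :
    IsSol a α (fun x => f₀ x + c₁ * expAbs k (x - a) + c₂ * expAbs k (x + a))
      (fun x => g₀ x + c₁ * expAbsDeriv k (x - a) + c₂ * expAbsDeriv k (x + a))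
      (fun x => φ₀ x + k ^ 2 * (c₁ * expAbs k (x - a) + c₂ * expAbs k (x + a))) := by
  have hloc : LocallyIntegrable (fun x => k ^ 2 * (c₁ * expAbs k (x - a) + c₂ * expAbs k (x + a)))
      volume := by
    have := continuous_expAbs k
    exact Continuous.locallyIntegrable (by fun_prop)
  have hfc : Continuous f₀ := continuous_iff_continuousAt.2 fun x => (hf x).continuousAt
  have hgc : Continuous g₀ := by
    have hc : ∀ p, Continuous fun x => g₀ p + ∫ s in p..x, -φ₀ s := fun p => continuous_const.add
      (intervalIntegral.continuous_primitive
        (fun u v => (LocallyIntegrable.intervalIntegrable' hφ u v).neg) p)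
    refine continuous_iff_continuousAt.2 fun x => ?_
    refine ((hc (x - 1)).continuousAt (x := x)).congr ?_
    filter_upwards [Ioi_mem_nhds (show x - 1 < x by linarith)] with y hy
    rw [← hg _ _ (le_of_lt hy)]; ring
  have hcE := continuous_expAbs k
  have tr : ∀ {c : ℝ} {F : ℝ → ℂ} {l : ℂ}, Tendsto F (𝓝[>] 0) (𝓝 l) →
      Tendsto (fun x => F (x - c)) (𝓝[>] c) (𝓝 l) := fun {c F l} h => by
    refine h.comp (tendsto_nhdsWithin_iff.2 ⟨?_, ?_⟩)
    · have : Continuous fun x : ℝ => x - c := by fun_prop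
      simpa using (this.tendsto c).mono_left nhdsWithin_le_nhds
    · filter_upwards [self_mem_nhdsWithin] with x hx using sub_pos.2 (mem_Ioi.1 hx)
  have tl : ∀ {c : ℝ} {F : ℝ → ℂ} {l : ℂ}, Tendsto F (𝓝[<] 0) (𝓝 l) →
      Tendsto (fun x => F (x - c)) (𝓝[<] c) (𝓝 l) := fun {c F l} h => by
    refine h.comp (tendsto_nhdsWithin_iff.2 ⟨?_, ?_⟩)
    · have : Continuous fun x : ℝ => x - c := by fun_prop
      simpa using (this.tendsto c).mono_left nhdsWithin_le_nhds
    · filter_upwards [self_mem_nhdsWithin] with x hx using sub_neg.2 (mem_Iio.1 hx)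
  have hdc : ∀ b : ℝ, b ≠ 0 → ContinuousAt (expAbsDeriv k) b := fun b hb =>
    (hasDerivAt_expAbsDeriv k hb).continuousAt
  have hne : ∀ x ∈ ({a, -a}ᶜ : Set ℝ), x - a ≠ 0 ∧ x + a ≠ 0 := fun x hx => by
    simp only [mem_compl_iff, mem_insert_iff, mem_singleton_iff, not_or] at hx
    exact ⟨sub_ne_zero.2 hx.1, fun h => hx.2 (by linarith)⟩
  have hF : Continuous fun x => f₀ x + c₁ * expAbs k (x - a) + c₂ * expAbs k (x + a) := by fun_prop
  have hder2 : ∀ x ∈ ({a, -a}ᶜ : Set ℝ),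
      HasDerivAt (fun x => c₁ * expAbsDeriv k (x - a) + c₂ * expAbsDeriv k (x + a))
        (-(k ^ 2 * (c₁ * expAbs k (x - a) + c₂ * expAbs k (x + a)))) x := fun x hx => by
    obtain ⟨n1, n2⟩ := hne x hx
    have d1 := ((hasDerivAt_expAbsDeriv k n1).comp_sub_const x a).const_mul c₁
    have d2 := ((hasDerivAt_expAbsDeriv k n2).comp_add_const x a).const_mul c₂
    exact (d1.fun_add d2).congr_deriv (by ring)
  refine ⟨hφ.add hloc, fun x hx => ?_, fun x y hxy hs => ?_, ?_, ?_⟩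
  · obtain ⟨n1, n2⟩ := hne x hx
    exact ((hf x).fun_add (((hasDerivAt_expAbs k n1).comp_sub_const x a).const_mul c₁)).fun_add
      (((hasDerivAt_expAbs k n2).comp_add_const x a).const_mul c₂)
  · have h1 := intervalIntegral.integral_eq_sub_of_hasDerivAt (a := x) (b := y)
      (fun z hz => hder2 z (hs (by rwa [uIcc_of_le hxy] at hz)))
      (LocallyIntegrable.intervalIntegrable' hloc x y).neg
    have h2 : ∫ s in x..y, -(φ₀ s + k ^ 2 * (c₁ * expAbs k (s - a) + c₂ * expAbs k (s + a)))
        = (∫ s in x..y, -φ₀ s)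
          + ∫ s in x..y, -(k ^ 2 * (c₁ * expAbs k (s - a) + c₂ * expAbs k (s + a))) := by
      simp only [intervalIntegral.integral_neg]
      rw [intervalIntegral.integral_add (LocallyIntegrable.intervalIntegrable' hφ x y)
        (LocallyIntegrable.intervalIntegrable' hloc x y)]
      ring
    rw [h2, h1, ← hg x y hxy]
    ring
  -- At `a` only the source located there has a kink, of size `2 i k c₁`; the other terms are
  -- differentiable. Hence `h₁` is precisely the interface condition.
  · have c2 : Tendsto (fun x => expAbsDeriv k (x + a)) (𝓝 a) (𝓝 (expAbsDeriv k (a + a))) :=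
      ((hdc (a + a) (by linarith)).tendsto).comp ((continuous_id.add continuous_const).tendsto a)
    refine ⟨f₀ a + c₁ * expAbs k (a - a) + c₂ * expAbs k (a + a),
      g₀ a + c₁ * (Complex.I * k) + c₂ * expAbsDeriv k (a + a),
      g₀ a + c₁ * (-(Complex.I * k)) + c₂ * expAbsDeriv k (a + a),
      (hF.tendsto a).mono_left nhdsWithin_le_nhds, (hF.tendsto a).mono_left nhdsWithin_le_nhds,
      (((hgc.tendsto a).mono_left nhdsWithin_le_nhds).add
        ((tr (tendsto_expAbsDeriv_pos k)).const_mul c₁)).add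
          ((c2.mono_left nhdsWithin_le_nhds).const_mul c₂),
      (((hgc.tendsto a).mono_left nhdsWithin_le_nhds).add
        ((tl (tendsto_expAbsDeriv_neg k)).const_mul c₁)).add
          ((c2.mono_left nhdsWithin_le_nhds).const_mul c₂), ?_⟩
    rw [sub_self, expAbs_zero, ← two_mul]
    linear_combination h₁
  · have c2 : Tendsto (fun x => expAbsDeriv k (x - a)) (𝓝 (-a)) (𝓝 (expAbsDeriv k (-a - a))) :=
      ((hdc (-a - a) (by linarith)).tendsto).comp
        ((continuous_id.sub continuous_const).tendsto (-a))
    have e : ∀ F : ℝ → ℂ, (fun x => F (x + a)) = fun x => F (x - -a) := fun F => by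
      ext x; rw [sub_neg_eq_add]
    refine ⟨f₀ (-a) + c₁ * expAbs k (-a - a) + c₂ * expAbs k (-a + a),
      g₀ (-a) + c₁ * expAbsDeriv k (-a - a) + c₂ * (Complex.I * k),
      g₀ (-a) + c₁ * expAbsDeriv k (-a - a) + c₂ * (-(Complex.I * k)),
      (hF.tendsto _).mono_left nhdsWithin_le_nhds, (hF.tendsto _).mono_left nhdsWithin_le_nhds,
      (((hgc.tendsto _).mono_left nhdsWithin_le_nhds).add
        ((c2.mono_left nhdsWithin_le_nhds).const_mul c₁)).add
          (Tendsto.const_mul c₂ (e _ ▸ tr (tendsto_expAbsDeriv_pos k))),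
      (((hgc.tendsto _).mono_left nhdsWithin_le_nhds).add
        ((c2.mono_left nhdsWithin_le_nhds).const_mul c₁)).add
          (Tendsto.const_mul c₂ (e _ ▸ tl (tendsto_expAbsDeriv_neg k))), ?_⟩
    rw [neg_add_cancel, expAbs_zero, show -a - a = -(2 * a) by ring, expAbs_neg]
    linear_combination h₂

/-! ### The resolvent at a large negative energy -/

theorem IsSol.congr_ae {a α : ℝ} {f g φ φ' : ℝ → ℂ} (h : IsSol a α f g φ)
    (he : φ =ᵐ[volume] φ') : IsSol a α f g φ' where
  locallyIntegrable := h.locallyIntegrable.congr he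
  hasDerivAt := h.hasDerivAt
  sub_eq := fun x y hxy hs => by
    rw [h.sub_eq x y hxy hs]
    refine intervalIntegral.integral_congr_ae ?_
    filter_upwards [he] with s hs' _
    rw [hs']
  delta := h.delta
  delta_neg := h.delta_neg

/-- Variation of constants for `B' = φ - μ B`. -/
theorem sub_eq_integral_of_primitive {φ A : ℝ → ℂ} (hφ : LocallyIntegrable φ volume) (μ : ℝ)
    (hA : ∀ p x, p ≤ x → A x - A p = ∫ s in p..x, Complex.exp (μ * s) * φ s) {p q : ℝ}
    (hpq : p ≤ q) :
    Complex.exp (-μ * q) * A q - Complex.exp (-μ * p) * A p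
      = ∫ s in p..q, (φ s - μ * (Complex.exp (-μ * s) * A s)) := by
  have hc1 : Continuous fun s : ℝ => Complex.exp (μ * s) := by fun_prop
  have hc2 : Continuous fun s : ℝ => -(μ : ℂ) * Complex.exp (-μ * s) := by fun_prop
  rw [← integral_mul_add_mul_eq (f := fun x : ℝ => Complex.exp (-μ * x)) (g := A)
    (u := fun s : ℝ => -(μ : ℂ) * Complex.exp (-μ * s))
    (v := fun s => Complex.exp (μ * s) * φ s) hpq]
  · refine intervalIntegral.integral_congr fun s _ => ?_
    rw [← mul_assoc (Complex.exp _) (Complex.exp _), ← Complex.exp_add]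
    simp only [neg_mul, neg_add_cancel, Complex.exp_zero]
    ring
  · exact hc2.intervalIntegrable _ _
  · exact (LocallyIntegrable.intervalIntegrable' hφ p q).continuousOn_mul hc1.continuousOn
  · intro x hx
    rw [intervalIntegral.integral_eq_sub_of_hasDerivAt (f := fun x : ℝ => Complex.exp (-μ * x))]
    · intro y _
      exact hasDerivAt_cexp_mul (-μ) y
    · exact hc2.intervalIntegrable _ _
  · exact fun x hx => hA p x hx.1

theorem memLp_cexp_restrict {μ : ℝ} {S : Set ℝ}
    (h : IntegrableOn (fun y => Real.exp (2 * μ * y)) S volume) :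
    MemLp (fun y : ℝ => Complex.exp (μ * y)) 2 (volume.restrict S) := by
  have hc : Continuous fun s : ℝ => Complex.exp (μ * s) := by fun_prop
  rw [memLp_two_iff_integrable_sq_norm hc.aestronglyMeasurable]
  refine Integrable.congr h (Eventually.of_forall fun y => ?_)
  simp only
  rw [Complex.norm_exp, ← Real.exp_nat_mul]
  congr 1
  simp
  ring

/-- The convolution of `|φ|` with `exp (-c |x|)`. -/
def expConv (c : ℝ) (h : ℝ → ℝ) (x : ℝ) : ℝ := ∫ y, h y * Real.exp (-(c * |x - y|))

theorem integrable_expConv {c : ℝ} (hc : 0 < c) {h : ℝ → ℝ} (hh : Integrable h volume) :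
    Integrable (expConv c h) volume :=
  hh.integrable_convolution (ContinuousLinearMap.mul ℝ ℝ) (integrable_exp_neg_mul_abs hc)

theorem integrable_exp_neg_mul_abs_sub {c : ℝ} (hc : 0 < c) (x : ℝ) :
    Integrable (fun y : ℝ => Real.exp (-(c * |x - y|))) volume :=
  (integrable_exp_neg_mul_abs hc).comp_sub_left x

theorem integrable_norm_mul_exp {c : ℝ} (hc : 0 < c) (φ : L2) (x : ℝ) :
    Integrable (fun y : ℝ => ‖φ y‖ * Real.exp (-(c * |x - y|))) volume := by
  have h1 : MemLp (fun y : ℝ => Real.exp (-(c * |x - y|))) 2 volume := by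
    rw [memLp_two_iff_integrable_sq_norm (by fun_prop)]
    refine (integrable_exp_neg_mul_abs_sub (c := 2 * c) (by linarith) x).congr
      (Eventually.of_forall fun y => ?_)
    simp only
    rw [Real.norm_eq_abs, sq_abs, ← Real.exp_nat_mul]
    congr 1; push_cast; ring
  exact (Lp.memLp φ).norm.integrable_mul h1

/-- Cauchy–Schwarz for the weight `exp(-c|x-y|)` of total mass `K`, in the form that the variance of
`|φ|` about its weighted mean `N / K` is nonnegative. -/
theorem expConv_sq_le {c : ℝ} (hc : 0 < c) (φ : L2) (x : ℝ) :
    expConv c (fun y => ‖φ y‖) x ^ 2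
      ≤ (∫ y, Real.exp (-(c * |y|))) * expConv c (fun y => ‖φ y‖ ^ 2) x := by
  set K := ∫ y, Real.exp (-(c * |y|)) with hK
  have hK' : ∫ y, Real.exp (-(c * |x - y|)) = K :=
    integral_sub_left_eq_self (fun y => Real.exp (-(c * |y|))) volume x
  have hKpos : 0 < K := integral_exp_pos (integrable_exp_neg_mul_abs hc)
  set N := expConv c (fun y => ‖φ y‖) x with hN
  set M := expConv c (fun y => ‖φ y‖ ^ 2) x with hM
  have i1 := integrable_exp_neg_mul_abs_sub hc x
  have i2 := integrable_norm_mul_exp hc φ x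
  have i3 : Integrable (fun y : ℝ => ‖φ y‖ ^ 2 * Real.exp (-(c * |x - y|))) volume := by
    refine (integrable_norm_sq φ).mul_bdd (c := 1) (by fun_prop) (Eventually.of_forall fun y => ?_)
    rw [Real.norm_eq_abs, Real.abs_exp, Real.exp_le_one_iff]
    have := mul_nonneg hc.le (abs_nonneg (x - y))
    linarith
  have h0 : 0 ≤ ∫ y, (‖φ y‖ - N / K) ^ 2 * Real.exp (-(c * |x - y|)) :=
    integral_nonneg fun y => by positivity
  have h1 : ∫ y, (‖φ y‖ - N / K) ^ 2 * Real.exp (-(c * |x - y|))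
      = M - 2 * (N / K) * N + (N / K) ^ 2 * K := by
    have e : (fun y => (‖φ y‖ - N / K) ^ 2 * Real.exp (-(c * |x - y|)))
        = fun y => (‖φ y‖ ^ 2 * Real.exp (-(c * |x - y|))
          - 2 * (N / K) * (‖φ y‖ * Real.exp (-(c * |x - y|))))
          + (N / K) ^ 2 * Real.exp (-(c * |x - y|)) := by ext y; ring
    have i4 : Integrable (fun y => ‖φ y‖ ^ 2 * Real.exp (-(c * |x - y|))
        - 2 * (N / K) * (‖φ y‖ * Real.exp (-(c * |x - y|)))) volume := i3.sub (i2.const_mul _)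
    rw [e, integral_add i4 (i1.const_mul _),
      integral_sub i3 (i2.const_mul _), integral_const_mul, integral_const_mul, hK']
    rfl
  rw [h1] at h0
  have h2 : M - 2 * (N / K) * N + (N / K) ^ 2 * K = (K * M - N ^ 2) / K := by
    field_simp; ring
  rw [h2] at h0
  have h3 := mul_nonneg h0 hKpos.le
  rw [div_mul_cancel₀ _ hKpos.ne'] at h3
  linarith

/-- Young's inequality: `|B|²` is dominated by the convolution of the integrable function `|φ|²`
with an integrable kernel. -/
theorem memLp_of_le_expConv {c : ℝ} (hc : 0 < c) (φ : L2) {B : ℝ → ℂ} (hB : Continuous B)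
    (h : ∀ x, ‖B x‖ ≤ expConv c (fun y => ‖φ y‖) x) : MemLp B 2 volume := by
  rw [memLp_two_iff_integrable_sq_norm hB.aestronglyMeasurable]
  refine ((integrable_expConv hc (integrable_norm_sq φ)).const_mul
    (∫ y, Real.exp (-(c * |y|)))).mono' (hB.norm.pow 2).aestronglyMeasurable
    (Eventually.of_forall fun x => ?_)
  rw [norm_pow, norm_norm]
  exact (by gcongr; exact h x : ‖B x‖ ^ 2 ≤ _).trans (expConv_sq_le hc φ x)

theorem integrable_of_le_expConv {c : ℝ} (hc : 0 < c) {φ : L2} (hφ : Integrable φ volume)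
    {B : ℝ → ℂ} (hB : Continuous B)
    (h : ∀ x, ‖B x‖ ≤ expConv c (fun y => ‖φ y‖) x) : Integrable B volume :=
  (integrable_expConv hc hφ.norm).mono' hB.aestronglyMeasurable (Eventually.of_forall h)

theorem continuous_of_sub_eq_integral {B η : ℝ → ℂ} (hη : ∀ p q, p ≤ q → IntervalIntegrable η volume p q)
    (h : ∀ p q, p ≤ q → B q - B p = ∫ s in p..q, η s) : Continuous B := by
  have hη' : ∀ p q, IntervalIntegrable η volume p q := fun p q => by
    rcases le_total p q with h | h
    · exact hη p q h
    · exact (hη q p h).symm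
  refine continuous_iff_continuousAt.2 fun x => ?_
  have hc : Continuous fun y => B (x - 1) + ∫ s in (x - 1)..y, η s := continuous_const.add
    (intervalIntegral.continuous_primitive hη' _)
  refine (hc.continuousAt (x := x)).congr ?_
  filter_upwards [Ioi_mem_nhds (show x - 1 < x by linarith)] with y hy
  rw [← h _ _ (le_of_lt hy)]; ring

/-- The solution of `B' = φ - μ B` that is bounded by the convolution with `exp (-|μ| |x|)`. -/
theorem exists_decaying_solution {μ : ℝ} (hμ : μ ≠ 0) (φ : L2) : ∃ B : ℝ → ℂ,
    Continuous B ∧ (∀ p q, p ≤ q → B q - B p = ∫ s in p..q, (φ s - μ * B s)) ∧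
    ∀ x, ‖B x‖ ≤ expConv |μ| (fun y => ‖φ y‖) x := by
  have hφ : LocallyIntegrable φ volume := (Lp.memLp φ).locallyIntegrable (by norm_num)
  have hc1 : Continuous fun s : ℝ => Complex.exp (μ * s) := by fun_prop
  -- With integrating factor `e^{μx}` the equation reads `A' = e^{μx} φ` for `A = e^{μx} B`; only
  -- the base point of the primitive remains to be chosen.
  have main : ∀ A : ℝ → ℂ,
      (∀ p x, p ≤ x → A x - A p = ∫ s in p..x, Complex.exp (μ * s) * φ s) →
      (∀ x, ‖A x‖ ≤ ∫ y, Real.exp (μ * x) * (‖φ y‖ * Real.exp (-(|μ| * |x - y|)))) →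
      ∃ B : ℝ → ℂ, Continuous B ∧ (∀ p q, p ≤ q → B q - B p = ∫ s in p..q, (φ s - μ * B s)) ∧
        ∀ x, ‖B x‖ ≤ expConv |μ| (fun y => ‖φ y‖) x := by
    intro A hA hb
    have hAc : Continuous A := continuous_of_sub_eq_integral (fun p q _ =>
      (LocallyIntegrable.intervalIntegrable' hφ p q).continuousOn_mul hc1.continuousOn) hA
    refine ⟨fun x => Complex.exp (-μ * x) * A x, by fun_prop,
      fun p q hpq => sub_eq_integral_of_primitive hφ μ hA hpq, fun x => ?_⟩
    rw [norm_mul, Complex.norm_exp]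
    have h1 := hb x
    rw [integral_const_mul] at h1
    have h2 : (-(μ : ℂ) * x).re = -(μ * x) := by simp
    rw [h2]
    calc Real.exp (-(μ * x)) * ‖A x‖
        ≤ Real.exp (-(μ * x)) * (Real.exp (μ * x) * expConv |μ| (fun y => ‖φ y‖) x) := by
          gcongr; exact h1
      _ = _ := by rw [← mul_assoc, ← Real.exp_add, neg_add_cancel, Real.exp_zero, one_mul]
  have hbound : ∀ (S : Set ℝ) (x : ℝ), MeasurableSet S →
      (∀ y ∈ S, μ * y = μ * x - |μ| * |x - y|) →
      ‖∫ y in S, Complex.exp (μ * y) * φ y‖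
        ≤ ∫ y, Real.exp (μ * x) * (‖φ y‖ * Real.exp (-(|μ| * |x - y|))) := by
    intro S x hS hSx
    have hi := (integrable_norm_mul_exp (abs_pos.2 hμ) φ x).const_mul (Real.exp (μ * x))
    refine (norm_integral_le_integral_norm _).trans ?_
    refine le_trans (le_of_eq ?_) (setIntegral_le_integral (s := S) hi
      (Eventually.of_forall fun y => by positivity))
    refine setIntegral_congr_fun hS fun y hy => ?_
    rw [norm_mul, Complex.norm_exp]
    have h2 : ((μ : ℂ) * y).re = μ * y := by simp
    rw [h2, hSx y hy, sub_eq_add_neg, Real.exp_add]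
    ring
  -- The sign of `μ` decides whether to integrate from `+∞` or from `-∞`, so that `e^{μ(y-x)} =
  -- e^{-|μ||x-y|}` on the half-line used.
  rcases lt_or_gt_of_ne hμ with hneg | hpos
  · have hint : ∀ x, IntegrableOn (fun y : ℝ => Complex.exp (μ * y) * φ y) (Ioi x) volume := fun x =>
      (memLp_cexp_restrict (integrableOn_exp_mul_Ioi (by linarith) x)).integrable_mul
        ((Lp.memLp φ).restrict _)
    refine main (fun x => -∫ y in Ioi x, Complex.exp (μ * y) * φ y) (fun p x hpx => ?_) fun x => ?_
    · rw [intervalIntegral.integral_of_le hpx, ← Ioc_union_Ioi_eq_Ioi hpx,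
        setIntegral_union (Ioc_disjoint_Ioi le_rfl) measurableSet_Ioi
          ((hint p).mono_set Ioc_subset_Ioi_self) (hint x)]
      ring
    · rw [norm_neg]
      refine hbound _ x measurableSet_Ioi fun y hy => ?_
      rw [abs_of_neg hneg, abs_of_neg (sub_neg.2 (mem_Ioi.1 hy))]; ring
  · have hint : ∀ x, IntegrableOn (fun y : ℝ => Complex.exp (μ * y) * φ y) (Iic x) volume := fun x =>
      (memLp_cexp_restrict (integrableOn_exp_mul_Iic (by linarith) x)).integrable_mul
        ((Lp.memLp φ).restrict _)
    refine main (fun x => ∫ y in Iic x, Complex.exp (μ * y) * φ y) (fun p x hpx => ?_) fun x => ?_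
    · exact intervalIntegral.integral_Iic_sub_Iic (hint p) (hint x)
    · refine hbound _ x measurableSet_Iic fun y hy => ?_
      rw [abs_of_pos hpos, abs_of_nonneg (sub_nonneg.2 (mem_Iic.1 hy))]; ring

/-- `H_α + l²` is onto if `l > |α|`, and its inverse maps `L¹ ∩ L²` to itself. -/
theorem exists_hasAction_resolvent {a α l : ℝ} (ha : 0 < a) (hl : |α| < l) (φ : L2) :
    ∃ ψ : L2, HasAction a α ψ (φ - ((l ^ 2 : ℝ) : ℂ) • ψ) ∧
      (Integrable φ volume → Integrable ψ volume) := by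
  have hl0 : 0 < l := (abs_nonneg α).trans_lt hl
  have hlC : (l : ℂ) ≠ 0 := by exact_mod_cast hl0.ne'
  have hφ : LocallyIntegrable φ volume := (Lp.memLp φ).locallyIntegrable (by norm_num)
  obtain ⟨p, pc, pe, pb⟩ := exists_decaying_solution hl0.ne' φ
  obtain ⟨q, qc, qe, qb⟩ := exists_decaying_solution (neg_ne_zero.2 hl0.ne') φ
  rw [abs_of_pos hl0] at pb
  rw [abs_neg, abs_of_pos hl0] at qb
  -- The free resolvent by factorization: `p' = φ - l p` and `q' = φ + l q` give `f₀' = -(p+q)/2`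
  -- and `-f₀'' + l² f₀ = φ`.
  let f₀ : ℝ → ℂ := fun x => (p x - q x) / (2 * l)
  let g₀ : ℝ → ℂ := fun x => -(p x + q x) / 2
  have hη : ∀ (B : ℝ → ℂ) (μ : ℝ), Continuous B → ∀ x y, IntervalIntegrable (fun s => φ s - μ * B s) volume x y :=
    fun B μ hB x y => (LocallyIntegrable.intervalIntegrable' hφ x y).sub
      ((continuous_const.mul hB).intervalIntegrable x y)
  have hgc : Continuous g₀ := by fun_prop
  have hfsub : ∀ x y, x ≤ y → f₀ y - f₀ x = ∫ s in x..y, g₀ s := fun x y hxy => by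
    have e : f₀ y - f₀ x = ((p y - p x) - (q y - q x)) / (2 * l) := by simp only [f₀]; ring
    rw [e, pe x y hxy, qe x y hxy, ← intervalIntegral.integral_sub (hη p l pc x y)
      (hη q (-l) qc x y), ← intervalIntegral.integral_div]
    refine intervalIntegral.integral_congr fun s _ => ?_
    simp only [g₀]
    push_cast
    field_simp
    ring
  have hf : ∀ x, HasDerivAt f₀ (g₀ x) x := fun x => by
    have h1 : HasDerivAt (fun y => f₀ (x - 1) + ∫ s in (x - 1)..y, g₀ s) (g₀ x) x :=
      (intervalIntegral.integral_hasDerivAt_right (hgc.intervalIntegrable _ _)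
        hgc.stronglyMeasurable.stronglyMeasurableAtFilter hgc.continuousAt).const_add _
    refine h1.congr_of_eventuallyEq ?_
    filter_upwards [Ioi_mem_nhds (show x - 1 < x by linarith)] with y hy
    rw [← hfsub _ _ (le_of_lt hy)]; ring
  have hfc : Continuous f₀ := by fun_prop
  have hg : ∀ x y, x ≤ y → g₀ y - g₀ x = ∫ s in x..y, -(φ s - (l : ℂ) ^ 2 * f₀ s) := fun x y hxy => by
    have e : g₀ y - g₀ x = -((p y - p x) + (q y - q x)) / 2 := by simp only [g₀]; ring
    rw [e, pe x y hxy, qe x y hxy, ← intervalIntegral.integral_add (hη p l pc x y)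
      (hη q (-l) qc x y), ← intervalIntegral.integral_neg, ← intervalIntegral.integral_div]
    refine intervalIntegral.integral_congr fun s _ => ?_
    simp only [f₀]
    push_cast
    field_simp
    ring
  set k : ℂ := Complex.I * l with hk
  have hkim : 0 < k.im := by simp [hk, hl0]
  have hIk : Complex.I * k = -l := by rw [hk, ← mul_assoc, Complex.I_mul_I]; ring
  set w := Real.exp (-(2 * a * l)) with hw
  have hw1 : expAbs k (2 * a) = w := by
    rw [expAbs, hIk, abs_of_pos (by linarith), hw]; push_cast; congr 1; ring
  have hwpos : 0 < w := Real.exp_pos _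
  have hwle : w ≤ 1 := by
    rw [hw, Real.exp_le_one_iff]
    have := mul_pos ha hl0
    linarith
  -- Since `0 < w ≤ 1`, the second summand is at most `2|α| < 2l` in modulus; this is where `l >
  -- |α|` enters.
  have hd : ∀ s : ℝ, |s| = 1 → (2 * l + α * (1 + s * w) : ℂ) ≠ 0 := fun s hs => by
    have : (2 * l + α * (1 + s * w) : ℝ) ≠ 0 := by
      have h1 : |1 + s * w| ≤ 2 := by
        calc |1 + s * w| ≤ |1| + |s * w| := abs_add_le _ _
          _ ≤ 2 := by rw [abs_mul, hs, abs_of_pos hwpos, abs_one]; linarith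
      have h2 : |α * (1 + s * w)| ≤ |α| * 2 := by rw [abs_mul]; gcongr
      have h3 := neg_abs_le (α * (1 + s * w))
      linarith
    exact_mod_cast this
  have d1 := hd 1 (by simp)
  have d2 := hd (-1) (by simp)
  push_cast at d1 d2
  -- The sum and the difference of the two source strengths decouple the interface equations into
  -- the even and the odd sector.
  set X₁ : ℂ := -α * (f₀ a + f₀ (-a)) / (2 * l + α * (1 + 1 * w)) with hX₁
  set X₂ : ℂ := -α * (f₀ a - f₀ (-a)) / (2 * l + α * (1 + -1 * w)) with hX₂
  have hX₁' : X₁ * (2 * l + α * (1 + 1 * w)) = -α * (f₀ a + f₀ (-a)) := div_mul_cancel₀ _ d1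
  have hX₂' : X₂ * (2 * l + α * (1 + -1 * w)) = -α * (f₀ a - f₀ (-a)) := div_mul_cancel₀ _ d2
  have hsol := IsSol.of_sources (a := a) (α := α) ha (f₀ := f₀) (g₀ := g₀)
    (φ₀ := fun s => φ s - (l : ℂ) ^ 2 * f₀ s) k ((X₁ + X₂) / 2) ((X₁ - X₂) / 2)
    (hφ.sub (continuous_const.mul hfc).locallyIntegrable) hf hg
    (by rw [hIk, hw1]; linear_combination (hX₁' + hX₂') / 2)
    (by rw [hIk, hw1]; linear_combination (hX₁' - hX₂') / 2)
  set c₁ := (X₁ + X₂) / 2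
  set c₂ := (X₁ - X₂) / 2
  have hk2 : k ^ 2 = -(l : ℂ) ^ 2 := by rw [hk, mul_pow, Complex.I_sq]; ring
  have mp : MemLp p 2 volume := memLp_of_le_expConv hl0 φ pc pb
  have mq : MemLp q 2 volume := memLp_of_le_expConv hl0 φ qc qb
  have mE : ∀ b, MemLp (fun x => expAbs k (x + b)) 2 volume := fun b =>
    (memLp_expAbs hkim).comp_measurePreserving (measurePreserving_add_right volume b)
  have mE' : ∀ b, MemLp (fun x => expAbsDeriv k (x + b)) 2 volume := fun b =>
    (memLp_expAbsDeriv hkim).comp_measurePreserving (measurePreserving_add_right volume b)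
  have iE : ∀ b, Integrable (fun x => expAbs k (x + b)) volume := fun b =>
    (integrable_expAbs hkim).comp_add_right b
  have mf : MemLp (fun x => f₀ x + c₁ * expAbs k (x - a) + c₂ * expAbs k (x + a)) 2 volume := by
    have m0 : MemLp f₀ 2 volume := by
      have := (mp.sub mq).const_mul (2 * l : ℂ)⁻¹
      refine this.congr_norm hfc.aestronglyMeasurable (Eventually.of_forall fun x => ?_)
      simp only [f₀, Pi.sub_apply]
      rw [div_eq_inv_mul]
    exact (m0.add ((mE (-a)).const_mul c₁)).add ((mE a).const_mul c₂)
  have mg : MemLp (fun x => g₀ x + c₁ * expAbsDeriv k (x - a) + c₂ * expAbsDeriv k (x + a)) 2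
      volume := by
    have m0 : MemLp g₀ 2 volume := by
      have := (mp.add mq).const_mul (-2 : ℂ)⁻¹
      refine this.congr_norm hgc.aestronglyMeasurable (Eventually.of_forall fun x => ?_)
      simp only [g₀, Pi.add_apply]
      congr 1; ring
    exact (m0.add ((mE' (-a)).const_mul c₁)).add ((mE' a).const_mul c₂)
  refine ⟨mf.toLp, hasAction_iff.2 ⟨_, _, mf.coeFn_toLp, mg, hsol.congr_ae ?_⟩, fun hint => ?_⟩
  · filter_upwards [Lp.coeFn_sub φ (((l ^ 2 : ℝ) : ℂ) • mf.toLp),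
      Lp.coeFn_smul ((l ^ 2 : ℝ) : ℂ) mf.toLp, mf.coeFn_toLp] with x h1 h2 h3
    rw [h1, Pi.sub_apply, h2, Pi.smul_apply, h3, hk2, smul_eq_mul]
    push_cast
    ring
  -- Integrability is kept along because the transforms are given by integrals only on `L¹ ∩ L²`; it
  -- lets the resolvent be tested there.
  · refine Integrable.congr ?_ mf.coeFn_toLp.symm
    have ip := integrable_of_le_expConv hl0 hint pc pb
    have iq := integrable_of_le_expConv hl0 hint qc qb
    exact (((ip.sub iq).div_const _).add ((iE (-a)).const_mul c₁)).add ((iE a).const_mul c₂)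

/-! ### Contour integrals over the upper half-plane -/

theorem integrable_const_div_one_add_sq (C : ℝ) :
    Integrable (fun x : ℝ => C / (1 + x ^ 2)) volume := by
  simpa [div_eq_mul_inv] using integrable_inv_one_add_sq.const_mul C

theorem sq_le_norm_add_mul_I_sq (x y : ℝ) : x ^ 2 ≤ ‖(x + y * Complex.I : ℂ)‖ ^ 2 := by
  rw [← Complex.normSq_eq_norm_sq, Complex.normSq_add_mul_I]
  nlinarith [sq_nonneg y]

theorem continuousOn_of_differentiableOn_line {f : ℂ → ℂ}
    (hf : DifferentiableOn ℂ f {z | 0 < z.im}) {y : ℝ} (hy : 0 < y) :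
    Continuous fun x : ℝ => f (x + y * Complex.I) := by
  refine hf.continuousOn.comp_continuous (by fun_prop) fun x => ?_
  simpa using hy

/-- Integrals over horizontal lines of a holomorphic function on the upper half-plane with
quadratic decay vanish. -/
theorem integral_line_eq_zero {f : ℂ → ℂ} {C : ℝ} (hf : DifferentiableOn ℂ f {z | 0 < z.im})
    (hb : ∀ z : ℂ, 0 < z.im → ‖f z‖ ≤ C / (1 + ‖z‖ ^ 2)) {δ : ℝ} (hδ : 0 < δ) :
    ∫ x : ℝ, f (x + δ * Complex.I) = 0 := by
  have hC : 0 ≤ C := by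
    have := (norm_nonneg _).trans (hb Complex.I (by simp))
    rwa [le_div_iff₀ (by positivity), zero_mul] at this
  have hbx : ∀ x y : ℝ, 0 < y → ‖f (x + y * Complex.I)‖ ≤ C / (1 + x ^ 2) := fun x y hy => by
    exact (hb _ (by simpa using hy)).trans (div_le_div_of_nonneg_left hC (by positivity)
      (by linarith [sq_le_norm_add_mul_I_sq x y]))
  have hint : ∀ y : ℝ, 0 < y → Integrable (fun x : ℝ => f (x + y * Complex.I)) volume := fun y hy =>
    (integrable_const_div_one_add_sq C).mono'
      (continuousOn_of_differentiableOn_line hf hy).aestronglyMeasurable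
      (Eventually.of_forall fun x => hbx x y hy)
  -- Cauchy on rectangles: the vertical sides vanish as their abscissae go to `±∞`, so the integral
  -- does not depend on the height.
  have heq : ∀ Y : ℝ, δ ≤ Y → ∫ x : ℝ, f (x + δ * Complex.I) = ∫ x : ℝ, f (x + Y * Complex.I) := by
    intro Y hY
    have hYpos := hδ.trans_le hY
    have hrect : ∀ X : ℝ, (∫ x in (-X)..X, f (x + δ * Complex.I))
        - (∫ x in (-X)..X, f (x + Y * Complex.I))
        + Complex.I • (∫ y in δ..Y, f (X + y * Complex.I))
        - Complex.I • (∫ y in δ..Y, f ((-X : ℝ) + y * Complex.I)) = 0 := by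
      intro X
      have := Complex.integral_boundary_rect_eq_zero_of_differentiableOn f
        (⟨-X, δ⟩ : ℂ) (⟨X, Y⟩ : ℂ) (hf.mono fun z hz => ?_)
      · simpa using this
      · have := hz.2
        rw [mem_preimage, uIcc_of_le hY] at this
        exact hδ.trans_le this.1
    have hside : ∀ s : ℝ → ℝ, (∀ X, s X ^ 2 = X ^ 2) → Tendsto (fun X : ℝ =>
        Complex.I • (∫ y in δ..Y, f ((s X : ℝ) + y * Complex.I))) atTop (𝓝 0) := by
      intro s hs
      have h1 : Tendsto (fun X : ℝ => C / (1 + X ^ 2) * |Y - δ|) atTop (𝓝 0) := by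
        have : Tendsto (fun X : ℝ => 1 + X ^ 2) atTop atTop :=
          tendsto_atTop_add_const_left _ _ (tendsto_pow_atTop two_ne_zero)
        simpa using (this.const_div_atTop C).mul_const |Y - δ|
      refine squeeze_zero_norm (fun X => ?_) h1
      rw [norm_smul, Complex.norm_I, one_mul]
      refine intervalIntegral.norm_integral_le_of_norm_le_const fun y hy => ?_
      rw [uIoc_of_le hY] at hy
      rw [← hs X]
      exact hbx (s X) y (hδ.trans hy.1)
    have h1 := intervalIntegral_tendsto_integral (hint δ hδ) tendsto_neg_atTop_atBot tendsto_id
    have h2 := intervalIntegral_tendsto_integral (hint Y hYpos) tendsto_neg_atTop_atBot tendsto_id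
    have h3 := ((h1.sub h2).add (hside (fun X => X) fun _ => rfl)).sub
      (hside (fun X => -X) fun X => by ring)
    have h4 : Tendsto (fun _ : ℝ => (0 : ℂ)) atTop
        (𝓝 ((∫ x : ℝ, f (x + δ * Complex.I)) - (∫ x : ℝ, f (x + Y * Complex.I)) + 0 - 0)) :=
      h3.congr fun X => hrect X
    have h5 := tendsto_nhds_unique tendsto_const_nhds h4
    rw [add_zero, sub_zero] at h5
    exact sub_eq_zero.1 h5.symm
  -- Pushing the line to infinite height: `C/(1+x²)` dominates for every height and the integrand
  -- tends to `0` pointwise.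
  have hlim : Tendsto (fun Y : ℝ => ∫ x : ℝ, f (x + Y * Complex.I)) atTop
      (𝓝 (∫ _ : ℝ, (0 : ℂ))) := by
    refine tendsto_integral_filter_of_dominated_convergence (fun x => C / (1 + x ^ 2)) ?_ ?_
      (integrable_const_div_one_add_sq C) (Eventually.of_forall fun x => ?_)
    · filter_upwards [eventually_gt_atTop 0] with Y hY
      exact (continuousOn_of_differentiableOn_line hf hY).aestronglyMeasurable
    · filter_upwards [eventually_gt_atTop 0] with Y hY
      exact Eventually.of_forall fun x => hbx x Y hY
    · have h1 : Tendsto (fun Y : ℝ => C / (1 + Y ^ 2)) atTop (𝓝 0) :=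
        Tendsto.const_div_atTop
          (tendsto_atTop_add_const_left _ _ (tendsto_pow_atTop two_ne_zero)) C
      refine squeeze_zero_norm' ?_ h1
      filter_upwards [eventually_gt_atTop 0] with Y hY
      refine (hb _ (by simpa using hY)).trans (div_le_div_of_nonneg_left hC (by positivity) ?_)
      rw [← Complex.normSq_eq_norm_sq, Complex.normSq_add_mul_I]
      nlinarith [sq_nonneg x]
  rw [integral_zero] at hlim
  refine tendsto_nhds_unique (tendsto_const_nhds.congr' ?_) hlim
  filter_upwards [eventually_ge_atTop δ] with Y hY using heq Y hY

/-- The lines at height `δ` descend to the real axis under the same integrable majorant, so boundary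
values are needed only almost everywhere. -/
theorem integral_boundary_eq_zero {f : ℂ → ℂ} {f₀ : ℝ → ℂ} {C : ℝ}
    (hf : DifferentiableOn ℂ f {z | 0 < z.im})
    (hb : ∀ z : ℂ, 0 < z.im → ‖f z‖ ≤ C / (1 + ‖z‖ ^ 2))
    (hlim : ∀ᵐ x : ℝ, Tendsto (fun δ : ℝ => f (x + δ * Complex.I)) (𝓝[>] 0) (𝓝 (f₀ x))) :
    ∫ x, f₀ x = 0 := by
  have hC : 0 ≤ C := by
    have := (norm_nonneg _).trans (hb Complex.I (by simp))
    rwa [le_div_iff₀ (by positivity), zero_mul] at this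
  have h1 : Tendsto (fun δ : ℝ => ∫ x : ℝ, f (x + δ * Complex.I)) (𝓝[>] 0) (𝓝 (∫ x, f₀ x)) := by
    refine tendsto_integral_filter_of_dominated_convergence (fun x => C / (1 + x ^ 2)) ?_ ?_
      (integrable_const_div_one_add_sq C) hlim
    · filter_upwards [self_mem_nhdsWithin] with δ hδ
      exact (continuousOn_of_differentiableOn_line hf hδ).aestronglyMeasurable
    · filter_upwards [self_mem_nhdsWithin] with δ hδ
      exact Eventually.of_forall fun x => (hb _ (by simpa using hδ)).trans
        (div_le_div_of_nonneg_left hC (by positivity)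
          (by linarith [sq_le_norm_add_mul_I_sq x δ]))
  refine tendsto_nhds_unique (h1.congr' ?_) tendsto_const_nhds
  filter_upwards [self_mem_nhdsWithin] with δ hδ using integral_line_eq_zero hf hb hδ

/-- This is `2p/((x-p)(x+p))` with `p = iκ`: a model with the pole to be subtracted and quadratic
decay, whose integral is elementary. It accounts for the residue `2πi`. -/
theorem integral_two_I_mul_div {κ : ℝ} (hκ : 0 < κ) :
    Integrable (fun x : ℝ => 2 * Complex.I * κ / ((x : ℂ) ^ 2 + κ ^ 2)) volume ∧
    ∫ x : ℝ, 2 * Complex.I * κ / ((x : ℂ) ^ 2 + κ ^ 2) = 2 * Real.pi * Complex.I := by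
  have e : (fun x : ℝ => 2 * Complex.I * κ / ((x : ℂ) ^ 2 + κ ^ 2))
      = fun x : ℝ => (2 * Complex.I / κ) * (((1 + (κ⁻¹ * x) ^ 2)⁻¹ : ℝ) : ℂ) := by
    ext x
    have h1 : ((x : ℂ) ^ 2 + κ ^ 2) ≠ 0 := by
      have : (x ^ 2 + κ ^ 2 : ℝ) ≠ 0 := by positivity
      exact_mod_cast this
    have h2 : (1 + ((κ : ℂ)⁻¹ * x) ^ 2) ≠ 0 := by
      have : (1 + (κ⁻¹ * x) ^ 2 : ℝ) ≠ 0 := by positivity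
      exact_mod_cast this
    have h3 : (κ : ℂ) ≠ 0 := by exact_mod_cast hκ.ne'
    push_cast
    have h4 : (x : ℂ) ^ 2 + κ ^ 2 = κ ^ 2 * (1 + ((κ : ℂ)⁻¹ * x) ^ 2) := by
      field_simp
      ring
    rw [h4]
    generalize (1 + ((κ : ℂ)⁻¹ * x) ^ 2) = y at h2
    field_simp
  rw [e]
  constructor
  · exact ((integrable_inv_one_add_sq.comp_mul_left' (inv_ne_zero hκ.ne')).ofReal).const_mul _
  · rw [integral_const_mul, integral_complex_ofReal,
      Measure.integral_comp_mul_left (fun x => (1 + x ^ 2)⁻¹) κ⁻¹, integral_univ_inv_one_add_sq,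
      inv_inv, abs_of_pos hκ]
    have h3 : (κ : ℂ) ≠ 0 := by exact_mod_cast hκ.ne'
    simp only [smul_eq_mul]
    push_cast
    field_simp

/-- The residue theorem in the upper half-plane for a function with one simple pole. -/
theorem integral_div_sub_eq {M : ℂ → ℂ} {M₀ : ℝ → ℂ} {C κ : ℝ} (hκ : 0 < κ)
    (hM : DifferentiableOn ℂ M {z | 0 < z.im})
    (hb : ∀ z : ℂ, 0 < z.im → ‖M z‖ ≤ C / (1 + ‖z‖))
    (hlim : ∀ᵐ x : ℝ, Tendsto (fun δ : ℝ => M (x + δ * Complex.I)) (𝓝[>] 0) (𝓝 (M₀ x)))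
    (hi : Integrable (fun x : ℝ => M₀ x / (x - Complex.I * κ)) volume) :
    ∫ x : ℝ, M₀ x / (x - Complex.I * κ) = 2 * Real.pi * Complex.I * M (Complex.I * κ) := by
  set p : ℂ := Complex.I * κ with hp
  have hpim : p.im = κ := by simp [hp]
  have hopen : IsOpen {z : ℂ | 0 < z.im} := isOpen_lt continuous_const Complex.continuous_im
  have hpmem : {z : ℂ | 0 < z.im} ∈ 𝓝 p := hopen.mem_nhds (by simpa [hpim] using hκ)
  have hC : 0 ≤ C := by
    have := (norm_nonneg _).trans (hb Complex.I (by simp))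
    rwa [le_div_iff₀ (by positivity), zero_mul] at this
  -- Off `p` this is `M/(z-p) - M(p)·2p/((z-p)(z+p))`. `dslope` removes the singularity at `p`, and
  -- the term with pole at `-p`, below the axis, restores quadratic decay.
  let f : ℂ → ℂ := fun z => dslope M p z + M p / (z + p)
  have hzp : ∀ z : ℂ, 0 < z.im → κ ≤ ‖z + p‖ := fun z hz => by
    have := Complex.abs_im_le_norm (z + p)
    rw [Complex.add_im, hpim, abs_of_pos (by linarith)] at this
    linarith
  have hzp0 : ∀ z : ℂ, 0 < z.im → z + p ≠ 0 := fun z hz h => by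
    have := hzp z hz
    rw [h, norm_zero] at this
    linarith
  have hfd : DifferentiableOn ℂ f {z | 0 < z.im} := by
    refine ((Complex.differentiableOn_dslope hpmem).2 hM).add ?_
    exact (differentiableOn_const _).div (by fun_prop) hzp0
  have hfeq : ∀ z, z ≠ p → z + p ≠ 0 → f z = M z / (z - p) - M p * (2 * p / ((z - p) * (z + p))) := by
    intro z hz hz'
    simp only [f]
    rw [dslope_of_ne _ hz, slope_def_field]
    have := sub_ne_zero.2 hz
    field_simp
    ring
  have hpn : ‖p‖ = κ := by rw [hp]; simp [abs_of_pos hκ]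
  set K : ℝ := 3 + 2 / κ with hK
  have hKpos : 0 < K := by positivity
  have hfar : ∀ z : ℂ, κ / 2 ≤ ‖z - p‖ → 1 + ‖z‖ ≤ K * ‖z - p‖ := fun z hz => by
    have h1 : ‖z‖ ≤ ‖z - p‖ + κ := by
      have := norm_add_le (z - p) p
      rwa [sub_add_cancel, hpn] at this
    have h2 : 1 ≤ 2 / κ * ‖z - p‖ := by
      rw [div_mul_eq_mul_div, le_div_iff₀ hκ]; linarith
    rw [hK, add_mul]; linarith
  have hplus : ∀ z : ℂ, 0 < z.im → 1 + ‖z‖ ≤ K * ‖z + p‖ := fun z hz => by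
    have h0 := hzp z hz
    have h1 : ‖z‖ ≤ ‖z + p‖ + κ := by
      have := norm_sub_le (z + p) p
      rwa [add_sub_cancel_right, hpn] at this
    have h2 : 1 ≤ 2 / κ * ‖z + p‖ := by
      rw [div_mul_eq_mul_div, le_div_iff₀ hκ]; linarith
    rw [hK, add_mul]; linarith
  have hsub : Metric.closedBall p (κ / 2) ⊆ {z : ℂ | 0 < z.im} := fun z hz => by
    rw [Metric.mem_closedBall, dist_eq_norm] at hz
    have := (Complex.abs_im_le_norm (z - p)).trans hz
    rw [Complex.sub_im, hpim] at this
    have h2 := (abs_le.1 this).1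
    simp only [mem_ofPred_eq]
    linarith
  -- Near `p` compactness bounds `f`; away from it both explicit summands are estimated directly.
  obtain ⟨B, hB⟩ := (isCompact_closedBall p (κ / 2)).exists_bound_of_continuousOn
    (hfd.continuousOn.mono hsub)
  have hB0 : 0 ≤ B := (norm_nonneg _).trans (hB p (Metric.mem_closedBall_self (by positivity)))
  have hsq : ∀ r : ℝ, 0 ≤ r → 1 + r ^ 2 ≤ (1 + r) ^ 2 := fun r hr => by nlinarith
  have hfb : ∀ z : ℂ, 0 < z.im →
      ‖f z‖ ≤ (B * (1 + (3 / 2 * κ) ^ 2) + (C * K + ‖M p‖ * (2 * κ) * K ^ 2)) / (1 + ‖z‖ ^ 2) := by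
    intro z hz
    rw [le_div_iff₀ (by positivity)]
    rcases le_or_gt ‖z - p‖ (κ / 2) with h | h
    · have h1 := hB z (by rwa [Metric.mem_closedBall, dist_eq_norm])
      have h2 : ‖z‖ ≤ 3 / 2 * κ := by
        have := norm_add_le (z - p) p
        rw [sub_add_cancel, hpn] at this
        linarith
      have h3 : ‖f z‖ * (1 + ‖z‖ ^ 2) ≤ B * (1 + (3 / 2 * κ) ^ 2) := by gcongr
      have : 0 ≤ C * K + ‖M p‖ * (2 * κ) * K ^ 2 := by positivity
      linarith
    · have hne : z ≠ p := fun h' => by rw [h', sub_self, norm_zero] at h; linarith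
      have g1 : 0 < ‖z - p‖ := (half_pos hκ).trans h
      have g2 : 0 < ‖z + p‖ := hκ.trans_le (hzp z hz)
      have k1 := hfar z h.le
      have k2 := hplus z hz
      have k3 := hsq ‖z‖ (norm_nonneg z)
      have n1 : ‖M z / (z - p)‖ * (1 + ‖z‖ ^ 2) ≤ C * K := by
        rw [norm_div, div_mul_eq_mul_div, div_le_iff₀ g1]
        calc ‖M z‖ * (1 + ‖z‖ ^ 2) ≤ C / (1 + ‖z‖) * (1 + ‖z‖) ^ 2 := by
              gcongr; exact hb z hz
          _ = C * (1 + ‖z‖) := by field_simp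
          _ ≤ C * (K * ‖z - p‖) := by gcongr
          _ = C * K * ‖z - p‖ := by ring
      have n2 : ‖M p * (2 * p / ((z - p) * (z + p)))‖ * (1 + ‖z‖ ^ 2)
          ≤ ‖M p‖ * (2 * κ) * K ^ 2 := by
        have e2 : ‖2 * p‖ = 2 * κ := by rw [norm_mul 2 p, hpn, Complex.norm_two]
        rw [norm_mul (M p), norm_div, e2, norm_mul (z - p), mul_div_assoc',
          div_mul_eq_mul_div, div_le_iff₀ (mul_pos g1 g2)]
        calc ‖M p‖ * (2 * κ) * (1 + ‖z‖ ^ 2) ≤ ‖M p‖ * (2 * κ) * ((1 + ‖z‖) * (1 + ‖z‖)) := by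
              gcongr; linarith
          _ ≤ ‖M p‖ * (2 * κ) * ((K * ‖z - p‖) * (K * ‖z + p‖)) := by gcongr
          _ = _ := by ring
      rw [hfeq z hne (hzp0 z hz)]
      have := norm_sub_le (M z / (z - p)) (M p * (2 * p / ((z - p) * (z + p))))
      have h5 : 0 ≤ B * (1 + (3 / 2 * κ) ^ 2) := by positivity
      nlinarith [norm_nonneg z]
  have hx1 : ∀ x : ℝ, (x : ℂ) - p ≠ 0 := fun x h => by
    have := congrArg Complex.im h
    simp [hpim] at this
    linarith
  have hx2 : ∀ x : ℝ, (x : ℂ) + p ≠ 0 := fun x h => by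
    have := congrArg Complex.im h
    simp [hpim] at this
    linarith
  have hxx : ∀ x : ℝ, 2 * p / (((x : ℂ) - p) * (x + p)) = 2 * Complex.I * κ / ((x : ℂ) ^ 2 + κ ^ 2) := by
    intro x
    congr 1
    · rw [hp]; ring
    · rw [hp]; ring_nf; rw [Complex.I_sq]; ring
  have h0 := integral_boundary_eq_zero (f₀ := fun x : ℝ => M₀ x / (x - p)
    - M p * (2 * Complex.I * κ / ((x : ℂ) ^ 2 + κ ^ 2))) hfd hfb (by
      filter_upwards [hlim] with x hx
      have hline : Tendsto (fun δ : ℝ => ((x : ℂ) + δ * Complex.I)) (𝓝[>] 0) (𝓝 (x : ℂ)) := by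
        have : Continuous fun δ : ℝ => ((x : ℂ) + δ * Complex.I) := by fun_prop
        simpa using (this.tendsto 0).mono_left nhdsWithin_le_nhds
      rw [← hxx x]
      have t1 := (hx.div (hline.sub_const p) (hx1 x)).sub (Tendsto.const_mul (M p)
        ((tendsto_const_nhds (x := 2 * p)).div ((hline.sub_const p).mul (hline.add_const p))
          (mul_ne_zero (hx1 x) (hx2 x))))
      refine t1.congr' ?_
      have e1 : ∀ᶠ δ : ℝ in 𝓝[>] 0, ((x : ℂ) + δ * Complex.I) - p ≠ 0 :=
        (hline.sub_const p).eventually_ne (hx1 x)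
      filter_upwards [e1, self_mem_nhdsWithin] with δ hδ hδ'
      rw [hfeq _ (sub_ne_zero.1 hδ) (hzp0 _ (by simpa using hδ'))]
      rfl)
  obtain ⟨i2, v2⟩ := integral_two_I_mul_div hκ
  rw [integral_sub hi (i2.const_mul _), integral_const_mul, v2] at h0
  linear_combination h0

/-! ### The Plancherel theorem for integrable functions -/

section Plancherel

open FourierTransform SchwartzMap

theorem continuous_fourier_of_integrable {f : ℝ → ℂ} (hf : Integrable f volume) :
    Continuous (𝓕 f) :=
  VectorFourier.fourierIntegral_continuous Real.continuous_fourierChar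
    continuous_inner hf

/-- On integrable functions the Fourier transform of `L²` is given by the Fourier integral. -/
theorem coeFn_fourier (f : L2) (hf : Integrable f volume) :
    (𝓕 f : L2) =ᵐ[volume] 𝓕 (f : ℝ → ℂ) := by
  refine ae_eq_of_integral_contDiff_smul_eq ((Lp.memLp _).locallyIntegrable (by norm_num))
    (continuous_fourier_of_integrable hf).locallyIntegrable fun g hg hgc => ?_
  have hg' : ContDiff ℝ ((⊤ : ℕ∞) : WithTop ℕ∞) (fun x => (g x : ℂ)) :=
    Complex.ofRealCLM.contDiff.comp hg
  have hgc' : HasCompactSupport (fun x => (g x : ℂ)) := hgc.comp_left Complex.ofReal_zero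
  let G : 𝓢(ℝ, ℂ) := hgc'.toSchwartzMap hg'
  have hG : ∀ x, G x = (g x : ℂ) := fun x => rfl
  have h1 := congrArg (fun T => T G) (Lp.fourier_toTemperedDistribution_eq f)
  simp only [TemperedDistribution.fourier_apply, Lp.toTemperedDistribution_apply] at h1
  have h2 := VectorFourier.integral_fourierIntegral_smul_eq_flip (L := innerₗ ℝ)
    (μ := (volume : Measure ℝ)) (ν := (volume : Measure ℝ)) Real.continuous_fourierChar
    continuous_inner (G.integrable (μ := volume)) hf
  rw [flip_innerₗ] at h2
  have h3 : ∫ x, (𝓕 G) x • f x = ∫ x, G x • 𝓕 (f : ℝ → ℂ) x := by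
    rw [SchwartzMap.fourier_coe]; exact h2
  have h4 := h1.symm.trans h3
  simpa [hG] using h4

/-- The Fourier integral `∫ e^{ikx} f(x) dx`. -/
def fourierExp (f : ℝ → ℂ) (k : ℝ) : ℂ := ∫ x : ℝ, Complex.exp (Complex.I * k * x) * f x

theorem fourierExp_eq (f : ℝ → ℂ) (k : ℝ) : fourierExp f k = 𝓕 f (-(2 * Real.pi)⁻¹ * k) := by
  rw [Real.fourier_real_eq_integral_exp_smul, fourierExp]
  congr 1; ext x
  rw [smul_eq_mul]
  congr 2
  push_cast
  have : (Real.pi : ℂ) ≠ 0 := by exact_mod_cast Real.pi_ne_zero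
  field_simp

theorem integrable_exp_mul {f : ℝ → ℂ} (hf : Integrable f volume) (k : ℝ) :
    Integrable (fun x : ℝ => Complex.exp (Complex.I * k * x) * f x) volume := by
  refine hf.bdd_mul (c := 1) (by fun_prop) (Eventually.of_forall fun x => ?_)
  rw [show Complex.I * k * x = ((k * x : ℝ) : ℂ) * Complex.I by push_cast; ring,
    Complex.norm_exp_ofReal_mul_I]

theorem continuous_fourierExp {f : ℝ → ℂ} (hf : Integrable f volume) :
    Continuous (fourierExp f) := by
  have : fourierExp f = fun k => 𝓕 f (-(2 * Real.pi)⁻¹ * k) := funext (fourierExp_eq f)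
  rw [this]
  exact (continuous_fourier_of_integrable hf).comp (by fun_prop)

/-- Plancherel in the normalization `𝓕` has constant one; the substitution `k = -2πξ` produces the
`2π`. -/
theorem memLp_fourierExp_and {f : ℝ → ℂ} (hf : Integrable f volume) (hf2 : MemLp f 2 volume) :
    Integrable (fun k => ‖fourierExp f k‖ ^ 2) volume ∧
      ∫ k, ‖fourierExp f k‖ ^ 2 = 2 * Real.pi * ∫ x, ‖f x‖ ^ 2 := by
  let φ : L2 := hf2.toLp f
  have hφ : φ =ᵐ[volume] f := hf2.coeFn_toLp
  have hF : (𝓕 φ : L2) =ᵐ[volume] 𝓕 f := by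
    refine (coeFn_fourier φ (hf.congr hφ.symm)).trans (Eventually.of_forall fun x => ?_)
    exact Real.fourier_congr_ae hφ x
  have h1 : ∫ x, ‖𝓕 f x‖ ^ 2 = ∫ x, ‖f x‖ ^ 2 := by
    calc ∫ x, ‖𝓕 f x‖ ^ 2 = ∫ x, ‖(𝓕 φ : L2) x‖ ^ 2 :=
          integral_congr_ae (by filter_upwards [hF] with x hx; rw [hx])
      _ = ‖φ‖ ^ 2 := by rw [← norm_sq_eq_integral, Lp.norm_fourier_eq]
      _ = ∫ x, ‖φ x‖ ^ 2 := norm_sq_eq_integral φ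
      _ = _ := integral_congr_ae (by filter_upwards [hφ] with x hx; rw [hx])
  have h2 : Integrable (fun x => ‖𝓕 f x‖ ^ 2) volume :=
    (integrable_norm_sq (𝓕 φ)).congr (by filter_upwards [hF] with x hx; rw [hx])
  have hne : -(2 * Real.pi)⁻¹ ≠ 0 := by
    have := Real.pi_pos
    simp [this.ne']
  have e : (fun k => ‖fourierExp f k‖ ^ 2) = fun k => ‖𝓕 f (-(2 * Real.pi)⁻¹ * k)‖ ^ 2 := by
    ext k; rw [fourierExp_eq]
  rw [e]
  refine ⟨h2.comp_mul_left' hne, ?_⟩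
  rw [Measure.integral_comp_mul_left (fun x => ‖𝓕 f x‖ ^ 2), h1, smul_eq_mul, inv_neg, inv_inv, abs_neg,
    abs_of_pos (by positivity)]

theorem integrable_norm_sq_fourierExp {f : ℝ → ℂ} (hf : Integrable f volume)
    (hf2 : MemLp f 2 volume) : Integrable (fun k => ‖fourierExp f k‖ ^ 2) volume :=
  (memLp_fourierExp_and hf hf2).1

theorem memLp_fourierExp {f : ℝ → ℂ} (hf : Integrable f volume) (hf2 : MemLp f 2 volume) :
    MemLp (fourierExp f) 2 volume :=
  (memLp_two_iff_integrable_sq_norm (continuous_fourierExp hf).aestronglyMeasurable).2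
    (integrable_norm_sq_fourierExp hf hf2)

/-- The transform against `e^{ik|x-c|}` of an integrable function in `L²` is in `L²`. -/
theorem memLp_integral_expAbs {f : ℝ → ℂ} (hf : Integrable f volume) (hf2 : MemLp f 2 volume)
    (c : ℝ) : MemLp (fun k : ℝ => ∫ x, expAbs k (x - c) * f x) 2 volume := by
  -- On each side of `c` the modulus is linear, which leaves two half-line Fourier integrals, at `k`
  -- and at `-k`, times unimodular factors.
  have e : (fun k : ℝ => ∫ x, expAbs k (x - c) * f x) = fun k : ℝ =>
      Complex.exp (-(Complex.I * k * c)) * fourierExp ((Ioi c).indicator f) k +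
      Complex.exp (Complex.I * k * c) * fourierExp ((Ioi c)ᶜ.indicator f) (-k) := by
    ext k
    rw [fourierExp, fourierExp, ← integral_const_mul, ← integral_const_mul, ← integral_add]
    · congr 1; ext x
      by_cases hx : x ∈ Ioi c
      · rw [indicator_of_mem hx, indicator_of_notMem (by simpa using hx), mul_zero, mul_zero,
          add_zero, expAbs_of_pos k (sub_pos.2 (mem_Ioi.1 hx)).le, ← mul_assoc, ← Complex.exp_add]
        congr 2; push_cast; ring
      · rw [indicator_of_notMem hx, indicator_of_mem (by simpa using hx), mul_zero, mul_zero,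
          zero_add, expAbs, abs_of_nonpos (by simpa using hx), ← mul_assoc, ← Complex.exp_add]
        congr 2; push_cast; ring
    · exact (integrable_exp_mul (hf.indicator measurableSet_Ioi) k).const_mul _
    · exact (integrable_exp_mul (hf.indicator (measurableSet_Ioi (a := c)).compl) (-k)).const_mul _
  rw [e]
  have hphase : ∀ k b : ℝ, ‖Complex.exp (Complex.I * k * b)‖ = 1 := fun k b => by
    rw [show Complex.I * k * b = ((k * b : ℝ) : ℂ) * Complex.I by push_cast; ring,
      Complex.norm_exp_ofReal_mul_I]
  refine MemLp.add ?_ ?_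
  · refine (memLp_fourierExp (hf.indicator (measurableSet_Ioi (a := c)))
      (hf2.indicator measurableSet_Ioi)).of_le_mul (c := 1) ?_ (Eventually.of_forall fun k => ?_)
    · exact ((by fun_prop : Continuous fun k : ℝ => Complex.exp (-(Complex.I * k * c))).mul
        (continuous_fourierExp (hf.indicator measurableSet_Ioi))).aestronglyMeasurable
    · have := hphase k (-c)
      rw [norm_mul, one_mul, show -(Complex.I * k * c) = Complex.I * k * (-c : ℝ) by push_cast; ring,
        this, one_mul]
  · have h1 := (memLp_fourierExp (hf.indicator (measurableSet_Ioi (a := c)).compl)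
      (hf2.indicator (measurableSet_Ioi (a := c)).compl)).comp_measurePreserving
      (Measure.measurePreserving_neg volume)
    refine h1.of_le_mul (c := 1) ?_ (Eventually.of_forall fun k => ?_)
    · exact ((by fun_prop : Continuous fun k : ℝ => Complex.exp (Complex.I * k * c)).mul
        ((continuous_fourierExp (hf.indicator (measurableSet_Ioi (a := c)).compl)).comp
          continuous_neg)).aestronglyMeasurable
    · rw [norm_mul, one_mul, hphase k c, one_mul, Function.comp_apply]

end Plancherel

/-! ### The characteristic function and its zeros -/

/-- The combination of two decaying exponentials of parity `σ = ±1`. -/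
def source (a σ : ℝ) (k : ℂ) (x : ℝ) : ℂ := expAbs k (x + a) + σ * expAbs k (x - a)

/-- The characteristic function of `H_α` in the sector of parity `σ = ±1`. -/
def denom (a α σ : ℝ) (k : ℂ) : ℂ :=
  2 * k + Complex.I * α * (1 + σ * Complex.exp (2 * Complex.I * a * k))

theorem expAbs_two_mul {a : ℝ} (ha : 0 < a) (k : ℂ) :
    expAbs k (2 * a) = Complex.exp (2 * Complex.I * a * k) := by
  rw [expAbs_of_pos k (by positivity)]
  congr 1; push_cast; ring

theorem continuous_source (a σ : ℝ) (k : ℂ) : Continuous (source a σ k) := by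
  have := continuous_expAbs k
  unfold source; fun_prop

theorem norm_le_one_of_sign {σ : ℝ} (hσ : σ = 1 ∨ σ = -1) : ‖(σ : ℂ)‖ = 1 := by
  rcases hσ with rfl | rfl <;> simp

theorem sign_sq {σ : ℝ} (hσ : σ = 1 ∨ σ = -1) : (σ : ℂ) * σ = 1 := by
  rcases hσ with rfl | rfl <;> simp

theorem norm_source_le_two {a σ : ℝ} (hσ : σ = 1 ∨ σ = -1) {k : ℂ} (hk : 0 ≤ k.im) (x : ℝ) :
    ‖source a σ k x‖ ≤ 2 := by
  have h1 := norm_expAbs_le_one hk (x + a)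
  have h2 := norm_expAbs_le_one hk (x - a)
  have h3 := norm_add_le (expAbs k (x + a)) (σ * expAbs k (x - a))
  rw [norm_mul, norm_le_one_of_sign hσ] at h3
  rw [source]; linarith

theorem norm_exp_sub_one_le_of_re_nonpos {z : ℂ} (hz : z.re ≤ 0) : ‖Complex.exp z - 1‖ ≤ ‖z‖ := by
  have h := Convex.norm_image_sub_le_of_norm_deriv_le (𝕜 := ℂ) (f := Complex.exp) (C := 1)
    (s := {z : ℂ | z.re ≤ 0}) (x := 0) (y := z) (fun w _ => Complex.differentiableAt_exp)
    (fun w hw => by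
      rw [Complex.deriv_exp, Complex.norm_exp]
      exact Real.exp_le_one_iff.2 hw)
    (convex_halfSpace_re_le 0) (by simp) hz
  simpa using h

theorem norm_expAbs_sub_le {k : ℂ} (hk : 0 ≤ k.im) (x y : ℝ) :
    ‖expAbs k x - expAbs k y‖ ≤ ‖k‖ * |x - y| := by
  wlog h : |y| ≤ |x| generalizing x y
  · rw [norm_sub_rev, abs_sub_comm]
    exact this y x (le_of_not_ge h)
  have e : expAbs k x - expAbs k y
      = expAbs k y * (Complex.exp (Complex.I * k * ((|x| - |y| : ℝ) : ℂ)) - 1) := by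
    rw [mul_sub, mul_one, expAbs, expAbs, ← Complex.exp_add]
    congr 2; push_cast; ring
  have hre : (Complex.I * k * ((|x| - |y| : ℝ) : ℂ)).re ≤ 0 := by
    rw [Complex.re_mul_ofReal]
    have : 0 ≤ |x| - |y| := sub_nonneg.2 h
    simp only [Complex.mul_re, Complex.I_re, zero_mul, Complex.I_im, one_mul, zero_sub]
    nlinarith
  rw [e, norm_mul]
  calc ‖expAbs k y‖ * ‖Complex.exp (Complex.I * k * ((|x| - |y| : ℝ) : ℂ)) - 1‖
      ≤ 1 * ‖Complex.I * k * ((|x| - |y| : ℝ) : ℂ)‖ := by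
        gcongr
        · exact norm_expAbs_le_one hk y
        · exact norm_exp_sub_one_le_of_re_nonpos hre
    _ = ‖k‖ * |(|x| - |y|)| := by
        rw [one_mul, norm_mul, norm_mul, Complex.norm_I, one_mul, Complex.norm_real,
          Real.norm_eq_abs]
    _ ≤ ‖k‖ * |x - y| :=
        mul_le_mul_of_nonneg_left (abs_abs_sub_abs_le_abs_sub x y) (norm_nonneg k)

/-- The odd source is a difference of one function at points `2a` apart, hence `O(|k|)`. This
cancels the zero of `denom` at `k = 0` in the odd sector. -/
theorem norm_source_neg_one_le {a : ℝ} (ha : 0 < a) {k : ℂ} (hk : 0 ≤ k.im) (x : ℝ) :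
    ‖source a (-1) k x‖ ≤ 2 * a * ‖k‖ := by
  have h := norm_expAbs_sub_le hk (x + a) (x - a)
  rw [show x + a - (x - a) = 2 * a by ring, abs_of_pos (by positivity)] at h
  simpa [source, sub_eq_add_neg, mul_comm] using h

theorem memLp_source (a σ : ℝ) {k : ℂ} (hk : 0 < k.im) : MemLp (source a σ k) 2 volume :=
  ((memLp_expAbs hk).comp_measurePreserving (measurePreserving_add_right volume a)).add
    (((memLp_expAbs hk).comp_measurePreserving (measurePreserving_sub_right volume a)).const_mul _)

/-- When `denom` vanishes the interface equations are solved without any incoming wave. For `0 <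
k.im` the solution decays and is a bound state. -/
theorem isSol_source {a α σ : ℝ} (ha : 0 < a) (hσ : σ = 1 ∨ σ = -1) {k : ℂ}
    (hD : denom a α σ k = 0) :
    IsSol a α (source a σ k) (fun x => σ * expAbsDeriv k (x - a) + expAbsDeriv k (x + a))
      (fun x => k ^ 2 * source a σ k x) := by
  have h := IsSol.of_sources (α := α) ha (f₀ := fun _ => 0) (g₀ := fun _ => 0) (φ₀ := fun _ => 0) k σ 1
    (continuous_const.locallyIntegrable) (fun x => hasDerivAt_const x 0) (by simp)
    (by
      rw [expAbs_two_mul ha]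
      rw [denom] at hD
      linear_combination (-Complex.I * σ) * hD + (α * σ * (1 + σ * Complex.exp (2 * Complex.I * a * k)))
        * Complex.I_mul_I - α * Complex.exp (2 * Complex.I * a * k) * (sign_sq hσ))
    (by
      rw [expAbs_two_mul ha]
      rw [denom] at hD
      linear_combination (-Complex.I) * hD +
        (α * (1 + σ * Complex.exp (2 * Complex.I * a * k))) * Complex.I_mul_I)
  convert h using 2 with x x x
  · simp only [source]; ring
  · ring
  · simp only [source]; ring

/-- The decaying solution as an element of `L²`. -/
def sourceLp (a σ : ℝ) {k : ℂ} (hk : 0 < k.im) : L2 := (memLp_source a σ hk).toLp _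

theorem coeFn_sourceLp (a σ : ℝ) {k : ℂ} (hk : 0 < k.im) :
    sourceLp a σ hk =ᵐ[volume] source a σ k := (memLp_source a σ hk).coeFn_toLp

theorem hasAction_sourceLp {a α σ : ℝ} (ha : 0 < a) (hσ : σ = 1 ∨ σ = -1) {k : ℂ} (hk : 0 < k.im)
    (hD : denom a α σ k = 0) :
    HasAction a α (sourceLp a σ hk) (k ^ 2 • sourceLp a σ hk) := by
  rw [hasAction_iff]
  refine ⟨_, _, coeFn_sourceLp a σ hk, ?_, (isSol_source ha hσ hD).congr_ae ?_⟩
  · exact (((memLp_expAbsDeriv hk).comp_measurePreserving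
      (measurePreserving_sub_right volume a)).const_mul _).add
      ((memLp_expAbsDeriv hk).comp_measurePreserving (measurePreserving_add_right volume a))
  · filter_upwards [Lp.coeFn_smul (k ^ 2) (sourceLp a σ hk), coeFn_sourceLp a σ hk] with x h1 h2
    rw [h1, Pi.smul_apply, h2, smul_eq_mul]

theorem sourceLp_ne_zero {a σ : ℝ} (ha : 0 < a) (hσ : σ = 1 ∨ σ = -1) {k : ℂ} (hk : 0 < k.im) :
    sourceLp a σ hk ≠ 0 := by
  intro h
  have h1 : source a σ k =ᵐ[volume] fun _ => 0 := by
    have := coeFn_sourceLp a σ hk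
    rw [h] at this
    exact this.symm.trans (Lp.coeFn_zero _ _ _)
  have h2 := congrFun (((continuous_source a σ k).ae_eq_iff_eq volume continuous_const).1 h1) (-a)
  rw [source, neg_add_cancel, expAbs_zero, show -a - a = -(2 * a) by ring, expAbs_neg] at h2
  have h3 : ‖(σ : ℂ) * expAbs k (2 * a)‖ < 1 := by
    rw [norm_mul, norm_le_one_of_sign hσ, one_mul, norm_expAbs, Real.exp_lt_one_iff]
    have := mul_pos hk (show 0 < |2 * a| by positivity)
    linarith
  rw [eq_neg_of_add_eq_zero_right h2, norm_neg, norm_one] at h3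
  exact lt_irrefl _ h3

/-- Zeros of the characteristic function in the upper half-plane are purely imaginary. -/
theorem re_eq_zero_of_denom_eq_zero {a α σ : ℝ} (ha : 0 < a) (hσ : σ = 1 ∨ σ = -1) {k : ℂ}
    (hk : 0 < k.im) (hD : denom a α σ k = 0) : k.re = 0 := by
  have h := hasAction_sourceLp ha hσ hk hD
  have h1 := HasAction.symm ha h h
  rw [inner_smul_left, inner_smul_right] at h1
  have h2 : (inner ℂ (sourceLp a σ hk) (sourceLp a σ hk) : ℂ) ≠ 0 :=
    inner_self_ne_zero.2 (sourceLp_ne_zero ha hσ hk)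
  have h3 := mul_right_cancel₀ h2 h1
  -- A symmetric operator has real eigenvalues, and `k²` real with `k.im > 0` leaves only the
  -- imaginary axis.
  have h4 : (k ^ 2).im = 0 := Complex.conj_eq_iff_im.1 h3
  rw [sq, Complex.mul_im] at h4
  have : k.re * k.im = 0 := by linarith
  exact (mul_eq_zero.1 this).resolve_right hk.ne'

theorem denom_I_mul (a α σ κ : ℝ) : denom a α σ (Complex.I * κ)
    = Complex.I * ((2 * κ + α * (1 + σ * Real.exp (-(2 * a * κ))) : ℝ) : ℂ) := by
  rw [denom]
  have : 2 * Complex.I * a * (Complex.I * κ) = ((-(2 * a * κ) : ℝ) : ℂ) := by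
    push_cast
    linear_combination (2 * a * κ : ℂ) * Complex.I_mul_I
  rw [this, ← Complex.ofReal_exp]
  push_cast; ring

theorem denom_I_mul_eq_zero_iff {a α σ κ : ℝ} : denom a α σ (Complex.I * κ) = 0 ↔
    2 * κ + α * (1 + σ * Real.exp (-(2 * a * κ))) = 0 := by
  rw [denom_I_mul, mul_eq_zero, or_iff_right Complex.I_ne_zero, Complex.ofReal_eq_zero]

theorem neg_of_denom_zero {a α σ κ : ℝ} (ha : 0 < a) (hσ : σ = 1 ∨ σ = -1) (hκ : 0 < κ)
    (h : 2 * κ + α * (1 + σ * Real.exp (-(2 * a * κ))) = 0) : α < 0 := by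
  by_contra hα
  have h1 : Real.exp (-(2 * a * κ)) ≤ 1 := Real.exp_le_one_iff.2 (by nlinarith [mul_pos ha hκ])
  have h2 := Real.exp_pos (-(2 * a * κ))
  have h3 : 0 ≤ 1 + σ * Real.exp (-(2 * a * κ)) := by rcases hσ with rfl | rfl <;> linarith
  have := mul_nonneg (not_lt.1 hα) h3
  linarith

/-- As `α < 0`, the equation is strictly monotone in `κ` for even parity. For odd parity `1 -
e^{-2aκ}` is strictly concave and vanishes at `0`, so it meets a line through the origin at most
once for `κ > 0`. -/
theorem denom_zero_unique {a α σ κ κ' : ℝ} (ha : 0 < a) (hσ : σ = 1 ∨ σ = -1) (hκ : 0 < κ)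
    (hκ' : 0 < κ') (h : 2 * κ + α * (1 + σ * Real.exp (-(2 * a * κ))) = 0)
    (h' : 2 * κ' + α * (1 + σ * Real.exp (-(2 * a * κ'))) = 0) : κ = κ' := by
  have hα := neg_of_denom_zero ha hσ hκ h
  wlog hlt : κ < κ' generalizing κ κ'
  · rcases eq_or_lt_of_le (not_lt.1 hlt) with e | l
    · exact e.symm
    · exact (this hκ' hκ h' h l).symm
  exfalso
  rcases hσ with rfl | rfl
  · have : Real.exp (-(2 * a * κ')) < Real.exp (-(2 * a * κ)) :=
      Real.exp_lt_exp.2 (by nlinarith)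
    nlinarith
  · have hne : -(2 * a * κ') ≠ 0 := by have := mul_pos ha hκ'; intro h; linarith
    have hc := strictConvexOn_exp.2 (mem_univ (-(2 * a * κ'))) (mem_univ 0) hne
      (show 0 < κ / κ' by positivity)
      (show 0 < 1 - κ / κ' by rw [sub_pos, div_lt_one hκ']; exact hlt) (by ring)
    simp only [smul_eq_mul, mul_zero, add_zero, Real.exp_zero, mul_one] at hc
    rw [show κ / κ' * -(2 * a * κ') = -(2 * a * κ) by field_simp] at hc
    have e : α * (1 - Real.exp (-(2 * a * κ'))) * (κ / κ') = -(2 * κ) := by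
      rw [show α * (1 - Real.exp (-(2 * a * κ'))) = -2 * κ' by linarith]
      field_simp
    nlinarith

/-- This is the `κ`-derivative of the real equation for the zero. Its positivity makes the zero
simple and fixes the sign of the residue. -/
theorem deriv_denom_pos {a α σ κ : ℝ} (ha : 0 < a) (hσ : σ = 1 ∨ σ = -1) (hκ : 0 < κ)
    (h : 2 * κ + α * (1 + σ * Real.exp (-(2 * a * κ))) = 0) :
    0 < 2 - 2 * a * α * σ * Real.exp (-(2 * a * κ)) := by
  have hα := neg_of_denom_zero ha hσ hκ h
  have h2 := Real.exp_pos (-(2 * a * κ))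
  rcases hσ with rfl | rfl
  · have : 0 < a * -α * Real.exp (-(2 * a * κ)) := by
      have := neg_pos.2 hα
      positivity
    nlinarith
  · have hy : 0 < 2 * a * κ := by positivity
    have h3 := Real.add_one_lt_exp hy.ne'
    have h4 : Real.exp (2 * a * κ) * Real.exp (-(2 * a * κ)) = 1 := by
      rw [← Real.exp_add, add_neg_cancel, Real.exp_zero]
    set E := Real.exp (-(2 * a * κ))
    have h5 : (2 * a * κ + 1) * E < 1 := by
      calc (2 * a * κ + 1) * E < Real.exp (2 * a * κ) * E := by gcongr
        _ = 1 := h4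
    have h6 : E < 1 := by nlinarith
    -- Multiplying by `1 - E` allows the zero equation `α (1 - E) = -2κ` to be inserted; what
    -- remains is `2(1 - (1 + 2aκ)E)`, positive by `1 + y < e^y`.
    have h7 : 0 < (2 + 2 * a * α * E) * (1 - E) := by
      have : (2 + 2 * a * α * E) * (1 - E) = 2 * (1 - E) + 2 * a * E * (α * (1 - E)) := by ring
      rw [this, show α * (1 - E) = -2 * κ by linarith]
      nlinarith
    have h8 := (pos_iff_pos_of_mul_pos h7).2 (by linarith)
    linarith

/-- On the real axis the characteristic function vanishes at most at the origin. -/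
theorem denom_ofReal_ne_zero {a α σ : ℝ} (hα : α ≠ 0) (hσ : σ = 1 ∨ σ = -1) {k : ℝ}
    (hk : σ = 1 ∨ k ≠ 0) : denom a α σ k ≠ 0 := by
  intro h
  have e : denom a α σ k = ((2 * k - α * σ * Real.sin (2 * a * k) : ℝ) : ℂ)
      + ((α * (1 + σ * Real.cos (2 * a * k)) : ℝ) : ℂ) * Complex.I := by
    rw [denom, show 2 * Complex.I * a * k = ((2 * a * k : ℝ) : ℂ) * Complex.I by push_cast; ring,
      Complex.exp_mul_I, ← Complex.ofReal_cos, ← Complex.ofReal_sin]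
    push_cast
    linear_combination (α * σ * Complex.sin (2 * a * k)) * Complex.I_mul_I
  rw [e] at h
  have hre := congrArg Complex.re h
  have him := congrArg Complex.im h
  simp only [Complex.add_re, Complex.ofReal_re, Complex.re_ofReal_mul, Complex.I_re, mul_zero,
    add_zero, Complex.zero_re, Complex.add_im, Complex.ofReal_im, Complex.im_ofReal_mul,
    Complex.I_im, mul_one, zero_add, Complex.zero_im] at hre him
  -- The imaginary part gives `cos = -σ`, hence `sin = 0`, and then the real part gives `k = 0`; for
  -- even parity this contradicts `cos 0 = 1`.
  have hc := (mul_eq_zero.1 him).resolve_left hα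
  have hs : Real.sin (2 * a * k) = 0 := by
    have := Real.sin_sq_add_cos_sq (2 * a * k)
    rcases hσ with rfl | rfl
    · have h2 : Real.cos (2 * a * k) = -1 := by linarith
      rw [h2] at this; nlinarith
    · have h2 : Real.cos (2 * a * k) = 1 := by linarith
      rw [h2] at this; nlinarith
  have hk0 : k = 0 := by rw [hs] at hre; linarith
  rw [hk0] at hc hk
  rcases hσ with rfl | rfl
  · norm_num at hc
  · rcases hk with h | h
    · norm_num at h
    · exact h rfl

/-! ### The reciprocal of the characteristic function -/

theorem norm_exp_two_I_mul_le_one {a : ℝ} (ha : 0 < a) {k : ℂ} (hk : 0 ≤ k.im) :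
    ‖Complex.exp (2 * Complex.I * a * k)‖ ≤ 1 := by
  rw [← expAbs_two_mul ha]
  exact norm_expAbs_le_one hk _

theorem differentiable_denom (a α σ : ℝ) : Differentiable ℂ (denom a α σ) := by
  unfold denom; fun_prop

theorem norm_le_norm_denom {a α σ : ℝ} (ha : 0 < a) (hσ : σ = 1 ∨ σ = -1) {k : ℂ} (hk : 0 ≤ k.im)
    (h : 2 * |α| ≤ ‖k‖) : ‖k‖ ≤ ‖denom a α σ k‖ := by
  have h1 : ‖Complex.I * α * (1 + σ * Complex.exp (2 * Complex.I * a * k))‖ ≤ |α| * 2 := by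
    rw [norm_mul, norm_mul, Complex.norm_I, one_mul, Complex.norm_real, Real.norm_eq_abs]
    gcongr
    refine (norm_add_le _ _).trans ?_
    rw [norm_one, norm_mul, norm_le_one_of_sign hσ, one_mul]
    linarith [norm_exp_two_I_mul_le_one ha hk]
  have h2 := norm_sub_le (denom a α σ k)
    (Complex.I * α * (1 + σ * Complex.exp (2 * Complex.I * a * k)))
  have h3 : denom a α σ k - Complex.I * α * (1 + σ * Complex.exp (2 * Complex.I * a * k)) = 2 * k := by
    rw [denom]; ring
  rw [h3, norm_mul, Complex.norm_two] at h2
  linarith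

theorem hasDerivAt_denom_I_mul (a α σ κ : ℝ) : HasDerivAt (denom a α σ)
    ((2 - 2 * a * α * σ * Real.exp (-(2 * a * κ)) : ℝ) : ℂ) (Complex.I * κ) := by
  have h1 : HasDerivAt (fun k : ℂ => 2 * Complex.I * a * k) (2 * Complex.I * a) (Complex.I * κ) := by
    simpa using (hasDerivAt_id (Complex.I * κ)).const_mul (2 * Complex.I * a)
  have h2 := (((h1.cexp.const_mul (σ : ℂ)).const_add 1).const_mul (Complex.I * α))
  have h3 := ((hasDerivAt_id (Complex.I * κ)).const_mul 2).fun_add h2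
  refine h3.congr_deriv ?_
  have e : 2 * Complex.I * a * (Complex.I * κ) = ((-(2 * a * κ) : ℝ) : ℂ) := by
    push_cast
    linear_combination (2 * a * κ : ℂ) * Complex.I_mul_I
  rw [e, ← Complex.ofReal_exp]
  push_cast
  linear_combination (α * σ * Complex.exp (-(2 * a * κ)) * 2 * a) * Complex.I_mul_I

/-- Division by an entire function with at most one zero, which is simple. -/
theorem exists_mul_eq_sub {T : ℂ → ℂ} (hT : Differentiable ℂ T) {p : ℂ}
    (hz : ∀ k : ℂ, 0 ≤ k.im → T k = 0 → k = p) (hd : T p = 0 → deriv T p ≠ 0) :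
    ∃ Q : ℂ → ℂ, (∀ k : ℂ, 0 ≤ k.im → DifferentiableAt ℂ Q k) ∧
      (∀ k : ℂ, 0 ≤ k.im → Q k * T k = k - p) ∧
      (T p ≠ 0 ∧ Q p = 0 ∨ T p = 0 ∧ Q p = (deriv T p)⁻¹) := by
  by_cases hp : T p = 0
  · have e : ∀ k, (k - p) * dslope T p k = T k := fun k => by
      have := sub_smul_dslope T p k
      rwa [hp, sub_zero, smul_eq_mul] at this
    have hne : ∀ k : ℂ, 0 ≤ k.im → dslope T p k ≠ 0 := fun k hk h => by
      by_cases hkp : k = p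
      · rw [hkp, dslope_same] at h
        exact hd hp h
      · exact hkp (hz k hk (by rw [← e k, h, mul_zero]))
    have hdiff : Differentiable ℂ (dslope T p) := by
      rw [← differentiableOn_univ] at hT ⊢
      exact (Complex.differentiableOn_dslope univ_mem).2 hT
    refine ⟨fun k => (dslope T p k)⁻¹, fun k hk => (hdiff k).inv (hne k hk), fun k hk => ?_,
      Or.inr ⟨hp, by simp⟩⟩
    have := hne k hk
    rw [← e k]; field_simp
  · have hne : ∀ k : ℂ, 0 ≤ k.im → T k ≠ 0 := fun k hk h => hp (hz k hk h ▸ h)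
    refine ⟨fun k => (k - p) / T k, fun k hk => ?_, fun k hk => div_mul_cancel₀ _ (hne k hk),
      Or.inl ⟨hp, by simp⟩⟩
    exact (differentiableAt_id.sub_const p).div (hT k) (hne k hk)

/-- The order of vanishing at the origin in the sector of parity `σ`. -/
def lowWeight (σ : ℝ) (k : ℂ) : ℝ := if σ = 1 then 1 else min 1 ‖k‖

theorem lowWeight_nonneg (σ : ℝ) (k : ℂ) : 0 ≤ lowWeight σ k := by
  unfold lowWeight; split_ifs <;> positivity

theorem lowWeight_le_one (σ : ℝ) (k : ℂ) : lowWeight σ k ≤ 1 := by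
  unfold lowWeight; split_ifs <;> simp

theorem norm_source_le {a σ : ℝ} (ha : 0 < a) (hσ : σ = 1 ∨ σ = -1) {k : ℂ} (hk : 0 ≤ k.im)
    (x : ℝ) : ‖source a σ k x‖ ≤ (2 + 2 * a) * lowWeight σ k := by
  have h2 := norm_source_le_two (a := a) hσ hk x
  rcases hσ with rfl | rfl
  · rw [lowWeight, if_pos rfl]; linarith
  · have h3 := norm_source_neg_one_le ha hk x
    rw [lowWeight, if_neg (by norm_num)]
    rcases le_total 1 ‖k‖ with h | h
    · rw [min_eq_left h]; linarith
    · rw [min_eq_right h]; nlinarith [norm_nonneg k]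

theorem exists_zero_location {a α σ : ℝ} (ha : 0 < a) (hσ : σ = 1 ∨ σ = -1) : ∃ κ : ℝ, 0 < κ ∧
    ∀ k : ℂ, 0 < k.im → denom a α σ k = 0 → k = Complex.I * κ := by
  have key : ∀ k : ℂ, 0 < k.im → denom a α σ k = 0 → k = Complex.I * k.im := fun k hk h => by
    apply Complex.ext <;> simp [re_eq_zero_of_denom_eq_zero ha hσ hk h]
  by_cases h : ∃ k₀ : ℂ, 0 < k₀.im ∧ denom a α σ k₀ = 0
  · obtain ⟨k₀, h0, hD0⟩ := h
    refine ⟨k₀.im, h0, fun k hk hD => ?_⟩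
    have e1 := key k hk hD
    have e0 := key k₀ h0 hD0
    rw [e1] at hD ⊢
    rw [e0] at hD0
    rw [denom_zero_unique ha hσ hk h0 (denom_I_mul_eq_zero_iff.1 hD)
      (denom_I_mul_eq_zero_iff.1 hD0)]
  · push Not at h
    -- Without a zero any positive `κ` will do: the factor `k - iκ` is then a dummy, and `Q`
    -- vanishes at `iκ`.
    exact ⟨1, one_pos, fun k hk hD => absurd hD (h k hk)⟩

/-- The reciprocal of the characteristic function, up to a factor that removes the pole. -/
theorem exists_denom_reciprocal {a α σ : ℝ} (ha : 0 < a) (hα : α ≠ 0) (haα : a * α ≠ -1)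
    (hσ : σ = 1 ∨ σ = -1) : ∃ (κ : ℝ) (Q : ℂ → ℂ) (C : ℝ), 0 < κ ∧ 0 ≤ C ∧
      DifferentiableOn ℂ Q {k | 0 < k.im} ∧
      (∀ k : ℂ, 0 ≤ k.im → k ≠ 0 → Q k * denom a α σ k = k - Complex.I * κ) ∧
      (∀ k : ℂ, 0 ≤ k.im → k ≠ 0 → ‖Q k‖ * lowWeight σ k ≤ C) ∧
      ∃ c : ℝ, 0 ≤ c ∧ -(α * Q (Complex.I * κ)) = 2 * c ∧
        (c ≠ 0 → denom a α σ (Complex.I * κ) = 0) := by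
  obtain ⟨κ, hκ, hz⟩ := exists_zero_location (α := α) ha hσ
  set p : ℂ := Complex.I * κ with hp
  have hpim : p.im = κ := by simp [hp]
  have hp0 : p ≠ 0 := fun h => by rw [h] at hpim; simp at hpim; linarith
  have hDd := hasDerivAt_denom_I_mul a α σ κ
  rw [← hp] at hDd
  have hdpos : denom a α σ p = 0 → 0 < 2 - 2 * a * α * σ * Real.exp (-(2 * a * κ)) := fun h =>
    deriv_denom_pos ha hσ hκ (denom_I_mul_eq_zero_iff.1 h)
  have hne : ∀ k : ℂ, 0 ≤ k.im → (σ = 1 ∨ k ≠ 0) → denom a α σ k = 0 → k = p := by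
    intro k hk hk0 h
    rcases eq_or_lt_of_le hk with h' | h'
    · have e : k = (k.re : ℂ) := Complex.ext rfl (by simp [← h'])
      rw [e] at h hk0
      exact absurd h (denom_ofReal_ne_zero hα hσ (hk0.imp id fun h => by simpa using h))
    · exact hz k h' h
  -- Common to both parities: for large `|k|` the bound `|denom| ≥ |k|` controls `Q`, so only a
  -- bound near the origin and the value at `p` depend on the sector.
  have finish : ∀ Q : ℂ → ℂ, DifferentiableOn ℂ Q {k | 0 < k.im} →
      (∀ k : ℂ, 0 ≤ k.im → k ≠ 0 → Q k * denom a α σ k = k - p) →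
      (∃ B, ∀ k : ℂ, 0 ≤ k.im → k ≠ 0 → ‖k‖ ≤ 2 * |α| + 1 → ‖Q k‖ * lowWeight σ k ≤ B) →
      (Q p = 0 ∨ denom a α σ p = 0 ∧
        Q p = ((2 - 2 * a * α * σ * Real.exp (-(2 * a * κ)) : ℝ) : ℂ)⁻¹) →
      ∃ (κ : ℝ) (Q : ℂ → ℂ) (C : ℝ), 0 < κ ∧ 0 ≤ C ∧
      DifferentiableOn ℂ Q {k | 0 < k.im} ∧
      (∀ k : ℂ, 0 ≤ k.im → k ≠ 0 → Q k * denom a α σ k = k - Complex.I * κ) ∧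
      (∀ k : ℂ, 0 ≤ k.im → k ≠ 0 → ‖Q k‖ * lowWeight σ k ≤ C) ∧
      ∃ c : ℝ, 0 ≤ c ∧ -(α * Q (Complex.I * κ)) = 2 * c ∧
        (c ≠ 0 → denom a α σ (Complex.I * κ) = 0) := by
    rintro Q hQ hQD ⟨B, hB⟩ hQp
    refine ⟨κ, Q, max B (1 + κ), hκ, le_max_of_le_right (by positivity), hQ, hQD, ?_, ?_⟩
    · intro k hk hk0
      rcases le_total ‖k‖ (2 * |α| + 1) with h | h
      · exact (hB k hk hk0 h).trans (le_max_left _ _)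
      · refine le_trans ?_ (le_max_right _ _)
        have h1 := norm_le_norm_denom ha hσ hk (show 2 * |α| ≤ ‖k‖ by linarith)
        have h2 : ‖Q k‖ * ‖denom a α σ k‖ ≤ ‖k‖ + κ := by
          rw [← norm_mul, hQD k hk hk0]
          refine (norm_sub_le _ _).trans ?_
          rw [hp]; simp [abs_of_pos hκ]
        have h3 : 1 ≤ ‖k‖ := by have := abs_nonneg α; linarith
        have h4 : ‖Q k‖ * ‖k‖ ≤ (1 + κ) * ‖k‖ :=
          calc ‖Q k‖ * ‖k‖ ≤ ‖Q k‖ * ‖denom a α σ k‖ := by gcongr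
            _ ≤ ‖k‖ + κ := h2
            _ ≤ (1 + κ) * ‖k‖ := by nlinarith
        have h5 := le_of_mul_le_mul_right h4 (by linarith)
        calc ‖Q k‖ * lowWeight σ k ≤ ‖Q k‖ * 1 := by gcongr; exact lowWeight_le_one σ k
          _ ≤ 1 + κ := by rwa [mul_one]
    · rcases hQp with h | ⟨h0, h⟩
      · exact ⟨0, le_rfl, by rw [← hp, h]; simp, fun h => absurd rfl h⟩
      · have hα0 := neg_of_denom_zero ha hσ hκ (denom_I_mul_eq_zero_iff.1 h0)
        -- At a genuine zero `Q(iκ)` is the reciprocal of the derivative of `denom`, so `2c = -α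
        -- Q(iκ)`; it is positive because `α < 0` and the derivative is positive.
        refine ⟨-α / (2 * (2 - 2 * a * α * σ * Real.exp (-(2 * a * κ)))), ?_, ?_, fun _ => h0⟩
        · have := hdpos h0
          have := neg_pos.2 hα0
          positivity
        · rw [← hp, h]
          have : ((2 - 2 * a * α * σ * Real.exp (-(2 * a * κ)) : ℝ) : ℂ) ≠ 0 := by
            exact_mod_cast (hdpos h0).ne'
          push_cast at this ⊢
          field_simp
  have hcompact : IsCompact (Metric.closedBall (0 : ℂ) (2 * |α| + 1) ∩ {k : ℂ | 0 ≤ k.im}) :=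
    (isCompact_closedBall _ _).inter_right (isClosed_le continuous_const Complex.continuous_im)
  rcases hσ with rfl | rfl
  · obtain ⟨Q, hQ, hQT, hQp⟩ := exists_mul_eq_sub (differentiable_denom a α 1) (p := p)
      (fun k hk h => hne k hk (Or.inl rfl) h) (fun h => by
        rw [hDd.deriv]; exact_mod_cast (hdpos h).ne')
    refine finish Q (fun k hk => (hQ k (le_of_lt hk)).differentiableWithinAt)
      (fun k hk _ => hQT k hk) ?_ ?_
    · obtain ⟨B, hB⟩ := hcompact.exists_bound_of_continuousOn
        (f := Q) (fun k hk => (hQ k hk.2).continuousAt.continuousWithinAt)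
      refine ⟨B, fun k hk _ hkR => ?_⟩
      rw [lowWeight, if_pos rfl, mul_one]
      exact hB k ⟨by simpa using hkR, hk⟩
    · rw [hDd.deriv] at hQp
      exact hQp.imp (fun h => h.2) id
  · have hD0 : denom a α (-1) 0 = 0 := by simp [denom]
    set T := dslope (denom a α (-1)) 0 with hTdef
    have hkT : ∀ k, k * T k = denom a α (-1) k := fun k => by
      have := sub_smul_dslope (denom a α (-1)) 0 k
      rwa [hD0, sub_zero, sub_zero, smul_eq_mul] at this
    have hT : Differentiable ℂ T := by
      have := differentiable_denom a α (-1)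
      rw [← differentiableOn_univ] at this ⊢
      exact (Complex.differentiableOn_dslope univ_mem).2 this
    -- In the odd sector the zero at `k = 0` is divided out first. The quotient has the value `2 +
    -- 2aα` there, and `haα` is exactly its nonvanishing.
    have hT0 : T 0 ≠ 0 := by
      have h := hasDerivAt_denom_I_mul a α (-1) 0
      rw [show Complex.I * ((0 : ℝ) : ℂ) = 0 by simp] at h
      rw [hTdef, dslope_same, h.deriv]
      intro h'
      have : (2 - 2 * a * α * (-1) * Real.exp (-(2 * a * 0)) : ℝ) = 0 := by exact_mod_cast h'
      rw [mul_zero, neg_zero, Real.exp_zero] at this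
      exact haα (by linarith)
    have hderiv : deriv (denom a α (-1)) p = T p + p * deriv T p := by
      have h1 : denom a α (-1) = fun k => k * T k := funext fun k => (hkT k).symm
      have h2 := (hasDerivAt_id p).fun_mul (hT p).hasDerivAt
      rw [h1]
      exact (h2.congr_deriv (by simp)).deriv
    rw [hDd.deriv] at hderiv
    obtain ⟨Q, hQ, hQT, hQp⟩ := exists_mul_eq_sub hT (p := p)
      (fun k hk h => by
        have hk0 : k ≠ 0 := fun h' => hT0 (h' ▸ h)
        exact hne k hk (Or.inr hk0) (by rw [← hkT, h, mul_zero])) (fun h h' => by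
        rw [h, h', mul_zero, add_zero] at hderiv
        exact (hdpos (by rw [← hkT, h, mul_zero])).ne' (by exact_mod_cast hderiv))
    refine finish (fun k => Q k / k) (fun k hk => ?_) (fun k hk hk0 => ?_) ?_ ?_
    · have hk0 : k ≠ 0 := fun h => by rw [h] at hk; simp at hk
      exact ((hQ k (le_of_lt hk)).div differentiableAt_id hk0).differentiableWithinAt
    · rw [← hkT, ← hQT k hk]; field_simp
    · obtain ⟨B, hB⟩ := hcompact.exists_bound_of_continuousOn
        (f := Q) (fun k hk => (hQ k hk.2).continuousAt.continuousWithinAt)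
      refine ⟨B, fun k hk hk0 hkR => ?_⟩
      have hk0' : 0 < ‖k‖ := norm_pos_iff.2 hk0
      rw [lowWeight, if_neg (by norm_num), norm_div]
      calc ‖Q k‖ / ‖k‖ * min 1 ‖k‖ ≤ ‖Q k‖ / ‖k‖ * ‖k‖ := by gcongr; exact min_le_right _ _
        _ = ‖Q k‖ := by field_simp
        _ ≤ B := hB k ⟨by simpa using hkR, hk⟩
    · rcases hQp with h | ⟨h, h'⟩
      · left; rw [h.2, zero_div]
      · right
        refine ⟨by rw [← hkT, h, mul_zero], ?_⟩
        rw [h, zero_add] at hderiv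
        rw [hderiv, h', mul_inv, div_eq_inv_mul]

/-! ### Generalized Fourier transforms -/

theorem continuous_expAbs_left (y : ℝ) : Continuous fun k : ℂ => expAbs k y := by
  unfold expAbs; fun_prop

theorem integrable_expAbs_mul {k : ℂ} (hk : 0 ≤ k.im) {φ : ℝ → ℂ} (hφ : Integrable φ volume)
    (c : ℝ) : Integrable (fun x => expAbs k (x - c) * φ x) volume :=
  hφ.bdd_mul (c := 1) (by have := continuous_expAbs k; fun_prop)
    (Eventually.of_forall fun x => norm_expAbs_le_one hk _)

theorem continuousOn_integral_expAbs {φ : ℝ → ℂ} (hφ : Integrable φ volume) (c : ℝ) :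
    ContinuousOn (fun k : ℂ => ∫ x, expAbs k (x - c) * φ x) {k | 0 ≤ k.im} := by
  refine continuousOn_of_dominated (bound := fun x => ‖φ x‖)
    (fun k hk => (integrable_expAbs_mul hk hφ c).aestronglyMeasurable)
    (fun k hk => Eventually.of_forall fun x => ?_) hφ.norm
    (Eventually.of_forall fun x => ((continuous_expAbs_left _).mul continuous_const).continuousOn)
  rw [norm_mul]
  exact mul_le_of_le_one_left (norm_nonneg _) (norm_expAbs_le_one hk _)

theorem hasDerivAt_expAbs_left (k : ℂ) (y : ℝ) :
    HasDerivAt (fun k : ℂ => expAbs k y) (expAbs k y * (Complex.I * (|y| : ℝ))) k := by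
  unfold expAbs
  have h : HasDerivAt (fun k : ℂ => Complex.I * k * (|y| : ℝ)) (Complex.I * (|y| : ℝ)) k := by
    simpa using ((hasDerivAt_id k).const_mul Complex.I).mul_const ((|y| : ℝ) : ℂ)
  exact h.cexp

theorem differentiableOn_integral_expAbs {φ : ℝ → ℂ} (hφ : Integrable φ volume) (c : ℝ) :
    DifferentiableOn ℂ (fun k : ℂ => ∫ x, expAbs k (x - c) * φ x) {k | 0 < k.im} := by
  intro k₀ hk₀
  have hk₀' : 0 < k₀.im := hk₀
  set δ := k₀.im / 2 with hδ
  have hδ0 : 0 < δ := by positivity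
  have him : ∀ k ∈ Metric.ball k₀ δ, δ ≤ k.im := fun k hk => by
    have h1 := (Complex.abs_im_le_norm (k - k₀)).trans (mem_ball_iff_norm.1 hk).le
    rw [Complex.sub_im] at h1
    linarith [(abs_le.1 h1).1]
  have hm : ∀ k : ℂ, AEStronglyMeasurable (fun x => expAbs k (x - c) * φ x) volume := fun k => by
    have := continuous_expAbs k
    exact (by fun_prop : Continuous fun x => expAbs k (x - c)).aestronglyMeasurable.mul
      hφ.aestronglyMeasurable
  have h := hasDerivAt_integral_of_dominated_loc_of_deriv_le (𝕜 := ℂ) (μ := (volume : Measure ℝ))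
    (F := fun (k : ℂ) x => expAbs k (x - c) * φ x)
    (F' := fun (k : ℂ) x => expAbs k (x - c) * (Complex.I * (|x - c| : ℝ)) * φ x) (x₀ := k₀)
    (bound := fun x => δ⁻¹ * ‖φ x‖) (Metric.ball_mem_nhds k₀ hδ0)
    (Eventually.of_forall hm) (integrable_expAbs_mul hk₀'.le hφ c)
    (by
      have := continuous_expAbs k₀
      exact (by fun_prop : Continuous fun x => expAbs k₀ (x - c) *
        (Complex.I * (|x - c| : ℝ))).aestronglyMeasurable.mul hφ.aestronglyMeasurable)
    (Eventually.of_forall fun x k hk => by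
      rw [norm_mul, norm_mul, norm_expAbs, norm_mul, Complex.norm_I, one_mul, Complex.norm_real,
        Real.norm_eq_abs, abs_abs]
      gcongr
      have h1 : Real.exp (-(k.im * |x - c|)) ≤ Real.exp (-(δ * |x - c|)) :=
        Real.exp_le_exp.2 (neg_le_neg (mul_le_mul_of_nonneg_right (him k hk) (abs_nonneg _)))
      have h2 := Real.add_one_le_exp (δ * |x - c|)
      have h3 : Real.exp (-(δ * |x - c|)) * Real.exp (δ * |x - c|) = 1 := by
        rw [← Real.exp_add, neg_add_cancel, Real.exp_zero]
      have h4 : Real.exp (-(δ * |x - c|)) * (δ * |x - c|) ≤ 1 := by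
        rw [← h3]; gcongr; linarith
      rw [← one_div, le_div_iff₀ hδ0]
      calc Real.exp (-(k.im * |x - c|)) * |x - c| * δ
          ≤ Real.exp (-(δ * |x - c|)) * |x - c| * δ := by gcongr
        _ ≤ 1 := by linarith)
    (hφ.norm.const_mul _)
    (Eventually.of_forall fun x k _ => (hasDerivAt_expAbs_left k (x - c)).mul_const (φ x))
  exact h.2.differentiableAt.differentiableWithinAt

/-- The transform `∫ u_σ(k,x) φ(x) dx`. -/
def sourceInt (a σ : ℝ) (φ : ℝ → ℂ) (k : ℂ) : ℂ := ∫ x, source a σ k x * φ x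

theorem sourceInt_eq (a σ : ℝ) {φ : ℝ → ℂ} (hφ : Integrable φ volume) {k : ℂ} (hk : 0 ≤ k.im) :
    sourceInt a σ φ k
      = (∫ x, expAbs k (x - -a) * φ x) + σ * ∫ x, expAbs k (x - a) * φ x := by
  rw [← integral_const_mul, ← integral_add (integrable_expAbs_mul hk hφ _)
    ((integrable_expAbs_mul hk hφ _).const_mul _), sourceInt]
  congr 1; ext x
  rw [source, sub_neg_eq_add]; ring

theorem integrable_source_mul {a σ : ℝ} (hσ : σ = 1 ∨ σ = -1) {φ : ℝ → ℂ} (hφ : Integrable φ volume)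
    {k : ℂ} (hk : 0 ≤ k.im) : Integrable (fun x => source a σ k x * φ x) volume :=
  hφ.bdd_mul (c := 2) (continuous_source a σ k).aestronglyMeasurable
    (Eventually.of_forall fun x => norm_source_le_two hσ hk x)

theorem continuousOn_sourceInt (a σ : ℝ) {φ : ℝ → ℂ} (hφ : Integrable φ volume) :
    ContinuousOn (sourceInt a σ φ) {k | 0 ≤ k.im} :=
  ((continuousOn_integral_expAbs hφ (-a)).add
    (continuousOn_const.mul (continuousOn_integral_expAbs hφ a))).congr
    fun _ hk => sourceInt_eq a σ hφ hk

theorem continuous_sourceInt_ofReal (a σ : ℝ) {φ : ℝ → ℂ} (hφ : Integrable φ volume) :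
    Continuous fun k : ℝ => sourceInt a σ φ k :=
  (continuousOn_sourceInt a σ hφ).comp_continuous Complex.continuous_ofReal fun k => by simp

theorem differentiableOn_sourceInt (a σ : ℝ) {φ : ℝ → ℂ} (hφ : Integrable φ volume) :
    DifferentiableOn ℂ (sourceInt a σ φ) {k | 0 < k.im} :=
  ((differentiableOn_integral_expAbs hφ (-a)).add
    ((differentiableOn_integral_expAbs hφ a).const_mul (σ : ℂ))).congr
    fun _ hk => sourceInt_eq a σ hφ (le_of_lt hk)

theorem norm_sourceInt_le {a σ : ℝ} (ha : 0 < a) (hσ : σ = 1 ∨ σ = -1) {φ : ℝ → ℂ}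
    (hφ : Integrable φ volume) {k : ℂ} (hk : 0 ≤ k.im) :
    ‖sourceInt a σ φ k‖ ≤ (2 + 2 * a) * (∫ x, ‖φ x‖) * lowWeight σ k := by
  calc ‖sourceInt a σ φ k‖ ≤ ∫ x, (2 + 2 * a) * lowWeight σ k * ‖φ x‖ := by
        refine norm_integral_le_of_norm_le (hφ.norm.const_mul _) (Eventually.of_forall fun x => ?_)
        rw [norm_mul]
        gcongr
        exact norm_source_le ha hσ hk x
    _ = _ := by rw [integral_const_mul]; ring

theorem memLp_sourceInt (a σ : ℝ) {φ : ℝ → ℂ} (hφ : Integrable φ volume) (hφ2 : MemLp φ 2 volume) :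
    MemLp (fun k : ℝ => sourceInt a σ φ k) 2 volume := by
  have e : (fun k : ℝ => sourceInt a σ φ k) = fun k : ℝ =>
      (∫ x, expAbs k (x - -a) * φ x) + σ * ∫ x, expAbs k (x - a) * φ x :=
    funext fun k => sourceInt_eq a σ hφ (by simp)
  rw [e]
  exact (memLp_integral_expAbs hφ hφ2 (-a)).add ((memLp_integral_expAbs hφ hφ2 a).const_mul _)

theorem conj_expAbs_ofReal (k x : ℝ) : (starRingEnd ℂ) (expAbs k x) = expAbs (-(k : ℂ)) x := by
  rw [expAbs, expAbs, ← Complex.exp_conj]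
  congr 1
  simp

theorem conj_source_ofReal (a σ k x : ℝ) :
    (starRingEnd ℂ) (source a σ k x) = source a σ (-(k : ℂ)) x := by
  rw [source, source, map_add, map_mul, conj_expAbs_ofReal, conj_expAbs_ofReal, Complex.conj_ofReal]

theorem conj_sourceInt_ofReal (a σ : ℝ) (φ : ℝ → ℂ) (k : ℝ) :
    (starRingEnd ℂ) (sourceInt a σ φ k)
      = sourceInt a σ (fun x => (starRingEnd ℂ) (φ x)) (-(k : ℂ)) := by
  rw [sourceInt, sourceInt, ← integral_conj]
  congr 1; ext x
  rw [map_mul, conj_source_ofReal]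

theorem conj_denom_ofReal (a α σ k : ℝ) :
    (starRingEnd ℂ) (denom a α σ k) = -denom a α σ (-(k : ℂ)) := by
  rw [denom, denom]
  simp only [map_add, map_mul, map_one, Complex.conj_ofReal, Complex.conj_I, ← Complex.exp_conj,
    Complex.conj_ofNat]
  ring_nf

/-! ### Standing waves and the algebra of the momentum density. -/

/-- The standing wave of parity `σ = ±1`. -/
def wave (σ k x : ℝ) : ℂ :=
  (Complex.exp (Complex.I * k * x) + σ * Complex.exp (-(Complex.I * k * x))) / 2

theorem continuous_wave (σ k : ℝ) : Continuous (wave σ k) := by unfold wave; fun_prop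

theorem norm_exp_I_mul_mul (k x : ℝ) : ‖Complex.exp (Complex.I * k * x)‖ = 1 := by
  rw [show Complex.I * k * x = ((k * x : ℝ) : ℂ) * Complex.I by push_cast; ring,
    Complex.norm_exp_ofReal_mul_I]

theorem norm_wave_le {σ : ℝ} (hσ : σ = 1 ∨ σ = -1) (k x : ℝ) : ‖wave σ k x‖ ≤ 1 := by
  rw [wave, norm_div, Complex.norm_two, div_le_one two_pos]
  refine (norm_add_le _ _).trans ?_
  have := norm_exp_I_mul_mul k (-x)
  rw [norm_mul, norm_le_one_of_sign hσ, norm_exp_I_mul_mul,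
    show -(Complex.I * k * x) = Complex.I * k * (-x : ℝ) by push_cast; ring, this]
  norm_num

theorem conj_exp_I_mul_mul (k x : ℝ) : (starRingEnd ℂ) (Complex.exp (Complex.I * k * x))
    = Complex.exp (-(Complex.I * k * x)) := by
  rw [← Complex.exp_conj]; congr 1; simp

theorem conj_wave {σ : ℝ} (hσ : σ = 1 ∨ σ = -1) (k x : ℝ) :
    (starRingEnd ℂ) (wave σ k x) = σ * wave σ k x := by
  have h2 : (starRingEnd ℂ) (Complex.exp (-(Complex.I * k * x))) = Complex.exp (Complex.I * k * x) := by
    rw [← conj_exp_I_mul_mul, Complex.conj_conj]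
  rw [wave, map_div₀, map_add, map_mul, conj_exp_I_mul_mul, h2, Complex.conj_ofReal,
    Complex.conj_ofNat]
  linear_combination -(Complex.exp (-(Complex.I * k * x)) / 2) * sign_sq hσ

theorem exp_add_exp_abs (k y : ℝ) : expAbs k y + expAbs (-(k : ℂ)) y
    = Complex.exp (Complex.I * k * y) + Complex.exp (-(Complex.I * k * y)) := by
  rcases le_total 0 y with h | h
  · rw [expAbs_of_pos _ h, expAbs_of_pos _ h]; ring_nf
  · rw [expAbs_of_neg _ h, expAbs_of_neg _ h, add_comm]; ring_nf

/-- `e^{ik|y|} + e^{-ik|y|}` does not see the absolute value, so the sum is smooth and factorizes by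
the addition theorem. With `denom_add_denom_neg` it turns the density of the transform into pure
algebra. -/
theorem source_add_source_neg {σ : ℝ} (hσ : σ = 1 ∨ σ = -1) (a k x : ℝ) :
    source a σ k x + source a σ (-(k : ℂ)) x = 4 * wave σ k a * wave σ k x := by
  have h1 := exp_add_exp_abs k (x + a)
  have h2 := exp_add_exp_abs k (x - a)
  rw [source, source, wave, wave]
  have e1 : Complex.exp (Complex.I * k * (x + a : ℝ))
      = Complex.exp (Complex.I * k * x) * Complex.exp (Complex.I * k * a) := by
    rw [← Complex.exp_add]; congr 1; push_cast; ring
  have e2 : Complex.exp (-(Complex.I * k * (x + a : ℝ)))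
      = Complex.exp (-(Complex.I * k * x)) * Complex.exp (-(Complex.I * k * a)) := by
    rw [← Complex.exp_add]; congr 1; push_cast; ring
  have e3 : Complex.exp (Complex.I * k * (x - a : ℝ))
      = Complex.exp (Complex.I * k * x) * Complex.exp (-(Complex.I * k * a)) := by
    rw [← Complex.exp_add]; congr 1; push_cast; ring
  have e4 : Complex.exp (-(Complex.I * k * (x - a : ℝ)))
      = Complex.exp (-(Complex.I * k * x)) * Complex.exp (Complex.I * k * a) := by
    rw [← Complex.exp_add]; congr 1; push_cast; ring
  rw [e1, e2] at h1
  rw [e3, e4] at h2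
  linear_combination h1 + σ * h2 - Complex.exp (-(Complex.I * k * x)) *
    Complex.exp (-(Complex.I * k * a)) * sign_sq hσ

theorem denom_add_denom_neg {σ : ℝ} (hσ : σ = 1 ∨ σ = -1) (a α k : ℝ) :
    denom a α σ k + denom a α σ (-(k : ℂ)) = 4 * Complex.I * α * σ * wave σ k a ^ 2 := by
  rw [denom, denom, wave]
  have e1 : Complex.exp (2 * Complex.I * a * k) = Complex.exp (Complex.I * k * a) ^ 2 := by
    rw [← Complex.exp_nat_mul]; congr 1; push_cast; ring
  have e2 : Complex.exp (2 * Complex.I * a * (-k)) = Complex.exp (-(Complex.I * k * a)) ^ 2 := by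
    rw [← Complex.exp_nat_mul]; congr 1; push_cast; ring
  have e3 : Complex.exp (Complex.I * k * a) * Complex.exp (-(Complex.I * k * a)) = 1 := by
    rw [← Complex.exp_add, add_neg_cancel, Complex.exp_zero]
  rw [e1, e2]
  rcases hσ with rfl | rfl
  · push_cast; linear_combination (-2 * Complex.I * α) * e3
  · push_cast; linear_combination (-2 * Complex.I * α) * e3

/-- The transform `∫ f_σ(k,x) φ(x) dx`. -/
def waveInt (σ : ℝ) (φ : ℝ → ℂ) (k : ℝ) : ℂ := ∫ x, wave σ k x * φ x

theorem integrable_wave_mul {σ : ℝ} (hσ : σ = 1 ∨ σ = -1) {φ : ℝ → ℂ} (hφ : Integrable φ volume)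
    (k : ℝ) : Integrable (fun x => wave σ k x * φ x) volume :=
  hφ.bdd_mul (c := 1) (continuous_wave σ k).aestronglyMeasurable
    (Eventually.of_forall fun x => norm_wave_le hσ k x)

theorem waveInt_eq (σ : ℝ) {φ : ℝ → ℂ} (hφ : Integrable φ volume) (k : ℝ) :
    waveInt σ φ k = (fourierExp φ k + σ * fourierExp φ (-k)) / 2 := by
  rw [fourierExp, fourierExp, ← integral_const_mul, ← integral_add (integrable_exp_mul hφ k)
    ((integrable_exp_mul hφ (-k)).const_mul _), ← integral_div, waveInt]
  congr 1; ext x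
  rw [wave]; push_cast; ring_nf

theorem continuous_waveInt (σ : ℝ) {φ : ℝ → ℂ} (hφ : Integrable φ volume) :
    Continuous (waveInt σ φ) := by
  have := continuous_fourierExp hφ
  rw [show waveInt σ φ = _ from funext (waveInt_eq σ hφ)]
  fun_prop

theorem memLp_waveInt (σ : ℝ) {φ : ℝ → ℂ} (hφ : Integrable φ volume) (hφ2 : MemLp φ 2 volume) :
    MemLp (waveInt σ φ) 2 volume := by
  have h1 := memLp_fourierExp hφ hφ2
  have h2 := h1.comp_measurePreserving (Measure.measurePreserving_neg volume)
  have e : waveInt σ φ = fun k => (1 / 2 : ℂ) * (fourierExp φ k + σ * (fourierExp φ ∘ Neg.neg) k) := by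
    ext k
    rw [waveInt_eq σ hφ, Function.comp_apply]
    ring
  rw [e]
  exact (h1.add (h2.const_mul _)).const_mul _

theorem integral_norm_sq_waveInt_add {φ : ℝ → ℂ} (hφ : Integrable φ volume)
    (hφ2 : MemLp φ 2 volume) :
    (∫ k, ‖waveInt 1 φ k‖ ^ 2) + ∫ k, ‖waveInt (-1) φ k‖ ^ 2 = 2 * Real.pi * ∫ x, ‖φ x‖ ^ 2 := by
  rw [← integral_add ((memLp_waveInt 1 hφ hφ2).integrable_norm_pow two_ne_zero)
    ((memLp_waveInt (-1) hφ hφ2).integrable_norm_pow two_ne_zero)]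
  have e : ∀ k, ‖waveInt 1 φ k‖ ^ 2 + ‖waveInt (-1) φ k‖ ^ 2
      = (1 / 2) * (‖fourierExp φ k‖ ^ 2 + ‖fourierExp φ (-k)‖ ^ 2) := fun k => by
    rw [waveInt_eq _ hφ, waveInt_eq _ hφ, norm_div, norm_div, Complex.norm_two, div_pow, div_pow]
    have := parallelogram_law_with_norm ℝ (fourierExp φ k) (fourierExp φ (-k))
    push_cast
    rw [one_mul, neg_one_mul, ← sub_eq_add_neg]
    nlinarith
  have h1 := (memLp_fourierExp_and hφ hφ2).1
  have h2 := (memLp_fourierExp_and hφ hφ2).2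
  simp_rw [e]
  rw [integral_const_mul, integral_add h1 h1.comp_neg,
    integral_neg_eq_self (fun k => ‖fourierExp φ k‖ ^ 2), h2]
  ring

/-- The transform against the generalized eigenfunctions of `H_α`. -/
def modeInt (a α σ : ℝ) (φ : ℝ → ℂ) (k : ℝ) : ℂ :=
  waveInt σ φ k - Complex.I * α * σ * wave σ k a * sourceInt a σ φ k / denom a α σ k

/-- The correction to the free transform in the spectral density. -/
def resolventPart (a α σ : ℝ) (χ φ : ℝ → ℂ) (k : ℝ) : ℂ :=
  sourceInt a σ φ k * sourceInt a σ (fun x => (starRingEnd ℂ) (χ x)) k / denom a α σ k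

theorem sourceInt_add_sourceInt_neg {a σ : ℝ} (hσ : σ = 1 ∨ σ = -1) {φ : ℝ → ℂ}
    (hφ : Integrable φ volume) (k : ℝ) :
    sourceInt a σ φ k + sourceInt a σ φ (-(k : ℂ)) = 4 * wave σ k a * waveInt σ φ k := by
  rw [sourceInt, sourceInt, ← integral_add (integrable_source_mul hσ hφ (by simp))
    (integrable_source_mul hσ hφ (by simp)), waveInt, ← integral_const_mul]
  congr 1; ext x
  rw [← add_mul, source_add_source_neg hσ]; ring

theorem conj_waveInt {σ : ℝ} (hσ : σ = 1 ∨ σ = -1) (φ : ℝ → ℂ) (k : ℝ) :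
    (starRingEnd ℂ) (waveInt σ φ k) = σ * waveInt σ (fun x => (starRingEnd ℂ) (φ x)) k := by
  rw [waveInt, waveInt, ← integral_conj, ← integral_const_mul]
  congr 1; ext x
  rw [map_mul, conj_wave hσ]; ring

theorem integrable_conj {φ : ℝ → ℂ} (hφ : Integrable φ volume) :
    Integrable (fun x => (starRingEnd ℂ) (φ x)) volume :=
  (Complex.conjCLE : ℂ →L[ℝ] ℂ).integrable_comp hφ

/-- On the real axis conjugation amounts to `k ↦ -k`, so the product contains `1/(D(k) D(-k))`.
Since `D(k) + D(-k) = 4iασ g²`, with `g` the wave at `a`, this splits into partial fractions, and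
each resulting term involves one side of the real axis only. -/
theorem conj_modeInt_mul_modeInt {a α σ : ℝ} (hα : α ≠ 0) (hσ : σ = 1 ∨ σ = -1) {χ φ : ℝ → ℂ}
    (hχ : Integrable χ volume) (hφ : Integrable φ volume) {k : ℝ} (hk : k ≠ 0) :
    (starRingEnd ℂ) (modeInt a α σ χ k) * modeInt a α σ φ k
      = (starRingEnd ℂ) (waveInt σ χ k) * waveInt σ φ k
        - Complex.I * α / 4 * (resolventPart a α σ χ φ k + resolventPart a α σ χ φ (-k)) := by
  have hχ' := integrable_conj hχ
  have h1 := sourceInt_add_sourceInt_neg (a := a) hσ hφ k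
  have h2 := sourceInt_add_sourceInt_neg (a := a) hσ hχ' k
  have h3 := denom_add_denom_neg hσ a α k
  have n1 : denom a α σ k ≠ 0 := denom_ofReal_ne_zero hα hσ (Or.inr hk)
  have n2 : denom a α σ (-(k : ℂ)) ≠ 0 := by
    have := denom_ofReal_ne_zero (a := a) hα hσ (k := -k) (Or.inr (neg_ne_zero.2 hk))
    rwa [Complex.ofReal_neg] at this
  rw [modeInt, modeInt, resolventPart, resolventPart]
  simp only [map_sub, map_mul, map_div₀, conj_waveInt hσ, conj_wave hσ, conj_sourceInt_ofReal,
    conj_denom_ofReal, Complex.conj_I, Complex.conj_ofReal, Complex.ofReal_neg]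
  generalize sourceInt a σ φ k = u at *
  generalize sourceInt a σ φ (-(k : ℂ)) = v at *
  generalize sourceInt a σ (fun x => (starRingEnd ℂ) (χ x)) k = u' at *
  generalize sourceInt a σ (fun x => (starRingEnd ℂ) (χ x)) (-(k : ℂ)) = v' at *
  generalize waveInt σ φ k = F at *
  generalize waveInt σ (fun x => (starRingEnd ℂ) (χ x)) k = F' at *
  generalize wave σ k a = g at *
  generalize denom a α σ k = D at *
  generalize denom a α σ (-(k : ℂ)) = D' at *
  have ev : v = 4 * g * F - u := by linear_combination h1
  have ev' : u' = 4 * g * F' - v' := by linear_combination h2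
  have eD : D' = 4 * Complex.I * α * σ * g ^ 2 - D := by linear_combination h3
  subst ev ev'
  rcases hσ with rfl | rfl
  · field_simp
    rw [eD]
    push_cast
    ring
  · field_simp
    rw [eD]
    push_cast
    ring

/-! ### The norm identity for the generalized Fourier transform -/

theorem continuous_denom_ofReal (a α σ : ℝ) : Continuous fun k : ℝ => denom a α σ k :=
  (differentiable_denom a α σ).continuous.comp Complex.continuous_ofReal

theorem norm_one_sub_I_mul_sq (ε : ℝ) (z : ℂ) :
    ‖1 - Complex.I * ε * z‖ ^ 2 = (1 + ε * z.im) ^ 2 + (ε * z.re) ^ 2 := by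
  rw [← Complex.normSq_eq_norm_sq, Complex.normSq_apply]
  simp [Complex.mul_re, Complex.mul_im]
  ring

theorem one_le_norm_one_sub_I_mul {ε : ℝ} (hε : 0 < ε) {z : ℂ} (hz : 0 ≤ z.im) :
    1 ≤ ‖1 - Complex.I * ε * z‖ := by
  have h := norm_one_sub_I_mul_sq ε z
  have : 0 ≤ ε * z.im := by positivity
  nlinarith [norm_nonneg (1 - Complex.I * ε * z), sq_nonneg (ε * z.re)]

theorem mul_norm_le_norm_one_sub_I_mul {ε : ℝ} (hε : 0 < ε) {z : ℂ} (hz : 0 ≤ z.im) :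
    ε * ‖z‖ ≤ ‖1 - Complex.I * ε * z‖ := by
  have h := norm_one_sub_I_mul_sq ε z
  have h1 : ‖z‖ ^ 2 = z.re ^ 2 + z.im ^ 2 := by
    rw [← Complex.normSq_eq_norm_sq, Complex.normSq_apply]; ring
  have : 0 ≤ ε * z.im := by positivity
  refine abs_le_of_sq_le_sq' ?_ (norm_nonneg _) |>.2
  rw [h, mul_pow, h1]
  nlinarith

theorem ofReal_sub_I_mul_ne_zero {κ : ℝ} (hκ : 0 < κ) (x : ℝ) : (x : ℂ) - Complex.I * κ ≠ 0 :=
  fun h => by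
    have := congrArg Complex.im h
    simp at this
    linarith

section

variable {a α σ κ C : ℝ} {Q : ℂ → ℂ} {φ χ : ℝ → ℂ}

theorem resolventPart_eq (hκ : 0 < κ)
    (hQD : ∀ k : ℂ, 0 ≤ k.im → k ≠ 0 → Q k * denom a α σ k = k - Complex.I * κ) {k : ℝ}
    (hk : k ≠ 0) : resolventPart a α σ χ φ k = sourceInt a σ φ k *
      sourceInt a σ (fun x => (starRingEnd ℂ) (χ x)) k * Q k / (k - Complex.I * κ) := by
  have h1 := hQD k (by simp) (by exact_mod_cast hk)
  have h2 := ofReal_sub_I_mul_ne_zero hκ k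
  have h3 : denom a α σ k ≠ 0 := fun h => h2 (by rw [← h1, h, mul_zero])
  rw [resolventPart, div_eq_div_iff h3 h2, ← h1]
  ring

theorem exists_norm_sourceInt_mul_le (ha : 0 < a) (hσ : σ = 1 ∨ σ = -1) (hC : 0 ≤ C)
    (hQC : ∀ k : ℂ, 0 ≤ k.im → k ≠ 0 → ‖Q k‖ * lowWeight σ k ≤ C)
    (hφ : Integrable φ volume) (hχ : Integrable χ volume) : ∃ B, 0 ≤ B ∧ ∀ k : ℂ, 0 ≤ k.im → k ≠ 0 →
      ‖sourceInt a σ φ k * sourceInt a σ χ k * Q k‖ ≤ B := by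
  set I₁ := (2 + 2 * a) * ∫ x, ‖φ x‖ with hI₁
  set I₂ := (2 + 2 * a) * ∫ x, ‖χ x‖ with hI₂
  have h1 : 0 ≤ I₁ := mul_nonneg (by positivity) (integral_nonneg fun x => norm_nonneg _)
  have h2 : 0 ≤ I₂ := mul_nonneg (by positivity) (integral_nonneg fun x => norm_nonneg _)
  refine ⟨I₁ * I₂ * C, by positivity, fun k hk hk0 => ?_⟩
  have h3 := norm_sourceInt_le ha hσ hφ hk
  have h4 := norm_sourceInt_le ha hσ hχ hk
  have h5 := lowWeight_nonneg σ k
  have h6 := lowWeight_le_one σ k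
  rw [norm_mul, norm_mul]
  calc ‖sourceInt a σ φ k‖ * ‖sourceInt a σ χ k‖ * ‖Q k‖
      ≤ (I₁ * 1) * (I₂ * lowWeight σ k) * ‖Q k‖ := by
        gcongr
        exact h3.trans (by gcongr)
    _ = I₁ * I₂ * (‖Q k‖ * lowWeight σ k) := by ring
    _ ≤ _ := by gcongr; exact hQC k hk hk0

/-- At low momentum `lowWeight` from one source factor absorbs the possible pole of `Q` at `0`. At
high momentum `|denom| ≥ 1`, and the numerator is a product of two `L²` functions. -/
theorem integrable_resolventPart (ha : 0 < a) (hσ : σ = 1 ∨ σ = -1) (hκ : 0 < κ) (hC : 0 ≤ C)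
    (hQD : ∀ k : ℂ, 0 ≤ k.im → k ≠ 0 → Q k * denom a α σ k = k - Complex.I * κ)
    (hQC : ∀ k : ℂ, 0 ≤ k.im → k ≠ 0 → ‖Q k‖ * lowWeight σ k ≤ C)
    (hφ : Integrable φ volume) (hφ2 : MemLp φ 2 volume) (hχ : Integrable χ volume)
    (hχ2 : MemLp χ 2 volume) : Integrable (resolventPart a α σ χ φ) volume := by
  have hχ' := integrable_conj hχ
  have hχ2' : MemLp (fun x => (starRingEnd ℂ) (χ x)) 2 volume := hχ2.star
  obtain ⟨B, hB0, hB⟩ := exists_norm_sourceInt_mul_le ha hσ hC hQC hφ hχ'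
  have hAB : Integrable (fun k : ℝ => ‖sourceInt a σ φ k‖ *
      ‖sourceInt a σ (fun x => (starRingEnd ℂ) (χ x)) k‖) volume :=
    (memLp_sourceInt a σ hφ hφ2).norm.integrable_mul (memLp_sourceInt a σ hχ' hχ2').norm
  set R := 2 * |α| + 1 with hR
  have hR1 : 1 ≤ R := by have := abs_nonneg α; linarith
  refine ((integrable_const_div_one_add_sq (B / κ * (1 + R ^ 2))).add hAB).mono' ?_ ?_
  · exact (((continuous_sourceInt_ofReal a σ hφ).mul
      (continuous_sourceInt_ofReal a σ hχ')).measurable.div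
      (continuous_denom_ofReal a α σ).measurable).aestronglyMeasurable
  · have h0 : ∀ᵐ k : ℝ, k ≠ 0 := by simp [ae_iff]
    filter_upwards [h0] with k hk
    rw [Pi.add_apply]
    have hkC : (k : ℂ) ≠ 0 := by exact_mod_cast hk
    rcases le_total ‖(k : ℂ)‖ R with h | h
    · rw [resolventPart_eq hκ hQD hk, norm_div]
      have h1 : κ ≤ ‖(k : ℂ) - Complex.I * κ‖ := by
        have := Complex.abs_im_le_norm ((k : ℂ) - Complex.I * κ)
        simpa [abs_of_pos hκ] using this
      have h2 := hB k (by simp) hkC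
      have h3 : (1 : ℝ) + k ^ 2 ≤ 1 + R ^ 2 := by
        rw [Complex.norm_real, Real.norm_eq_abs] at h
        have := sq_le_sq' (by linarith [neg_abs_le k]) ((le_abs_self k).trans h)
        linarith
      have h4 : B / κ ≤ B / κ * (1 + R ^ 2) / (1 + k ^ 2) := by
        rw [le_div_iff₀ (by positivity)]
        gcongr
      refine le_add_of_le_of_nonneg (le_trans ?_ h4) (by positivity)
      gcongr
    · have h1 := norm_le_norm_denom (α := α) ha hσ (k := k) (by simp) (by linarith)
      rw [resolventPart, norm_div, norm_mul]
      refine le_add_of_nonneg_of_le (by positivity) ?_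
      refine div_le_self (by positivity) (by linarith)

/-- The only pole in the upper half-plane is at `iκ`. The decay that the residue theorem requires is
supplied by the factor `1/(1 - iεk)`, which is at most one in modulus there, and `ε → 0` is taken by
dominated convergence. -/
theorem integral_resolventPart (ha : 0 < a) (hσ : σ = 1 ∨ σ = -1) (hκ : 0 < κ) (hC : 0 ≤ C)
    (hQ : DifferentiableOn ℂ Q {k | 0 < k.im})
    (hQD : ∀ k : ℂ, 0 ≤ k.im → k ≠ 0 → Q k * denom a α σ k = k - Complex.I * κ)
    (hQC : ∀ k : ℂ, 0 ≤ k.im → k ≠ 0 → ‖Q k‖ * lowWeight σ k ≤ C)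
    (hφ : Integrable φ volume) (hφ2 : MemLp φ 2 volume) (hχ : Integrable χ volume)
    (hχ2 : MemLp χ 2 volume) : ∫ k, resolventPart a α σ χ φ k
      = 2 * Real.pi * Complex.I * (sourceInt a σ φ (Complex.I * κ) *
        sourceInt a σ (fun x => (starRingEnd ℂ) (χ x)) (Complex.I * κ) * Q (Complex.I * κ)) := by
  have hint := integrable_resolventPart ha hσ hκ hC hQD hQC hφ hφ2 hχ hχ2
  have hχ' := integrable_conj hχ
  obtain ⟨B, hB0, hB⟩ := exists_norm_sourceInt_mul_le ha hσ hC hQC hφ hχ'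
  set χ' : ℝ → ℂ := fun x => (starRingEnd ℂ) (χ x) with hχ'def
  have h0 : ∀ᵐ k : ℝ, k ≠ 0 := by simp [ae_iff]
  have hne0 : ∀ {k : ℂ}, 0 < k.im → k ≠ 0 := fun hk h => by rw [h] at hk; simp at hk
  have hreg : ∀ {ε : ℝ}, 0 < ε → ∀ k : ℂ, 0 ≤ k.im → 1 - Complex.I * ε * k ≠ 0 := fun hε k hk h => by
    have := one_le_norm_one_sub_I_mul hε hk
    rw [h, norm_zero] at this
    linarith
  have hcont : ∀ᵐ x : ℝ, Tendsto (fun δ : ℝ => sourceInt a σ φ (x + δ * Complex.I) *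
      sourceInt a σ χ' (x + δ * Complex.I) * Q (x + δ * Complex.I)) (𝓝[>] 0)
      (𝓝 (sourceInt a σ φ x * sourceInt a σ χ' x * Q x)) := by
    filter_upwards [h0] with x hx
    have hxC : (x : ℂ) ≠ 0 := by exact_mod_cast hx
    have hline : Tendsto (fun δ : ℝ => ((x : ℂ) + δ * Complex.I)) (𝓝[>] 0)
        (𝓝[{k : ℂ | 0 ≤ k.im}] (x : ℂ)) := by
      refine tendsto_nhdsWithin_iff.2 ⟨?_, ?_⟩
      · have : Continuous fun δ : ℝ => ((x : ℂ) + δ * Complex.I) := by fun_prop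
        simpa using (this.tendsto 0).mono_left nhdsWithin_le_nhds
      · filter_upwards [self_mem_nhdsWithin] with δ hδ
        simpa using (mem_Ioi.1 hδ).le
    have hmem : (x : ℂ) ∈ {k : ℂ | 0 ≤ k.im} := by simp
    have t1 := ((continuousOn_sourceInt a σ hφ) x hmem).tendsto.comp hline
    have t2 := ((continuousOn_sourceInt a σ hχ') x hmem).tendsto.comp hline
    have hD0 : denom a α σ x ≠ 0 := fun h => by
      have := hQD x (by simp) hxC
      rw [h, mul_zero] at this
      exact ofReal_sub_I_mul_ne_zero hκ x this.symm
    have hline' := hline.mono_right nhdsWithin_le_nhds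
    have tD : Tendsto (fun δ : ℝ => denom a α σ (x + δ * Complex.I)) (𝓝[>] 0)
        (𝓝 (denom a α σ x)) :=
      ((differentiable_denom a α σ).continuous.tendsto _).comp hline'
    have t3 : Tendsto (fun δ : ℝ => Q (x + δ * Complex.I)) (𝓝[>] 0) (𝓝 (Q x)) := by
      have e : Q x = (x - Complex.I * κ) / denom a α σ x := by
        rw [eq_div_iff hD0, hQD x (by simp) hxC]
      rw [e]
      refine ((hline'.sub_const _).div tD hD0).congr' ?_
      filter_upwards [tD.eventually_ne hD0, hline'.eventually_ne hxC, self_mem_nhdsWithin]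
        with δ h1 h2 h3
      change _ / denom a α σ (x + δ * Complex.I) = _
      rw [eq_comm, eq_div_iff h1, hQD _ (by simpa using (mem_Ioi.1 h3).le) h2]
    exact (t1.mul t2).mul t3
  have key : ∀ ε : ℝ, 0 < ε → ε ≤ 1 →
      ∫ k : ℝ, resolventPart a α σ χ φ k / (1 - Complex.I * ε * k)
        = 2 * Real.pi * Complex.I * (sourceInt a σ φ (Complex.I * κ) *
        sourceInt a σ χ' (Complex.I * κ) * Q (Complex.I * κ)
          / (1 - Complex.I * ε * (Complex.I * κ))) := by
    intro ε hε hε1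
    have heq : (fun k : ℝ => resolventPart a α σ χ φ k / (1 - Complex.I * ε * k)) =ᵐ[volume]
        fun k : ℝ => (sourceInt a σ φ k * sourceInt a σ χ' k * Q k / (1 - Complex.I * ε * k)) /
          (k - Complex.I * κ) := by
      filter_upwards [h0] with k hk
      rw [resolventPart_eq hκ hQD hk, div_right_comm]
    rw [integral_congr_ae heq]
    refine integral_div_sub_eq (C := 2 * B / ε) hκ
      (M := fun k => sourceInt a σ φ k * sourceInt a σ χ' k * Q k / (1 - Complex.I * ε * k)) ?_ ?_
      ?_ ?_
    · refine (((differentiableOn_sourceInt a σ hφ).mul (differentiableOn_sourceInt a σ hχ')).mul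
        hQ).div (by fun_prop) fun k hk => hreg hε k (le_of_lt hk)
    · intro z hz
      have h1 := one_le_norm_one_sub_I_mul hε hz.le
      have h2 := mul_norm_le_norm_one_sub_I_mul hε hz.le
      rw [norm_div, div_div, div_le_div_iff₀ (by linarith) (by positivity)]
      have h3 := hB z hz.le (hne0 hz)
      calc ‖sourceInt a σ φ z * sourceInt a σ χ' z * Q z‖ * (ε * (1 + ‖z‖))
          ≤ B * (2 * ‖1 - Complex.I * ε * z‖) :=
            mul_le_mul h3 (by nlinarith) (by positivity) hB0
        _ = _ := by ring
    · filter_upwards [hcont] with x hx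
      have hline : Tendsto (fun δ : ℝ => 1 - Complex.I * ε * ((x : ℂ) + δ * Complex.I)) (𝓝[>] 0)
          (𝓝 (1 - Complex.I * ε * x)) := by
        have : Continuous fun δ : ℝ => 1 - Complex.I * ε * ((x : ℂ) + δ * Complex.I) := by fun_prop
        simpa using (this.tendsto 0).mono_left nhdsWithin_le_nhds
      exact hx.div hline (hreg hε x (by simp))
    · refine Integrable.congr ?_ heq
      refine hint.mono (hint.aestronglyMeasurable.aemeasurable.div
        (by fun_prop : Continuous fun k : ℝ =>
          1 - Complex.I * ε * k).measurable.aemeasurable).aestronglyMeasurable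
        (Eventually.of_forall fun k => ?_)
      rw [norm_div]
      exact div_le_self (norm_nonneg _) (one_le_norm_one_sub_I_mul hε (by simp))
  have lim1 : Tendsto (fun ε : ℝ => ∫ k : ℝ, resolventPart a α σ χ φ k / (1 - Complex.I * ε * k))
      (𝓝[>] 0) (𝓝 (∫ k, resolventPart a α σ χ φ k)) := by
    refine tendsto_integral_filter_of_dominated_convergence
      (fun k => ‖resolventPart a α σ χ φ k‖) ?_ ?_ hint.norm ?_
    · exact Eventually.of_forall fun ε => (hint.aestronglyMeasurable.aemeasurable.div
        (by fun_prop : Continuous fun k : ℝ =>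
          1 - Complex.I * ε * k).measurable.aemeasurable).aestronglyMeasurable
    · filter_upwards [self_mem_nhdsWithin] with ε hε
      refine Eventually.of_forall fun k => ?_
      rw [norm_div]
      exact div_le_self (norm_nonneg _) (one_le_norm_one_sub_I_mul hε (by simp))
    · refine Eventually.of_forall fun k => ?_
      have : Tendsto (fun ε : ℝ => 1 - Complex.I * ε * k) (𝓝[>] 0) (𝓝 1) := by
        have : Continuous fun ε : ℝ => 1 - Complex.I * ε * k := by fun_prop
        simpa using (this.tendsto 0).mono_left nhdsWithin_le_nhds
      have t := (tendsto_const_nhds (x := resolventPart a α σ χ φ k)).div this one_ne_zero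
      rw [div_one] at t
      exact t
  have lim2 : Tendsto (fun ε : ℝ => 2 * Real.pi * Complex.I * (sourceInt a σ φ (Complex.I * κ) *
        sourceInt a σ χ' (Complex.I * κ) * Q (Complex.I * κ)
          / (1 - Complex.I * ε * (Complex.I * κ)))) (𝓝[>] 0)
      (𝓝 (2 * Real.pi * Complex.I * (sourceInt a σ φ (Complex.I * κ) *
        sourceInt a σ χ' (Complex.I * κ) * Q (Complex.I * κ)))) := by
    have : Tendsto (fun ε : ℝ => 1 - Complex.I * ε * (Complex.I * κ)) (𝓝[>] 0) (𝓝 1) := by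
      have : Continuous fun ε : ℝ => 1 - Complex.I * ε * (Complex.I * κ) := by fun_prop
      simpa using (this.tendsto 0).mono_left nhdsWithin_le_nhds
    have t := ((tendsto_const_nhds (x := sourceInt a σ φ (Complex.I * κ) *
        sourceInt a σ χ' (Complex.I * κ) * Q (Complex.I * κ))).div this one_ne_zero).const_mul
          (2 * Real.pi * Complex.I)
    rw [div_one] at t
    exact t
  refine tendsto_nhds_unique lim1 (lim2.congr' ?_)
  have : Ioc (0 : ℝ) 1 ∈ 𝓝[>] (0 : ℝ) := Ioc_mem_nhdsGT one_pos
  filter_upwards [this] with ε hε using (key ε hε.1 hε.2).symm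

end

theorem conj_source_I_mul (a σ κ x : ℝ) :
    (starRingEnd ℂ) (source a σ (Complex.I * κ) x) = source a σ (Complex.I * κ) x := by
  have h : ∀ y : ℝ, (starRingEnd ℂ) (expAbs (Complex.I * κ) y) = expAbs (Complex.I * κ) y := by
    intro y
    rw [expAbs, ← Complex.exp_conj]
    congr 1
    simp
  rw [source, map_add, map_mul, h, h, Complex.conj_ofReal]

theorem conj_sourceInt_I_mul (a σ κ : ℝ) (φ : ℝ → ℂ) :
    (starRingEnd ℂ) (sourceInt a σ φ (Complex.I * κ))
      = sourceInt a σ (fun x => (starRingEnd ℂ) (φ x)) (Complex.I * κ) := by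
  rw [sourceInt, sourceInt, ← integral_conj]
  congr 1; ext x
  rw [map_mul, conj_source_I_mul]

theorem measurable_modeInt (a α σ : ℝ) {φ : ℝ → ℂ} (hφ : Integrable φ volume) :
    Measurable (modeInt a α σ φ) := by
  have h1 := (continuous_waveInt σ hφ).measurable
  have h2 := (continuous_sourceInt_ofReal a σ hφ).measurable
  have h3 := (continuous_denom_ofReal a α σ).measurable
  have h4 : Measurable fun k : ℝ => wave σ k a := by
    unfold wave
    exact (by fun_prop : Continuous _).measurable
  unfold modeInt
  exact h1.sub (((measurable_const.mul h4).mul h2).div h3)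

/-- The transform against generalized eigenfunctions loses exactly the bound state. -/
theorem exists_integral_norm_sq_modeInt {a α σ : ℝ} (ha : 0 < a) (haα : a * α ≠ -1)
    (hσ : σ = 1 ∨ σ = -1) : ∃ κ c : ℝ, 0 < κ ∧ 0 ≤ c ∧
      (c ≠ 0 → denom a α σ (Complex.I * κ) = 0) ∧
      ∀ φ : ℝ → ℂ, Integrable φ volume → MemLp φ 2 volume → MemLp (modeInt a α σ φ) 2 volume ∧
        ∫ k, ‖modeInt a α σ φ k‖ ^ 2 = (∫ k, ‖waveInt σ φ k‖ ^ 2)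
          - 2 * Real.pi * (c * ‖sourceInt a σ φ (Complex.I * κ)‖ ^ 2) := by
  by_cases hα : α = 0
  · refine ⟨1, 0, one_pos, le_rfl, fun h => absurd rfl h, fun φ hφ hφ2 => ?_⟩
    have e : modeInt a α σ φ = waveInt σ φ := by
      ext k; simp [modeInt, hα]
    rw [e]
    exact ⟨memLp_waveInt σ hφ hφ2, by simp⟩
  · obtain ⟨κ, Q, C, hκ, hC, hQ, hQD, hQC, c, hc, hcQ, hc0⟩ := exists_denom_reciprocal ha hα haα hσ
    refine ⟨κ, c, hκ, hc, hc0, fun φ hφ hφ2 => ?_⟩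
    have hG := integrable_resolventPart ha hσ hκ hC hQD hQC hφ hφ2 hφ hφ2
    have hGv := integral_resolventPart ha hσ hκ hC hQ hQD hQC hφ hφ2 hφ hφ2
    have hW := (memLp_waveInt σ hφ hφ2).integrable_norm_pow two_ne_zero
    have h0 : ∀ᵐ k : ℝ, k ≠ 0 := by simp [ae_iff]
    have heq : (fun k : ℝ => ((‖modeInt a α σ φ k‖ ^ 2 : ℝ) : ℂ)) =ᵐ[volume] fun k : ℝ =>
        ((‖waveInt σ φ k‖ ^ 2 : ℝ) : ℂ) - Complex.I * α / 4 *
          (resolventPart a α σ φ φ k + resolventPart a α σ φ φ (-k)) := by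
      filter_upwards [h0] with k hk
      have h := conj_modeInt_mul_modeInt (a := a) hα hσ hφ hφ hk
      rw [← Complex.normSq_eq_norm_sq, ← Complex.normSq_eq_norm_sq, Complex.normSq_eq_conj_mul_self,
        Complex.normSq_eq_conj_mul_self, h]
    have hWc : Integrable (fun k => ((‖waveInt σ φ k‖ ^ 2 : ℝ) : ℂ)) volume := hW.ofReal
    have hGG : Integrable (fun k => resolventPart a α σ φ φ k + resolventPart a α σ φ φ (-k))
        volume := hG.add hG.comp_neg
    have hint : Integrable (fun k : ℝ => ((‖modeInt a α σ φ k‖ ^ 2 : ℝ) : ℂ)) volume :=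
      (hWc.sub (hGG.const_mul _)).congr heq.symm
    have hint' : Integrable (fun k : ℝ => ‖modeInt a α σ φ k‖ ^ 2) volume := by
      exact hint.re.congr (Eventually.of_forall fun k => Complex.ofReal_re _)
    refine ⟨(memLp_two_iff_integrable_sq_norm
      (measurable_modeInt a α σ hφ).aestronglyMeasurable).2 hint', ?_⟩
    have hv := integral_congr_ae heq
    rw [integral_sub hWc (hGG.const_mul _), integral_const_mul,
      integral_add hG hG.comp_neg, integral_neg_eq_self (resolventPart a α σ φ φ), hGv,
      integral_complex_ofReal, integral_complex_ofReal, ← conj_sourceInt_I_mul] at hv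
    have hA := Complex.normSq_eq_conj_mul_self (z := sourceInt a σ φ (Complex.I * κ))
    rw [Complex.normSq_eq_norm_sq] at hA
    apply Complex.ofReal_injective
    rw [hv]
    push_cast at hA ⊢
    rw [hA]
    generalize sourceInt a σ φ (Complex.I * κ) = A
    -- The terms at `k` and `-k` contribute equally: `-(iα/4)·2·2πi |A|² Q(iκ) = πα |A|² Q(iκ) =
    -- -2πc |A|²`.
    linear_combination (-Real.pi * A * (starRingEnd ℂ) A) * hcQ +
      (-Real.pi * A * (starRingEnd ℂ) A * α * Q (Complex.I * κ)) * Complex.I_mul_I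

/-! ### Generalized eigenfunctions -/

theorem denom_ofReal_ne_zero' {a α σ : ℝ} (hσ : σ = 1 ∨ σ = -1) {k : ℝ} (hk : k ≠ 0) :
    denom a α σ k ≠ 0 := by
  by_cases hα : α = 0
  · simp [denom, hα, hk]
  · exact denom_ofReal_ne_zero hα hσ (Or.inr hk)

/-- The amplitude of the outgoing part of a generalized eigenfunction. -/
def amplitude (a α σ k : ℝ) : ℂ := -(Complex.I * α * σ * wave σ k a / denom a α σ k)

/-- The generalized eigenfunction of `H_α` of parity `σ` and energy `k²`. -/
def mode (a α σ k x : ℝ) : ℂ := wave σ k x + amplitude a α σ k * source a σ k x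

/-- The derivative of the generalized eigenfunction. -/
def modeDeriv (a α σ k x : ℝ) : ℂ :=
  Complex.I * k * ((Complex.exp (Complex.I * k * x) - σ * Complex.exp (-(Complex.I * k * x))) / 2)
    + σ * amplitude a α σ k * expAbsDeriv k (x - a) + amplitude a α σ k * expAbsDeriv k (x + a)

theorem continuous_mode (a α σ k : ℝ) : Continuous (mode a α σ k) := by
  have h1 := continuous_wave σ k
  have h2 := continuous_source a σ k
  unfold mode; fun_prop

theorem measurable_modeDeriv (a α σ k : ℝ) : Measurable (modeDeriv a α σ k) := by
  have h1 := measurable_expAbsDeriv k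
  unfold modeDeriv
  fun_prop

theorem norm_mode_le {a α σ : ℝ} (hσ : σ = 1 ∨ σ = -1) (k x : ℝ) :
    ‖mode a α σ k x‖ ≤ 1 + 2 * ‖amplitude a α σ k‖ := by
  refine (norm_add_le _ _).trans (add_le_add (norm_wave_le hσ k x) ?_)
  rw [norm_mul, mul_comm]
  gcongr
  exact norm_source_le_two hσ (by simp) x

theorem norm_modeDeriv_le {a α σ : ℝ} (hσ : σ = 1 ∨ σ = -1) (k x : ℝ) :
    ‖modeDeriv a α σ k x‖ ≤ |k| + 2 * ‖amplitude a α σ k‖ * |k| := by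
  have h1 : ∀ y, ‖expAbsDeriv k y‖ ≤ |k| := fun y => by
    have h := norm_expAbsDeriv_le k y
    have h' := norm_expAbs_le_one (k := k) (by simp) y
    rw [Complex.norm_real, Real.norm_eq_abs] at h
    exact h.trans (mul_le_of_le_one_right (abs_nonneg k) h')
  have h2 : ‖(Complex.exp (Complex.I * k * x) - σ * Complex.exp (-(Complex.I * k * x))) / 2‖ ≤ 1 := by
    rw [norm_div, Complex.norm_two, div_le_one two_pos]
    refine (norm_sub_le _ _).trans ?_
    have := norm_exp_I_mul_mul k (-x)
    rw [norm_mul, norm_le_one_of_sign hσ, norm_exp_I_mul_mul,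
      show -(Complex.I * k * x) = Complex.I * k * (-x : ℝ) by push_cast; ring, this]
    norm_num
  have h3 : ‖Complex.I * k * ((Complex.exp (Complex.I * k * x)
      - σ * Complex.exp (-(Complex.I * k * x))) / 2)‖ ≤ |k| := by
    rw [norm_mul, norm_mul, Complex.norm_I, one_mul, Complex.norm_real, Real.norm_eq_abs]
    exact mul_le_of_le_one_right (abs_nonneg k) h2
  refine (norm_add₃_le).trans ?_
  rw [norm_mul (σ * amplitude a α σ k), norm_mul (σ : ℂ), norm_le_one_of_sign hσ, one_mul,
    norm_mul (amplitude a α σ k)]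
  have e1 := mul_le_mul_of_nonneg_left (h1 (x - a)) (norm_nonneg (amplitude a α σ k))
  have e2 := mul_le_mul_of_nonneg_left (h1 (x + a)) (norm_nonneg (amplitude a α σ k))
  linarith

/-- `amplitude` solves the interface equation at `a` for the given incoming wave; by parity, `wave σ
k (-a) = σ wave σ k a`, the equation at `-a` is the same one. -/
theorem isSol_mode {a α σ : ℝ} (ha : 0 < a) (hσ : σ = 1 ∨ σ = -1) {k : ℝ} (hk : k ≠ 0) :
    IsSol a α (mode a α σ k) (modeDeriv a α σ k) (fun x => (k : ℂ) ^ 2 * mode a α σ k x) := by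
  have hD := denom_ofReal_ne_zero' (a := a) (α := α) hσ hk
  have d1 : ∀ x : ℝ, HasDerivAt (fun x : ℝ => Complex.exp (Complex.I * k * x))
      (Complex.I * k * Complex.exp (Complex.I * k * x)) x := fun x => hasDerivAt_cexp_mul _ x
  have d2 : ∀ x : ℝ, HasDerivAt (fun x : ℝ => Complex.exp (-(Complex.I * k * x)))
      (-(Complex.I * k) * Complex.exp (-(Complex.I * k * x))) x := fun x => by
    have := hasDerivAt_cexp_mul (-(Complex.I * k)) x
    simpa only [neg_mul] using this
  have hf : ∀ x : ℝ, HasDerivAt (wave σ k) (Complex.I * k *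
      ((Complex.exp (Complex.I * k * x) - σ * Complex.exp (-(Complex.I * k * x))) / 2)) x := fun x =>
    (((d1 x).fun_add ((d2 x).const_mul (σ : ℂ))).div_const 2).congr_deriv (by ring)
  have hg : ∀ x : ℝ, HasDerivAt (fun x : ℝ => Complex.I * k *
      ((Complex.exp (Complex.I * k * x) - σ * Complex.exp (-(Complex.I * k * x))) / 2))
      (-((k : ℂ) ^ 2 * wave σ k x)) x := fun x => by
    refine ((((d1 x).fun_sub ((d2 x).const_mul (σ : ℂ))).div_const 2).const_mul
      (Complex.I * k)).congr_deriv ?_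
    rw [wave]
    linear_combination (k ^ 2 * (Complex.exp (Complex.I * k * x)
      + σ * Complex.exp (-(Complex.I * k * x))) / 2) * Complex.I_mul_I
  have hwc := continuous_wave σ k
  have hs := sign_sq hσ
  have hA : amplitude a α σ k * denom a α σ k = -(Complex.I * α * σ * wave σ k a) := by
    rw [amplitude]; field_simp
  have hA' := hA
  rw [denom] at hA'
  have hneg : wave σ k (-a) = σ * wave σ k a := by
    have h1 : Complex.I * k * ((-a : ℝ) : ℂ) = -(Complex.I * k * a) := by push_cast; ring
    rw [wave, wave, h1, neg_neg]
    linear_combination -(Complex.exp (-(Complex.I * k * a)) / 2) * hs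
  have h := IsSol.of_sources (α := α) ha (f₀ := wave σ k) (φ₀ := fun x => (k : ℂ) ^ 2 * wave σ k x) k
    (σ * amplitude a α σ k) (amplitude a α σ k)
    (Continuous.locallyIntegrable (by fun_prop)) hf
    (fun x y hxy => (intervalIntegral.integral_eq_sub_of_hasDerivAt (fun z _ => hg z)
      (Continuous.intervalIntegrable (by fun_prop) _ _)).symm)
    (by
      rw [expAbs_two_mul ha]
      generalize amplitude a α σ k = A at *
      generalize Complex.exp (2 * Complex.I * a * k) = w at *
      generalize wave σ k a = g at *
      linear_combination (-Complex.I * σ) * hA' + (α * σ * (A * (1 + σ * w)) + α * g * σ * σ) *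
        Complex.I_mul_I - (α * A * w + α * g) * hs)
    (by
      rw [expAbs_two_mul ha, hneg]
      generalize amplitude a α σ k = A at *
      generalize Complex.exp (2 * Complex.I * a * k) = w at *
      generalize wave σ k a = g at *
      linear_combination (-Complex.I) * hA' + (α * A * (1 + σ * w) + α * σ * g) * Complex.I_mul_I)
  have e1 : mode a α σ k = fun x => wave σ k x + σ * amplitude a α σ k * expAbs k (x - a)
      + amplitude a α σ k * expAbs k (x + a) := by
    ext x; simp only [mode, source]; ring
  have e2 : (fun x => (k : ℂ) ^ 2 * mode a α σ k x) = fun x => (k : ℂ) ^ 2 * wave σ k x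
      + (k : ℂ) ^ 2 * (σ * amplitude a α σ k * expAbs k (x - a)
      + amplitude a α σ k * expAbs k (x + a)) := by
    ext x; simp only [mode, source]; ring
  rw [e2, e1]
  exact h

theorem modeInt_eq_integral {a α σ : ℝ} (hσ : σ = 1 ∨ σ = -1) {φ : ℝ → ℂ}
    (hφ : Integrable φ volume) (k : ℝ) : modeInt a α σ φ k = ∫ x, mode a α σ k x * φ x := by
  have h1 := integrable_wave_mul hσ hφ k
  have h2 := integrable_source_mul (a := a) hσ hφ (k := k) (by simp)
  have e : (fun x => mode a α σ k x * φ x)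
      = fun x => wave σ k x * φ x + amplitude a α σ k * (source a σ k x * φ x) := by
    ext x; rw [mode]; ring
  rw [e, integral_add h1 (h2.const_mul _), integral_const_mul, modeInt, waveInt, sourceInt,
    amplitude]
  ring

theorem integrable_mode_mul {a α σ : ℝ} (hσ : σ = 1 ∨ σ = -1) {φ : ℝ → ℂ}
    (hφ : Integrable φ volume) (k : ℝ) : Integrable (fun x => mode a α σ k x * φ x) volume :=
  hφ.bdd_mul (continuous_mode a α σ k).aestronglyMeasurable
    (Eventually.of_forall fun x => norm_mode_le hσ k x)

/-- Green's identity between the eigenfunction and `ψ`. The eigenfunction is bounded but not in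
`L²`, so the Wronskian is only known to be in `L²`. -/
theorem modeInt_of_hasAction {a α σ : ℝ} (ha : 0 < a) (hσ : σ = 1 ∨ σ = -1) {ψ φ : L2}
    (h : HasAction a α ψ φ) (hψ : Integrable ψ volume) (hφ : Integrable φ volume) {k : ℝ}
    (hk : k ≠ 0) : modeInt a α σ φ k = ((k ^ 2 : ℝ) : ℂ) * modeInt a α σ ψ k := by
  obtain ⟨f, g, hf, hg, hs⟩ := hasAction_iff.1 h
  have hf1 : Integrable f volume := hψ.congr hf
  have hf2 : MemLp f 2 volume := (memLp_congr_ae hf).1 (Lp.memLp ψ)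
  have i1 := integrable_mode_mul (a := a) (α := α) hσ hf1 k
  have hW1 : MemLp (fun x => mode a α σ k x * g x) 2 volume :=
    hg.of_le_mul ((continuous_mode a α σ k).aestronglyMeasurable.mul hg.aestronglyMeasurable)
      (Eventually.of_forall fun x => by
        rw [norm_mul]
        exact mul_le_mul_of_nonneg_right (norm_mode_le hσ k x) (norm_nonneg _))
  have hW2 : MemLp (fun x => modeDeriv a α σ k x * f x) 2 volume :=
    hf2.of_le_mul ((measurable_modeDeriv a α σ k).aestronglyMeasurable.mul hf2.aestronglyMeasurable)
      (Eventually.of_forall fun x => by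
        rw [norm_mul]
        exact mul_le_mul_of_nonneg_right (norm_modeDeriv_le hσ k x) (norm_nonneg _))
  have key := IsSol.integral_eq ha (isSol_mode ha hσ hk) hs
    (by simpa only [mul_assoc] using i1.const_mul ((k : ℂ) ^ 2))
    (integrable_mode_mul hσ hφ k) (Or.inr ((hW1.sub hW2).integrable_norm_pow two_ne_zero))
  rw [modeInt_eq_integral hσ hφ, modeInt_eq_integral hσ hψ, ← key, ← integral_const_mul]
  refine integral_congr_ae ?_
  filter_upwards [hf] with x hx
  rw [hx]; push_cast; ring

/-! ### The spectral representation of the Hamiltonian -/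

/-- The integrable functions in `L²`. -/
def integrableL2 : Submodule ℂ L2 where
  carrier := {ψ | Integrable ψ volume}
  zero_mem' := (integrable_zero ℝ ℂ volume).congr (Lp.coeFn_zero ℂ 2 volume).symm
  add_mem' := fun {ψ φ} hψ hφ => (Integrable.add hψ hφ).congr (Lp.coeFn_add ψ φ).symm
  smul_mem' := fun c {ψ} hψ => (Integrable.smul c hψ).congr (Lp.coeFn_smul c ψ).symm

theorem denseRange_integrableL2 : DenseRange (integrableL2.subtype) := by
  refine (SchwartzMap.denseRange_toLpCLM (E := ℝ) (F := ℂ) (p := 2) (μ := volume)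
    ENNReal.ofNat_ne_top).mono ?_
  rintro _ ⟨f, rfl⟩
  refine ⟨⟨f.toLp 2 volume, ?_⟩, rfl⟩
  exact (f.integrable (μ := volume)).congr (f.coeFn_toLp 2 volume).symm

theorem modeInt_congr {a α σ : ℝ} {φ χ : ℝ → ℂ} (h : φ =ᵐ[volume] χ) :
    modeInt a α σ φ = modeInt a α σ χ := by
  have h1 : ∀ u : ℝ → ℂ, ∫ x, u x * φ x = ∫ x, u x * χ x := fun u =>
    integral_congr_ae (by filter_upwards [h] with x hx; rw [hx])
  ext k
  simp only [modeInt, waveInt, sourceInt, h1]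

theorem modeInt_add {a α σ : ℝ} (hσ : σ = 1 ∨ σ = -1) {φ χ : ℝ → ℂ} (hφ : Integrable φ volume)
    (hχ : Integrable χ volume) (k : ℝ) : modeInt a α σ (fun x => φ x + χ x) k
      = modeInt a α σ φ k + modeInt a α σ χ k := by
  have h : Integrable (fun x => φ x + χ x) volume := hφ.add hχ
  rw [modeInt_eq_integral hσ hφ, modeInt_eq_integral hσ hχ, modeInt_eq_integral hσ h,
    ← integral_add (integrable_mode_mul hσ hφ k) (integrable_mode_mul hσ hχ k)]
  congr 1; ext x; ring

theorem modeInt_smul {a α σ : ℝ} (hσ : σ = 1 ∨ σ = -1) {φ : ℝ → ℂ} (hφ : Integrable φ volume)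
    (c : ℂ) (k : ℝ) : modeInt a α σ (fun x => c * φ x) k = c * modeInt a α σ φ k := by
  rw [modeInt_eq_integral hσ hφ, modeInt_eq_integral hσ (hφ.const_mul c), ← integral_const_mul]
  congr 1; ext x; ring

/-- The unitarily normalized transform as a bounded operator, and the bound state that it
misses. -/
theorem exists_modeOp {a α σ : ℝ} (ha : 0 < a) (haα : a * α ≠ -1) (hσ : σ = 1 ∨ σ = -1) :
    ∃ (κ c : ℝ) (F : L2 →L[ℂ] L2), 0 < κ ∧ 0 ≤ c ∧ (c ≠ 0 → denom a α σ (Complex.I * κ) = 0) ∧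
      ∀ ψ : L2, Integrable ψ volume →
        (F ψ =ᵐ[volume] fun k => ((√(2 * Real.pi))⁻¹ : ℝ) * modeInt a α σ ψ k) ∧
        ‖F ψ‖ ^ 2 + c * ‖sourceInt a σ ψ (Complex.I * κ)‖ ^ 2
          = (2 * Real.pi)⁻¹ * ∫ k, ‖waveInt σ ψ k‖ ^ 2 := by
  obtain ⟨κ, c, hκ, hc, hc0, hmode⟩ := exists_integral_norm_sq_modeInt ha haα hσ
  set n : ℂ := (((√(2 * Real.pi))⁻¹ : ℝ) : ℂ) with hn
  have hπ := Real.pi_pos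
  have hn2 : ‖n‖ ^ 2 = (2 * Real.pi)⁻¹ := by
    rw [hn, Complex.norm_real, norm_inv, Real.norm_eq_abs, abs_of_nonneg (Real.sqrt_nonneg _),
      inv_pow, Real.sq_sqrt (by positivity)]
  have hm : ∀ ψ : integrableL2, MemLp (fun k => n * modeInt a α σ (ψ : L2) k) 2 volume := fun ψ =>
    (hmode (ψ : L2) ψ.2 (Lp.memLp _)).1.const_mul n
  let f : integrableL2 →ₗ[ℂ] L2 :=
    { toFun := fun ψ => (hm ψ).toLp
      map_add' := fun ψ φ => by
        apply Lp.ext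
        filter_upwards [(hm (ψ + φ)).coeFn_toLp, (hm ψ).coeFn_toLp, (hm φ).coeFn_toLp,
          Lp.coeFn_add (hm ψ).toLp (hm φ).toLp] with k h1 h2 h3 h4
        rw [h1, h4, Pi.add_apply, h2, h3, Submodule.coe_add,
          modeInt_congr (Lp.coeFn_add (ψ : L2) (φ : L2)), ← mul_add]
        congr 1
        exact modeInt_add hσ ψ.2 φ.2 k
      map_smul' := fun z ψ => by
        apply Lp.ext
        filter_upwards [(hm (z • ψ)).coeFn_toLp, (hm ψ).coeFn_toLp,
          Lp.coeFn_smul z (hm ψ).toLp] with k h1 h2 h3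
        rw [h1, RingHom.id_apply, h3, Pi.smul_apply, h2, Submodule.coe_smul,
          modeInt_congr (Lp.coeFn_smul z (ψ : L2)), smul_eq_mul, mul_left_comm]
        congr 1
        exact modeInt_smul hσ ψ.2 z k }
  have hf : ∀ ψ, f ψ =ᵐ[volume] fun k => n * modeInt a α σ (ψ : L2) k := fun ψ =>
    (hm ψ).coeFn_toLp
  have hnorm : ∀ ψ : integrableL2,
      ‖f ψ‖ ^ 2 + c * ‖sourceInt a σ (ψ : L2) (Complex.I * κ)‖ ^ 2
        = (2 * Real.pi)⁻¹ * ∫ k, ‖waveInt σ (ψ : L2) k‖ ^ 2 := fun ψ => by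
    have h1 := (hmode (ψ : L2) ψ.2 (Lp.memLp _)).2
    have h2 : ‖f ψ‖ ^ 2 = (2 * Real.pi)⁻¹ * ∫ k, ‖modeInt a α σ (ψ : L2) k‖ ^ 2 := by
      rw [norm_sq_eq_integral, ← integral_const_mul]
      refine integral_congr_ae ?_
      filter_upwards [hf ψ] with k hk
      rw [hk, norm_mul, mul_pow, hn2]
    rw [h2, h1]
    field_simp
    ring
  have hbd : ∀ ψ : integrableL2, ‖f ψ‖ ≤ 1 * ‖integrableL2.subtype ψ‖ := fun ψ => by
    rw [one_mul, Submodule.subtype_apply]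
    refine abs_le_of_sq_le_sq' ?_ (norm_nonneg _) |>.2
    have h1 := hnorm ψ
    have h2 := integral_norm_sq_waveInt_add ψ.2 (Lp.memLp (ψ : L2))
    rw [← norm_sq_eq_integral] at h2
    -- One parity carries at most the total Plancherel mass, so the normalized transform is a
    -- contraction on a dense subspace and extends.
    have h3 : ∫ k, ‖waveInt σ (ψ : L2) k‖ ^ 2 ≤ 2 * Real.pi * ‖(ψ : L2)‖ ^ 2 := by
      rw [← h2]
      have p1 : 0 ≤ ∫ k, ‖waveInt 1 (ψ : L2) k‖ ^ 2 := integral_nonneg fun _ => by positivity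
      have p2 : 0 ≤ ∫ k, ‖waveInt (-1) (ψ : L2) k‖ ^ 2 := integral_nonneg fun _ => by positivity
      rcases hσ with rfl | rfl <;> linarith
    have h4 : 0 ≤ c * ‖sourceInt a σ (ψ : L2) (Complex.I * κ)‖ ^ 2 := by positivity
    calc ‖f ψ‖ ^ 2 ≤ (2 * Real.pi)⁻¹ * ∫ k, ‖waveInt σ (ψ : L2) k‖ ^ 2 := by linarith
      _ ≤ (2 * Real.pi)⁻¹ * (2 * Real.pi * ‖(ψ : L2)‖ ^ 2) := by gcongr
      _ = ‖(ψ : L2)‖ ^ 2 := by field_simp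
  refine ⟨κ, c, f.extendOfNorm integrableL2.subtype, hκ, hc, hc0, fun ψ hψ => ?_⟩
  have e := LinearMap.extendOfNorm_eq denseRange_integrableL2 ⟨1, hbd⟩ (⟨ψ, hψ⟩ : integrableL2)
  rw [Submodule.subtype_apply] at e
  simp only at e
  rw [e]
  exact ⟨hf ⟨ψ, hψ⟩, hnorm ⟨ψ, hψ⟩⟩

theorem hamiltonian_symm {a : ℝ} (α : ℝ) (ha : 0 < a) : ∀ p ∈ (hamiltonian a α).graph,
    ∀ q ∈ (hamiltonian a α).graph, inner ℂ p.2 q.1 = inner ℂ p.1 q.2 := by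
  rintro ⟨ψ, φ⟩ hp ⟨ψ', φ'⟩ hq
  exact HasAction.symm ha ((mem_hamiltonian_graph _ _ _ _).1 hp) ((mem_hamiltonian_graph _ _ _ _).1 hq)

theorem hamiltonian_add_surjective {a : ℝ} (α : ℝ) (ha : 0 < a) (φ : L2) :
    ∃ ψ, (ψ, φ - (((|α| + 1) ^ 2 : ℝ) : ℂ) • ψ) ∈ (hamiltonian a α).graph := by
  obtain ⟨ψ, h, -⟩ := exists_hasAction_resolvent ha (lt_add_one |α|) φ
  exact ⟨ψ, (mem_hamiltonian_graph _ _ _ _).2 h⟩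

/-- The transform diagonalizes the Hamiltonian. -/
theorem modeOp_graph {a α σ : ℝ} (ha : 0 < a) (hσ : σ = 1 ∨ σ = -1) {F : L2 →L[ℂ] L2} {n : ℂ}
    (hF : ∀ ψ : L2, Integrable ψ volume → F ψ =ᵐ[volume] fun k => n * modeInt a α σ ψ k)
    {ψ φ : L2} (h : (ψ, φ) ∈ (hamiltonian a α).graph) :
    F φ =ᵐ[volume] fun k => ((k ^ 2 : ℝ) : ℂ) * F ψ k := by
  have hsymm := hamiltonian_symm α ha
  have hsurj := hamiltonian_add_surjective α ha
  set c : ℝ := (|α| + 1) ^ 2 with hc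
  have hc1 : 1 ≤ c := by have := abs_nonneg α; rw [hc]; nlinarith
  obtain ⟨R, -, -, hR⟩ := exists_resolvent hsymm c hsurj
  have huniq : ∀ ψ χ, (ψ, χ - (c : ℂ) • ψ) ∈ (hamiltonian a α).graph → ψ = R χ := by
    intro ψ χ h
    have hd := Submodule.sub_mem _ h (hR χ)
    rw [Prod.mk_sub_mk, sub_sub_sub_cancel_left, ← neg_sub, ← smul_sub] at hd
    refine sub_eq_zero.1 (ext_inner_right ℂ fun η => ?_)
    have h1 := hsymm _ hd _ (hR η)
    simp only [inner_neg_left, inner_smul_left, inner_sub_right, inner_smul_right,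
      Complex.conj_ofReal] at h1
    rw [inner_zero_left, ← neg_sub, inner_neg_left]
    linear_combination -h1
  have hpos : ∀ k : ℝ, (((k ^ 2 + c : ℝ)) : ℂ) ≠ 0 := fun k => by
    have : 0 < k ^ 2 + c := by positivity
    exact_mod_cast this.ne'
  have hm : Measurable fun k : ℝ => (((k ^ 2 + c : ℝ)) : ℂ)⁻¹ := by fun_prop
  have hb : ∀ k : ℝ, ‖(((k ^ 2 + c : ℝ)) : ℂ)⁻¹‖ ≤ 1 := fun k => by
    rw [norm_inv, Complex.norm_real, Real.norm_eq_abs, abs_of_pos (by positivity)]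
    exact inv_le_one_of_one_le₀ (by nlinarith [sq_nonneg k])
  have h0 : ∀ᵐ k : ℝ, k ≠ 0 := by simp [ae_iff]
  -- Diagonalization is proved for the resolvent, where both sides are bounded and may be compared
  -- on `L¹ ∩ L²`; the unbounded statement follows by inverting `k² + c`.
  have key : F ∘L R = mulOp _ hm hb ∘L F := by
    refine ContinuousLinearMap.coeFn_injective
      (denseRange_integrableL2.equalizer (by fun_prop) (by fun_prop) ?_)
    ext1 ⟨χ, hχ⟩
    simp only [Function.comp_apply, Submodule.subtype_apply, ContinuousLinearMap.comp_apply]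
    obtain ⟨η, hη, hη1⟩ := exists_hasAction_resolvent ha (lt_add_one |α|) χ
    rw [← hc] at hη
    have hη1' := hη1 hχ
    rw [← huniq η χ ((mem_hamiltonian_graph _ _ _ _).2 hη)]
    have hi : Integrable (χ - (c : ℂ) • η : L2) volume :=
      integrableL2.sub_mem (x := χ) hχ (integrableL2.smul_mem (c : ℂ) hη1')
    apply Lp.ext
    filter_upwards [hF η hη1', coeFn_mulOp _ hm hb (F χ), hF χ hχ, h0] with k h1 h2 h3 hk
    rw [h1, h2, h3]
    have h4 := modeInt_of_hasAction ha hσ hη hη1' hi hk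
    have h5 : modeInt a α σ (χ - (c : ℂ) • η : L2) k
        = modeInt a α σ χ k - c * modeInt a α σ η k := by
      have e : ((χ - (c : ℂ) • η : L2) : ℝ → ℂ) =ᵐ[volume] fun x => χ x + (-c : ℂ) * η x := by
        filter_upwards [Lp.coeFn_sub χ ((c : ℂ) • η), Lp.coeFn_smul (c : ℂ) η] with x e1 e2
        rw [e1, Pi.sub_apply, e2, Pi.smul_apply, smul_eq_mul]; ring
      rw [modeInt_congr e, modeInt_add hσ hχ (hη1'.const_mul _), modeInt_smul hσ hη1']
      ring
    rw [h5] at h4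
    have h6 : modeInt a α σ χ k = ((k ^ 2 + c : ℝ) : ℂ) * modeInt a α σ η k := by
      push_cast at h4 ⊢
      linear_combination h4
    rw [h6]
    have := hpos k
    field_simp
  set χ := φ + (c : ℂ) • ψ with hχ
  have hψ : ψ = R χ := huniq ψ χ (by rw [hχ, add_sub_cancel_right]; exact h)
  have hFψ : F ψ = mulOp _ hm hb (F χ) := by
    rw [hψ]; exact congrArg (fun T : L2 →L[ℂ] L2 => T χ) key
  have hFφ : F φ = F χ - (c : ℂ) • F ψ := by
    rw [hχ, map_add, map_smul, add_sub_cancel_right]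
  rw [hFφ]
  filter_upwards [Lp.coeFn_sub (F χ) ((c : ℂ) • F ψ), Lp.coeFn_smul (c : ℂ) (F ψ),
    coeFn_mulOp _ hm hb (F χ)] with k h1 h2 h3
  rw [← hFψ] at h3
  rw [h1, Pi.sub_apply, h2, Pi.smul_apply, smul_eq_mul]
  have h4 : F χ k = ((k ^ 2 + c : ℝ) : ℂ) * F ψ k := by
    rw [h3]
    have := hpos k
    field_simp
  rw [h4]
  push_cast
  ring

theorem modeOp_intertwine {a α σ : ℝ} (ha : 0 < a) (hσ : σ = 1 ∨ σ = -1) {F : L2 →L[ℂ] L2} {n : ℂ}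
    (hF : ∀ ψ : L2, Integrable ψ volume → F ψ =ᵐ[volume] fun k => n * modeInt a α σ ψ k)
    {U : ℝ → L2 →L[ℂ] L2} (hU : IsUnitaryGroupOf (hamiltonian a α) U) (t : ℝ) (ψ : L2) :
    F (U t ψ) = phaseMul t (F ψ) := by
  obtain ⟨R, -, hd, hR⟩ := exists_resolvent (hamiltonian_symm α ha) _
    (hamiltonian_add_surjective α ha)
  have h : ∀ χ, F (U t (R χ)) = phaseMul t (F (R χ)) := fun χ =>
    hU.intertwine norm_phaseMul_le phaseMul_zero phaseMul_add continuous_phaseMul F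
      (fun ψ φ h => hasDerivAt_phaseMul (modeOp_graph ha hσ hF h)) (hR χ) t
  exact congrFun (hd.equalizer (g := fun ψ => F (U t ψ)) (h := fun ψ => phaseMul t (F ψ))
    (by fun_prop) (by fun_prop) (funext h)) ψ

theorem modeOp_eigenvector {a α σ : ℝ} (ha : 0 < a) (hσ : σ = 1 ∨ σ = -1) {F : L2 →L[ℂ] L2} {n : ℂ}
    (hF : ∀ ψ : L2, Integrable ψ volume → F ψ =ᵐ[volume] fun k => n * modeInt a α σ ψ k)
    {v : L2} {κ : ℝ} (hκ : 0 < κ) (hv : (v, ((-κ ^ 2 : ℝ) : ℂ) • v) ∈ (hamiltonian a α).graph) :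
    F v = 0 := by
  rw [Lp.eq_zero_iff_ae_eq_zero]
  filter_upwards [modeOp_graph ha hσ hF hv, Lp.coeFn_smul ((-κ ^ 2 : ℝ) : ℂ) (F v)] with k h1 h2
  rw [map_smul, h2, Pi.smul_apply, smul_eq_mul] at h1
  have h3 : ((k ^ 2 + κ ^ 2 : ℝ) : ℂ) * F v k = 0 := by
    push_cast at h1 ⊢
    linear_combination -h1
  have : 0 < k ^ 2 + κ ^ 2 := by positivity
  exact (mul_eq_zero.1 h3).resolve_left (by exact_mod_cast this.ne')

/-- The parity that belongs to a truth value. -/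
def paritySign (b : Bool) : ℝ := if b then 1 else -1

theorem paritySign_eq (b : Bool) : paritySign b = 1 ∨ paritySign b = -1 := by
  cases b <;> simp [paritySign]

/-- The spectral representation of the absolutely continuous part of `H_α`. -/
theorem exists_spectral_representation {a α : ℝ} (ha : 0 < a) (haα : a * α ≠ -1)
    {U : ℝ → L2 →L[ℂ] L2} (hU : IsUnitaryGroupOf (hamiltonian a α) U) :
    ∃ F : Bool → L2 →L[ℂ] L2, (∀ b t ψ, F b (U t ψ) = phaseMul t (F b ψ)) ∧
      (∀ b, ∀ ψ : L2, Integrable ψ volume → F b ψ =ᵐ[volume] fun k =>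
        ((√(2 * Real.pi))⁻¹ : ℝ) * modeInt a α (paritySign b) ψ k) ∧
      ∀ ψ, acProjection U ψ = ∑ b, (F b).adjoint (F b ψ) := by
  choose κ c F hκ hc hc0 hF using fun b : Bool => exists_modeOp ha haα (paritySign_eq b)
  have hF1 : ∀ b, ∀ ψ : L2, Integrable ψ volume → F b ψ =ᵐ[volume] fun k =>
        ((√(2 * Real.pi))⁻¹ : ℝ) * modeInt a α (paritySign b) ψ k := fun b ψ hψ => (hF b ψ hψ).1
  have hint : ∀ b t ψ, F b (U t ψ) = phaseMul t (F b ψ) := fun b t ψ =>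
    modeOp_intertwine ha (paritySign_eq b) (hF1 b) hU t ψ
  have him : ∀ b, 0 < (Complex.I * κ b).im := fun b => by simpa using hκ b
  -- The scaling by `√c` makes `|⟨v, ψ⟩|²` the term missing in the norm identity. In a sector
  -- without bound state `c = 0` and `v = 0`, which satisfies the eigenvalue equation trivially.
  let v : Bool → L2 := fun b => ((√(c b) : ℝ) : ℂ) • sourceLp a (paritySign b) (him b)
  have hv : ∀ b, (v b, ((-κ b ^ 2 : ℝ) : ℂ) • v b) ∈ (hamiltonian a α).graph := by
    intro b
    by_cases h : c b = 0
    · simp only [v, h, Real.sqrt_zero, Complex.ofReal_zero, zero_smul, smul_zero]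
      exact Submodule.zero_mem _
    · have h1 := (mem_hamiltonian_graph _ _ _ _).2
        (hasAction_sourceLp ha (paritySign_eq b) (him b) (hc0 b h))
      have h2 := Submodule.smul_mem _ ((√(c b) : ℝ) : ℂ) h1
      rw [Prod.smul_mk, smul_comm] at h2
      convert h2 using 3
      rw [mul_pow, Complex.I_sq]; push_cast; ring
  refine ⟨F, hint, hF1, acProjection_eq hU F v (fun b => -κ b ^ 2) hint hv
    (fun i j => modeOp_eigenvector ha (paritySign_eq i) (hF1 i) (hκ j) (hv j)) ?_⟩
  have hinner : ∀ b, ∀ ψ : L2, ‖inner ℂ (v b) ψ‖ ^ 2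
      = c b * ‖sourceInt a (paritySign b) ψ (Complex.I * κ b)‖ ^ 2 := by
    intro b ψ
    have e : inner ℂ (sourceLp a (paritySign b) (him b)) ψ
        = sourceInt a (paritySign b) ψ (Complex.I * κ b) := by
      rw [L2.inner_def, sourceInt]
      refine integral_congr_ae ?_
      filter_upwards [coeFn_sourceLp a (paritySign b) (him b)] with x hx
      rw [RCLike.inner_apply, hx, conj_source_I_mul, mul_comm]
    rw [inner_smul_left, e, norm_mul, mul_pow, RCLike.norm_conj, Complex.norm_real,
      Real.norm_eq_abs, sq_abs, Real.sq_sqrt (hc b)]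
  have hsum : ∀ ψ : L2, ∑ b, ‖F b ψ‖ ^ 2 + ∑ b, ‖inner ℂ (v b) ψ‖ ^ 2 = ‖ψ‖ ^ 2 := by
    refine fun ψ => congrFun (denseRange_integrableL2.equalizer
      (g := fun ψ : L2 => ∑ b, ‖F b ψ‖ ^ 2 + ∑ b, ‖inner ℂ (v b) ψ‖ ^ 2)
      (h := fun ψ : L2 => ‖ψ‖ ^ 2) (by fun_prop) (by fun_prop) ?_) ψ
    ext1 ⟨φ, hφ⟩
    simp only [Function.comp_apply, Submodule.subtype_apply]
    have h1 := integral_norm_sq_waveInt_add hφ (Lp.memLp φ)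
    rw [← norm_sq_eq_integral] at h1
    rw [← Finset.sum_add_distrib]
    simp_rw [hinner, fun b => (hF b φ hφ).2]
    rw [Fintype.sum_bool, ← mul_add]
    simp only [paritySign, if_true, Bool.false_eq_true, if_false]
    rw [h1]
    have := Real.pi_pos
    field_simp
  let T : L2 →L[ℂ] L2 := ∑ b, (F b).adjoint ∘L F b + ∑ b, (innerSL ℂ (v b)).smulRight (v b) - 1
  have hT : ∀ ψ, T ψ = ∑ b, (F b).adjoint (F b ψ) + ∑ b, inner ℂ (v b) ψ • v b - ψ := fun ψ => by
    simp [T]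
  have hself : ∀ x : L2, inner ℂ x x = ((‖x‖ ^ 2 : ℝ) : ℂ) := fun x => by
    rw [inner_self_eq_norm_sq_to_K]; push_cast; rfl
  -- Parseval says that the quadratic form of `T` vanishes; over `ℂ` polarization then gives `T =
  -- 0`, which is completeness.
  have hT0 : T = 0 := by
    have : (T : L2 →ₗ[ℂ] L2) = 0 := by
      rw [← inner_map_self_eq_zero]
      intro ψ
      rw [ContinuousLinearMap.coe_coe, hT, inner_sub_left, inner_add_left, sum_inner, sum_inner,
        sub_eq_zero, hself, ← hsum ψ, Complex.ofReal_add, Complex.ofReal_sum, Complex.ofReal_sum]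
      congr 1
      · exact Finset.sum_congr rfl fun b _ => by
          rw [ContinuousLinearMap.adjoint_inner_left, hself]
      · refine Finset.sum_congr rfl fun b _ => ?_
        rw [inner_smul_left, ← Complex.normSq_eq_conj_mul_self, Complex.normSq_eq_norm_sq]
    ext1 ψ
    exact LinearMap.congr_fun this ψ
  intro ψ
  have := hT ψ
  rw [hT0, zero_apply] at this
  exact (sub_eq_zero.1 this.symm)

/-! ### Parabolic cylinder integrals -/

theorem integrableOn_pow_mul_exp (m : ℕ) {δ : ℝ} (hδ : 0 < δ) (L : ℝ) :
    IntegrableOn (fun s : ℝ => s ^ m * Real.exp (-(δ * s ^ 2) + L * s)) (Ioi 0) volume := by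
  have h := ((integrable_rpow_mul_exp_neg_mul_sq (half_pos hδ) (s := m)
    (by have : (0 : ℝ) ≤ m := by positivity
        linarith)).const_mul (Real.exp (L ^ 2 / (2 * δ)))).integrableOn (s := Ioi 0)
  refine Integrable.mono' h (by fun_prop) ?_
  filter_upwards [ae_restrict_mem measurableSet_Ioi] with s hs
  have hs' : 0 < s := hs
  rw [Real.norm_eq_abs, abs_of_nonneg (by positivity), Real.rpow_natCast, mul_left_comm,
    ← Real.exp_add]
  refine mul_le_mul_of_nonneg_left (Real.exp_le_exp.2 ?_) (by positivity)
  have h2 : 0 ≤ (δ * s - L) ^ 2 / (2 * δ) := by positivity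
  have h3 : (δ * s - L) ^ 2 / (2 * δ) = δ / 2 * s ^ 2 - L * s + L ^ 2 / (2 * δ) := by
    field_simp; ring
  linarith

theorem norm_pow_mul_cexp (m : ℕ) (c β : ℂ) {s : ℝ} (hs : 0 < s) :
    ‖(s : ℂ) ^ m * Complex.exp (-(c * s ^ 2) - β * s)‖
      = s ^ m * Real.exp (-(c.re * s ^ 2) + -β.re * s) := by
  rw [norm_mul, norm_pow, Complex.norm_real, Real.norm_eq_abs, abs_of_pos hs, Complex.norm_exp]
  congr 2
  rw [Complex.sub_re, Complex.neg_re, ← Complex.ofReal_pow, Complex.re_mul_ofReal,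
    Complex.re_mul_ofReal]
  ring

theorem integrableOn_pow_mul_cexp (m : ℕ) {c : ℂ} (hc : 0 < c.re) (β : ℂ) :
    IntegrableOn (fun s : ℝ => (s : ℂ) ^ m * Complex.exp (-(c * s ^ 2) - β * s)) (Ioi 0) volume := by
  refine Integrable.mono' (integrableOn_pow_mul_exp m hc (-β.re)) (by fun_prop) ?_
  filter_upwards [ae_restrict_mem measurableSet_Ioi] with s hs
  exact (norm_pow_mul_cexp m c β hs).le

/-- `∫_0^∞ s^m e^{-s²/2 - ζs} ds`. -/
def parabolicInt (m : ℕ) (ζ : ℂ) : ℂ :=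
  ∫ s in Ioi (0 : ℝ), (s : ℂ) ^ m * Complex.exp (-(s : ℂ) ^ 2 / 2 - ζ * s)

theorem parabolicInt_eq (m : ℕ) (ζ : ℂ) : parabolicInt m ζ
    = ∫ s in Ioi (0 : ℝ), (s : ℂ) ^ m * Complex.exp (-((1 / 2 : ℂ) * s ^ 2) - ζ * s) := by
  rw [parabolicInt]
  congr 1; ext s; congr 3; ring

theorem continuous_parabolicInt (m : ℕ) : Continuous (parabolicInt m) := by
  rw [continuous_iff_continuousAt]
  intro ζ₀
  rw [show parabolicInt m = _ from funext (parabolicInt_eq m)]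
  refine continuousAt_of_dominated
    (bound := fun s : ℝ => s ^ m * Real.exp (-((1 / 2) * s ^ 2) + (‖ζ₀‖ + 1) * s)) ?_ ?_
    (integrableOn_pow_mul_exp m (by norm_num) _) ?_
  · exact Eventually.of_forall fun ζ => by fun_prop
  · filter_upwards [Metric.ball_mem_nhds ζ₀ one_pos] with ζ hζ
    filter_upwards [ae_restrict_mem measurableSet_Ioi] with s hs
    have hs' : 0 < s := hs
    have h1 := mem_ball_iff_norm.1 hζ
    have h2 : -ζ.re ≤ ‖ζ₀‖ + 1 := by
      have h3 := (neg_le_abs ζ.re).trans (Complex.abs_re_le_norm ζ)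
      have h4 := norm_sub_norm_le ζ ζ₀
      linarith
    rw [norm_pow_mul_cexp m _ ζ hs, show ((1 / 2 : ℂ)).re = 1 / 2 by norm_num]
    gcongr
  · exact Eventually.of_forall fun s => by fun_prop

/-- Rotating the ray of integration. -/
theorem parabolicInt_rotate (m : ℕ) (β : ℂ) {u : ℂ} (hu : |u.im| < u.re) :
    u ^ (m + 1) * ∫ s in Ioi (0 : ℝ), (s : ℂ) ^ m * Complex.exp (-(u ^ 2 / 2 * s ^ 2) - β * u * s)
      = parabolicInt m β := by
  let S : Set ℂ := {u | |u.im| < u.re}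
  have hS : IsOpen S := isOpen_lt (by fun_prop) (by fun_prop)
  have hSc : Convex ℝ S := by
    intro x hx y hy p q hp hq hpq
    have hx' : |x.im| < x.re := hx
    have hy' : |y.im| < y.re := hy
    change |(p • x + q • y).im| < (p • x + q • y).re
    simp only [Complex.add_im, Complex.smul_im, Complex.add_re, Complex.smul_re, smul_eq_mul]
    refine (abs_add_le _ _).trans_lt ?_
    rw [abs_mul, abs_mul, abs_of_nonneg hp, abs_of_nonneg hq]
    rcases eq_or_lt_of_le hp with h | h
    · have : q = 1 := by linarith
      rw [← h, this]; linarith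
    · have h1 := mul_lt_mul_of_pos_left hx' h
      have h2 := mul_le_mul_of_nonneg_left hy'.le hq
      linarith
  have hre : ∀ u ∈ S, 0 < (u ^ 2 / 2).re := fun u hu => by
    have hu' : |u.im| < u.re := hu
    have : (u ^ 2 / 2).re = (u.re ^ 2 - u.im ^ 2) / 2 := by
      rw [sq, show u * u / 2 = ((1 / 2 : ℝ) : ℂ) * (u * u) by push_cast; ring,
        Complex.re_ofReal_mul, Complex.mul_re]
      ring
    rw [this]
    have := sq_lt_sq' (by linarith [abs_nonneg u.im]) hu'
    rw [sq_abs] at this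
    linarith
  let h : ℂ → ℝ → ℂ := fun u s =>
    u ^ (m + 1) * ((s : ℂ) ^ m * Complex.exp (-(u ^ 2 / 2 * s ^ 2) - β * u * s))
  let h' : ℂ → ℝ → ℂ := fun u s =>
    ((m + 1 : ℂ) * u ^ m * (s : ℂ) ^ m - β * u ^ (m + 1) * (s : ℂ) ^ (m + 1)
      - u ^ (m + 2) * (s : ℂ) ^ (m + 2)) * Complex.exp (-(u ^ 2 / 2 * s ^ 2) - β * u * s)
  have hexpu : ∀ (u : ℂ) (s : ℝ), HasDerivAt (fun u : ℂ =>
      Complex.exp (-(u ^ 2 / 2 * s ^ 2) - β * u * s))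
      (Complex.exp (-(u ^ 2 / 2 * s ^ 2) - β * u * s) * (-(u * s ^ 2) - β * s)) u := fun u s => by
    have h1 : HasDerivAt (fun u : ℂ => -(u ^ 2 / 2 * (s : ℂ) ^ 2) - β * u * s)
        (-(u * s ^ 2) - β * s) u := by
      have a1 := (((hasDerivAt_pow 2 u).div_const 2).mul_const ((s : ℂ) ^ 2)).fun_neg
      have a2 := ((hasDerivAt_id u).const_mul β).mul_const (s : ℂ)
      refine (a1.fun_sub a2).congr_deriv ?_
      push_cast; ring
    exact h1.cexp
  have hder : ∀ (u : ℂ) (s : ℝ), HasDerivAt (fun u => h u s) (h' u s) u := fun u s => by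
    have a1 := (hasDerivAt_pow (m + 1) u).fun_mul ((hexpu u s).const_mul ((s : ℂ) ^ m))
    refine a1.congr_deriv ?_
    simp only [h', Nat.add_sub_cancel]
    push_cast
    ring
  -- The `u`-derivative of the integrand is a total `s`-derivative, so its integral is a boundary
  -- term and vanishes. The rotated integral is therefore constant on the convex sector and may be
  -- evaluated at `u = 1`.
  have hderS : ∀ (u : ℂ), u ∈ S → ∀ s : ℝ, HasDerivAt
      (fun s : ℝ => u ^ m * ((s : ℂ) ^ (m + 1) * Complex.exp (-(u ^ 2 / 2 * s ^ 2) - β * u * s)))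
      (h' u s) s := fun u _ s => by
    have h1 : HasDerivAt (fun z : ℂ => -(u ^ 2 / 2 * z ^ 2) - β * u * z)
        (-(u ^ 2 * s) - β * u) (s : ℂ) := by
      have a1 := ((hasDerivAt_pow 2 (s : ℂ)).const_mul (u ^ 2 / 2)).fun_neg
      have a2 := (hasDerivAt_id (s : ℂ)).const_mul (β * u)
      refine (a1.fun_sub a2).congr_deriv ?_
      push_cast; ring
    have h2 := ((hasDerivAt_pow (m + 1) (s : ℂ)).fun_mul h1.cexp).const_mul (u ^ m)
    have h3 := h2.comp_ofReal
    refine h3.congr_deriv ?_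
    simp only [h', Nat.add_sub_cancel]
    push_cast
    ring
  have hint' : ∀ u ∈ S, IntegrableOn (h' u) (Ioi 0) volume := fun u hu => by
    have i0 := (integrableOn_pow_mul_cexp m (hre u hu) (β * u)).const_mul ((m + 1 : ℂ) * u ^ m)
    have i1 := (integrableOn_pow_mul_cexp (m + 1) (hre u hu) (β * u)).const_mul (β * u ^ (m + 1))
    have i2 := (integrableOn_pow_mul_cexp (m + 2) (hre u hu) (β * u)).const_mul (u ^ (m + 2))
    refine ((i0.sub i1).sub i2).congr (Eventually.of_forall fun s => ?_)
    simp only [h', Pi.sub_apply]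
    ring
  have hzero : ∀ u ∈ S, ∫ s in Ioi (0 : ℝ), h' u s = 0 := fun u hu => by
    have i1 := (integrableOn_pow_mul_cexp (m + 1) (hre u hu) (β * u)).const_mul (u ^ m)
    have t := tendsto_zero_of_hasDerivAt_of_integrableOn_Ioi (fun s _ => hderS u hu s)
      (hint' u hu) i1
    have := integral_Ioi_of_hasDerivAt_of_tendsto' (fun s _ => hderS u hu s) (hint' u hu) t
    rw [this]
    simp
  have hG : ∀ u ∈ S, HasDerivAt (fun u => ∫ s in Ioi (0 : ℝ), h u s) 0 u := by
    intro u₀ hu₀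
    obtain ⟨r, hr, hball⟩ := Metric.isOpen_iff.1 hS u₀ hu₀
    have hK : IsCompact (Metric.closedBall u₀ (r / 2)) := isCompact_closedBall _ _
    have hKS : Metric.closedBall u₀ (r / 2) ⊆ S :=
      (Metric.closedBall_subset_ball (by linarith)).trans hball
    -- The minimum of `Re(u²/2)` over a compact ball in the sector gives a Gaussian rate uniform in
    -- `u`, as needed to differentiate under the integral.
    obtain ⟨u₁, hu₁, hmin⟩ := hK.exists_isMinOn ⟨u₀, Metric.mem_closedBall_self (by positivity)⟩
      (f := fun u : ℂ => (u ^ 2 / 2).re) (by fun_prop)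
    set δ := (u₁ ^ 2 / 2).re with hδ
    have hδ0 : 0 < δ := hre u₁ (hKS hu₁)
    set M := ‖u₀‖ + r with hM
    have hMle : ∀ u ∈ Metric.closedBall u₀ (r / 2), ‖u‖ ≤ M := fun u hu => by
      have h1 := mem_closedBall_iff_norm.1 hu
      have h2 := norm_sub_norm_le u u₀
      linarith
    have hM0 : 0 ≤ M := by positivity
    have hrew := hasDerivAt_integral_of_dominated_loc_of_deriv_le (𝕜 := ℂ)
      (μ := volume.restrict (Ioi (0 : ℝ))) (F := h) (F' := h') (x₀ := u₀)
      (bound := fun s => (m + 1) * M ^ m * (s ^ m * Real.exp (-(δ * s ^ 2) + ‖β‖ * M * s))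
        + ‖β‖ * M ^ (m + 1) * (s ^ (m + 1) * Real.exp (-(δ * s ^ 2) + ‖β‖ * M * s))
        + M ^ (m + 2) * (s ^ (m + 2) * Real.exp (-(δ * s ^ 2) + ‖β‖ * M * s)))
      (Metric.ball_mem_nhds u₀ (half_pos hr))
      (Eventually.of_forall fun u => by simp only [h]; fun_prop)
      ((integrableOn_pow_mul_cexp m (hre u₀ hu₀) (β * u₀)).const_mul _)
      (by simp only [h']; fun_prop)
      (by
        filter_upwards [ae_restrict_mem measurableSet_Ioi] with s hs u hu
        have hs' : 0 < s := hs
        have huc := Metric.ball_subset_closedBall hu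
        have b1 := hMle u huc
        have b2 : δ ≤ (u ^ 2 / 2).re := hmin huc
        have e : h' u s = (m + 1 : ℂ) * u ^ m *
            ((s : ℂ) ^ m * Complex.exp (-(u ^ 2 / 2 * s ^ 2) - β * u * s))
            - β * u ^ (m + 1) * ((s : ℂ) ^ (m + 1) * Complex.exp (-(u ^ 2 / 2 * s ^ 2) - β * u * s))
            - u ^ (m + 2) * ((s : ℂ) ^ (m + 2) * Complex.exp (-(u ^ 2 / 2 * s ^ 2) - β * u * s)) := by
          simp only [h']; ring
        have b3 : -(β * u).re ≤ ‖β‖ * M := by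
          have h3 := (neg_le_abs (β * u).re).trans (Complex.abs_re_le_norm (β * u))
          rw [norm_mul] at h3
          exact h3.trans (by gcongr)
        have b4 : Real.exp (-((u ^ 2 / 2).re * s ^ 2) + -(β * u).re * s)
            ≤ Real.exp (-(δ * s ^ 2) + ‖β‖ * M * s) := by gcongr
        have b5 : ‖(m + 1 : ℂ)‖ = m + 1 := by
          rw [show (m + 1 : ℂ) = ((m + 1 : ℝ) : ℂ) by push_cast; ring, Complex.norm_real,
            Real.norm_eq_abs, abs_of_nonneg (by positivity)]
        rw [e]
        refine (norm_sub_le _ _).trans (add_le_add ((norm_sub_le _ _).trans (add_le_add ?_ ?_)) ?_)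
        · rw [norm_mul, norm_mul, norm_pow u, norm_pow_mul_cexp _ _ _ hs', b5]
          gcongr
        · rw [norm_mul, norm_mul, norm_pow u, norm_pow_mul_cexp _ _ _ hs']
          gcongr
        · rw [norm_mul, norm_pow u, norm_pow_mul_cexp _ _ _ hs']
          gcongr)
      ((((integrableOn_pow_mul_exp m hδ0 _).const_mul _).add
        ((integrableOn_pow_mul_exp (m + 1) hδ0 _).const_mul _)).add
        ((integrableOn_pow_mul_exp (m + 2) hδ0 _).const_mul _))
      (Eventually.of_forall fun s u _ => hder u s)
    have := hrew.2
    rwa [hzero u₀ hu₀] at this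
  have h1S : (1 : ℂ) ∈ S := by simp [S]
  have hconst := hS.is_const_of_deriv_eq_zero hSc.isPreconnected
    (fun u hu => (hG u hu).differentiableAt.differentiableWithinAt) (fun u hu => (hG u hu).deriv)
    hu h1S
  have e1 : ∫ s in Ioi (0 : ℝ), h u s = u ^ (m + 1) *
      ∫ s in Ioi (0 : ℝ), (s : ℂ) ^ m * Complex.exp (-(u ^ 2 / 2 * s ^ 2) - β * u * s) :=
    integral_const_mul _ _
  rw [← e1, hconst, parabolicInt_eq]
  simp [h]

theorem integrableOn_pow_mul_cexp_neg (m : ℕ) {r : ℂ} (hr : 0 < r.re) :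
    IntegrableOn (fun s : ℝ => (s : ℂ) ^ m * Complex.exp (-(r * s))) (Ioi 0) volume := by
  have h := Real.GammaIntegral_convergent (s := (m : ℝ) + 1) (by positivity)
  have h2 := (integrableOn_Ioi_comp_mul_left_iff (fun x : ℝ => Real.exp (-x) * x ^ ((m : ℝ) + 1 - 1))
    0 hr).2 (by simpa using h)
  refine Integrable.mono' (h2.const_mul ((r.re ^ m)⁻¹)) (by fun_prop) ?_
  filter_upwards [ae_restrict_mem measurableSet_Ioi] with s hs
  have hs' : 0 < s := hs
  rw [norm_mul, norm_pow, Complex.norm_real, Real.norm_eq_abs, abs_of_pos hs', Complex.norm_exp,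
    Complex.neg_re, Complex.re_mul_ofReal, add_sub_cancel_right, Real.rpow_natCast, mul_pow]
  apply le_of_eq
  field_simp

theorem integral_pow_mul_cexp_neg (m : ℕ) {r : ℂ} (hr : 0 < r.re) :
    ∫ s in Ioi (0 : ℝ), (s : ℂ) ^ m * Complex.exp (-(r * s)) = m.factorial / r ^ (m + 1) := by
  have hr0 : r ≠ 0 := fun h => by rw [h] at hr; simp at hr
  have hexp : ∀ z : ℂ, HasDerivAt (fun z : ℂ => Complex.exp (-(r * z)))
      (Complex.exp (-(r * z)) * -r) z := fun z => by
    have h1 : HasDerivAt (fun z : ℂ => -(r * z)) (-r) z := by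
      simpa using ((hasDerivAt_id z).const_mul r).fun_neg
    exact h1.cexp
  induction m with
  | zero =>
    have hd : ∀ s : ℝ, HasDerivAt (fun s : ℝ => Complex.exp (-(r * s)))
        (Complex.exp (-(r * s)) * -r) s := fun s => (hexp s).comp_ofReal
    have i0 := integrableOn_pow_mul_cexp_neg 0 hr
    simp only [pow_zero, one_mul] at i0
    have t := tendsto_zero_of_hasDerivAt_of_integrableOn_Ioi (a := 0) (fun s _ => hd s)
      (i0.mul_const _) i0
    have := integral_Ioi_of_hasDerivAt_of_tendsto' (a := 0) (fun s _ => hd s) (i0.mul_const _) t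
    rw [integral_mul_const] at this
    simp only [Complex.ofReal_zero, mul_zero, neg_zero, Complex.exp_zero, zero_sub] at this
    simp only [pow_zero, one_mul, Nat.factorial_zero, Nat.cast_one, zero_add, pow_one]
    rw [eq_div_iff hr0]
    linear_combination -this
  | succ m ih =>
    have hd : ∀ s : ℝ, HasDerivAt (fun s : ℝ => (s : ℂ) ^ (m + 1) * Complex.exp (-(r * s)))
        ((m + 1 : ℂ) * ((s : ℂ) ^ m * Complex.exp (-(r * s)))
          - r * ((s : ℂ) ^ (m + 1) * Complex.exp (-(r * s)))) s := fun s => by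
      have h3 := ((hasDerivAt_pow (m + 1) (s : ℂ)).fun_mul (hexp s)).comp_ofReal
      refine h3.congr_deriv ?_
      rw [Nat.add_sub_cancel]; push_cast; ring
    have i0 := (integrableOn_pow_mul_cexp_neg m hr).const_mul (m + 1 : ℂ)
    have i1 := (integrableOn_pow_mul_cexp_neg (m + 1) hr)
    have i2 := i1.const_mul r
    have t := tendsto_zero_of_hasDerivAt_of_integrableOn_Ioi (a := 0) (fun s _ => hd s)
      (i0.sub i2) i1
    have := integral_Ioi_of_hasDerivAt_of_tendsto' (a := 0) (fun s _ => hd s) (i0.sub i2) t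
    rw [integral_sub i0 i2, integral_const_mul, integral_const_mul, ih] at this
    simp only [Complex.ofReal_zero, ne_eq, Nat.add_eq_zero_iff, one_ne_zero, and_false,
      not_false_eq_true, zero_pow, zero_mul, sub_zero] at this
    have e := sub_eq_zero.1 this
    rw [Nat.factorial_succ, pow_succ r (m + 1), eq_div_iff (by positivity)]
    push_cast
    rw [mul_comm, mul_assoc, ← e]
    field_simp

/-! ### Gaussian integrals of powers of the reflection coefficient -/

/-- The open sector `|arg ϑ| < π/4`. -/
def sector : Set ℂ := {ϑ | |ϑ.im| < ϑ.re}

theorem re_pos_of_mem_sector {ϑ : ℂ} (h : ϑ ∈ sector) : 0 < ϑ.re := (abs_nonneg _).trans_lt h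

theorem ne_zero_of_mem_sector {ϑ : ℂ} (h : ϑ ∈ sector) : ϑ ≠ 0 := fun h0 => by
  have := re_pos_of_mem_sector h
  rw [h0] at this
  simp at this

theorem re_sq_pos_of_mem_sector {ϑ : ℂ} (h : ϑ ∈ sector) : 0 < (ϑ ^ 2).re := by
  have h' : |ϑ.im| < ϑ.re := h
  rw [sq, Complex.mul_re]
  have := sq_lt_sq' (by linarith [abs_nonneg ϑ.im]) h'
  rw [sq_abs] at this
  linarith

theorem div_mem_sector {ϑ : ℂ} (h : ϑ ∈ sector) {r : ℝ} (hr : 0 < r) : (r : ℂ) / ϑ ∈ sector := by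
  have h' : |ϑ.im| < ϑ.re := h
  have hn : 0 < Complex.normSq ϑ := Complex.normSq_pos.2 (ne_zero_of_mem_sector h)
  change |((r : ℂ) / ϑ).im| < ((r : ℂ) / ϑ).re
  rw [div_eq_mul_inv, Complex.im_ofReal_mul, Complex.re_ofReal_mul, Complex.inv_im, Complex.inv_re,
    abs_mul, abs_div, abs_neg, abs_of_pos hn, abs_of_pos hr]
  gcongr

theorem integral_gaussian_mul_exp {ϑ : ℂ} (h : ϑ ∈ sector) (y : ℝ) :
    ∫ k : ℝ, Complex.exp (-ϑ ^ 2 * k ^ 2) * Complex.exp (Complex.I * y * k)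
      = (√Real.pi : ℝ) / ϑ * Complex.exp (-y ^ 2 / (4 * ϑ ^ 2)) := by
  have e := fourierIntegral_gaussian (re_sq_pos_of_mem_sector h) y
  have e2 : (Real.pi / ϑ ^ 2 : ℂ) ^ (1 / 2 : ℂ) = (√Real.pi : ℝ) / ϑ := by
    have h1 : (Real.pi / ϑ ^ 2 : ℂ) = ((√Real.pi : ℝ) / ϑ : ℂ) ^ 2 := by
      rw [div_pow, ← Complex.ofReal_pow, Real.sq_sqrt Real.pi_pos.le]
    rw [h1, one_div, Complex.sq_cpow_two_inv]
    exact re_pos_of_mem_sector (div_mem_sector h (Real.sqrt_pos.2 Real.pi_pos))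
  rw [← e2, ← e]
  congr 1; ext k; ring

theorem norm_exp_neg_sq_mul (ϑ : ℂ) (k : ℝ) :
    ‖Complex.exp (-ϑ ^ 2 * k ^ 2)‖ = Real.exp (-(ϑ ^ 2).re * k ^ 2) := by
  rw [Complex.norm_exp, ← Complex.ofReal_pow, Complex.re_mul_ofReal, Complex.neg_re]

theorem norm_exp_neg_sq_mul_le_one {ϑ : ℂ} (h : 0 ≤ (ϑ ^ 2).re) (k : ℝ) :
    ‖Complex.exp (-ϑ ^ 2 * k ^ 2)‖ ≤ 1 := by
  rw [norm_exp_neg_sq_mul, Real.exp_le_one_iff]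
  nlinarith [sq_nonneg k, mul_nonneg h (sq_nonneg k)]

/-- The reflection coefficient `iα / (2k + iα)` of a single delta interaction. -/
def reflection (α k : ℝ) : ℂ := Complex.I * α / (2 * k + Complex.I * α)

theorem two_mul_add_I_mul_ne_zero {α : ℝ} (hα : α ≠ 0) (k : ℝ) :
    (2 * k + Complex.I * α : ℂ) ≠ 0 := fun h => hα <| by
  have := congrArg Complex.im h
  simpa using this

theorem reflection_eq {α : ℝ} (hα : α ≠ 0) (k : ℝ) :
    reflection α k = 1 / (1 - Complex.I * (2 / α : ℝ) * k) := by
  have h1 := two_mul_add_I_mul_ne_zero hα k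
  have h2 : (α : ℂ) ≠ 0 := by exact_mod_cast hα
  have h3 : (1 - Complex.I * (2 / α : ℝ) * k : ℂ) = (2 * k + Complex.I * α) / (Complex.I * α) := by
    push_cast
    field_simp
    linear_combination (-2 * (k : ℂ)) * Complex.I_sq
  rw [h3, one_div_div, reflection]

theorem continuous_reflection {α : ℝ} (hα : α ≠ 0) : Continuous (reflection α) := by
  unfold reflection
  exact Continuous.div (by fun_prop) (by fun_prop) (two_mul_add_I_mul_ne_zero hα)

theorem norm_reflection_lt_one (α : ℝ) {k : ℝ} (hk : k ≠ 0) : ‖reflection α k‖ < 1 := by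
  have hk2 : 0 < k ^ 2 := by positivity
  have h1 : ‖(2 * k + Complex.I * α : ℂ)‖ ^ 2 = 4 * k ^ 2 + α ^ 2 := by
    rw [← Complex.normSq_eq_norm_sq, Complex.normSq_apply]
    simp
    ring
  have h2 : ‖(Complex.I * α : ℂ)‖ ^ 2 = α ^ 2 := by simp
  rw [reflection, norm_div]
  have h3 : ‖(Complex.I * α : ℂ)‖ < ‖(2 * k + Complex.I * α : ℂ)‖ :=
    lt_of_pow_lt_pow_left₀ 2 (norm_nonneg _) (by rw [h1, h2]; linarith)
  rw [div_lt_one ((norm_nonneg _).trans_lt h3)]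
  exact h3

theorem norm_reflection_le_one (α k : ℝ) : ‖reflection α k‖ ≤ 1 := by
  rcases eq_or_ne k 0 with rfl | hk
  · rw [reflection, norm_div]
    simp [div_self_le_one]
  · exact (norm_reflection_lt_one α hk).le

/-- As `r = 1/(1 - 2ik/α)` is the reciprocal of a number with real part one, `r^{m+1}` is a Gamma
integral `(1/m!) ∫ s^m e^{-(1 - 2ik/α)s} ds`. After Fubini the `k`-integral is Gaussian with
frequency `z + 2s/α`. -/
theorem integral_gaussian_mul_reflection_pow {α : ℝ} (hα : α ≠ 0) (m : ℕ) (z : ℝ) {ϑ : ℂ}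
    (h : ϑ ∈ sector) :
    ∫ k : ℝ, Complex.exp (-ϑ ^ 2 * k ^ 2) *
        (reflection α k ^ (m + 1) * Complex.exp (Complex.I * z * k))
      = (√Real.pi : ℝ) / ϑ / m.factorial * ∫ s in Ioi (0 : ℝ),
          (s : ℂ) ^ m * Complex.exp (-s) * Complex.exp (-(z + 2 / α * s : ℝ) ^ 2 / (4 * ϑ ^ 2)) := by
  have hm : (m.factorial : ℂ) ≠ 0 := by exact_mod_cast m.factorial_ne_zero
  have hre : ∀ k : ℝ, (1 - Complex.I * (2 / α : ℝ) * k : ℂ).re = 1 := fun k => by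
    rw [mul_assoc, ← Complex.ofReal_mul]; simp
  have e1 : ∀ k : ℝ, Complex.exp (-ϑ ^ 2 * k ^ 2) *
        (reflection α k ^ (m + 1) * Complex.exp (Complex.I * z * k))
      = ∫ s in Ioi (0 : ℝ), Complex.exp (-ϑ ^ 2 * k ^ 2) * ((s : ℂ) ^ m * Complex.exp (-s)) *
        Complex.exp (Complex.I * (z + 2 / α * s : ℝ) * k) / m.factorial := fun k => by
    have e := integral_pow_mul_cexp_neg m (r := 1 - Complex.I * (2 / α : ℝ) * k)
      (by rw [hre]; exact one_pos)
    rw [reflection_eq hα, one_div, inv_pow]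
    have e' : ((1 - Complex.I * (2 / α : ℝ) * k : ℂ) ^ (m + 1))⁻¹ = (∫ s in Ioi (0 : ℝ),
        (s : ℂ) ^ m * Complex.exp (-((1 - Complex.I * (2 / α : ℝ) * k) * s))) / m.factorial := by
      rw [e]; field_simp
    rw [e', ← integral_div, ← integral_mul_const, ← integral_const_mul]
    congr 1; ext s
    rw [show Complex.exp (-((1 - Complex.I * (2 / α : ℝ) * k) * s))
      = Complex.exp (-s) * Complex.exp (Complex.I * (2 / α * s : ℝ) * k) by
        rw [← Complex.exp_add]; congr 1; push_cast; ring,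
      show Complex.exp (Complex.I * (z + 2 / α * s : ℝ) * k)
      = Complex.exp (Complex.I * z * k) * Complex.exp (Complex.I * (2 / α * s : ℝ) * k) by
        rw [← Complex.exp_add]; congr 1; push_cast; ring]
    ring
  simp_rw [e1]
  rw [integral_integral_swap, ← integral_const_mul]
  · congr 1; ext s
    have e2 := integral_gaussian_mul_exp h (z + 2 / α * s)
    rw [integral_div]
    have e3 : ∀ k : ℝ, Complex.exp (-ϑ ^ 2 * k ^ 2) * ((s : ℂ) ^ m * Complex.exp (-s)) *
        Complex.exp (Complex.I * (z + 2 / α * s : ℝ) * k) = ((s : ℂ) ^ m * Complex.exp (-s)) *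
        (Complex.exp (-ϑ ^ 2 * k ^ 2) * Complex.exp (Complex.I * (z + 2 / α * s : ℝ) * k)) :=
      fun k => by ring
    simp_rw [e3]
    rw [integral_const_mul, e2]
    ring
  · have i1 := integrable_cexp_neg_mul_sq (re_sq_pos_of_mem_sector h)
    have i2 : Integrable (fun s : ℝ => (s : ℂ) ^ m * Complex.exp (-s))
        (volume.restrict (Ioi (0 : ℝ))) := by
      have := integrableOn_pow_mul_cexp_neg m (r := 1) (by simp)
      simp only [one_mul] at this
      exact this
    refine Integrable.div_const (Integrable.mono (i1.mul_prod i2) ?_ (Eventually.of_forall ?_)) _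
    · exact Continuous.aestronglyMeasurable (by fun_prop)
    · rintro ⟨k, s⟩
      rw [norm_mul, show Complex.exp (Complex.I * (z + 2 / α * s : ℝ) * k)
        = Complex.exp (((z + 2 / α * s) * k : ℝ) * Complex.I) by congr 1; push_cast; ring,
        Complex.norm_exp_ofReal_mul_I, mul_one]

/-- In the sector the Gaussian in `s` has modulus at most one, so the `s`-integral is at most `m!`.
The bound does not depend on `z` and stays finite as `ϑ` approaches the boundary off `0`. -/
theorem norm_integral_gaussian_mul_reflection_pow_le {α : ℝ} (hα : α ≠ 0) (m : ℕ) (z : ℝ) {ϑ : ℂ}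
    (h : ϑ ∈ sector) :
    ‖∫ k : ℝ, Complex.exp (-ϑ ^ 2 * k ^ 2) *
        (reflection α k ^ (m + 1) * Complex.exp (Complex.I * z * k))‖ ≤ √Real.pi / ‖ϑ‖ := by
  rw [integral_gaussian_mul_reflection_pow hα m z h, norm_mul, norm_div, norm_div,
    Complex.norm_real, Real.norm_eq_abs, abs_of_nonneg (Real.sqrt_nonneg _), Complex.norm_natCast]
  have i2 : Integrable (fun s : ℝ => (s : ℂ) ^ m * Complex.exp (-s))
      (volume.restrict (Ioi (0 : ℝ))) := by
    have := integrableOn_pow_mul_cexp_neg m (r := 1) (by simp)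
    simp only [one_mul] at this
    exact this
  have hn : ∀ s ∈ Ioi (0 : ℝ), ‖(s : ℂ) ^ m * Complex.exp (-s)‖ = s ^ m * Real.exp (-s) :=
    fun s hs => by
      have hs' : 0 < s := hs
      rw [norm_mul, norm_pow, Complex.norm_real, Real.norm_eq_abs, abs_of_pos hs', Complex.norm_exp]
      simp
  have i3 : ∫ s in Ioi (0 : ℝ), ‖(s : ℂ) ^ m * Complex.exp (-s)‖ = m.factorial := by
    rw [setIntegral_congr_fun measurableSet_Ioi hn]
    have e := integral_pow_mul_cexp_neg m (r := 1) (by simp)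
    have e' : ∀ s : ℝ, (s : ℂ) ^ m * Complex.exp (-(1 * s)) = ((s ^ m * Real.exp (-s) : ℝ) : ℂ) :=
      fun s => by push_cast; rw [one_mul]
    simp_rw [e'] at e
    rw [integral_complex_ofReal] at e
    simp only [one_pow, div_one] at e
    exact_mod_cast e
  have hb : ‖∫ s in Ioi (0 : ℝ), (s : ℂ) ^ m * Complex.exp (-s) *
      Complex.exp (-(z + 2 / α * s : ℝ) ^ 2 / (4 * ϑ ^ 2))‖ ≤ m.factorial := by
    rw [← i3]
    refine norm_integral_le_of_norm_le i2.norm (Eventually.of_forall fun s => ?_)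
    rw [norm_mul]
    refine mul_le_of_le_one_right (norm_nonneg _) ?_
    rw [Complex.norm_exp, Real.exp_le_one_iff]
    have h1 : (-((z + 2 / α * s : ℝ) : ℂ) ^ 2 / (4 * ϑ ^ 2))
        = ((-((z + 2 / α * s) ^ 2 / 4) : ℝ) : ℂ) * (ϑ ^ 2)⁻¹ := by
      push_cast; rw [div_mul_eq_div_div]; ring
    rw [h1, Complex.re_ofReal_mul, Complex.inv_re]
    have h2 := re_sq_pos_of_mem_sector h
    have h3 := Complex.normSq_nonneg (ϑ ^ 2)
    exact mul_nonpos_of_nonpos_of_nonneg (by nlinarith [sq_nonneg (z + 2 / α * s)])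
      (div_nonneg h2.le h3)
  have hf : (0 : ℝ) < m.factorial := by exact_mod_cast m.factorial_pos
  calc _ ≤ √Real.pi / ‖ϑ‖ / m.factorial * m.factorial :=
        mul_le_mul_of_nonneg_left hb (by positivity)
    _ = _ := by field_simp

/-- The value of `∫ e^{-ϑ²k²} (iα/(2k+iα))^{m+1} e^{izk} dk` through a parabolic cylinder
integral; this makes sense up to the boundary of the sector. -/
def cylinderTerm (α : ℝ) (m : ℕ) (z : ℝ) (ϑ : ℂ) : ℂ :=
  (√Real.pi : ℝ) / ϑ * Complex.exp (-z ^ 2 / (4 * ϑ ^ 2)) *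
    ((|α| * ϑ / (√2 : ℝ)) ^ (m + 1) / m.factorial *
      parabolicInt m ((1 + z / (α * ϑ ^ 2)) * (|α| * ϑ / (√2 : ℝ))))

/-- The exponent is `-z²/(4ϑ²) - s²/(α²ϑ²) - (1 + z/(αϑ²)) s`. Rescaling by the complex number `v =
|α|ϑ/√2` normalizes the quadratic part to `s²/2`; this is a rotation of the ray, hence
`parabolicInt_rotate` with `u = v⁻¹`. -/
theorem integral_eq_cylinderTerm {α : ℝ} (hα : α ≠ 0) (m : ℕ) (z : ℝ) {ϑ : ℂ}
    (h : ϑ ∈ sector) :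
    ∫ k : ℝ, Complex.exp (-ϑ ^ 2 * k ^ 2) *
        (reflection α k ^ (m + 1) * Complex.exp (Complex.I * z * k)) = cylinderTerm α m z ϑ := by
  have hϑ := ne_zero_of_mem_sector h
  have hα' : 0 < |α| := abs_pos.2 hα
  have hαc : (α : ℂ) ≠ 0 := by exact_mod_cast hα
  have hαa : ((|α| : ℝ) : ℂ) ≠ 0 := by exact_mod_cast hα'.ne'
  have h2 : ((√2 : ℝ) : ℂ) ≠ 0 := by
    exact_mod_cast (Real.sqrt_pos.2 (by norm_num : (0 : ℝ) < 2)).ne'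
  have h22 : ((√2 : ℝ) : ℂ) ^ 2 = 2 := by
    rw [← Complex.ofReal_pow, Real.sq_sqrt (by norm_num)]; norm_num
  have haa : ((|α| : ℝ) : ℂ) ^ 2 = (α : ℂ) ^ 2 := by
    rw [← Complex.ofReal_pow, sq_abs, Complex.ofReal_pow]
  set v : ℂ := |α| * ϑ / (√2 : ℝ) with hv
  have hv0 : v ≠ 0 := by rw [hv]; exact div_ne_zero (mul_ne_zero hαa hϑ) h2
  have hu : v⁻¹ ∈ sector := by
    have := div_mem_sector h (r := √2 / |α|) (by positivity)
    convert this using 1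
    rw [hv]; push_cast; field_simp
  have hr := parabolicInt_rotate m ((1 + z / (α * ϑ ^ 2)) * v) (u := v⁻¹) hu
  rw [integral_gaussian_mul_reflection_pow hα m z h, cylinderTerm, ← hv, ← hr]
  have e : ∀ s : ℝ, (s : ℂ) ^ m * Complex.exp (-s) *
      Complex.exp (-(z + 2 / α * s : ℝ) ^ 2 / (4 * ϑ ^ 2))
      = Complex.exp (-z ^ 2 / (4 * ϑ ^ 2)) * ((s : ℂ) ^ m *
        Complex.exp (-(v⁻¹ ^ 2 / 2 * s ^ 2) - (1 + z / (α * ϑ ^ 2)) * v * v⁻¹ * s)) := fun s => by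
    rw [mul_left_comm, mul_assoc, ← Complex.exp_add, ← Complex.exp_add, mul_assoc _ v, 
      mul_inv_cancel₀ hv0, mul_one, hv, inv_pow, div_pow, mul_pow, haa, h22]
    congr 2
    push_cast
    field_simp
    ring
  simp_rw [e]
  rw [integral_const_mul]
  generalize (∫ s in Ioi (0 : ℝ), (s : ℂ) ^ m *
    Complex.exp (-(v⁻¹ ^ 2 / 2 * s ^ 2) - (1 + z / (α * ϑ ^ 2)) * v * v⁻¹ * s)) = J
  rw [inv_pow]
  field_simp

/-- The closed form is continuous beyond the open sector, in particular at `ϑ² = it`, where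
`e^{-ϑ²k²}` no longer decays. -/
theorem continuousAt_cylinderTerm {α : ℝ} (hα : α ≠ 0) (m : ℕ) (z : ℝ) {ϑ : ℂ} (hϑ : ϑ ≠ 0) :
    ContinuousAt (cylinderTerm α m z) ϑ := by
  have hαc : (α : ℂ) ≠ 0 := by exact_mod_cast hα
  unfold cylinderTerm
  have c1 : ContinuousAt (fun ϑ : ℂ => (1 + z / (α * ϑ ^ 2)) * (|α| * ϑ / (√2 : ℝ))) ϑ := by
    exact ContinuousAt.mul (continuousAt_const.add (continuousAt_const.div (by fun_prop)
      (mul_ne_zero hαc (pow_ne_zero 2 hϑ)))) (by fun_prop)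
  refine ContinuousAt.mul (ContinuousAt.mul (continuousAt_const.div continuousAt_id hϑ)
    (ContinuousAt.cexp (continuousAt_const.div (by fun_prop)
      (mul_ne_zero (by norm_num) (pow_ne_zero 2 hϑ))))) ?_
  exact ContinuousAt.mul (by fun_prop) ((continuous_parabolicInt m).continuousAt.comp c1)

/-! ### The boundary value `ϑ² = it` and the functions `r_n`. -/

/-- `√(t/2) (1 + i)`, the square root of `it`. -/
def rootIt (t : ℝ) : ℂ := (√(t / 2) : ℝ) * (1 + Complex.I)

theorem rootIt_sq {t : ℝ} (ht : 0 < t) : rootIt t ^ 2 = Complex.I * t := by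
  rw [rootIt, mul_pow, ← Complex.ofReal_pow, Real.sq_sqrt (by positivity)]
  push_cast
  linear_combination (t / 2 : ℂ) * Complex.I_sq

theorem rootIt_ne_zero {t : ℝ} (ht : 0 < t) : rootIt t ≠ 0 := fun h => by
  have := rootIt_sq ht
  rw [h] at this
  have h2 : Complex.I * (t : ℂ) ≠ 0 := mul_ne_zero Complex.I_ne_zero (by exact_mod_cast ht.ne')
  exact h2 (by rw [← this]; simp)

theorem rootIt_re (t : ℝ) : (rootIt t).re = √(t / 2) := by
  rw [rootIt, Complex.re_ofReal_mul]; simp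

theorem rootIt_im (t : ℝ) : (rootIt t).im = √(t / 2) := by
  rw [rootIt, Complex.im_ofReal_mul]; simp

theorem rootIt_add_mem_sector (t : ℝ) {ε : ℝ} (hε : 0 < ε) : rootIt t + ε ∈ sector := by
  change |(rootIt t + ε).im| < (rootIt t + ε).re
  rw [Complex.add_im, Complex.add_re, Complex.ofReal_im, Complex.ofReal_re, rootIt_re, rootIt_im,
    add_zero, abs_of_nonneg (Real.sqrt_nonneg _)]
  linarith

theorem norm_rootIt_le_norm_add (t : ℝ) {ε : ℝ} (hε : 0 < ε) : ‖rootIt t‖ ≤ ‖rootIt t + ε‖ := by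
  refine le_of_sq_le_sq ?_ (norm_nonneg _)
  rw [← Complex.normSq_eq_norm_sq, ← Complex.normSq_eq_norm_sq, Complex.normSq_apply,
    Complex.normSq_apply, Complex.add_im, Complex.add_re, Complex.ofReal_im, Complex.ofReal_re,
    rootIt_re, add_zero]
  nlinarith [Real.sqrt_nonneg (t / 2)]

theorem tendsto_rootIt_add (t : ℝ) :
    Tendsto (fun ε : ℝ => rootIt t + ε) (𝓝[>] 0) (𝓝 (rootIt t)) := by
  have : Tendsto (fun ε : ℝ => rootIt t + ε) (𝓝 0) (𝓝 (rootIt t + (0 : ℝ))) :=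
    Continuous.tendsto (by fun_prop) 0
  rw [Complex.ofReal_zero, add_zero] at this
  exact this.mono_left nhdsWithin_le_nhds

/-- The prefactor `e^{(i a_n - b_n)²}` cancels the `e^{-ζ²/4}` inside `D`, and the argument `ζ` of
`D` is the argument of `parabolicInt` at `ϑ² = it`. The order `-m-1` gives the normalization `Γ(m+1)
= m!`. -/
theorem rn_eq_cylinderTerm {a α t : ℝ} (hα : α ≠ 0) (ht : 0 < t) (m : ℕ) (x y : ℝ) :
    rn a α ((m : ℝ) / 2) t x y = cylinderTerm α m (zn a ((m : ℝ) / 2) x y) (rootIt t) := by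
  have hα' : 0 < |α| := abs_pos.2 hα
  have hαc : (α : ℂ) ≠ 0 := by exact_mod_cast hα
  have htc : (t : ℂ) ≠ 0 := by exact_mod_cast ht.ne'
  have hst : 0 < √t := Real.sqrt_pos.2 ht
  have hstc : ((√t : ℝ) : ℂ) ≠ 0 := by exact_mod_cast hst.ne'
  have hst2 : ((√t : ℝ) : ℂ) ^ 2 = t := by
    rw [← Complex.ofReal_pow, Real.sq_sqrt ht.le]
  have h2 : ((√2 : ℝ) : ℂ) ≠ 0 := by
    exact_mod_cast (Real.sqrt_pos.2 (by norm_num : (0 : ℝ) < 2)).ne'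
  have h22 : ((√2 : ℝ) : ℂ) ^ 2 = 2 := by
    rw [← Complex.ofReal_pow, Real.sq_sqrt (by norm_num)]; norm_num
  set z := zn a ((m : ℝ) / 2) x y with hz
  set τ : ℂ := rootIt t / (√2 : ℝ) with hτ
  have hτ' : τ = (√t : ℝ) / 2 * (1 + Complex.I) := by
    rw [hτ, rootIt, Real.sqrt_div ht.le, Complex.ofReal_div]
    field_simp
    rw [h22]
    ring
  have hτ2 : τ ^ 2 = Complex.I * t / 2 := by
    rw [hτ, div_pow, rootIt_sq ht, h22]
  have hτre : 0 < τ.re := by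
    rw [hτ', show ((√t : ℝ) / 2 : ℂ) = ((√t / 2 : ℝ) : ℂ) by push_cast; ring,
      Complex.re_ofReal_mul]
    simp only [Complex.add_re, Complex.one_re, Complex.I_re, add_zero, mul_one]
    positivity
  -- `τ` is the square root of `it/2` with positive real part, that is, the principal one, so the
  -- power `m/2` of `it/2` is `τ^m`.
  have hpow : (Complex.I * t / 2 : ℂ) ^ (((m : ℝ) / 2 : ℝ) : ℂ) = τ ^ m := by
    rw [show (((m : ℝ) / 2 : ℝ) : ℂ) = (2⁻¹ : ℂ) * m by push_cast; ring, Complex.cpow_mul_nat,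
      ← hτ2, Complex.sq_cpow_two_inv hτre]
  have hs : ((Real.sign α : ℝ) : ℂ) * α = (|α| : ℝ) := by
    rcases lt_or_gt_of_ne hα with h | h
    · rw [Real.sign_of_neg h, abs_of_neg h]; push_cast; ring
    · rw [Real.sign_of_pos h, abs_of_pos h]; push_cast; ring
  have hs2 : ((Real.sign α : ℝ) : ℂ) ^ 2 = 1 := by
    rcases lt_or_gt_of_ne hα with h | h
    · rw [Real.sign_of_neg h]; norm_num
    · rw [Real.sign_of_pos h]; norm_num
  set A : ℂ := (an a α ((m : ℝ) / 2) t x y : ℂ) with hA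
  set B : ℂ := (bn a α ((m : ℝ) / 2) t x y : ℂ) with hB
  have hA' : A = z / (4 * (√t : ℝ)) - α * (√t : ℝ) / 4 := by rw [hA, an, ← hz]; push_cast; ring
  have hB' : B = z / (4 * (√t : ℝ)) + α * (√t : ℝ) / 4 := by rw [hB, bn, ← hz]; push_cast; ring
  set ζ : ℂ := -(Real.sign α : ℂ) * (2 * Complex.I) * (A + Complex.I * B) with hζ
  have hζ2 : (Complex.I * A - B) ^ 2 + -ζ ^ 2 / 4 = 0 := by
    have h1 : Complex.I * A - B = Complex.I * (A + Complex.I * B) := by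
      linear_combination (-B) * Complex.I_sq
    rw [hζ, h1]
    linear_combination (-(Complex.I * (A + Complex.I * B)) ^ 2) * hs2
  have hζ' : ζ = (1 + z / (α * rootIt t ^ 2)) * (|α| * rootIt t / (√2 : ℝ)) := by
    rw [mul_div_assoc, ← hτ, rootIt_sq ht, hτ', hζ, hA', hB', ← hs, ← hst2]
    field_simp
    ring_nf
    simp only [Complex.I_sq, show Complex.I ^ 3 = -Complex.I by
      rw [pow_succ, Complex.I_sq]; ring]
    ring
  have hD : parabolicCylinderD (-2 * ((m : ℝ) / 2) - 1) ζ
      = Complex.exp (-ζ ^ 2 / 4) / m.factorial * parabolicInt m ζ := by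
    rw [parabolicCylinderD, parabolicInt]
    have e1 : -(-2 * ((m : ℝ) / 2) - 1) = m + 1 := by ring
    rw [e1, Real.Gamma_nat_eq_factorial]
    push_cast
    congr 2
    ext s
    rw [add_sub_cancel_right, Real.rpow_natCast]
    push_cast
    rfl
  have habs : (|α| ^ (2 * ((m : ℝ) / 2) + 1) : ℝ) = |α| ^ (m + 1) := by
    rw [show 2 * ((m : ℝ) / 2) + 1 = ((m + 1 : ℕ) : ℝ) by push_cast; ring, Real.rpow_natCast]
  have hexp : Complex.exp ((Complex.I * A - B) ^ 2) * Complex.exp (-ζ ^ 2 / 4) = 1 := by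
    rw [← Complex.exp_add, hζ2, Complex.exp_zero]
  have hg : Complex.exp (-z ^ 2 / (4 * rootIt t ^ 2))
      = Complex.exp (Complex.I * (z : ℂ) ^ 2 / (4 * t)) := by
    rw [rootIt_sq ht]
    congr 1
    field_simp
    linear_combination (-(z : ℂ) ^ 2) * Complex.I_sq
  have hpi : ((√(Real.pi / 2) : ℝ) : ℂ) * (√2 : ℝ) = (√Real.pi : ℝ) := by
    rw [← Complex.ofReal_mul, ← Real.sqrt_mul (by positivity), div_mul_cancel₀ _ (by norm_num)]
  have hroot : rootIt t = τ * (√2 : ℝ) := by rw [hτ, div_mul_cancel₀ _ h2]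
  have hτ0 : τ ≠ 0 := fun h => by rw [h] at hτre; simp at hτre
  unfold rn
  rw [← hz, ← hA, ← hB, ← hζ, hD, hpow, habs, cylinderTerm, ← hζ', hg, mul_div_assoc _ (rootIt t), ← hτ,
    hroot, ← hpi]
  rw [Complex.ofReal_pow, mul_pow ((|α| : ℝ) : ℂ) τ, pow_succ τ]
  generalize Complex.exp (Complex.I * (z : ℂ) ^ 2 / (4 * t)) = E
  generalize hE₁ : Complex.exp ((Complex.I * A - B) ^ 2) = E₁ at hexp ⊢
  generalize hE₂ : Complex.exp (-ζ ^ 2 / 4) = E₂ at hexp ⊢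
  have e : ((√(Real.pi / 2) : ℝ) * (√2 : ℝ) / (τ * (√2 : ℝ)) : ℂ) = (√(Real.pi / 2) : ℝ) / τ := by
    field_simp
  have e' : ((√(Real.pi / 2) : ℝ) / τ * (τ ^ m * τ) : ℂ) = (√(Real.pi / 2) : ℝ) * τ ^ m := by
    field_simp
  rw [e]
  linear_combination ((√(Real.pi / 2) : ℝ) * (|α| : ℝ) ^ (m + 1) * τ ^ m * E * parabolicInt m ζ
    / m.factorial : ℂ) * hexp - ((|α| : ℝ) ^ (m + 1) * E * parabolicInt m ζ / m.factorial : ℂ) * e'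

/-! ### Expansion of the scattered part of the kernel -/

/-- The contribution of parity `σ` to the scattered part of the kernel at momentum `k`. -/
def scatteringPart (a α σ k : ℝ) (p : ℝ × ℝ) : ℂ :=
  Complex.I * α / denom a α σ k * (source a σ k p.1 * source a σ k p.2 / 2)

/-- The ratio of the geometric series for `scatteringPart`. -/
def scatteringRatio (a α σ k : ℝ) : ℂ :=
  -(σ * reflection α k * Complex.exp (2 * Complex.I * a * k))

/-- The scattered part of the kernel at momentum `k`. -/
def scatteringKernel (a α k : ℝ) (p : ℝ × ℝ) : ℂ :=
  ∑ b : Bool, scatteringPart a α (paritySign b) k p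

/-- The contribution to the scattered part of the paths with `m` passages between `±a`. -/
def scatteringTerm (a α : ℝ) (m : ℕ) (k : ℝ) (p : ℝ × ℝ) : ℂ :=
  (-1) ^ m *
    (reflection α k ^ (m + 1) *
        Complex.exp (Complex.I * zn a ((m : ℝ) / 2) p.1 ((-1) ^ m * p.2) * k) +
      reflection α k ^ (m + 1) *
        Complex.exp (Complex.I * zn a ((m : ℝ) / 2) (-p.1) ((-1) ^ m * -p.2) * k))

/-- What remains of the scattered part after `N` terms. -/
def scatteringRem (a α : ℝ) (N : ℕ) (k : ℝ) (p : ℝ × ℝ) : ℂ :=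
  ∑ b : Bool, scatteringPart a α (paritySign b) k p * scatteringRatio a α (paritySign b) k ^ N

/-- `denom = (2k + iα)(1 - q)` with `q = scatteringRatio`, so `iα/denom = r/(1 - q)` is expanded in
a finite geometric sum with its exact remainder. -/
theorem scatteringPart_eq {a α σ k : ℝ} (hα : α ≠ 0) (hσ : σ = 1 ∨ σ = -1) (hk : k ≠ 0)
    (p : ℝ × ℝ) (N : ℕ) :
    scatteringPart a α σ k p = ∑ m ∈ Finset.range N, reflection α k * scatteringRatio a α σ k ^ m *
        (source a σ k p.1 * source a σ k p.2 / 2)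
      + scatteringPart a α σ k p * scatteringRatio a α σ k ^ N := by
  have hD := denom_ofReal_ne_zero' (a := a) (α := α) hσ hk
  have hg := two_mul_add_I_mul_ne_zero hα k
  have h1 : Complex.I * α / denom a α σ k * (1 - scatteringRatio a α σ k) = reflection α k := by
    have h2 : denom a α σ k = (2 * k + Complex.I * α) * (1 - scatteringRatio a α σ k) := by
      rw [scatteringRatio, reflection, denom]
      field_simp
      ring
    have h3 : 1 - scatteringRatio a α σ k ≠ 0 := fun h => hD (by rw [h2, h, mul_zero])
    rw [h2, reflection]
    field_simp
  have h2 := mul_neg_geom_sum (scatteringRatio a α σ k) N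
  rw [scatteringPart, ← Finset.sum_mul, ← Finset.mul_sum, ← h1]
  linear_combination (-(Complex.I * α / denom a α σ k *
    (source a σ k p.1 * source a σ k p.2 / 2))) * h2

theorem exp_zn (a : ℝ) (m : ℕ) (k x y : ℝ) :
    Complex.exp (Complex.I * zn a ((m : ℝ) / 2) x y * k)
      = Complex.exp (2 * Complex.I * a * k) ^ m * (expAbs k (x + a) * expAbs k (y + a)) := by
  rw [expAbs, expAbs, ← Complex.exp_add, ← Complex.exp_nat_mul, ← Complex.exp_add, zn]
  congr 1
  push_cast
  ring

/-- The sum over `σ = ±1` with weight `σ^m` keeps the products of sources at equal points for even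
`m` and at opposite points for odd `m`. This is the origin of `(-1)^m y`. -/
theorem sum_scatteringPart_term (a α : ℝ) (m : ℕ) (k : ℝ) (p : ℝ × ℝ) :
    ∑ b : Bool, reflection α k * scatteringRatio a α (paritySign b) k ^ m *
        (source a (paritySign b) k p.1 * source a (paritySign b) k p.2 / 2)
      = scatteringTerm a α m k p := by
  rw [Fintype.sum_bool, scatteringTerm, exp_zn, exp_zn]
  have e1 : ∀ x : ℝ, expAbs k (-x + a) = expAbs k (x - a) := fun x => by
    rw [← expAbs_neg]; congr 1; ring
  have hr : ∀ σ : ℝ, scatteringRatio a α σ k ^ m = (-1) ^ m * (σ : ℂ) ^ m * reflection α k ^ m *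
      Complex.exp (2 * Complex.I * a * k) ^ m := fun σ => by
    rw [scatteringRatio, neg_pow, mul_pow, mul_pow]; ring
  rw [hr, hr]
  simp only [paritySign, if_true, Bool.false_eq_true, if_false, source, e1]
  rcases Nat.even_or_odd m with h | h
  · rw [Even.neg_one_pow h, Even.neg_one_pow h, one_mul p.2, one_mul (-p.2), e1]
    push_cast
    rw [Even.neg_one_pow h]
    ring
  · rw [Odd.neg_one_pow h, Odd.neg_one_pow h, neg_one_mul p.2, neg_one_mul (-p.2), neg_neg, e1]
    push_cast
    rw [Odd.neg_one_pow h]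
    ring

theorem scatteringKernel_eq {a α k : ℝ} (hα : α ≠ 0) (hk : k ≠ 0) (p : ℝ × ℝ) (N : ℕ) :
    scatteringKernel a α k p
      = ∑ m ∈ Finset.range N, scatteringTerm a α m k p + scatteringRem a α N k p := by
  simp_rw [← sum_scatteringPart_term]
  rw [Finset.sum_comm, scatteringRem, ← Finset.sum_add_distrib, scatteringKernel]
  exact Finset.sum_congr rfl fun b _ => scatteringPart_eq hα (paritySign_eq b) hk p N

theorem mul_sqrt_one_add_sq_le {c : ℝ} (hc : 0 < c) (k : ℝ) :
    min 1 c * √(1 + k ^ 2) ≤ √(k ^ 2 + c ^ 2) := by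
  have h0 : 0 < min 1 c := lt_min one_pos hc
  have h1 : min 1 c ^ 2 ≤ 1 ^ 2 := pow_le_pow_left₀ h0.le (min_le_left _ _) 2
  have h2 : min 1 c ^ 2 ≤ c ^ 2 := pow_le_pow_left₀ h0.le (min_le_right _ _) 2
  apply Real.le_sqrt_of_sq_le
  rw [mul_pow, Real.sq_sqrt (by positivity)]
  nlinarith [sq_nonneg k]

/-- `1/denom = Q/(k - iκ)` decays like `1/√(1+k²)`. One of the two source factors is spent on the
weight that bounds `Q` near `k = 0`, the other is merely bounded, uniformly in the position. -/
theorem exists_norm_scatteringPart_le {a α σ : ℝ} (ha : 0 < a) (hα : α ≠ 0) (haα : a * α ≠ -1)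
    (hσ : σ = 1 ∨ σ = -1) : ∃ C : ℝ, 0 ≤ C ∧ ∀ (k : ℝ) (p : ℝ × ℝ), k ≠ 0 →
      ‖scatteringPart a α σ k p‖ ≤ C / √(1 + k ^ 2) := by
  obtain ⟨κ, Q, C, hκ, hC, -, hQD, hQC, -⟩ := exists_denom_reciprocal ha hα haα hσ
  refine ⟨|α| * ((2 + 2 * a) * (2 + 2 * a) * C) / min 1 κ, by positivity, fun k p hk => ?_⟩
  have hkC : (k : ℂ) ≠ 0 := by exact_mod_cast hk
  have him : 0 ≤ (k : ℂ).im := by simp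
  have h1 := hQD k him hkC
  have h2 := hQC k him hkC
  have hD := denom_ofReal_ne_zero' (a := a) (α := α) hσ hk
  have s1 := norm_source_le ha hσ him p.1
  have s2 := norm_source_le ha hσ him p.2
  have l0 := lowWeight_nonneg σ k
  have l1 := lowWeight_le_one σ k
  have hn : ‖(k : ℂ) - Complex.I * κ‖ = √(k ^ 2 + κ ^ 2) := by
    rw [Complex.norm_def, Complex.normSq_apply]
    congr 1
    simp
    ring
  have hpos : 0 < √(1 + k ^ 2) := by positivity
  have hmin : 0 < min 1 κ := lt_min one_pos hκ
  have h3 := mul_sqrt_one_add_sq_le hκ k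
  rw [← hn, ← h1, norm_mul] at h3
  have hDpos : 0 < ‖denom a α σ k‖ := norm_pos_iff.2 hD
  have hss : ‖source a σ k p.1‖ * ‖source a σ k p.2‖
      ≤ (2 + 2 * a) * (2 + 2 * a) * lowWeight σ k := by
    calc _ ≤ ((2 + 2 * a) * lowWeight σ k) * ((2 + 2 * a) * 1) :=
          mul_le_mul s1 (s2.trans (by gcongr)) (norm_nonneg _) (by positivity)
      _ = _ := by ring
  rw [scatteringPart, norm_mul, norm_div, norm_mul, norm_div, norm_mul, Complex.norm_I, one_mul,
    Complex.norm_real, Real.norm_eq_abs, Complex.norm_two, div_div, div_mul_eq_mul_div,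
    div_le_div_iff₀ hDpos (by positivity)]
  calc |α| * (‖source a σ k p.1‖ * ‖source a σ k p.2‖ / 2) * (min 1 κ * √(1 + k ^ 2))
      ≤ |α| * ((2 + 2 * a) * (2 + 2 * a) * lowWeight σ k) * (‖Q k‖ * ‖denom a α σ k‖) := by
        refine mul_le_mul (mul_le_mul_of_nonneg_left ?_ (abs_nonneg _)) h3 (by positivity)
          (by positivity)
        exact (half_le_self (by positivity)).trans hss
    _ = |α| * ((2 + 2 * a) * (2 + 2 * a) * (‖Q k‖ * lowWeight σ k)) * ‖denom a α σ k‖ := by ring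
    _ ≤ _ := by
        refine mul_le_mul_of_nonneg_right (mul_le_mul_of_nonneg_left
          (mul_le_mul_of_nonneg_left h2 (by positivity)) (abs_nonneg _)) (norm_nonneg _)

theorem norm_reflection_le {α : ℝ} (hα : α ≠ 0) (k : ℝ) :
    ‖reflection α k‖ ≤ |α| / min 1 |α| / √(1 + k ^ 2) := by
  have hα' : 0 < |α| := abs_pos.2 hα
  have hmin : 0 < min 1 |α| := lt_min one_pos hα'
  have hn : ‖(2 * k + Complex.I * α : ℂ)‖ = √((2 * k) ^ 2 + |α| ^ 2) := by
    rw [Complex.norm_def, Complex.normSq_apply]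
    congr 1
    simp
    ring
  have h3 := mul_sqrt_one_add_sq_le hα' k
  have h4 : √(k ^ 2 + |α| ^ 2) ≤ √((2 * k) ^ 2 + |α| ^ 2) :=
    Real.sqrt_le_sqrt (by nlinarith [sq_nonneg k])
  rw [reflection, norm_div, hn, norm_mul, Complex.norm_I, one_mul, Complex.norm_real,
    Real.norm_eq_abs, div_div]
  exact div_le_div_of_nonneg_left hα'.le (by positivity) (h3.trans h4)

theorem norm_scatteringRatio (a α : ℝ) {σ : ℝ} (hσ : σ = 1 ∨ σ = -1) (k : ℝ) :
    ‖scatteringRatio a α σ k‖ = ‖reflection α k‖ := by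
  rw [scatteringRatio, norm_neg, norm_mul, norm_mul, norm_le_one_of_sign hσ, one_mul,
    show 2 * Complex.I * a * k = ((2 * a * k : ℝ) : ℂ) * Complex.I by push_cast; ring,
    Complex.norm_exp_ofReal_mul_I, mul_one]

/-- Of the `N + 1` reflection factors in the remainder one is traded for a second `1/√(1+k²)`. This
makes the remainder integrable in `k` and leaves `|r|^N`; without any subtracted term there is no
such integrability. -/
theorem exists_norm_scattering_le {a α : ℝ} (ha : 0 < a) (hα : α ≠ 0) (haα : a * α ≠ -1) :
    ∃ C : ℝ, 0 ≤ C ∧ (∀ (k : ℝ) (p : ℝ × ℝ), k ≠ 0 → ‖scatteringKernel a α k p‖ ≤ C) ∧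
      ∀ (N : ℕ) (k : ℝ) (p : ℝ × ℝ), k ≠ 0 →
        ‖scatteringRem a α (N + 1) k p‖ ≤ C / (1 + k ^ 2) * ‖reflection α k‖ ^ N := by
  choose C hC0 hC using fun b : Bool =>
    exists_norm_scatteringPart_le ha hα haα (paritySign_eq b)
  set M := |α| / min 1 |α| with hM
  have hM0 : 0 ≤ M := by
    have : 0 < min 1 |α| := lt_min one_pos (abs_pos.2 hα)
    positivity
  have hs : 0 ≤ ∑ b, C b := Finset.sum_nonneg fun b _ => hC0 b
  refine ⟨(∑ b, C b) + (∑ b, C b) * M, by positivity, fun k p hk => ?_, fun N k p hk => ?_⟩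
  · have h1 : 1 ≤ √(1 + k ^ 2) := by
      rw [Real.one_le_sqrt]; nlinarith [sq_nonneg k]
    rw [scatteringKernel]
    refine (norm_sum_le _ _).trans ((Finset.sum_le_sum fun b _ => (hC b k p hk).trans
      (div_le_self (hC0 b) h1)).trans ?_)
    nlinarith [mul_nonneg hs hM0]
  · have hsq : √(1 + k ^ 2) * √(1 + k ^ 2) = 1 + k ^ 2 := Real.mul_self_sqrt (by positivity)
    have hpos : 0 < √(1 + k ^ 2) := by positivity
    rw [scatteringRem]
    calc _ ≤ ∑ b : Bool, C b / √(1 + k ^ 2) * (M / √(1 + k ^ 2) * ‖reflection α k‖ ^ N) := by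
          refine (norm_sum_le _ _).trans (Finset.sum_le_sum fun b _ => ?_)
          rw [norm_mul, norm_pow, norm_scatteringRatio a α (paritySign_eq b), pow_succ']
          refine mul_le_mul (hC b k p hk) (mul_le_mul_of_nonneg_right (norm_reflection_le hα k)
            (by positivity)) (by positivity) (div_nonneg (hC0 b) hpos.le)
      _ = (∑ b, C b) * M / (1 + k ^ 2) * ‖reflection α k‖ ^ N := by
          rw [← Finset.sum_mul, ← Finset.sum_div, ← mul_assoc, div_mul_div_comm, hsq]
      _ ≤ _ := by
          refine mul_le_mul_of_nonneg_right ?_ (by positivity)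
          gcongr
          linarith

theorem measurable_scatteringPart (a α σ : ℝ) :
    Measurable fun q : ℝ × ℝ × ℝ => scatteringPart a α σ q.1 q.2 := by
  have h1 : Measurable fun q : ℝ × ℝ × ℝ => denom a α σ q.1 :=
    (continuous_denom_ofReal a α σ).measurable.comp measurable_fst
  have h2 : Measurable fun q : ℝ × ℝ × ℝ => source a σ q.1 q.2.1 * source a σ q.1 q.2.2 / 2 := by
    unfold source expAbs
    exact (by fun_prop : Continuous _).measurable
  unfold scatteringPart
  exact (measurable_const.div h1).mul h2

theorem measurable_scatteringKernel (a α : ℝ) :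
    Measurable fun q : ℝ × ℝ × ℝ => scatteringKernel a α q.1 q.2 := by
  unfold scatteringKernel
  exact Finset.measurable_fun_sum _ fun b _ => measurable_scatteringPart a α (paritySign b)

theorem measurable_scatteringRem {a α : ℝ} (hα : α ≠ 0) (N : ℕ) :
    Measurable fun q : ℝ × ℝ × ℝ => scatteringRem a α N q.1 q.2 := by
  have h1 : ∀ σ : ℝ, Measurable fun q : ℝ × ℝ × ℝ => scatteringRatio a α σ q.1 := fun σ => by
    have h2 := (continuous_reflection hα).comp (continuous_fst (X := ℝ) (Y := ℝ × ℝ))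
    have h3 : Continuous fun q : ℝ × ℝ × ℝ => reflection α q.1 := h2
    unfold scatteringRatio
    exact (by fun_prop : Continuous _).measurable
  unfold scatteringRem
  exact Finset.measurable_fun_sum _ fun b _ =>
    (measurable_scatteringPart a α (paritySign b)).mul ((h1 _).pow_const N)

theorem ae_ne_zero : ∀ᵐ k : ℝ, k ≠ 0 := by simp [ae_iff]

theorem integrable_scatteringRem {a α : ℝ} (ha : 0 < a) (hα : α ≠ 0) (haα : a * α ≠ -1) (N : ℕ)
    (p : ℝ × ℝ) : Integrable (fun k => scatteringRem a α (N + 1) k p) volume := by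
  obtain ⟨C, hC, -, hR⟩ := exists_norm_scattering_le ha hα haα
  refine (integrable_const_div_one_add_sq C).mono'
    ((measurable_scatteringRem hα (N + 1)).comp measurable_prodMk_right).aestronglyMeasurable ?_
  filter_upwards [ae_ne_zero] with k hk
  refine (hR N k p hk).trans (mul_le_of_le_one_right (by positivity) ?_)
  exact pow_le_one₀ (norm_nonneg _) (norm_reflection_le_one α k)

/-! ### Gaussian regularization and termwise limits. -/

theorem integrable_gaussian_mul {ϑ : ℂ} (h : ϑ ∈ sector) {g : ℝ → ℂ}
    (hg : AEStronglyMeasurable g volume) {C : ℝ} (hC : ∀ᵐ k, ‖g k‖ ≤ C) :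
    Integrable (fun k : ℝ => Complex.exp (-ϑ ^ 2 * k ^ 2) * g k) volume :=
  (integrable_cexp_neg_mul_sq (re_sq_pos_of_mem_sector h)).mul_bdd hg hC

theorem integrable_gaussian_mul_integrable {ϑ : ℂ} (h : 0 ≤ (ϑ ^ 2).re) {g : ℝ → ℂ}
    (hg : Integrable g volume) :
    Integrable (fun k : ℝ => Complex.exp (-ϑ ^ 2 * k ^ 2) * g k) volume :=
  hg.bdd_mul (Continuous.aestronglyMeasurable (by fun_prop))
    (Eventually.of_forall (norm_exp_neg_sq_mul_le_one h))

theorem re_rootIt_sq {t : ℝ} (ht : 0 < t) : (rootIt t ^ 2).re = 0 := by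
  rw [rootIt_sq ht]; simp

/-- Gaussian regularization of an absolutely convergent oscillating integral. -/
theorem tendsto_integral_gaussian {t : ℝ} {g : ℝ → ℂ} (hg : Integrable g volume) :
    Tendsto (fun ε : ℝ => ∫ k : ℝ, Complex.exp (-(rootIt t + ε) ^ 2 * k ^ 2) * g k) (𝓝[>] 0)
      (𝓝 (∫ k : ℝ, Complex.exp (-rootIt t ^ 2 * k ^ 2) * g k)) := by
  refine tendsto_integral_filter_of_dominated_convergence (fun k => ‖g k‖) ?_ ?_ hg.norm ?_
  · exact Eventually.of_forall fun ε =>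
      (Continuous.aestronglyMeasurable (by fun_prop)).mul hg.aestronglyMeasurable
  · filter_upwards [self_mem_nhdsWithin] with ε hε
    refine Eventually.of_forall fun k => ?_
    rw [norm_mul]
    exact mul_le_of_le_one_left (norm_nonneg _) (norm_exp_neg_sq_mul_le_one
      (re_sq_pos_of_mem_sector (rootIt_add_mem_sector t hε)).le k)
  · refine Eventually.of_forall fun k => Tendsto.mul_const _ ?_
    have h1 : Continuous fun ϑ : ℂ => Complex.exp (-ϑ ^ 2 * k ^ 2) := by fun_prop
    exact (h1.tendsto (rootIt t)).comp (tendsto_rootIt_add t)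

/-- The Gaussian integral of `scatteringTerm`. -/
def seriesTermAt (a α : ℝ) (m : ℕ) (p : ℝ × ℝ) (ϑ : ℂ) : ℂ :=
  (-1) ^ m * (cylinderTerm α m (zn a ((m : ℝ) / 2) p.1 ((-1) ^ m * p.2)) ϑ
    + cylinderTerm α m (zn a ((m : ℝ) / 2) (-p.1) ((-1) ^ m * -p.2)) ϑ)

theorem integrable_gaussian_mul_reflection_pow {α : ℝ} (hα : α ≠ 0) (m : ℕ) (z : ℝ) {ϑ : ℂ}
    (h : ϑ ∈ sector) : Integrable (fun k : ℝ => Complex.exp (-ϑ ^ 2 * k ^ 2) *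
        (reflection α k ^ (m + 1) * Complex.exp (Complex.I * z * k))) volume := by
  have hc := continuous_reflection hα
  refine integrable_gaussian_mul h (Continuous.aestronglyMeasurable (by fun_prop))
    (Eventually.of_forall fun k => (?_ : _ ≤ (1 : ℝ)))
  rw [norm_mul, norm_pow, show Complex.I * z * k = ((z * k : ℝ) : ℂ) * Complex.I by
    push_cast; ring, Complex.norm_exp_ofReal_mul_I, mul_one]
  exact pow_le_one₀ (norm_nonneg _) (norm_reflection_le_one α k)

theorem integral_gaussian_mul_scatteringTerm {a α : ℝ} (hα : α ≠ 0) (m : ℕ) (p : ℝ × ℝ) {ϑ : ℂ}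
    (h : ϑ ∈ sector) :
    Integrable (fun k : ℝ => Complex.exp (-ϑ ^ 2 * k ^ 2) * scatteringTerm a α m k p) volume ∧
    ∫ k : ℝ, Complex.exp (-ϑ ^ 2 * k ^ 2) * scatteringTerm a α m k p = seriesTermAt a α m p ϑ := by
  have i1 := integrable_gaussian_mul_reflection_pow hα m
    (zn a ((m : ℝ) / 2) p.1 ((-1) ^ m * p.2)) h
  have i2 := integrable_gaussian_mul_reflection_pow hα m
    (zn a ((m : ℝ) / 2) (-p.1) ((-1) ^ m * -p.2)) h
  have e : ∀ k : ℝ, Complex.exp (-ϑ ^ 2 * k ^ 2) * scatteringTerm a α m k p = (-1) ^ m *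
      (Complex.exp (-ϑ ^ 2 * k ^ 2) * (reflection α k ^ (m + 1) *
        Complex.exp (Complex.I * zn a ((m : ℝ) / 2) p.1 ((-1) ^ m * p.2) * k)) +
      Complex.exp (-ϑ ^ 2 * k ^ 2) * (reflection α k ^ (m + 1) *
        Complex.exp (Complex.I * zn a ((m : ℝ) / 2) (-p.1) ((-1) ^ m * -p.2) * k))) := fun k => by
    rw [scatteringTerm]; ring
  simp_rw [e]
  refine ⟨(i1.add i2).const_mul _, ?_⟩
  rw [integral_const_mul, integral_add i1 i2, integral_eq_cylinderTerm hα m _ h,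
    integral_eq_cylinderTerm hα m _ h, seriesTermAt]

theorem norm_seriesTermAt_le {a α : ℝ} (hα : α ≠ 0) (m : ℕ) (p : ℝ × ℝ) {ϑ : ℂ}
    (h : ϑ ∈ sector) : ‖seriesTermAt a α m p ϑ‖ ≤ 2 * (√Real.pi / ‖ϑ‖) := by
  rw [seriesTermAt, norm_mul, norm_pow, norm_neg, norm_one, one_pow, one_mul, two_mul]
  refine (norm_add_le _ _).trans (add_le_add ?_ ?_) <;>
  · rw [← integral_eq_cylinderTerm hα m _ h]
    exact norm_integral_gaussian_mul_reflection_pow_le hα m _ h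

theorem tendsto_seriesTermAt {a α t : ℝ} (hα : α ≠ 0) (ht : 0 < t) (m : ℕ) (p : ℝ × ℝ) :
    Tendsto (fun ε : ℝ => seriesTermAt a α m p (rootIt t + ε)) (𝓝[>] 0)
      (𝓝 (seriesTerm a α t m p.1 p.2)) := by
  have e : seriesTerm a α t m p.1 p.2 = seriesTermAt a α m p (rootIt t) := by
    rw [seriesTerm, pm, pm, rn_eq_cylinderTerm hα ht, rn_eq_cylinderTerm hα ht, seriesTermAt]
    ring
  rw [e]
  have hc : ContinuousAt (seriesTermAt a α m p) (rootIt t) :=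
    ((continuousAt_cylinderTerm hα m _ (rootIt_ne_zero ht)).add
      (continuousAt_cylinderTerm hα m _ (rootIt_ne_zero ht))).const_mul _
  exact hc.tendsto.comp (tendsto_rootIt_add t)

theorem integral_gaussian_mul_scatteringKernel {a α : ℝ} (ha : 0 < a) (hα : α ≠ 0)
    (haα : a * α ≠ -1) (N : ℕ) (p : ℝ × ℝ) {ϑ : ℂ} (h : ϑ ∈ sector) :
    ∫ k : ℝ, Complex.exp (-ϑ ^ 2 * k ^ 2) * scatteringKernel a α k p
      = ∑ m ∈ Finset.range (N + 1), seriesTermAt a α m p ϑ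
        + ∫ k : ℝ, Complex.exp (-ϑ ^ 2 * k ^ 2) * scatteringRem a α (N + 1) k p := by
  have i1 := fun m (_ : m ∈ Finset.range (N + 1)) =>
    (integral_gaussian_mul_scatteringTerm (a := a) hα m p h).1
  have i2 := integrable_gaussian_mul_integrable (re_sq_pos_of_mem_sector h).le
    (integrable_scatteringRem ha hα haα N p)
  have e : (fun k : ℝ => Complex.exp (-ϑ ^ 2 * k ^ 2) * scatteringKernel a α k p) =ᵐ[volume]
      fun k => ∑ m ∈ Finset.range (N + 1), Complex.exp (-ϑ ^ 2 * k ^ 2) * scatteringTerm a α m k p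
        + Complex.exp (-ϑ ^ 2 * k ^ 2) * scatteringRem a α (N + 1) k p := by
    filter_upwards [ae_ne_zero] with k hk
    rw [scatteringKernel_eq hα hk p (N + 1), mul_add, Finset.mul_sum]
  rw [integral_congr_ae e, integral_add (integrable_finsetSum _ i1) i2,
    integral_finsetSum _ i1]
  congr 1
  exact Finset.sum_congr rfl fun m _ => (integral_gaussian_mul_scatteringTerm hα m p h).2

/-- The left side does not involve `N`, so the limits for different `N` coincide. This identifies
the tail of the series with a remainder integral. -/
theorem tendsto_integral_gaussian_scatteringKernel {a α t : ℝ} (ha : 0 < a) (hα : α ≠ 0)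
    (haα : a * α ≠ -1) (ht : 0 < t) (N : ℕ) (p : ℝ × ℝ) :
    Tendsto (fun ε : ℝ => ∫ k : ℝ, Complex.exp (-(rootIt t + ε) ^ 2 * k ^ 2) *
        scatteringKernel a α k p) (𝓝[>] 0)
      (𝓝 (∑ m ∈ Finset.range (N + 1), seriesTerm a α t m p.1 p.2
        + ∫ k : ℝ, Complex.exp (-rootIt t ^ 2 * k ^ 2) * scatteringRem a α (N + 1) k p)) := by
  have h1 := (tendsto_finsetSum (Finset.range (N + 1)) fun m _ =>
    tendsto_seriesTermAt (a := a) hα ht m p).add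
    (tendsto_integral_gaussian (t := t) (integrable_scatteringRem ha hα haα N p))
  refine h1.congr' ?_
  filter_upwards [self_mem_nhdsWithin] with ε hε
  exact (integral_gaussian_mul_scatteringKernel ha hα haα N p (rootIt_add_mem_sector t hε)).symm

/-- Uniform bound for the regularized scattered part. -/
theorem exists_norm_integral_gaussian_scatteringKernel_le {a α t : ℝ} (ha : 0 < a) (hα : α ≠ 0)
    (haα : a * α ≠ -1) (ht : 0 < t) : ∃ B : ℝ, ∀ ε : ℝ, 0 < ε → ∀ p : ℝ × ℝ,
      ‖∫ k : ℝ, Complex.exp (-(rootIt t + ε) ^ 2 * k ^ 2) * scatteringKernel a α k p‖ ≤ B := by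
  obtain ⟨C, hC, -, hR⟩ := exists_norm_scattering_le ha hα haα
  refine ⟨2 * (√Real.pi / ‖rootIt t‖) + ∫ k : ℝ, C / (1 + k ^ 2), fun ε hε p => ?_⟩
  have hs := rootIt_add_mem_sector t hε
  have hpos : 0 < ‖rootIt t‖ := norm_pos_iff.2 (rootIt_ne_zero ht)
  -- Splitting off the single term `m = 0`, which has an explicit bound uniform in `p`, already
  -- leaves an absolutely integrable remainder.
  rw [integral_gaussian_mul_scatteringKernel ha hα haα 0 p hs, zero_add, Finset.sum_range_one]
  refine (norm_add_le _ _).trans (add_le_add ((norm_seriesTermAt_le hα 0 p hs).trans ?_) ?_)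
  · exact mul_le_mul_of_nonneg_left (div_le_div_of_nonneg_left (Real.sqrt_nonneg _) hpos
      (norm_rootIt_le_norm_add t hε)) (by norm_num)
  · refine norm_integral_le_of_norm_le (integrable_const_div_one_add_sq C) ?_
    filter_upwards [ae_ne_zero] with k hk
    have := hR 0 k p hk
    rw [pow_zero, mul_one] at this
    rw [norm_mul]
    exact (mul_le_of_le_one_left (norm_nonneg _)
      (norm_exp_neg_sq_mul_le_one (re_sq_pos_of_mem_sector hs).le k)).trans this

/-- The distance from the limit is a remainder integral bounded by `∫ C/(1+k²) |r|^N`, in which `p`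
does not occur. It tends to `0` by dominated convergence, as `|r| < 1` for `k ≠ 0`. -/
theorem tendstoUniformly_of_ne_zero {a α t : ℝ} (ha : 0 < a) (hα : α ≠ 0)
    (haα : a * α ≠ -1) (ht : 0 < t) : ∃ S : ℝ × ℝ → ℂ,
      (∀ p, Tendsto (fun ε : ℝ => ∫ k : ℝ, Complex.exp (-(rootIt t + ε) ^ 2 * k ^ 2) *
        scatteringKernel a α k p) (𝓝[>] 0) (𝓝 (S p))) ∧
      TendstoUniformly (fun (N : ℕ) (p : ℝ × ℝ) =>
        ∑ m ∈ Finset.range N, seriesTerm a α t m p.1 p.2) S atTop := by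
  refine ⟨fun p => _, fun p => tendsto_integral_gaussian_scatteringKernel ha hα haα ht 0 p, ?_⟩
  obtain ⟨C, hC, -, hR⟩ := exists_norm_scattering_le ha hα haα
  have hc := continuous_reflection hα
  have hlim : Tendsto (fun N : ℕ => ∫ k : ℝ, C / (1 + k ^ 2) * ‖reflection α k‖ ^ N) atTop
      (𝓝 (∫ _ : ℝ, 0)) := by
    refine tendsto_integral_of_dominated_convergence (fun k => C / (1 + k ^ 2)) (fun N => ?_)
      (integrable_const_div_one_add_sq C) (fun N => Eventually.of_forall fun k => ?_) ?_
    · exact ((integrable_const_div_one_add_sq C).aestronglyMeasurable).mul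
        (Continuous.aestronglyMeasurable (by fun_prop))
    · rw [Real.norm_eq_abs, abs_of_nonneg (by positivity)]
      exact mul_le_of_le_one_right (by positivity)
        (pow_le_one₀ (norm_nonneg _) (norm_reflection_le_one α k))
    · filter_upwards [ae_ne_zero] with k hk
      have := (tendsto_pow_atTop_nhds_zero_of_lt_one (norm_nonneg _)
        (norm_reflection_lt_one α hk)).const_mul (C / (1 + k ^ 2))
      rwa [mul_zero] at this
  rw [integral_zero] at hlim
  rw [Metric.tendstoUniformly_iff]
  intro δ hδ
  have h1 := (tendsto_order.1 hlim).2 δ hδ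
  -- The partial sum with `N` terms leaves a remainder with only the power `N - 1` of `|r|`, whence
  -- the shift.
  have h2 : ∀ᶠ N : ℕ in atTop, ∫ k : ℝ, C / (1 + k ^ 2) * ‖reflection α k‖ ^ (N - 1) < δ :=
    (tendsto_sub_atTop_nat 1).eventually h1
  filter_upwards [h2, eventually_ge_atTop 1] with N hN hN1 p
  obtain ⟨n, rfl⟩ := Nat.exists_eq_add_of_le' hN1
  rw [Nat.add_sub_cancel] at hN
  -- The limit was defined by the expansion with one term; equating it with the expansion with `n +
  -- 1` terms exhibits the difference as a remainder.
  have e := tendsto_nhds_unique (tendsto_integral_gaussian_scatteringKernel ha hα haα ht 0 p)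
    (tendsto_integral_gaussian_scatteringKernel ha hα haα ht n p)
  rw [dist_eq_norm, e, add_sub_cancel_left]
  refine lt_of_le_of_lt ?_ hN
  refine norm_integral_le_of_norm_le ?_ ?_
  · refine (integrable_const_div_one_add_sq C).mono'
      (((integrable_const_div_one_add_sq C).aestronglyMeasurable).mul
        (Continuous.aestronglyMeasurable (by fun_prop))) (Eventually.of_forall fun k => ?_)
    rw [Real.norm_eq_abs, abs_of_nonneg (by positivity)]
    exact mul_le_of_le_one_right (by positivity)
        (pow_le_one₀ (norm_nonneg _) (norm_reflection_le_one α k))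
  · filter_upwards [ae_ne_zero] with k hk
    rw [norm_mul]
    exact (mul_le_of_le_one_left (norm_nonneg _)
      (norm_exp_neg_sq_mul_le_one (re_rootIt_sq ht).ge k)).trans (hR n k p hk)

/-! ### The integral kernel -/

theorem seriesTerm_zero (a t : ℝ) (m : ℕ) (x y : ℝ) : seriesTerm a 0 t m x y = 0 := by
  have h : ∀ x y : ℝ, rn a 0 ((m : ℝ) / 2) t x y = 0 := fun x y => by
    have h1 : (2 * ((m : ℝ) / 2) + 1) ≠ 0 := by positivity
    rw [rn, abs_zero, Real.zero_rpow h1]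
    simp
  rw [seriesTerm, pm, pm, h, h]
  simp

theorem scatteringPart_zero (a σ k : ℝ) (p : ℝ × ℝ) : scatteringPart a 0 σ k p = 0 := by
  simp [scatteringPart]

theorem scatteringKernel_zero (a k : ℝ) (p : ℝ × ℝ) : scatteringKernel a 0 k p = 0 := by
  simp [scatteringKernel, scatteringPart_zero]

theorem seriesSum_eq {a α t x y : ℝ} {s : ℂ}
    (h : Tendsto (fun N : ℕ => ∑ m ∈ Finset.range N, seriesTerm a α t m x y) atTop (𝓝 s)) :
    seriesSum a α t x y = s := by
  refine HasSum.tsum_eq ?_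
  rw [HasSum, SummationFilter.conditional_filter_eq_map_range, tendsto_map'_iff]
  exact h

theorem tendstoUniformly_seriesSum {a α t : ℝ} (ha : 0 < a) (haα : a * α ≠ -1) (ht : 0 < t) :
    (∀ p : ℝ × ℝ, Tendsto (fun ε : ℝ => ∫ k : ℝ, Complex.exp (-(rootIt t + ε) ^ 2 * k ^ 2) *
      scatteringKernel a α k p) (𝓝[>] 0) (𝓝 (seriesSum a α t p.1 p.2))) ∧
    TendstoUniformly (fun (N : ℕ) (p : ℝ × ℝ) =>
      ∑ m ∈ Finset.range N, seriesTerm a α t m p.1 p.2)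
      (fun p : ℝ × ℝ => seriesSum a α t p.1 p.2) atTop := by
  have key : ∃ S : ℝ × ℝ → ℂ,
      (∀ p, Tendsto (fun ε : ℝ => ∫ k : ℝ, Complex.exp (-(rootIt t + ε) ^ 2 * k ^ 2) *
        scatteringKernel a α k p) (𝓝[>] 0) (𝓝 (S p))) ∧
      TendstoUniformly (fun (N : ℕ) (p : ℝ × ℝ) =>
        ∑ m ∈ Finset.range N, seriesTerm a α t m p.1 p.2) S atTop := by
    rcases eq_or_ne α 0 with rfl | hα
    · refine ⟨fun _ => 0, fun p => ?_, ?_⟩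
      · simp only [scatteringKernel_zero, mul_zero, integral_zero]
        exact tendsto_const_nhds
      · simp only [seriesTerm_zero, Finset.sum_const_zero]
        rw [Metric.tendstoUniformly_iff]
        exact fun δ hδ => Eventually.of_forall fun N p => by rwa [dist_self]
    · exact tendstoUniformly_of_ne_zero ha hα haα ht
  obtain ⟨S, hS, hU⟩ := key
  have e : (fun p : ℝ × ℝ => seriesSum a α t p.1 p.2) = S := by
    ext p
    exact seriesSum_eq (hU.tendsto_at p)
  exact ⟨fun p => by rw [show seriesSum a α t p.1 p.2 = S p from congrFun e p]; exact hS p,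
    by rw [e]; exact hU⟩

/-- The kernel of the spectral projection density of parity `σ` at momentum `k`. -/
def modeKernel (a α σ k : ℝ) (p : ℝ × ℝ) : ℂ :=
  σ * (wave σ k p.1 * wave σ k p.2) -
    (scatteringPart a α σ k p + scatteringPart a α σ (-k) p) / 2

theorem measurable_modeKernel (a α σ : ℝ) :
    Measurable fun q : ℝ × ℝ × ℝ => modeKernel a α σ q.1 q.2 := by
  have h1 := measurable_scatteringPart a α σ
  have hneg : Measurable fun q : ℝ × ℝ × ℝ => ((-q.1, q.2) : ℝ × ℝ × ℝ) :=
    measurable_fst.neg.prodMk measurable_snd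
  have h2 := h1.comp hneg
  simp only [Function.comp_def] at h2
  have h3 : Measurable fun q : ℝ × ℝ × ℝ => (σ : ℂ) * (wave σ q.1 q.2.1 * wave σ q.1 q.2.2) := by
    have h5 : Continuous fun q : ℝ × ℝ × ℝ => (σ : ℂ) * (wave σ q.1 q.2.1 * wave σ q.1 q.2.2) := by
      unfold wave
      fun_prop
    exact h5.measurable
  have h4 : Measurable fun q : ℝ × ℝ × ℝ =>
      (scatteringPart a α σ q.1 q.2 + scatteringPart a α σ (-q.1) q.2) / 2 :=
    (h1.add h2).div_const 2
  unfold modeKernel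
  exact Measurable.sub (f := fun q : ℝ × ℝ × ℝ => (σ : ℂ) * (wave σ q.1 q.2.1 * wave σ q.1 q.2.2))
    (g := fun q : ℝ × ℝ × ℝ =>
      (scatteringPart a α σ q.1 q.2 + scatteringPart a α σ (-q.1) q.2) / 2) h3 h4

theorem exists_norm_scatteringPart_le_const {a α σ : ℝ} (ha : 0 < a) (haα : a * α ≠ -1)
    (hσ : σ = 1 ∨ σ = -1) : ∃ C : ℝ, 0 ≤ C ∧ ∀ (k : ℝ) (p : ℝ × ℝ), k ≠ 0 →
      ‖scatteringPart a α σ k p‖ ≤ C := by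
  rcases eq_or_ne α 0 with rfl | hα
  · exact ⟨0, le_rfl, fun k p _ => by rw [scatteringPart_zero, norm_zero]⟩
  · obtain ⟨C, hC0, hC⟩ := exists_norm_scatteringPart_le ha hα haα hσ
    refine ⟨C, hC0, fun k p hk => (hC k p hk).trans (div_le_self hC0 ?_)⟩
    rw [Real.one_le_sqrt]
    nlinarith [sq_nonneg k]

theorem integrable_mul_scatteringPart {a α σ : ℝ} (ha : 0 < a) (haα : a * α ≠ -1)
    (hσ : σ = 1 ∨ σ = -1) {F : ℝ × ℝ → ℂ} (hF : Integrable F volume) {k : ℝ} (hk : k ≠ 0) :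
    Integrable (fun p => F p * scatteringPart a α σ k p) volume := by
  obtain ⟨C, -, hC⟩ := exists_norm_scatteringPart_le_const ha haα hσ
  exact hF.mul_bdd ((measurable_scatteringPart a α σ).comp
    measurable_prodMk_left).aestronglyMeasurable (Eventually.of_forall fun p => hC k p hk)

theorem integral_mul_scatteringPart (a α σ : ℝ) (χ φ : ℝ → ℂ) (k : ℝ) :
    ∫ p : ℝ × ℝ, starRingEnd ℂ (χ p.1) * φ p.2 * scatteringPart a α σ k p
      = Complex.I * α / 2 * resolventPart a α σ χ φ k := by
  have e : ∀ p : ℝ × ℝ, starRingEnd ℂ (χ p.1) * φ p.2 * scatteringPart a α σ k p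
      = (Complex.I * α / denom a α σ k / 2 * (source a σ k p.1 * starRingEnd ℂ (χ p.1))) *
        (source a σ k p.2 * φ p.2) := fun p => by rw [scatteringPart]; ring
  simp_rw [e]
  rw [Measure.volume_eq_prod, integral_prod_mul
      (fun x : ℝ => Complex.I * α / denom a α σ k / 2 * (source a σ k x * starRingEnd ℂ (χ x)))
      (fun y : ℝ => source a σ k y * φ y), integral_const_mul, resolventPart, sourceInt, sourceInt]
  ring

/-- The density identity is rewritten as a double integral against a kernel in `(x, y)`; the factor
`σ` in `modeKernel` comes from conjugating the standing wave. -/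
theorem conj_modeInt_mul_modeInt_eq_integral {a α σ : ℝ} (ha : 0 < a) (haα : a * α ≠ -1)
    (hσ : σ = 1 ∨ σ = -1) {χ φ : ℝ → ℂ} (hχ : Integrable χ volume) (hφ : Integrable φ volume)
    {k : ℝ} (hk : k ≠ 0) :
    starRingEnd ℂ (modeInt a α σ χ k) * modeInt a α σ φ k
      = ∫ p : ℝ × ℝ, starRingEnd ℂ (χ p.1) * φ p.2 * modeKernel a α σ k p := by
  have hF : Integrable (fun p : ℝ × ℝ => starRingEnd ℂ (χ p.1) * φ p.2) volume :=
    (integrable_conj hχ).mul_prod hφ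
  have i1 := integrable_mul_scatteringPart ha haα hσ hF hk
  have i2 := integrable_mul_scatteringPart ha haα hσ hF (neg_ne_zero.2 hk)
  have i3 : Integrable (fun p : ℝ × ℝ => σ * (wave σ k p.1 * starRingEnd ℂ (χ p.1)) *
      (wave σ k p.2 * φ p.2)) volume :=
    ((integrable_wave_mul hσ (integrable_conj hχ) k).const_mul (σ : ℂ)).mul_prod
      (integrable_wave_mul hσ hφ k)
  have i12 : Integrable (fun p : ℝ × ℝ =>
      (starRingEnd ℂ (χ p.1) * φ p.2 * scatteringPart a α σ k p
        + starRingEnd ℂ (χ p.1) * φ p.2 * scatteringPart a α σ (-k) p) / 2) volume :=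
    (i1.add i2).div_const 2
  have e : ∀ p : ℝ × ℝ, starRingEnd ℂ (χ p.1) * φ p.2 * modeKernel a α σ k p
      = σ * (wave σ k p.1 * starRingEnd ℂ (χ p.1)) * (wave σ k p.2 * φ p.2) -
        (starRingEnd ℂ (χ p.1) * φ p.2 * scatteringPart a α σ k p
        + starRingEnd ℂ (χ p.1) * φ p.2 * scatteringPart a α σ (-k) p) / 2 := fun p => by
    rw [modeKernel]; ring
  simp_rw [e]
  rw [integral_sub i3 i12, integral_div, integral_add i1 i2, integral_mul_scatteringPart,
    integral_mul_scatteringPart, Measure.volume_eq_prod,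
    integral_prod_mul (fun x : ℝ => σ * (wave σ k x * starRingEnd ℂ (χ x)))
      (fun y : ℝ => wave σ k y * φ y), integral_const_mul]
  have e2 := conj_waveInt hσ χ k
  rw [waveInt, waveInt] at e2
  rw [← e2]
  rcases eq_or_ne α 0 with rfl | hα
  · simp [modeInt, waveInt]
  · rw [conj_modeInt_mul_modeInt hα hσ hχ hφ hk, waveInt, waveInt]
    ring

/-! ### Passage from momentum integrals to the integral kernel. -/

/-- Fubini's theorem for an oscillating integral, with Gaussian regularization. -/
theorem integral_oscillating_eq {t : ℝ} {G : ℝ → ℝ × ℝ → ℂ}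
    (hGm : Measurable fun q : ℝ × ℝ × ℝ => G q.1 q.2) {C : ℝ}
    (hGC : ∀ (k : ℝ) (p : ℝ × ℝ), k ≠ 0 → ‖G k p‖ ≤ C) {F : ℝ × ℝ → ℂ}
    (hF : Integrable F volume) {R : ℝ → ℂ} (hR : Integrable R volume)
    (hRG : ∀ k : ℝ, k ≠ 0 → R k = ∫ p, F p * G k p) {K : ℝ × ℝ → ℂ} {B : ℝ}
    (hB : ∀ ε : ℝ, 0 < ε → ∀ p : ℝ × ℝ,
      ‖∫ k : ℝ, Complex.exp (-(rootIt t + ε) ^ 2 * k ^ 2) * G k p‖ ≤ B)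
    (hK : ∀ p, Tendsto (fun ε : ℝ => ∫ k : ℝ, Complex.exp (-(rootIt t + ε) ^ 2 * k ^ 2) * G k p)
      (𝓝[>] 0) (𝓝 (K p))) :
    ∫ k : ℝ, Complex.exp (-rootIt t ^ 2 * k ^ 2) * R k = ∫ p, F p * K p := by
  have hGp : Measurable fun q : (ℝ × ℝ) × ℝ => G q.2 q.1 :=
    hGm.comp (measurable_snd.prodMk measurable_fst)
  have hT : ∀ ε : ℝ, StronglyMeasurable fun p : ℝ × ℝ =>
      ∫ k : ℝ, Complex.exp (-(rootIt t + ε) ^ 2 * k ^ 2) * G k p := fun ε => by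
    refine StronglyMeasurable.integral_prod_right' (f := fun q : (ℝ × ℝ) × ℝ =>
      Complex.exp (-(rootIt t + ε) ^ 2 * q.2 ^ 2) * G q.2 q.1) (Measurable.stronglyMeasurable ?_)
    exact (by fun_prop : Continuous fun q : (ℝ × ℝ) × ℝ =>
      Complex.exp (-(rootIt t + ε) ^ 2 * q.2 ^ 2)).measurable.mul hGp
  -- For `ε > 0` the Gaussian is integrable in `k`, `F` in `p`, and `G` is bounded, so Fubini
  -- applies. Afterwards `R` dominates on the `k` side and `B |F|` on the `p` side.
  have hswap : ∀ ε : ℝ, 0 < ε → ∫ k : ℝ, Complex.exp (-(rootIt t + ε) ^ 2 * k ^ 2) * R k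
      = ∫ p, F p * ∫ k : ℝ, Complex.exp (-(rootIt t + ε) ^ 2 * k ^ 2) * G k p := by
    intro ε hε
    have hs := rootIt_add_mem_sector t hε
    have e1 : (fun k : ℝ => Complex.exp (-(rootIt t + ε) ^ 2 * k ^ 2) * R k) =ᵐ[volume]
        fun k => ∫ p, Complex.exp (-(rootIt t + ε) ^ 2 * k ^ 2) * F p * G k p := by
      filter_upwards [ae_ne_zero] with k hk
      rw [hRG k hk, ← integral_const_mul]
      simp_rw [mul_assoc]
    rw [integral_congr_ae e1, integral_integral_swap]
    · congr 1; ext p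
      rw [← integral_const_mul]
      congr 1; ext k; ring
    · have i1 := (integrable_cexp_neg_mul_sq (re_sq_pos_of_mem_sector hs)).mul_prod hF
      refine i1.mul_bdd (c := C) hGm.aestronglyMeasurable ?_
      have h0 : ∀ᵐ q : ℝ × ℝ × ℝ ∂(volume.prod volume), q.1 ≠ 0 :=
        Measure.quasiMeasurePreserving_fst.ae ae_ne_zero
      filter_upwards [h0] with q hq
      exact hGC q.1 q.2 hq
  have l1 := tendsto_integral_gaussian (t := t) hR
  have l2 : Tendsto (fun ε : ℝ => ∫ p, F p *
      ∫ k : ℝ, Complex.exp (-(rootIt t + ε) ^ 2 * k ^ 2) * G k p) (𝓝[>] 0)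
      (𝓝 (∫ p, F p * K p)) := by
    refine tendsto_integral_filter_of_dominated_convergence (fun p => ‖F p‖ * B) ?_ ?_
      (hF.norm.mul_const B) ?_
    · exact Eventually.of_forall fun ε =>
        hF.aestronglyMeasurable.mul (hT ε).aestronglyMeasurable
    · filter_upwards [self_mem_nhdsWithin] with ε hε
      refine Eventually.of_forall fun p => ?_
      rw [norm_mul]
      exact mul_le_mul_of_nonneg_left (hB ε hε p) (norm_nonneg _)
    · exact Eventually.of_forall fun p => (hK p).const_mul _
  refine tendsto_nhds_unique (l1.congr' ?_) l2
  filter_upwards [self_mem_nhdsWithin] with ε hε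
  exact hswap ε hε

/-- The Gaussian integral of the free part of the kernel. -/
def freeKernelAt (p : ℝ × ℝ) (ϑ : ℂ) : ℂ :=
  (√Real.pi : ℝ) / ϑ * Complex.exp (-(p.1 - p.2 : ℝ) ^ 2 / (4 * ϑ ^ 2))

theorem norm_freeKernelAt_le (p : ℝ × ℝ) {ϑ : ℂ} (h : ϑ ∈ sector) :
    ‖freeKernelAt p ϑ‖ ≤ √Real.pi / ‖ϑ‖ := by
  rw [freeKernelAt, norm_mul, norm_div, Complex.norm_real, Real.norm_eq_abs,
    abs_of_nonneg (Real.sqrt_nonneg _)]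
  refine mul_le_of_le_one_right (by positivity) ?_
  rw [Complex.norm_exp, Real.exp_le_one_iff]
  have h1 : (-((p.1 - p.2 : ℝ) : ℂ) ^ 2 / (4 * ϑ ^ 2))
      = ((-((p.1 - p.2) ^ 2 / 4) : ℝ) : ℂ) * (ϑ ^ 2)⁻¹ := by
    push_cast; rw [div_mul_eq_div_div]; ring
  rw [h1, Complex.re_ofReal_mul, Complex.inv_re]
  exact mul_nonpos_of_nonpos_of_nonneg (by nlinarith [sq_nonneg (p.1 - p.2)])
    (div_nonneg (re_sq_pos_of_mem_sector h).le (Complex.normSq_nonneg _))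

/-- The principal square root of `4πit` is `2√π · rootIt t`, and the Gaussian formula is continuous
there. -/
theorem tendsto_freeKernelAt {t : ℝ} (ht : 0 < t) (p : ℝ × ℝ) :
    Tendsto (fun ε : ℝ => freeKernelAt p (rootIt t + ε)) (𝓝[>] 0)
      (𝓝 (2 * Real.pi * freeKernel t p.1 p.2)) := by
  have h0 := rootIt_ne_zero ht
  have htc : (t : ℂ) ≠ 0 := by exact_mod_cast ht.ne'
  have hpi : ((√Real.pi : ℝ) : ℂ) ≠ 0 := by exact_mod_cast (Real.sqrt_pos.2 Real.pi_pos).ne'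
  have hpi2 : ((√Real.pi : ℝ) : ℂ) ^ 2 = Real.pi := by
    rw [← Complex.ofReal_pow, Real.sq_sqrt Real.pi_pos.le]
  have e : 2 * Real.pi * freeKernel t p.1 p.2 = freeKernelAt p (rootIt t) := by
    have e1 : (4 * Real.pi * Complex.I * t : ℂ) = (2 * (√Real.pi : ℝ) * rootIt t) ^ 2 := by
      rw [mul_pow, mul_pow, hpi2, rootIt_sq ht]; ring
    have hre : 0 < (2 * (√Real.pi : ℝ) * rootIt t).re := by
      rw [show (2 * (√Real.pi : ℝ) * rootIt t : ℂ) = ((2 * √Real.pi : ℝ) : ℂ) * rootIt t by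
        push_cast; ring, Complex.re_ofReal_mul, rootIt_re]
      have := Real.pi_pos
      positivity
    rw [freeKernel, freeKernelAt, e1, Complex.cpow_neg, one_div, Complex.sq_cpow_two_inv hre,
      ← Complex.ofReal_pow, sq_abs, Complex.ofReal_pow, rootIt_sq ht]
    have e2 : Complex.exp (-((p.1 - p.2 : ℝ) : ℂ) ^ 2 / (4 * (Complex.I * t)))
        = Complex.exp (Complex.I * ((p.1 - p.2 : ℝ) : ℂ) ^ 2 / (4 * t)) := by
      congr 1
      field_simp
      linear_combination (-((p.1 - p.2 : ℝ) : ℂ) ^ 2) * Complex.I_sq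
    rw [e2, ← hpi2]
    field_simp
  rw [e]
  have hc : ContinuousAt (freeKernelAt p) (rootIt t) :=
    (continuousAt_const.div continuousAt_id h0).mul (ContinuousAt.cexp
      (continuousAt_const.div (by fun_prop) (mul_ne_zero (by norm_num) (pow_ne_zero 2 h0))))
  exact hc.tendsto.comp (tendsto_rootIt_add t)

theorem sum_wave (k x y : ℝ) :
    ∑ b : Bool, (paritySign b : ℂ) * (wave (paritySign b) k x * wave (paritySign b) k y)
      = (Complex.exp (Complex.I * (x - y : ℝ) * k) + Complex.exp (Complex.I * (y - x : ℝ) * k)) / 2 := by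
  have e1 : Complex.exp (Complex.I * (x - y : ℝ) * k)
      = Complex.exp (Complex.I * k * x) * Complex.exp (-(Complex.I * k * y)) := by
    rw [← Complex.exp_add]; congr 1; push_cast; ring
  have e2 : Complex.exp (Complex.I * (y - x : ℝ) * k)
      = Complex.exp (Complex.I * k * y) * Complex.exp (-(Complex.I * k * x)) := by
    rw [← Complex.exp_add]; congr 1; push_cast; ring
  rw [Fintype.sum_bool, e1, e2]
  simp only [paritySign, if_true, Bool.false_eq_true, if_false, wave]
  push_cast
  ring

theorem integrable_gaussian_mul_exp {ϑ : ℂ} (h : ϑ ∈ sector) (y : ℝ) : Integrable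
    (fun k : ℝ => Complex.exp (-ϑ ^ 2 * k ^ 2) * Complex.exp (Complex.I * y * k)) volume := by
  refine integrable_gaussian_mul h (Continuous.aestronglyMeasurable (by fun_prop))
    (Eventually.of_forall fun k => (?_ : _ ≤ (1 : ℝ)))
  rw [show Complex.I * y * k = ((y * k : ℝ) : ℂ) * Complex.I by push_cast; ring,
    Complex.norm_exp_ofReal_mul_I]

/-- Over both parities the standing waves add up to `cos k(x-y)`. The Gaussian is even in `k`, so
the average over `k` and `-k` leaves the integral of the scattered part unchanged. -/
theorem integral_gaussian_mul_modeKernel {a α : ℝ} (ha : 0 < a) (haα : a * α ≠ -1) {ϑ : ℂ}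
    (h : ϑ ∈ sector) (p : ℝ × ℝ) :
    ∫ k : ℝ, Complex.exp (-ϑ ^ 2 * k ^ 2) * ∑ b : Bool, modeKernel a α (paritySign b) k p
      = freeKernelAt p ϑ - ∫ k : ℝ, Complex.exp (-ϑ ^ 2 * k ^ 2) * scatteringKernel a α k p := by
  choose C _ hC using fun b : Bool =>
    exists_norm_scatteringPart_le_const ha haα (paritySign_eq b)
  have i1 : Integrable (fun k : ℝ => Complex.exp (-ϑ ^ 2 * k ^ 2) * scatteringKernel a α k p)
      volume := by
    refine integrable_gaussian_mul h (C := ∑ b, C b) ((measurable_scatteringKernel a α).comp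
      measurable_prodMk_right).aestronglyMeasurable ?_
    filter_upwards [ae_ne_zero] with k hk
    exact (norm_sum_le _ _).trans (Finset.sum_le_sum fun b _ => hC b k p hk)
  have i2 : Integrable (fun k : ℝ => Complex.exp (-ϑ ^ 2 * k ^ 2) * scatteringKernel a α (-k) p)
      volume := by
    refine i1.comp_neg.congr (Eventually.of_forall fun k => ?_)
    simp
  have e2 : ∫ k : ℝ, Complex.exp (-ϑ ^ 2 * k ^ 2) * scatteringKernel a α (-k) p
      = ∫ k : ℝ, Complex.exp (-ϑ ^ 2 * k ^ 2) * scatteringKernel a α k p := by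
    rw [← integral_neg_eq_self]
    simp
  have j1 := integrable_gaussian_mul_exp h (p.1 - p.2)
  have j2 := integrable_gaussian_mul_exp h (p.2 - p.1)
  have i12 : Integrable (fun k : ℝ => (Complex.exp (-ϑ ^ 2 * k ^ 2) * scatteringKernel a α k p
      + Complex.exp (-ϑ ^ 2 * k ^ 2) * scatteringKernel a α (-k) p) / 2) volume :=
    (i1.add i2).div_const 2
  have j12 : Integrable (fun k : ℝ =>
      (Complex.exp (-ϑ ^ 2 * k ^ 2) * Complex.exp (Complex.I * (p.1 - p.2 : ℝ) * k)
      + Complex.exp (-ϑ ^ 2 * k ^ 2) * Complex.exp (Complex.I * (p.2 - p.1 : ℝ) * k)) / 2) volume :=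
    (j1.add j2).div_const 2
  have e : ∀ k : ℝ, Complex.exp (-ϑ ^ 2 * k ^ 2) * ∑ b : Bool, modeKernel a α (paritySign b) k p
      = (Complex.exp (-ϑ ^ 2 * k ^ 2) * Complex.exp (Complex.I * (p.1 - p.2 : ℝ) * k)
      + Complex.exp (-ϑ ^ 2 * k ^ 2) * Complex.exp (Complex.I * (p.2 - p.1 : ℝ) * k)) / 2
      - (Complex.exp (-ϑ ^ 2 * k ^ 2) * scatteringKernel a α k p
      + Complex.exp (-ϑ ^ 2 * k ^ 2) * scatteringKernel a α (-k) p) / 2 := fun k => by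
    simp only [modeKernel]
    rw [Finset.sum_sub_distrib, sum_wave, ← Finset.sum_div, Finset.sum_add_distrib,
      scatteringKernel, scatteringKernel]
    ring
  simp_rw [e]
  rw [integral_sub j12 i12, integral_div, integral_div, integral_add j1 j2, integral_add i1 i2, e2,
    integral_gaussian_mul_exp h, integral_gaussian_mul_exp h, freeKernelAt,
    show (((p.2 - p.1 : ℝ) : ℂ)) ^ 2 = ((p.1 - p.2 : ℝ) : ℂ) ^ 2 by push_cast; ring]
  ring

theorem exists_norm_integral_gaussian_modeKernel_le {a α t : ℝ} (ha : 0 < a) (haα : a * α ≠ -1)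
    (ht : 0 < t) : ∃ B : ℝ, ∀ ε : ℝ, 0 < ε → ∀ p : ℝ × ℝ,
      ‖∫ k : ℝ, Complex.exp (-(rootIt t + ε) ^ 2 * k ^ 2) *
        ∑ b : Bool, modeKernel a α (paritySign b) k p‖ ≤ B := by
  have key : ∃ B : ℝ, ∀ ε : ℝ, 0 < ε → ∀ p : ℝ × ℝ,
      ‖∫ k : ℝ, Complex.exp (-(rootIt t + ε) ^ 2 * k ^ 2) * scatteringKernel a α k p‖ ≤ B := by
    rcases eq_or_ne α 0 with rfl | hα
    · exact ⟨0, fun ε _ p => by simp [scatteringKernel_zero]⟩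
    · exact exists_norm_integral_gaussian_scatteringKernel_le ha hα haα ht
  obtain ⟨B, hB⟩ := key
  have hpos : 0 < ‖rootIt t‖ := norm_pos_iff.2 (rootIt_ne_zero ht)
  refine ⟨√Real.pi / ‖rootIt t‖ + B, fun ε hε p => ?_⟩
  have hs := rootIt_add_mem_sector t hε
  rw [integral_gaussian_mul_modeKernel ha haα hs]
  exact (norm_sub_le _ _).trans (add_le_add ((norm_freeKernelAt_le p hs).trans
    (div_le_div_of_nonneg_left (Real.sqrt_nonneg _) hpos (norm_rootIt_le_norm_add t hε)))
    (hB ε hε p))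

theorem tendsto_integral_gaussian_modeKernel {a α t : ℝ} (ha : 0 < a) (haα : a * α ≠ -1)
    (ht : 0 < t) (p : ℝ × ℝ) :
    Tendsto (fun ε : ℝ => ∫ k : ℝ, Complex.exp (-(rootIt t + ε) ^ 2 * k ^ 2) *
        ∑ b : Bool, modeKernel a α (paritySign b) k p) (𝓝[>] 0)
      (𝓝 (2 * Real.pi * kernelU a α t p.1 p.2)) := by
  have hpi : (Real.pi : ℂ) ≠ 0 := by exact_mod_cast Real.pi_pos.ne'
  have e : 2 * Real.pi * kernelU a α t p.1 p.2
      = 2 * Real.pi * freeKernel t p.1 p.2 - seriesSum a α t p.1 p.2 := by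
    rw [kernelU]; field_simp
  rw [e]
  refine ((tendsto_freeKernelAt ht p).sub ((tendstoUniformly_seriesSum ha haα ht).1 p)).congr' ?_
  filter_upwards [self_mem_nhdsWithin] with ε hε
  exact (integral_gaussian_mul_modeKernel ha haα (rootIt_add_mem_sector t hε) p).symm

theorem conj_phase_neg {t : ℝ} (ht : 0 < t) (k : ℝ) :
    starRingEnd ℂ (phase (-t) k) = Complex.exp (-rootIt t ^ 2 * k ^ 2) := by
  rw [phase, ← Complex.exp_conj, rootIt_sq ht]
  congr 1
  simp only [map_neg, map_mul, Complex.conj_I, Complex.conj_ofReal]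
  push_cast
  ring

theorem exists_norm_modeKernel_le {a α : ℝ} (ha : 0 < a) (haα : a * α ≠ -1) : ∃ C : ℝ,
    ∀ (k : ℝ) (p : ℝ × ℝ), k ≠ 0 → ‖∑ b : Bool, modeKernel a α (paritySign b) k p‖ ≤ C := by
  choose C _ hC using fun b : Bool =>
    exists_norm_scatteringPart_le_const ha haα (paritySign_eq b)
  refine ⟨∑ b : Bool, (1 + (C b + C b) / 2), fun k p hk =>
    (norm_sum_le _ _).trans (Finset.sum_le_sum fun b _ => ?_)⟩
  rw [modeKernel]
  refine (norm_sub_le _ _).trans (add_le_add ?_ ?_)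
  · rw [norm_mul, norm_mul, norm_le_one_of_sign (paritySign_eq b), one_mul]
    exact mul_le_one₀ (norm_wave_le (paritySign_eq b) _ _) (norm_nonneg _)
      (norm_wave_le (paritySign_eq b) _ _)
  · rw [norm_div, Complex.norm_two]
    have h1 := hC b k p hk
    have h2 := hC b (-k) p (neg_ne_zero.2 hk)
    have h3 := norm_add_le (scatteringPart a α (paritySign b) k p)
      (scatteringPart a α (paritySign b) (-k) p)
    linarith

/-- `P_c` is the sum of `F* F` and `F` turns the evolution into a phase, so the matrix element is
`(2π)⁻¹ ∫ e^{-itk²}` times the density of the transforms; `integral_oscillating_eq` carries this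
over to `(x, y)`. -/
theorem inner_unitaryGroup_acProjection {a α : ℝ} (ha : 0 < a) (haα : a * α ≠ -1)
    {U : ℝ → L2 →L[ℂ] L2} (hU : IsUnitaryGroupOf (hamiltonian a α) U) {t : ℝ} (ht : 0 < t)
    {χ φ : L2} (hχ : Integrable χ volume) (hφ : Integrable φ volume) :
    inner ℂ χ ((U t * acProjection U) φ)
      = ∫ p : ℝ × ℝ, starRingEnd ℂ (χ p.1) * φ p.2 * kernelU a α t p.1 p.2 := by
  obtain ⟨F, hFU, hFm, hFP⟩ := exists_spectral_representation ha haα hU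
  have hpi : (0 : ℝ) < 2 * Real.pi := by positivity
  have hpic : (2 * Real.pi : ℂ) ≠ 0 := by exact_mod_cast hpi.ne'
  have hc : (((√(2 * Real.pi))⁻¹ : ℝ) : ℂ) * (((√(2 * Real.pi))⁻¹ : ℝ) : ℂ)
      = (2 * Real.pi : ℂ)⁻¹ := by
    rw [← Complex.ofReal_mul, ← mul_inv, Real.mul_self_sqrt hpi.le]; push_cast; rfl
  have hi : ∀ b, Integrable (fun k => starRingEnd ℂ (modeInt a α (paritySign b) χ k) *
      modeInt a α (paritySign b) φ k) volume := fun b => by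
    have h := (L2.integrable_inner (𝕜 := ℂ) (F b χ) (F b φ)).const_mul (2 * Real.pi : ℂ)
    refine h.congr ?_
    filter_upwards [hFm b χ hχ, hFm b φ hφ] with k h1 h2
    rw [h1, h2, RCLike.inner_apply, map_mul, Complex.conj_ofReal]
    linear_combination (2 * Real.pi * modeInt a α (paritySign b) φ k *
      starRingEnd ℂ (modeInt a α (paritySign b) χ k)) * hc +
      (modeInt a α (paritySign b) φ k * starRingEnd ℂ (modeInt a α (paritySign b) χ k)) *
        mul_inv_cancel₀ hpic
  have hsum : ∀ b, inner ℂ χ (U t ((F b).adjoint (F b φ)))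
      = (2 * Real.pi : ℂ)⁻¹ * ∫ k : ℝ, Complex.exp (-rootIt t ^ 2 * k ^ 2) *
        (starRingEnd ℂ (modeInt a α (paritySign b) χ k) * modeInt a α (paritySign b) φ k) := by
    intro b
    rw [hU.inner_apply_right, ContinuousLinearMap.adjoint_inner_right, hFU, L2.inner_def,
      ← integral_const_mul]
    refine integral_congr_ae ?_
    filter_upwards [coeFn_phaseMul (-t) (F b χ), hFm b χ hχ, hFm b φ hφ] with k h0 h1 h2
    rw [h0, h1, h2, RCLike.inner_apply, map_mul, map_mul, Complex.conj_ofReal,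
      conj_phase_neg ht, ← hc]
    ring
  have hbound := exists_norm_modeKernel_le ha haα
  obtain ⟨C, hC⟩ := hbound
  obtain ⟨B, hB⟩ := exists_norm_integral_gaussian_modeKernel_le ha haα ht
  have hF : Integrable (fun p : ℝ × ℝ => starRingEnd ℂ (χ p.1) * φ p.2) volume :=
    (integrable_conj hχ).mul_prod hφ
  have hm : Measurable fun q : ℝ × ℝ × ℝ => ∑ b : Bool, modeKernel a α (paritySign b) q.1 q.2 :=
    Finset.measurable_fun_sum _ fun b _ => measurable_modeKernel a α (paritySign b)
  have key := integral_oscillating_eq (t := t)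
    (G := fun k p => ∑ b : Bool, modeKernel a α (paritySign b) k p) hm hC hF
    (R := fun k => ∑ b : Bool, starRingEnd ℂ (modeInt a α (paritySign b) χ k) *
      modeInt a α (paritySign b) φ k) (integrable_finsetSum _ fun b _ => hi b)
    (fun k hk => by
      simp_rw [Finset.mul_sum]
      rw [integral_finsetSum]
      · exact Finset.sum_congr rfl fun b _ =>
          conj_modeInt_mul_modeInt_eq_integral ha haα (paritySign_eq b) hχ hφ hk
      · intro b _
        have i1 := integrable_mul_scatteringPart ha haα (paritySign_eq b) hF hk
        have i2 := integrable_mul_scatteringPart ha haα (paritySign_eq b) hF (neg_ne_zero.2 hk)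
        have i3 : Integrable (fun p : ℝ × ℝ =>
            paritySign b * (wave (paritySign b) k p.1 * starRingEnd ℂ (χ p.1)) *
            (wave (paritySign b) k p.2 * φ p.2)) volume :=
          ((integrable_wave_mul (paritySign_eq b) (integrable_conj hχ) k).const_mul
            (paritySign b : ℂ)).mul_prod (integrable_wave_mul (paritySign_eq b) hφ k)
        refine (i3.sub ((i1.add i2).div_const 2)).congr (Eventually.of_forall fun p => ?_)
        simp only [Pi.sub_apply, Pi.add_apply, modeKernel]
        ring)
    hB (tendsto_integral_gaussian_modeKernel ha haα ht)
  have hlast : ∫ p : ℝ × ℝ, starRingEnd ℂ (χ p.1) * φ p.2 * kernelU a α t p.1 p.2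
      = (2 * Real.pi : ℂ)⁻¹ * ∫ p : ℝ × ℝ, starRingEnd ℂ (χ p.1) * φ p.2 *
        (2 * Real.pi * kernelU a α t p.1 p.2) := by
    rw [← integral_const_mul]
    congr 1; ext p
    field_simp
  rw [hlast, ← key, mul_apply_eq_comp, hFP, map_sum, inner_sum]
  simp_rw [hsum, Finset.mul_sum]
  rw [integral_finsetSum, Finset.mul_sum]
  exact fun b _ => integrable_gaussian_mul_integrable (re_rootIt_sq ht).ge (hi b)

/-- Measurability is not read off from the series but from the representation as a pointwise limit
of parameter integrals. -/
theorem measurable_kernelU {a α t : ℝ} (ha : 0 < a) (haα : a * α ≠ -1) (ht : 0 < t) :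
    Measurable fun p : ℝ × ℝ => kernelU a α t p.1 p.2 := by
  have hpi : (2 * Real.pi : ℂ) ≠ 0 := by
    exact_mod_cast (by positivity : (0 : ℝ) < 2 * Real.pi).ne'
  have hT : ∀ ε : ℝ, Measurable fun p : ℝ × ℝ => ∫ k : ℝ,
      Complex.exp (-(rootIt t + ε) ^ 2 * k ^ 2) *
        ∑ b : Bool, modeKernel a α (paritySign b) k p := fun ε => by
    have hm : Measurable fun q : ℝ × ℝ × ℝ => Complex.exp (-(rootIt t + ε) ^ 2 * q.1 ^ 2) *
        ∑ b : Bool, modeKernel a α (paritySign b) q.1 q.2 := by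
      refine Measurable.mul (by fun_prop : Continuous _).measurable ?_
      exact Finset.measurable_fun_sum _ fun b _ => measurable_modeKernel a α (paritySign b)
    have h := hm.stronglyMeasurable.integral_prod_left' (μ := (volume : Measure ℝ))
    exact h.measurable
  have h := measurable_of_tendsto_metrizable' (𝓝[>] (0 : ℝ)) hT
    (tendsto_pi_nhds.2 fun p => tendsto_integral_gaussian_modeKernel ha haα ht p)
  have h2 := h.const_mul (2 * Real.pi : ℂ)⁻¹
  simp only [inv_mul_cancel_left₀ hpi] at h2
  exact h2

/-- The bound for the regularized integrals is uniform in `ε` and survives the limit. It makes the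
kernel integral absolutely convergent for every `φ ∈ L¹`. -/
theorem exists_norm_kernelU_le {a α t : ℝ} (ha : 0 < a) (haα : a * α ≠ -1) (ht : 0 < t) :
    ∃ B : ℝ, ∀ p : ℝ × ℝ, ‖kernelU a α t p.1 p.2‖ ≤ B := by
  obtain ⟨B, hB⟩ := exists_norm_integral_gaussian_modeKernel_le ha haα ht
  refine ⟨B / (2 * Real.pi), fun p => ?_⟩
  have h := le_of_tendsto (tendsto_integral_gaussian_modeKernel ha haα ht p).norm
    (eventually_nhdsWithin_of_forall fun ε hε => hB ε hε p)
  have e : ‖(2 * Real.pi * kernelU a α t p.1 p.2 : ℂ)‖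
      = 2 * Real.pi * ‖kernelU a α t p.1 p.2‖ := by
    rw [norm_mul, norm_mul, Complex.norm_two, Complex.norm_real, Real.norm_eq_abs,
      abs_of_pos Real.pi_pos]
  rw [e] at h
  rw [le_div_iff₀ (by positivity)]
  linarith

/-- Testing with indicators of sets of finite measure, which lie in `L¹ ∩ L²`, turns the identity of
matrix elements into equality of set integrals and so into equality almost everywhere. -/
theorem isIntegralKernel_kernelU {a α : ℝ} (ha : 0 < a) (haα : a * α ≠ -1)
    {U : ℝ → L2 →L[ℂ] L2} (hU : IsUnitaryGroupOf (hamiltonian a α) U) {t : ℝ} (ht : 0 < t) :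
    IsIntegralKernel (U t * acProjection U) (kernelU a α t) := by
  have hKm := measurable_kernelU ha haα ht
  obtain ⟨B, hB⟩ := exists_norm_kernelU_le ha haα ht
  refine ⟨hKm, fun φ hφ => ?_⟩
  have hint : ∀ x, Integrable (fun y => kernelU a α t x y * φ y) volume := fun x =>
    hφ.bdd_mul (c := B) (hKm.comp measurable_prodMk_left).aestronglyMeasurable
      (Eventually.of_forall fun y => hB (x, y))
  have hΘm : AEStronglyMeasurable (fun x => ∫ y, kernelU a α t x y * φ y) volume :=
    AEStronglyMeasurable.integral_prod_right' (f := fun p : ℝ × ℝ => kernelU a α t p.1 p.2 * φ p.2)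
      (hKm.aestronglyMeasurable.mul hφ.aestronglyMeasurable.comp_snd)
  have hΘb : ∀ x, ‖∫ y, kernelU a α t x y * φ y‖ ≤ B * ∫ y, ‖φ y‖ := fun x => by
    rw [← integral_const_mul]
    refine norm_integral_le_of_norm_le (hφ.norm.const_mul B) (Eventually.of_forall fun y => ?_)
    rw [norm_mul]
    exact mul_le_mul_of_nonneg_right (hB (x, y)) (norm_nonneg _)
  have hΘi : ∀ s : Set ℝ, MeasurableSet s → volume s < ⊤ →
      IntegrableOn (fun x => ∫ y, kernelU a α t x y * φ y) s volume := fun s hs hμ => by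
    have : IsFiniteMeasure (volume.restrict s) := ⟨by simpa using hμ⟩
    exact Integrable.of_bound hΘm.restrict _ (Eventually.of_forall hΘb)
  have hae : ((U t * acProjection U) φ : L2) =ᵐ[volume]
      fun x => ∫ y, kernelU a α t x y * φ y := by
    refine ae_eq_of_forall_setIntegral_eq_of_sigmaFinite (fun s hs hμ => ?_) hΘi
      (fun s hs hμ => ?_)
    · have : IsFiniteMeasure (volume.restrict s) := ⟨by simpa using hμ⟩
      exact ((Lp.memLp ((U t * acProjection U) φ)).restrict s).integrable (by norm_num)
    · set χ : L2 := indicatorConstLp 2 hs hμ.ne (1 : ℂ) with hχd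
      have hχe : χ =ᵐ[volume] s.indicator fun _ => (1 : ℂ) := indicatorConstLp_coeFn
      have hχ : Integrable χ volume :=
        ((integrable_indicator_iff hs).2 (integrableOn_const hμ.ne)).congr hχe.symm
      rw [← L2.inner_indicatorConstLp_one hs hμ.ne, ← hχd,
        inner_unitaryGroup_acProjection ha haα hU ht hχ hφ]
      have i1 : Integrable (fun p : ℝ × ℝ =>
          starRingEnd ℂ (χ p.1) * φ p.2 * kernelU a α t p.1 p.2) (volume.prod volume) :=
        ((integrable_conj hχ).mul_prod hφ).mul_bdd (c := B) hKm.aestronglyMeasurable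
          (Eventually.of_forall hB)
      rw [Measure.volume_eq_prod, integral_prod _ i1, ← integral_indicator hs]
      refine integral_congr_ae ?_
      filter_upwards [hχe] with x hx
      rw [hx]
      by_cases hxs : x ∈ s
      · simp only [indicator_of_mem hxs, map_one, one_mul]
        congr 1; ext y; ring
      · simp [indicator_of_notMem hxs]
  filter_upwards [hae] with x hx
  exact ⟨hint x, hx⟩

end TwoDelta

end

/-! ### Existence of the group, its kernel, and uniform convergence. -/

theorem theorem3p1 (a α : ℝ) (ha : 0 < a) (haα : a * α ≠ -1) :
    (∃ U : ℝ → TwoDelta.L2 →L[ℂ] TwoDelta.L2,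
      TwoDelta.IsUnitaryGroupOf (TwoDelta.hamiltonian a α) U) ∧
    (∀ U : ℝ → TwoDelta.L2 →L[ℂ] TwoDelta.L2,
      TwoDelta.IsUnitaryGroupOf (TwoDelta.hamiltonian a α) U →
        ∀ t : ℝ, 0 < t →
          TwoDelta.IsIntegralKernel (U t * TwoDelta.acProjection U) (TwoDelta.kernelU a α t)) ∧
    (∀ t : ℝ, 0 < t →
      TendstoUniformly
        (fun (N : ℕ) (p : ℝ × ℝ) => ∑ m ∈ Finset.range N, TwoDelta.seriesTerm a α t m p.1 p.2)
        (fun p : ℝ × ℝ => TwoDelta.seriesSum a α t p.1 p.2) Filter.atTop) := by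
  exact ⟨TwoDelta.exists_unitaryGroup (TwoDelta.hamiltonian_symm α ha) _
      (TwoDelta.hamiltonian_add_surjective α ha),
    fun _ hU _ ht => TwoDelta.isIntegralKernel_kernelU ha haα hU ht,
    fun _ ht => (TwoDelta.tendstoUniformly_seriesSum ha haα ht).2⟩
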